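/- Let $X$ and $Y$ be smooth orientable $n$-manifolds without boundary, with $Y$ closed (compact). Let $a:B_2(0)\to X$ and $b:B_2(0)\to Y$ be smooth embeddings of the open ball of radius $2$ in $\mathbb R^n$ onto open subsets, put $X^\circ=X\setminus a(\overline{B_{1/2}(0)})$ and $Y^\circ=Y\setminus b(\overline{B_{1/2}(0)})$, and let $M=X\# Y$ be the connected sum, that is, the smooth manifold obtained by gluing $X^\circ$ and $Y^\circ$ along the shells $1/2<|x|<2$ through $a(x)\sim b(x/|x|^2)$. Let $j_X:X^\circ\to M$, $j_Y:Y^\circ\to M$ be the resulting embeddings, $\iota_X:X^\circ\to X$, $\iota_Y:Y^\circ\to Y$ the inclusions, and $\hat X=j_X(X^\circ)$, $\hat Y=j_Y(Y^\circ)$; so $\hat X$ and $\hat Y$ are the parts of $X$ and $Y$ in $M$, each together with a tubular neighbourhood of the common sphere $|x|=1$. An integral flat $k$-chain in a manifold $N$ is a current $R+\partial S$, where $R$ and $S$ are rectifiable currents in $N$ with integer multiplicities and compact support, of dimensions $k$ and $k+1$. Let $\mathcal Z_k(N)$ be the group of flat $k$-chains without boundary (integral cycles), $\mathcal B_k(N)$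 the group of boundaries of flat $(k+1)$-chains, and $H_k(N)=\mathcal Z_k(N)/\mathcal B_k(N)$. A class in $H_k(N)$ is anchored in a compact set $K\subset N$ if it is represented by a cycle with support in $K$ and by no cycle with support disjoint from $K$. Then for $1\le i\le n-1$: (1) The maps $(\iota_X)_*:H_i(X^\circ)\to H_i(X)$ and $(\iota_Y)_*:H_i(Y^\circ)\to H_i(Y)$ are surjective, and there is an isomorphism $$\Phi: H_i(X)\oplus H_i(Y)\to H_i(M)$$ with $\Phi((\iota_X)_*c,0)=(j_X)_*c$ for all $c\in H_i(X^\circ)$ and $\Phi(0,(\iota_Y)_*c)=(j_Y)_*c$ for all $c\in H_i(Y^\circ)$. (By the surjectivity, $\Phi$ is unique.) (2) If $\beta\in H_i(Y)$ and $\Phi(0,\beta)$ is the class of $A_1+A_2$ with $A_1,A_2\in\mathcal Z_i(M)$, $\operatorname{spt}A_1\subset\hat X$ and $\operatorname{spt}A_2\subset\hat Y$, then $A_1$ is a boundary in $M$, i.e. $A_1\in\mathcal B_i(M)$. (3) If $0\neq\beta\in H_i(Y)$, then $\Phi(0,\beta)$ is anchored in the compact set $j_Y\big(Y\setminus b(B_r(0))\big)\subset\hat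 Y$ for every $r\in(1/2,1]$. -/

import Mathlib

open scoped Manifold ContDiff

noncomputable section

namespace FlatChain

/-! ### Currents with compact support on a smooth manifold

A current with compact support is recorded through its values on the forms
`f dπ₁ ∧ … ∧ dπₖ` with `f, π₁, …, πₖ` smooth functions. These forms span all smooth `k`-forms over
any neighbourhood of a compact set, so they determine the current. -/

/-- Smooth real functions on `M`. -/
abbrev TestFn (n : ℕ) (M : Type*) [TopologicalSpace M]
    [ChartedSpace (EuclideanSpace ℝ (Fin n)) M] : Type _ :=
  C^∞⟮𝓡 n, M; ℝ⟯

/-- Real functions of the forms `f dπ₁ ∧ … ∧ dπₖ`. All chains below lie in this group. -/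
abbrev Functional (n : ℕ) (M : Type*) [TopologicalSpace M]
    [ChartedSpace (EuclideanSpace ℝ (Fin n)) M] (k : ℕ) : Type _ :=
  TestFn n M → (Fin k → TestFn n M) → ℝ

section Basic

variable (n : ℕ) (M : Type*) [TopologicalSpace M] [ChartedSpace (EuclideanSpace ℝ (Fin n)) M]

/-- The boundary `(∂T)(ω) = T(dω)`; here `d(f dπ₁ ∧ … ∧ dπₖ) = 1 df ∧ dπ₁ ∧ … ∧ dπₖ`. -/
def boundary (k : ℕ) : Functional n M (k + 1) →+ Functional n M k where
  toFun T := fun f π => T 1 (Fin.cons f π)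
  map_zero' := rfl
  map_add' _ _ := rfl

variable {n M}

/-- The support: the complement of the largest open set on which `T` vanishes. -/
def spt {k : ℕ} (T : Functional n M k) : Set M :=
  {x | ∀ W : Set M, IsOpen W → x ∈ W →
    ∃ (f : TestFn n M) (π : Fin k → TestFn n M), tsupport f ⊆ W ∧ T f π ≠ 0}

/-- The coefficient of `φ^*(dπ₁ ∧ … ∧ dπₖ)` with respect to `dx₁ ∧ … ∧ dxₖ` at `x ∈ ℝᵏ`. -/
def jac {k : ℕ} (π : Fin k → TestFn n M) (φ : (Fin k → ℝ) → M) (x : Fin k → ℝ) : ℝ :=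
  Matrix.det (Matrix.of fun a b : Fin k => fderiv ℝ (fun y => π a (φ y)) x (Pi.single b 1))

end Basic

/-- The data of a rectifiable `k`-current with integer multiplicities and compact support:
countably many Borel sets `E j ⊆ ℝᵏ`, mapped to `M` by `φ j`, which is `C¹` near `E j`, with integer
multiplicity `m j`. All images lie in one compact set, and the total mass, counted with
multiplicity, is finite. Finiteness of mass is expressed without a Riemannian metric: over a
compact set, the mass measure of any metric is bounded by finitely many of the densities
`|φ^*(dπ₁ ∧ … ∧ dπₖ)|` and bounds all of them. -/
structure RectData (n : ℕ) (M : Type*) [TopologicalSpace M]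
    [ChartedSpace (EuclideanSpace ℝ (Fin n)) M] (k : ℕ) where
  ι : Type
  countable : Countable ι
  U : ι → Set (Fin k → ℝ)
  E : ι → Set (Fin k → ℝ)
  φ : ι → (Fin k → ℝ) → M
  m : ι → ℤ
  K : Set M
  isOpen_U : ∀ j, IsOpen (U j)
  measurableSet_E : ∀ j, MeasurableSet (E j)
  E_subset : ∀ j, E j ⊆ U j
  contMDiffOn : ∀ j, ContMDiffOn 𝓘(ℝ, Fin k → ℝ) (𝓡 n) 1 (φ j) (U j)
  isCompact_K : IsCompact K
  mapsTo : ∀ j, Set.MapsTo (φ j) (E j) K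
  mass_finite : ∀ π : Fin k → TestFn n M,
    ∑' j, ∫⁻ x in E j, ‖(m j : ℝ) * jac π (φ j) x‖ₑ ≠ ⊤

namespace RectData

variable {l n : ℕ} {N M : Type*}
  [TopologicalSpace N] [ChartedSpace (EuclideanSpace ℝ (Fin l)) N]
  [TopologicalSpace M] [ChartedSpace (EuclideanSpace ℝ (Fin n)) M] {k : ℕ}

/-- The current `∑ⱼ mⱼ (φⱼ)_# ⟦Eⱼ⟧`. -/
def current (P : RectData n M k) : Functional n M k :=
  fun f π => ∑' j, ∫ x in P.E j, (P.m j : ℝ) * (f (P.φ j x) * jac π (P.φ j) x)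

theorem summable (P : RectData n M k) (f : TestFn n M) (π : Fin k → TestFn n M) :
    Summable fun j => ∫ x in P.E j, (P.m j : ℝ) * (f (P.φ j x) * jac π (P.φ j) x) := by
  obtain ⟨C, hC⟩ := P.isCompact_K.exists_bound_of_continuousOn f.contMDiff.continuous.continuousOn
  apply Summable.of_enorm
  refine ne_top_of_le_ne_top
    (ENNReal.mul_ne_top (ENNReal.ofReal_ne_top (r := C)) (P.mass_finite π)) ?_
  rw [← ENNReal.tsum_mul_left]
  refine ENNReal.tsum_le_tsum fun j => ?_
  refine (MeasureTheory.enorm_integral_le_lintegral_enorm _).trans ?_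
  rw [← MeasureTheory.lintegral_const_mul' _ _ ENNReal.ofReal_ne_top]
  refine MeasureTheory.setLIntegral_mono' (P.measurableSet_E j) fun x hx => ?_
  rw [mul_left_comm, enorm_mul]
  gcongr
  rw [← ofReal_norm]
  exact ENNReal.ofReal_le_ofReal (hC _ (P.mapsTo j hx))

/-- The empty family. -/
def zero : RectData n M k where
  ι := Empty
  countable := inferInstance
  U := Empty.elim
  E := Empty.elim
  φ := fun j => j.elim
  m := Empty.elim
  K := ∅
  isOpen_U j := j.elim
  measurableSet_E j := j.elim
  E_subset j := j.elim
  contMDiffOn j := j.elim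
  isCompact_K := isCompact_empty
  mapsTo j := j.elim
  mass_finite := by simp

/-- The union of two families. -/
def add (P Q : RectData n M k) : RectData n M k where
  ι := P.ι ⊕ Q.ι
  countable := by
    have := P.countable
    have := Q.countable
    infer_instance
  U := Sum.elim P.U Q.U
  E := Sum.elim P.E Q.E
  φ := Sum.elim P.φ Q.φ
  m := Sum.elim P.m Q.m
  K := P.K ∪ Q.K
  isOpen_U := by rintro (j | j); exacts [P.isOpen_U j, Q.isOpen_U j]
  measurableSet_E := by rintro (j | j); exacts [P.measurableSet_E j, Q.measurableSet_E j]
  E_subset := by rintro (j | j); exacts [P.E_subset j, Q.E_subset j]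
  contMDiffOn := by rintro (j | j); exacts [P.contMDiffOn j, Q.contMDiffOn j]
  isCompact_K := P.isCompact_K.union Q.isCompact_K
  mapsTo := by
    rintro (j | j)
    exacts [fun x hx => Or.inl (P.mapsTo j hx), fun x hx => Or.inr (Q.mapsTo j hx)]
  mass_finite π := by
    rw [Summable.tsum_sum ENNReal.summable ENNReal.summable]
    exact ENNReal.add_ne_top.2 ⟨P.mass_finite π, Q.mass_finite π⟩

/-- Reversal of all multiplicities. -/
def neg (P : RectData n M k) : RectData n M k where
  __ := P
  m := fun j => - P.m j
  mass_finite π := by simpa using P.mass_finite π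

/-- The push-forward under a smooth map. -/
def map (F : C^∞⟮𝓡 l, N; 𝓡 n, M⟯) (P : RectData l N k) : RectData n M k where
  ι := P.ι
  countable := P.countable
  U := P.U
  E := P.E
  φ := fun j x => F (P.φ j x)
  m := P.m
  K := F '' P.K
  isOpen_U := P.isOpen_U
  measurableSet_E := P.measurableSet_E
  E_subset := P.E_subset
  contMDiffOn := fun j => (F.contMDiff.of_le (by simp)).comp_contMDiffOn (P.contMDiffOn j)
  isCompact_K := P.isCompact_K.image F.contMDiff.continuous
  mapsTo := fun j x hx => Set.mem_image_of_mem _ (P.mapsTo j hx)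
  mass_finite π := P.mass_finite fun a => (π a).comp F

theorem zero_current : (zero : RectData n M k).current = 0 := by
  funext f π
  simp [current, zero]

theorem add_current (P Q : RectData n M k) : (P.add Q).current = P.current + Q.current := by
  funext f π
  exact Summable.tsum_sum (P.summable f π) (Q.summable f π)

theorem neg_current (P : RectData n M k) : P.neg.current = - P.current := by
  funext f π
  simp only [current, neg, Pi.neg_apply, Int.cast_neg, neg_mul, MeasureTheory.integral_neg,
    tsum_neg]

end RectData

section Homology

variable (n : ℕ) (M : Type*) [TopologicalSpace M] [ChartedSpace (EuclideanSpace ℝ (Fin n)) M]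

/-- The rectifiable `k`-currents with integer multiplicities and compact support in `M`. -/
def rectifiable (k : ℕ) : AddSubgroup (Functional n M k) where
  carrier := {T | ∃ P : RectData n M k, P.current = T}
  zero_mem' := ⟨RectData.zero, RectData.zero_current⟩
  add_mem' := by
    rintro _ _ ⟨P, rfl⟩ ⟨Q, rfl⟩
    exact ⟨P.add Q, P.add_current Q⟩
  neg_mem' := by
    rintro _ ⟨P, rfl⟩
    exact ⟨P.neg, P.neg_current⟩

/-- The integral flat `k`-chains `R + ∂S`, with `R` and `S` rectifiable of dimension `k`, `k + 1`. -/
def flatChains (k : ℕ) : AddSubgroup (Functional n M k) :=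
  rectifiable n M k ⊔ (rectifiable n M (k + 1)).map (boundary n M k)

/-- The integral cycles `𝒵ₖ(M)`: flat chains without boundary (every flat `0`-chain is a cycle). -/
def cycles : (k : ℕ) → AddSubgroup (Functional n M k)
  | 0 => flatChains n M 0
  | k + 1 => flatChains n M (k + 1) ⊓ (boundary n M k).ker

/-- The integral boundaries `ℬₖ(M)`: boundaries of flat `(k + 1)`-chains. -/
def boundaries (k : ℕ) : AddSubgroup (Functional n M k) :=
  (flatChains n M (k + 1)).map (boundary n M k)

variable {n M} in
theorem rectifiable_one_cons_one {k : ℕ} {T : Functional n M (k + 1)}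
    (hT : T ∈ rectifiable n M (k + 1)) (f : TestFn n M) (π : Fin k → TestFn n M) :
    T f (Fin.cons 1 π) = 0 := by
  obtain ⟨P, rfl⟩ := hT
  have h : ∀ φ x, jac (Fin.cons (1 : TestFn n M) π) φ x = 0 := fun φ x =>
    Matrix.det_eq_zero_of_row_eq_zero 0 fun b => by simp
  simp [RectData.current, h]

theorem boundaries_le_cycles (k : ℕ) : boundaries n M k ≤ cycles n M k := by
  rintro _ ⟨T, hT, rfl⟩
  obtain ⟨R, hR, _, ⟨S, hS, rfl⟩, rfl⟩ := AddSubgroup.mem_sup.1 hT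
  have hzero : boundary n M k (boundary n M (k + 1) S) = 0 := by
    funext f π
    exact rectifiable_one_cons_one hS 1 _
  rw [map_add, hzero, add_zero]
  have hflat : boundary n M k R ∈ flatChains n M k :=
    AddSubgroup.mem_sup_right ⟨R, hR, rfl⟩
  cases k with
  | zero => exact hflat
  | succ k =>
    refine ⟨hflat, ?_⟩
    funext f π
    exact rectifiable_one_cons_one hR 1 _

/-- The integral homology `Hₖ(M) = 𝒵ₖ(M) / ℬₖ(M)`. -/
abbrev Homology (k : ℕ) : Type _ :=
  cycles n M k ⧸ (boundaries n M k).addSubgroupOf (cycles n M k)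

variable {n M} in
/-- The homology class of a cycle. -/
def cls {k : ℕ} (T : cycles n M k) : Homology n M k :=
  QuotientAddGroup.mk T

variable {n M} in
/-- A class is anchored in the compact set `K` if it has a representative with support in `K` and
no representative with support disjoint from `K`. -/
def IsAnchored {k : ℕ} (K : Set M) (a : Homology n M k) : Prop :=
  IsCompact K ∧ (∃ T : cycles n M k, cls T = a ∧ spt T.1 ⊆ K) ∧
    ¬ ∃ T : cycles n M k, cls T = a ∧ Disjoint (spt T.1) K

end Homology

section Functoriality

variable {l n : ℕ} {N M : Type*}
  [TopologicalSpace N] [ChartedSpace (EuclideanSpace ℝ (Fin l)) N]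
  [TopologicalSpace M] [ChartedSpace (EuclideanSpace ℝ (Fin n)) M]

/-- The push-forward `(F_# T)(ω) = T(F^* ω)`. -/
def push (F : C^∞⟮𝓡 l, N; 𝓡 n, M⟯) (k : ℕ) : Functional l N k →+ Functional n M k where
  toFun T := fun f π => T (ContMDiffMap.comp f F) fun a => (π a).comp F
  map_zero' := rfl
  map_add' _ _ := rfl

theorem push_boundary (F : C^∞⟮𝓡 l, N; 𝓡 n, M⟯) (k : ℕ) (T : Functional l N (k + 1)) :
    push F k (boundary l N k T) = boundary n M k (push F (k + 1) T) := by
  funext f π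
  change T _ _ = T _ _
  congr 1
  funext a
  refine Fin.cases ?_ (fun _ => ?_) a <;> simp

theorem push_rectifiable (F : C^∞⟮𝓡 l, N; 𝓡 n, M⟯) (k : ℕ) {T : Functional l N k}
    (hT : T ∈ rectifiable l N k) : push F k T ∈ rectifiable n M k := by
  obtain ⟨P, rfl⟩ := hT
  exact ⟨P.map F, rfl⟩

theorem push_flatChains (F : C^∞⟮𝓡 l, N; 𝓡 n, M⟯) (k : ℕ) {T : Functional l N k}
    (hT : T ∈ flatChains l N k) : push F k T ∈ flatChains n M k := by
  obtain ⟨R, hR, _, ⟨S, hS, rfl⟩, rfl⟩ := AddSubgroup.mem_sup.1 hT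
  rw [map_add, push_boundary]
  exact AddSubgroup.mem_sup.2
    ⟨_, push_rectifiable F k hR, _, ⟨_, push_rectifiable F (k + 1) hS, rfl⟩, rfl⟩

theorem push_cycles (F : C^∞⟮𝓡 l, N; 𝓡 n, M⟯) (k : ℕ) {T : Functional l N k}
    (hT : T ∈ cycles l N k) : push F k T ∈ cycles n M k := by
  cases k with
  | zero => exact push_flatChains F 0 hT
  | succ k =>
    refine ⟨push_flatChains F (k + 1) hT.1, ?_⟩
    have h : boundary l N k T = 0 := hT.2
    change boundary n M k (push F (k + 1) T) = 0
    rw [← push_boundary, h, map_zero]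

theorem push_boundaries (F : C^∞⟮𝓡 l, N; 𝓡 n, M⟯) (k : ℕ) {T : Functional l N k}
    (hT : T ∈ boundaries l N k) : push F k T ∈ boundaries n M k := by
  obtain ⟨S, hS, rfl⟩ := hT
  rw [push_boundary]
  exact ⟨_, push_flatChains F (k + 1) hS, rfl⟩

/-- The map of cycles induced by a smooth map. -/
def pushCycles (F : C^∞⟮𝓡 l, N; 𝓡 n, M⟯) (k : ℕ) : cycles l N k →+ cycles n M k :=
  ((push F k).comp (cycles l N k).subtype).codRestrict (cycles n M k)
    fun T => push_cycles F k T.2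

/-- The homomorphism `F_* : Hₖ(N) → Hₖ(M)` induced by a smooth map `F : N → M`. -/
def homologyMap (F : C^∞⟮𝓡 l, N; 𝓡 n, M⟯) (k : ℕ) : Homology l N k →+ Homology n M k :=
  QuotientAddGroup.map _ _ (pushCycles F k) fun _ hT => push_boundaries F k hT

end Functoriality

end FlatChain

/-! ### Orientability and connected sums -/

/-- A smooth manifold is orientable if its smooth structure contains an atlas whose coordinate
changes all have positive Jacobian determinant. -/
def IsOrientable (n : ℕ) (M : Type*) [TopologicalSpace M]
    [ChartedSpace (EuclideanSpace ℝ (Fin n)) M] : Prop :=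
  ∃ A ⊆ IsManifold.maximalAtlas (𝓡 n) ∞ M, (∀ x : M, ∃ e ∈ A, x ∈ e.source) ∧
    ∀ e ∈ A, ∀ e' ∈ A, ∀ x ∈ (e.symm.trans e').source, 0 < (fderiv ℝ (e.symm.trans e') x).det

/-- A smooth embedding of the open ball of radius `2` in `ℝⁿ` onto an open subset of `X`
(the values of the function outside that ball are irrelevant). -/
structure EmbeddedBall (n : ℕ) (X : Type*) [TopologicalSpace X]
    [ChartedSpace (EuclideanSpace ℝ (Fin n)) X] where
  toFun : EuclideanSpace ℝ (Fin n) → X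
  isLocalDiffeomorphOn : IsLocalDiffeomorphOn (𝓡 n) (𝓡 n) ∞ toFun (Metric.ball 0 2)
  injOn : Set.InjOn toFun (Metric.ball 0 2)

/-- `X` minus the closed ball of radius `1/2`: the complement of the open unit ball, enlarged by a
tubular neighbourhood of the unit sphere. -/
def EmbeddedBall.hat {n : ℕ} {X : Type*} [TopologicalSpace X] [T2Space X]
    [ChartedSpace (EuclideanSpace ℝ (Fin n)) X] (a : EmbeddedBall n X) :
    TopologicalSpace.Opens X where
  carrier := (a.toFun '' Metric.closedBall 0 (1 / 2))ᶜ
  is_open' := by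
    refine (IsCompact.isClosed ?_).isOpen_compl
    refine (isCompact_closedBall _ _).image_of_continuousOn ?_
    exact a.isLocalDiffeomorphOn.contMDiffOn.continuousOn.mono
      (Metric.closedBall_subset_ball (by norm_num))

/-- The inclusion of `X` minus a closed ball into `X`. -/
def EmbeddedBall.incl {n : ℕ} {X : Type*} [TopologicalSpace X] [T2Space X]
    [ChartedSpace (EuclideanSpace ℝ (Fin n)) X] (a : EmbeddedBall n X) :
    C^∞⟮𝓡 n, a.hat; 𝓡 n, X⟯ :=
  ⟨Subtype.val, contMDiff_subtype_val⟩

/-- The smooth manifold `M` as the connected sum of `X` and `Y` along embedded balls: `M` is the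
union of open copies of the two complements of the balls of radius `1/2`, and these copies are glued
exactly along the open shells `1/2 < ‖x‖ < 2` by the inversion `x ↦ x / ‖x‖²`, which exchanges the
two sides of the common unit sphere. These conditions determine `M` up to diffeomorphism. -/
structure ConnectedSum (n : ℕ) (X Y M : Type*)
    [TopologicalSpace X] [T2Space X] [ChartedSpace (EuclideanSpace ℝ (Fin n)) X]
    [TopologicalSpace Y] [T2Space Y] [ChartedSpace (EuclideanSpace ℝ (Fin n)) Y]
    [TopologicalSpace M] [ChartedSpace (EuclideanSpace ℝ (Fin n)) M] where
  ballX : EmbeddedBall n X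
  ballY : EmbeddedBall n Y
  jX : ballX.hat → M
  jY : ballY.hat → M
  jX_isLocalDiffeomorph : IsLocalDiffeomorph (𝓡 n) (𝓡 n) ∞ jX
  jY_isLocalDiffeomorph : IsLocalDiffeomorph (𝓡 n) (𝓡 n) ∞ jY
  jX_injective : Function.Injective jX
  jY_injective : Function.Injective jY
  cover : Set.range jX ∪ Set.range jY = Set.univ
  glue : ∀ p q, jX p = jY q ↔ ∃ x : EuclideanSpace ℝ (Fin n), 1 / 2 < ‖x‖ ∧ ‖x‖ < 2 ∧
    p.1 = ballX.toFun x ∧ q.1 = ballY.toFun ((‖x‖ ^ 2)⁻¹ • x)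

namespace ConnectedSum

variable {n : ℕ} {X Y M : Type*}
  [TopologicalSpace X] [T2Space X] [ChartedSpace (EuclideanSpace ℝ (Fin n)) X]
  [TopologicalSpace Y] [T2Space Y] [ChartedSpace (EuclideanSpace ℝ (Fin n)) Y]
  [TopologicalSpace M] [ChartedSpace (EuclideanSpace ℝ (Fin n)) M]

/-- The part `X̂ ⊆ M` of the connected sum coming from `X`. -/
def hatX (D : ConnectedSum n X Y M) : Set M := Set.range D.jX

/-- The part `Ŷ ⊆ M` of the connected sum coming from `Y`. -/
def hatY (D : ConnectedSum n X Y M) : Set M := Set.range D.jY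

/-- The part of `Ŷ` coming from the complement of the open ball of radius `r` in `Y`. For
`1/2 < r < 1` it is the part of `Y` in `M` with a closed tubular neighbourhood of the unit sphere,
and for `r = 1` it is the part of `Y` in `M` itself. -/
def closedHatY (D : ConnectedSum n X Y M) (r : ℝ) : Set M :=
  D.jY '' {q | q.1 ∉ D.ballY.toFun '' Metric.ball 0 r}

/-- The smooth embedding of `X` minus a closed ball into `M`. -/
def embX (D : ConnectedSum n X Y M) : C^∞⟮𝓡 n, D.ballX.hat; 𝓡 n, M⟯ :=
  ⟨D.jX, D.jX_isLocalDiffeomorph.contMDiff⟩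

/-- The smooth embedding of `Y` minus a closed ball into `M`. -/
def embY (D : ConnectedSum n X Y M) : C^∞⟮𝓡 n, D.ballY.hat; 𝓡 n, M⟯ :=
  ⟨D.jY, D.jY_isLocalDiffeomorph.contMDiff⟩

end ConnectedSum

end

/-! The inverse of the isomorphism is induced by two smooth maps `cX : M → X` and `cY : M → Y`. The
map `cX` collapses the part of `M` coming from `Y` to the centre of the ball in `X`; its composite
with the embedding of the punctured `X` is the inclusion followed by a self-map of `X` that shrinks
a ball and is homotopic to the identity (`exists_retract`, `exists_collapse`). Hence `cX` undoes the
embedding of the first piece on homology. It also kills every cycle supported in the second piece,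
since it moves such a cycle into a ball, where the cycle contracts (`homologyMap_eq_zero_of_spt`).
The same holds with the roles exchanged.

Surjectivity of the pair `(cX, cY)` on homology follows from surjectivity of the two inclusions. A
cycle of dimension `k < n` is pushed out of a ball by radial projection from a centre chosen by
averaging, as in the deformation theorem: the derivative of the projection is `O(1/|x - p|)`, and
`|x - p|⁻ᵏ` is integrable along the chain for almost every centre `p` (`exists_center`,
`exists_push_out`). The projection is singular, so the homotopy formula is first proved for smooth
maps and then passed to a dominated limit (`homotopy_formula_limit`).

Injectivity has two ingredients. Every cycle of `M` is a sum of a cycle in each piece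
(`exists_decomposition`). And a cycle of a piece that bounds in the closed-up manifold bounds in
`M`. If the filling has dimension less than `n`, it is pushed out of the ball. If it has dimension
`n`, the constancy theorem gives it an integer multiplicity `m` on the ball (`exists_multiplicity`).
On the side of `Y`, which is closed and oriented, `m` times the fundamental cycle is subtracted, so
that the filling vanishes on the ball (`exists_boundary_of_compact`). On the side of `X`, which may
be noncompact, the ball is instead replaced by `-m` times the fundamental cycle of `Y` outside its
ball; the inversion reverses orientation, so the two parts agree across the gluing shell
(`exists_boundary_glued`).

Statements (2) and (3) are then formal. In (2) both collapsing maps kill `A₁`: one because of the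
support of `A₁`, the other because it kills both the sum and `A₂`. In (3) a representative avoiding
the compact set would be supported in the first piece, so `cY` would kill the class, although it
sends it to the given nonzero class. -/

open scoped Manifold ContDiff Topology
open Set Filter MeasureTheory

noncomputable section

namespace FlatChain

/-! ### Cut-off functions and locality of Jacobians -/

section Cutoff

variable {n : ℕ} {M : Type*} [TopologicalSpace M] [T2Space M] [SecondCountableTopology M]
  [ChartedSpace (EuclideanSpace ℝ (Fin n)) M] [IsManifold (𝓡 n) ∞ M]

/-- A smooth cut-off function that is `1` near a closed set and supported in an open set. -/
theorem exists_cutoff {K W : Set M} (hK : IsClosed K) (hW : IsOpen W) (hKW : K ⊆ W) :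
    ∃ χ : TestFn n M, (∀ᶠ x in 𝓝ˢ K, χ x = 1) ∧ tsupport χ ⊆ W := by
  have : LocallyCompactSpace M := Manifold.locallyCompact_of_finiteDimensional (𝓡 n)
  obtain ⟨χ, h0, h1, -⟩ := exists_contMDiffMap_zero_one_nhds_of_isClosed (𝓡 n) (n := ⊤)
    hW.isClosed_compl hK (disjoint_compl_left_iff_subset.2 hKW)
  refine ⟨χ, h1, fun x hx => ?_⟩
  by_contra hxW
  exact (notMem_tsupport_iff_eventuallyEq.2 ((eventually_nhdsSet_iff_forall.1 h0) x hxW)) hx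

/-- A function that is smooth on an open neighbourhood of a compact set agrees near this set with
a smooth function defined everywhere. -/
theorem exists_testFn_eq_near {K W : Set M} (hK : IsCompact K) (hW : IsOpen W) (hKW : K ⊆ W)
    {g : M → ℝ} (hg : ContMDiffOn (𝓡 n) 𝓘(ℝ, ℝ) ∞ g W) :
    ∃ g' : TestFn n M, (∀ᶠ x in 𝓝ˢ K, g' x = g x) ∧ ∀ x, g' x ≠ 0 → x ∈ W ∧ g x ≠ 0 := by
  obtain ⟨χ, h1, hχ⟩ := exists_cutoff (n := n) hK.isClosed hW hKW
  have hsm : ContMDiff (𝓡 n) 𝓘(ℝ, ℝ) ∞ fun x => χ x * g x := by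
    refine contMDiff_of_tsupport fun x hx => ?_
    have hx' : x ∈ W := hχ (closure_mono (fun y hy => by
      simp only [Function.mem_support] at hy ⊢
      exact left_ne_zero_of_mul hy) hx)
    exact χ.contMDiff.contMDiffAt.mul (hg.contMDiffAt (hW.mem_nhds hx'))
  refine ⟨⟨_, hsm⟩, ?_, fun x hx => ?_⟩
  · filter_upwards [h1] with x hx
    change χ x * g x = g x
    rw [hx, one_mul]
  · change χ x * g x ≠ 0 at hx
    exact ⟨hχ (subset_tsupport _ (left_ne_zero_of_mul hx)), right_ne_zero_of_mul hx⟩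

end Cutoff

section Jac

variable {n l k : ℕ} {M N : Type*} [TopologicalSpace M] [ChartedSpace (EuclideanSpace ℝ (Fin n)) M]
  [TopologicalSpace N] [ChartedSpace (EuclideanSpace ℝ (Fin l)) N]

/-- Only germs of the compositions `π a ∘ φ` enter, and the two targets may differ. This permits
replacing a test function by a global function that agrees, only near a compact set, with its
pull-back along a locally defined map. -/
theorem jac_congr {π : Fin k → TestFn n M} {π' : Fin k → TestFn l N} {φ : (Fin k → ℝ) → M}
    {φ' : (Fin k → ℝ) → N} {x : Fin k → ℝ}
    (h : ∀ a, (fun y => π a (φ y)) =ᶠ[𝓝 x] fun y => π' a (φ' y)) : jac π φ x = jac π' φ' x := by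
  unfold jac
  congr 1
  ext a b
  simp only [Matrix.of_apply]
  rw [(h a).fderiv_eq]

theorem jac_eq_zero {π : Fin k → TestFn n M} {φ : (Fin k → ℝ) → M} {x : Fin k → ℝ} (a : Fin k)
    (c : ℝ) (h : ∀ᶠ y in 𝓝 x, π a (φ y) = c) : jac π φ x = 0 := by
  refine Matrix.det_eq_zero_of_row_eq_zero a fun b => ?_
  have h' : (fun y => π a (φ y)) =ᶠ[𝓝 x] fun _ => c := h
  simp only [Matrix.of_apply]
  rw [h'.fderiv_eq]
  simp

theorem jac_comp_perm (π : Fin k → TestFn n M) (φ : (Fin k → ℝ) → M) (x : Fin k → ℝ)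
    (σ : Equiv.Perm (Fin k)) : jac (π ∘ σ) φ x = (Equiv.Perm.sign σ : ℤ) * jac π φ x := by
  unfold jac
  rw [← Matrix.det_permute]
  rfl

end Jac

/-! ### Integrability, restriction and local push-forward of rectifiable currents -/

namespace RectData

section Integrability

variable {n k : ℕ} {M : Type*} [TopologicalSpace M] [ChartedSpace (EuclideanSpace ℝ (Fin n)) M]

theorem continuousOn_φ (P : RectData n M k) (j : P.ι) : ContinuousOn (P.φ j) (P.U j) :=
  (P.contMDiffOn j).continuousOn

theorem continuousAt_φ (P : RectData n M k) {j : P.ι} {x : Fin k → ℝ} (hx : x ∈ P.E j) :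
    ContinuousAt (P.φ j) x :=
  (P.continuousOn_φ j).continuousAt ((P.isOpen_U j).mem_nhds (P.E_subset j hx))

theorem contDiffOn_comp (P : RectData n M k) (j : P.ι) (g : TestFn n M) :
    ContDiffOn ℝ 1 (fun y => g (P.φ j y)) (P.U j) := by
  rw [← contMDiffOn_iff_contDiffOn]
  exact (g.contMDiff.of_le (by simp)).comp_contMDiffOn (P.contMDiffOn j)

theorem continuousOn_jac (P : RectData n M k) (j : P.ι) (π : Fin k → TestFn n M) :
    ContinuousOn (jac π (P.φ j)) (P.U j) := by
  unfold jac
  refine (continuous_id.matrix_det).comp_continuousOn ?_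
  refine continuousOn_pi.2 fun a => continuousOn_pi.2 fun b => ?_
  exact ((P.contDiffOn_comp j (π a)).continuousOn_fderiv_of_isOpen (P.isOpen_U j)
    le_rfl).clm_apply continuousOn_const

theorem aestronglyMeasurable (P : RectData n M k) (j : P.ι) (f : TestFn n M)
    (π : Fin k → TestFn n M) :
    AEStronglyMeasurable (fun x => (P.m j : ℝ) * (f (P.φ j x) * jac π (P.φ j) x))
      (volume.restrict (P.E j)) := by
  have h : ContinuousOn (fun x => (P.m j : ℝ) * (f (P.φ j x) * jac π (P.φ j) x)) (P.U j) :=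
    continuousOn_const.mul ((f.contMDiff.continuous.comp_continuousOn (P.continuousOn_φ j)).mul
      (P.continuousOn_jac j π))
  exact (h.mono (P.E_subset j)).aestronglyMeasurable (P.measurableSet_E j)

theorem tsum_lintegral_ne_top (P : RectData n M k) (f : TestFn n M) (π : Fin k → TestFn n M) :
    ∑' j, ∫⁻ x in P.E j, ‖(P.m j : ℝ) * (f (P.φ j x) * jac π (P.φ j) x)‖ₑ ≠ ⊤ := by
  obtain ⟨C, hC⟩ := P.isCompact_K.exists_bound_of_continuousOn f.contMDiff.continuous.continuousOn
  refine ne_top_of_le_ne_top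
    (ENNReal.mul_ne_top (ENNReal.ofReal_ne_top (r := C)) (P.mass_finite π)) ?_
  rw [← ENNReal.tsum_mul_left]
  refine ENNReal.tsum_le_tsum fun j => ?_
  rw [← lintegral_const_mul' _ _ ENNReal.ofReal_ne_top]
  refine setLIntegral_mono' (P.measurableSet_E j) fun x hx => ?_
  rw [mul_left_comm, enorm_mul]
  gcongr
  rw [← ofReal_norm]
  exact ENNReal.ofReal_le_ofReal (hC _ (P.mapsTo j hx))

theorem integrableOn (P : RectData n M k) (j : P.ι) (f : TestFn n M) (π : Fin k → TestFn n M) :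
    IntegrableOn (fun x => (P.m j : ℝ) * (f (P.φ j x) * jac π (P.φ j) x)) (P.E j) :=
  ⟨P.aestronglyMeasurable j f π,
    (ENNReal.ne_top_of_tsum_ne_top (P.tsum_lintegral_ne_top f π) j).lt_top⟩

theorem current_eq_zero (P : RectData n M k) {f : TestFn n M} {π : Fin k → TestFn n M}
    (h : ∀ j, ∀ x ∈ P.E j, f (P.φ j x) * jac π (P.φ j) x = 0) : P.current f π = 0 := by
  unfold current
  refine (tsum_congr fun j => ?_).trans tsum_zero
  refine setIntegral_eq_zero_of_forall_eq_zero fun x hx => ?_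
  rw [h j x hx, mul_zero]

theorem current_add_left (P : RectData n M k) (f g : TestFn n M) (π : Fin k → TestFn n M) :
    P.current (f + g) π = P.current f π + P.current g π := by
  unfold current
  rw [← (P.summable f π).tsum_add (P.summable g π)]
  refine tsum_congr fun j => ?_
  rw [← integral_add (P.integrableOn j f π) (P.integrableOn j g π)]
  refine integral_congr_ae (Eventually.of_forall fun x => ?_)
  simp only [ContMDiffMap.coe_add, Pi.add_apply]
  ring

/-- The determinant is linear in its first row. Differentiability of `f ∘ φ` is available because
`E` lies in the open set where `φ` is `C¹`. The result makes the boundary additive in `f`, as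
partitions of unity require. -/
theorem jac_cons_add (P : RectData n M (k + 1)) {j : P.ι} {x : Fin (k + 1) → ℝ} (hx : x ∈ P.E j)
    (f g : TestFn n M) (π : Fin k → TestFn n M) :
    jac (Fin.cons (f + g) π) (P.φ j) x
      = jac (Fin.cons f π) (P.φ j) x + jac (Fin.cons g π) (P.φ j) x := by
  have hd : ∀ g : TestFn n M, DifferentiableAt ℝ (fun y => g (P.φ j y)) x := fun g =>
    ((P.contDiffOn_comp j g).contDiffAt ((P.isOpen_U j).mem_nhds (P.E_subset j hx))).differentiableAt
      (by simp)
  unfold jac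
  have key : ∀ h : TestFn n M, (Matrix.of fun a b : Fin (k + 1) =>
      fderiv ℝ (fun y => (Fin.cons h π : Fin (k + 1) → TestFn n M) a (P.φ j y)) x (Pi.single b 1))
      = Matrix.updateRow (Matrix.of fun a b : Fin (k + 1) =>
      fderiv ℝ (fun y => (Fin.cons 0 π : Fin (k + 1) → TestFn n M) a (P.φ j y)) x (Pi.single b 1)) 0
        (fun b => fderiv ℝ (fun y => h (P.φ j y)) x (Pi.single b 1)) := by
    intro h
    ext a b
    refine Fin.cases ?_ (fun a => ?_) a
    · simp
    · simp [Matrix.updateRow_ne]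
  rw [key (f + g), key g, key f, ← Matrix.det_updateRow_add]
  congr 2
  ext b
  simp only [Pi.add_apply]
  rw [← add_apply, ← fderiv_fun_add (hd f) (hd g)]
  rfl

theorem boundary_add_left (P : RectData n M (k + 1)) (f g : TestFn n M) (π : Fin k → TestFn n M) :
    boundary n M k P.current (f + g) π
      = boundary n M k P.current f π + boundary n M k P.current g π := by
  change P.current _ _ = P.current _ _ + P.current _ _
  unfold current
  rw [← (P.summable _ _).tsum_add (P.summable _ _)]
  refine tsum_congr fun j => ?_
  rw [← integral_add (P.integrableOn j _ _) (P.integrableOn j _ _)]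
  refine setIntegral_congr_fun (P.measurableSet_E j) fun x hx => ?_
  simp only [P.jac_cons_add hx]
  ring

end Integrability

section Restrict

variable {n k : ℕ} {M : Type*} [TopologicalSpace M] [ChartedSpace (EuclideanSpace ℝ (Fin n)) M]

/-- The map `φ` is arbitrary outside `U`, so the preimage is shown to be Borel in the subspace `U`
first and is then carried back to `ℝᵏ`. -/
theorem measurableSet_inter_preimage (P : RectData n M k) (j : P.ι) {B : Set M}
    (hB : MeasurableSet[borel M] B) : MeasurableSet (P.E j ∩ P.φ j ⁻¹' B) := by
  borelize M
  have h1 : MeasurableSet ((P.U j).domRestrict (P.φ j) ⁻¹' B) :=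
    (continuousOn_iff_continuous_domRestrict.1 (P.continuousOn_φ j)).measurable hB
  have h2 := (P.isOpen_U j).measurableSet.subtype_image h1
  have h3 : P.E j ∩ P.φ j ⁻¹' B = P.E j ∩ (Subtype.val '' ((P.U j).domRestrict (P.φ j) ⁻¹' B)) := by
    ext x
    simp only [mem_inter_iff, mem_preimage, mem_image, Subtype.exists, exists_and_right,
      exists_eq_right]
    constructor
    · rintro ⟨h, h'⟩
      exact ⟨h, P.E_subset j h, h'⟩
    · rintro ⟨h, _, h'⟩
      exact ⟨h, h'⟩
  rw [h3]
  exact (P.measurableSet_E j).inter h2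

/-- The part of a rectifiable current in a Borel set `B`. -/
def restrict (P : RectData n M k) (B : Set M) (hB : MeasurableSet[borel M] B) : RectData n M k where
  ι := P.ι
  countable := P.countable
  U := P.U
  E := fun j => P.E j ∩ P.φ j ⁻¹' B
  φ := P.φ
  m := P.m
  -- The closure keeps the carrier compact. For the complement of an open set, the main case below,
  -- it adds no points.
  K := P.K ∩ closure B
  isOpen_U := P.isOpen_U
  measurableSet_E := fun j => P.measurableSet_inter_preimage j hB
  E_subset := fun j => inter_subset_left.trans (P.E_subset j)
  contMDiffOn := P.contMDiffOn
  isCompact_K := P.isCompact_K.inter_right isClosed_closure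
  mapsTo := fun j _ hx => ⟨P.mapsTo j hx.1, subset_closure hx.2⟩
  mass_finite π := by
    refine ne_top_of_le_ne_top (P.mass_finite π) (ENNReal.tsum_le_tsum fun j => ?_)
    exact lintegral_mono_set inter_subset_left

theorem current_restrict_add (P : RectData n M k) {B : Set M} (hB : MeasurableSet[borel M] B)
    (hB' : MeasurableSet[borel M] Bᶜ) :
    (P.restrict B hB).current + (P.restrict Bᶜ hB').current = P.current := by
  funext f π
  rw [Pi.add_apply, Pi.add_apply]
  refine (((P.restrict B hB).summable f π).tsum_add ((P.restrict Bᶜ hB').summable f π)).symm.trans ?_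
  refine tsum_congr fun j => ?_
  have := integral_inter_add_sdiff₀ (μ := volume) (s := P.E j) (t := P.E j ∩ P.φ j ⁻¹' B)
    (P.measurableSet_inter_preimage j hB).nullMeasurableSet (P.integrableOn j f π)
  rw [← this]
  congr 3
  · ext x; simp [restrict]
  · ext x; simp [restrict]

/-- Restriction does not change the value on functions supported inside. -/
theorem current_restrict_of_forall (P : RectData n M k) {B : Set M} (hB : MeasurableSet[borel M] B)
    (hB' : MeasurableSet[borel M] Bᶜ)
    {f : TestFn n M} {π : Fin k → TestFn n M}
    (h : ∀ j, ∀ x ∈ P.E j, P.φ j x ∉ B → f (P.φ j x) * jac π (P.φ j) x = 0) :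
    (P.restrict B hB).current f π = P.current f π := by
  rw [← P.current_restrict_add hB hB', Pi.add_apply, Pi.add_apply,
    (P.restrict Bᶜ hB').current_eq_zero (fun j x hx => h j x hx.1 hx.2), add_zero]

end Restrict

section MapOn

variable {l n k : ℕ} {N M : Type*}
  [TopologicalSpace N] [T2Space N] [SecondCountableTopology N]
  [ChartedSpace (EuclideanSpace ℝ (Fin l)) N] [IsManifold (𝓡 l) ∞ N]
  [TopologicalSpace M] [ChartedSpace (EuclideanSpace ℝ (Fin n)) M]

/-- The push-forward under a map that is smooth on an open neighbourhood of `P.K`. -/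
def mapOn (P : RectData l N k) {G : N → M} {W : Set N} (hW : IsOpen W)
    (hG : ContMDiffOn (𝓡 l) (𝓡 n) ∞ G W) (hK : P.K ⊆ W) : RectData n M k where
  ι := P.ι
  countable := P.countable
  U := fun j => P.U j ∩ P.φ j ⁻¹' W
  E := P.E
  φ := fun j x => G (P.φ j x)
  m := P.m
  K := G '' P.K
  isOpen_U := fun j => (P.continuousOn_φ j).isOpen_inter_preimage (P.isOpen_U j) hW
  measurableSet_E := P.measurableSet_E
  E_subset := fun j x hx => ⟨P.E_subset j hx, hK (P.mapsTo j hx)⟩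
  contMDiffOn := fun j => (hG.of_le (by simp)).comp ((P.contMDiffOn j).mono inter_subset_left)
    fun _ hx => hx.2
  isCompact_K := P.isCompact_K.image_of_continuousOn (hG.continuousOn.mono hK)
  mapsTo := fun j x hx => mem_image_of_mem _ (P.mapsTo j hx)
  mass_finite π := by
    -- The functions `π a ∘ G` live only on `W`. Global functions with the same germs along `P.K`
    -- give the same Jacobians, so the finite mass of `P` suffices.
    choose π' hπ' _ using fun a => exists_testFn_eq_near (n := l) P.isCompact_K hW hK
      ((π a).contMDiff.comp_contMDiffOn hG)
    refine ne_top_of_le_ne_top (P.mass_finite π') (ENNReal.tsum_le_tsum fun j => ?_)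
    refine (setLIntegral_congr_fun (P.measurableSet_E j) fun x hx => ?_).le
    congr 2
    refine jac_congr fun a => ?_
    refine ((P.continuousAt_φ hx).eventually
      (eventually_nhdsSet_iff_forall.1 (hπ' a) _ (P.mapsTo j hx))).mono fun y hy => ?_
    exact hy.symm

/-- The function `f'` needs to agree with `f ∘ G` only on the carrier, whereas the `π' a` are
differentiated and must agree with `π a ∘ G` near it. -/
theorem mapOn_current (P : RectData l N k) {G : N → M} {W : Set N} (hW : IsOpen W)
    (hG : ContMDiffOn (𝓡 l) (𝓡 n) ∞ G W) (hK : P.K ⊆ W) {f : TestFn n M}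
    {π : Fin k → TestFn n M} {f' : TestFn l N} {π' : Fin k → TestFn l N}
    (hf : ∀ x ∈ P.K, f' x = f (G x)) (hπ : ∀ a, ∀ᶠ x in 𝓝ˢ P.K, π' a x = π a (G x)) :
    (P.mapOn hW hG hK).current f π = P.current f' π' := by
  unfold current
  refine tsum_congr fun j => setIntegral_congr_fun (P.measurableSet_E j) fun x hx => ?_
  change _ * (f (G (P.φ j x)) * _) = _
  rw [← hf _ (P.mapsTo j hx)]
  congr 2
  refine jac_congr fun a => ?_
  refine ((P.continuousAt_φ hx).eventually
    (eventually_nhdsSet_iff_forall.1 (hπ a) _ (P.mapsTo j hx))).mono fun y hy => ?_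
  exact hy.symm

end MapOn

end RectData

/-! ### Coefficients of forms pulled back along a linear homotopy -/

section Homotopy

variable {n k : ℕ}

local notation "𝔼" => EuclideanSpace ℝ (Fin n)

/-- The differential of `g` along the linear homotopy `y + t (z - y)`, where `A` is the derivative
of `z` with respect to `y`. -/
def hrow (g : EuclideanSpace ℝ (Fin n) → ℝ) (t : ℝ) (y z : EuclideanSpace ℝ (Fin n))
    (A : EuclideanSpace ℝ (Fin n) →L[ℝ] EuclideanSpace ℝ (Fin n))
    (c : Fin n) : ℝ :=
  fderiv ℝ g (y + t • (z - y))
    (EuclideanSpace.single c 1 + t • (A (EuclideanSpace.single c 1) - EuclideanSpace.single c 1))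

/-- The coefficients of the pull-back of `f dπ` under the map `y ↦ y + t (z - y)`. -/
def pullCoeff (f : EuclideanSpace ℝ (Fin n) → ℝ) (π : Fin k → EuclideanSpace ℝ (Fin n) → ℝ)
    (I : Fin k → Fin n) (t : ℝ) (y z : EuclideanSpace ℝ (Fin n))
    (A : EuclideanSpace ℝ (Fin n) →L[ℝ] EuclideanSpace ℝ (Fin n)) : ℝ :=
  f (y + t • (z - y)) * ∏ a, hrow (π a) t y z A (I a)

/-- The coefficients of the contraction with `∂/∂t` of the pull-back of `df ∧ dπ` under the linear
homotopy `y + t (z - y)`. -/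
def homCoeff (f : EuclideanSpace ℝ (Fin n) → ℝ) (π : Fin k → EuclideanSpace ℝ (Fin n) → ℝ)
    (I : Fin k → Fin n) (t : ℝ) (y z : EuclideanSpace ℝ (Fin n))
    (A : EuclideanSpace ℝ (Fin n) →L[ℝ] EuclideanSpace ℝ (Fin n)) : ℝ :=
  fderiv ℝ f (y + t • (z - y)) (z - y) * ∏ a, hrow (π a) t y z A (I a)
    - ∑ a, fderiv ℝ (π a) (y + t • (z - y)) (z - y)
      * ∏ b, hrow (Function.update π a f b) t y z A (I b)

theorem continuous_hrow {g : 𝔼 → ℝ} (hg : ContDiff ℝ ∞ g) (c : Fin n) :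
    Continuous fun p : ℝ × 𝔼 × 𝔼 × (𝔼 →L[ℝ] 𝔼) => hrow g p.1 p.2.1 p.2.2.1 p.2.2.2 c := by
  unfold hrow
  have h := hg.continuous_fderiv (by simp)
  fun_prop

theorem continuous_pullCoeff {f : 𝔼 → ℝ} (hf : ContDiff ℝ ∞ f) {π : Fin k → 𝔼 → ℝ}
    (hπ : ∀ a, ContDiff ℝ ∞ (π a)) (I : Fin k → Fin n) :
    Continuous fun p : ℝ × 𝔼 × 𝔼 × (𝔼 →L[ℝ] 𝔼) => pullCoeff f π I p.1 p.2.1 p.2.2.1 p.2.2.2 := by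
  unfold pullCoeff
  have h := hf.continuous
  have h2 := fun a => continuous_hrow (hπ a) (I a)
  exact (by fun_prop : Continuous _).mul (continuous_finsetProd _ fun a _ => h2 a)

theorem contDiff_update {f : 𝔼 → ℝ} (hf : ContDiff ℝ ∞ f) {π : Fin k → 𝔼 → ℝ}
    (hπ : ∀ a, ContDiff ℝ ∞ (π a)) (a b : Fin k) : ContDiff ℝ ∞ (Function.update π a f b) := by
  rcases eq_or_ne b a with rfl | h
  · simpa using hf
  · simpa [h] using hπ b

theorem continuous_homCoeff {f : 𝔼 → ℝ} (hf : ContDiff ℝ ∞ f) {π : Fin k → 𝔼 → ℝ}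
    (hπ : ∀ a, ContDiff ℝ ∞ (π a)) (I : Fin k → Fin n) :
    Continuous fun p : ℝ × 𝔼 × 𝔼 × (𝔼 →L[ℝ] 𝔼) => homCoeff f π I p.1 p.2.1 p.2.2.1 p.2.2.2 := by
  unfold homCoeff
  have h := hf.continuous_fderiv (by simp)
  have h1 := fun a => (hπ a).continuous_fderiv (by simp)
  have h2 := fun a => continuous_hrow (hπ a) (I a)
  have h3 := fun a b => continuous_hrow (contDiff_update hf hπ a b) (I b)
  refine Continuous.sub ?_ ?_
  · exact (by fun_prop : Continuous _).mul (continuous_finsetProd _ fun a _ => h2 a)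
  · refine continuous_finsetSum _ fun a _ => ?_
    have := h1 a
    exact (by fun_prop : Continuous _).mul (continuous_finsetProd _ fun b _ => h3 a b)

theorem norm_segment_le {R t : ℝ} (ht : t ∈ Icc (0 : ℝ) 1) {y z : 𝔼} (hy : ‖y‖ ≤ R) (hz : ‖z‖ ≤ R) :
    ‖y + t • (z - y)‖ ≤ R := by
  have h := (convex_closedBall (0 : 𝔼) R).add_smul_sub_mem (x := y) (y := z)
    (by simpa using hy) (by simpa using hz) ht
  simpa using h

/-- The growth in the derivative `A` is linear, uniformly in time and in the end points within a
ball. A product of `k` such rows therefore costs `(1 + ‖A‖) ^ k`, the energy that must be integrable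
for a singular map. -/
theorem exists_bound_hrow {g : 𝔼 → ℝ} (hg : ContDiff ℝ ∞ g) (R : ℝ) :
    ∃ C, 0 ≤ C ∧ ∀ t ∈ Icc (0 : ℝ) 1, ∀ y z : 𝔼, ‖y‖ ≤ R → ‖z‖ ≤ R → ∀ A c,
      |hrow g t y z A c| ≤ C * (1 + ‖A‖) := by
  obtain ⟨C, hC⟩ := (isCompact_closedBall (0 : 𝔼) R).exists_bound_of_continuousOn
    (hg.continuous_fderiv (by simp)).continuousOn
  refine ⟨2 * max C 0, by positivity, fun t ht y z hy hz A c => ?_⟩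
  have h1 := hC (y + t • (z - y)) (by simpa using norm_segment_le ht hy hz)
  have hs : ‖(EuclideanSpace.single c 1 : 𝔼)‖ = 1 := by simp
  have h3 : ‖A (EuclideanSpace.single c 1)‖ ≤ ‖A‖ := by simpa [hs] using A.le_opNorm (EuclideanSpace.single c 1 : 𝔼)
  have h2 : ‖(EuclideanSpace.single c 1 : 𝔼)
      + t • (A (EuclideanSpace.single c 1) - EuclideanSpace.single c 1)‖ ≤ 2 * (1 + ‖A‖) := by
    refine (norm_add_le _ _).trans ?_
    rw [norm_smul, Real.norm_of_nonneg ht.1, hs]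
    have h4 := norm_sub_le (A (EuclideanSpace.single c 1)) (EuclideanSpace.single c 1 : 𝔼)
    rw [hs] at h4
    nlinarith [ht.1, ht.2, norm_nonneg A, norm_nonneg (A (EuclideanSpace.single c 1) - (EuclideanSpace.single c 1 : 𝔼))]
  unfold hrow
  rw [← Real.norm_eq_abs]
  refine (ContinuousLinearMap.le_opNorm _ _).trans ?_
  calc _ ≤ max C 0 * (2 * (1 + ‖A‖)) := by
        refine mul_le_mul (h1.trans (le_max_left _ _)) h2 (norm_nonneg _) (le_max_right _ _)
    _ = _ := by ring

theorem exists_bound_prod_hrow {π : Fin k → 𝔼 → ℝ} (hπ : ∀ a, ContDiff ℝ ∞ (π a)) (R : ℝ) :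
    ∃ C, 0 ≤ C ∧ ∀ t ∈ Icc (0 : ℝ) 1, ∀ y z : 𝔼, ‖y‖ ≤ R → ‖z‖ ≤ R → ∀ A (I : Fin k → Fin n),
      |∏ a, hrow (π a) t y z A (I a)| ≤ C * (1 + ‖A‖) ^ k := by
  choose C hC0 hC using fun a => exists_bound_hrow (hπ a) R
  refine ⟨∏ a, C a, Finset.prod_nonneg fun a _ => hC0 a, fun t ht y z hy hz A I => ?_⟩
  rw [Finset.abs_prod]
  refine (Finset.prod_le_prod (fun _ _ => abs_nonneg _)
    fun a _ => hC a t ht y z hy hz A (I a)).trans ?_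
  rw [Finset.prod_mul_distrib]
  simp

theorem exists_bound_pullCoeff {f : 𝔼 → ℝ} (hf : ContDiff ℝ ∞ f) {π : Fin k → 𝔼 → ℝ}
    (hπ : ∀ a, ContDiff ℝ ∞ (π a)) (R : ℝ) :
    ∃ C, 0 ≤ C ∧ ∀ t ∈ Icc (0 : ℝ) 1, ∀ y z : 𝔼, ‖y‖ ≤ R → ‖z‖ ≤ R → ∀ A (I : Fin k → Fin n),
      |pullCoeff f π I t y z A| ≤ C * (1 + ‖A‖) ^ k := by
  obtain ⟨C, hC⟩ := (isCompact_closedBall (0 : 𝔼) R).exists_bound_of_continuousOn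
    hf.continuous.continuousOn
  obtain ⟨D, hD0, hD⟩ := exists_bound_prod_hrow hπ R
  refine ⟨max C 0 * D, by positivity, fun t ht y z hy hz A I => ?_⟩
  have h1 := hC (y + t • (z - y)) (by simpa using norm_segment_le ht hy hz)
  unfold pullCoeff
  rw [abs_mul, mul_assoc]
  exact mul_le_mul (h1.trans (le_max_left _ _)) (hD t ht y z hy hz A I) (abs_nonneg _)
    (le_max_right _ _)

/-- The contracted factor contains `z - y`, which is bounded, and no derivative of the map. So the
exponent stays `k` although the homotopy has dimension `k + 1`: the energy that controls the
push-forward also controls the homotopy. -/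
theorem exists_bound_homCoeff {f : 𝔼 → ℝ} (hf : ContDiff ℝ ∞ f) {π : Fin k → 𝔼 → ℝ}
    (hπ : ∀ a, ContDiff ℝ ∞ (π a)) (R : ℝ) :
    ∃ C, 0 ≤ C ∧ ∀ t ∈ Icc (0 : ℝ) 1, ∀ y z : 𝔼, ‖y‖ ≤ R → ‖z‖ ≤ R → ∀ A (I : Fin k → Fin n),
      |homCoeff f π I t y z A| ≤ C * (1 + ‖A‖) ^ k := by
  have key : ∀ g : 𝔼 → ℝ, ContDiff ℝ ∞ g → ∀ π : Fin k → 𝔼 → ℝ, (∀ a, ContDiff ℝ ∞ (π a)) →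
      ∃ C, 0 ≤ C ∧ ∀ t ∈ Icc (0 : ℝ) 1, ∀ y z : 𝔼, ‖y‖ ≤ R → ‖z‖ ≤ R → ∀ A (I : Fin k → Fin n),
      |fderiv ℝ g (y + t • (z - y)) (z - y) * ∏ a, hrow (π a) t y z A (I a)|
        ≤ C * (1 + ‖A‖) ^ k := by
    intro g hg π hπ
    obtain ⟨C, hC⟩ := (isCompact_closedBall (0 : 𝔼) R).exists_bound_of_continuousOn
      (hg.continuous_fderiv (by simp)).continuousOn
    obtain ⟨D, hD0, hD⟩ := exists_bound_prod_hrow hπ R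
    refine ⟨max C 0 * (2 * |R|) * D, by positivity, fun t ht y z hy hz A I => ?_⟩
    have h1 := hC (y + t • (z - y)) (by simpa using norm_segment_le ht hy hz)
    have h2 : ‖z - y‖ ≤ 2 * |R| := by
      have := norm_sub_le z y
      have := le_abs_self R
      linarith
    rw [abs_mul, mul_assoc _ D]
    refine mul_le_mul ?_ (hD t ht y z hy hz A I) (abs_nonneg _) (by positivity)
    rw [← Real.norm_eq_abs]
    exact (ContinuousLinearMap.le_opNorm _ _).trans
      (mul_le_mul (h1.trans (le_max_left _ _)) h2 (norm_nonneg _) (le_max_right _ _))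
  obtain ⟨C, hC0, hC⟩ := key f hf π hπ
  choose D hD0 hD using fun a => key (π a) (hπ a) (Function.update π a f)
    (fun b => contDiff_update hf hπ a b)
  refine ⟨C + ∑ a, D a, add_nonneg hC0 (Finset.sum_nonneg fun a _ => hD0 a),
    fun t ht y z hy hz A I => ?_⟩
  unfold homCoeff
  rw [add_mul, Finset.sum_mul]
  refine (abs_sub _ _).trans (add_le_add (hC t ht y z hy hz A I) ?_)
  exact (Finset.abs_sum_le_sum_abs _ _).trans (Finset.sum_le_sum fun a _ => hD a t ht y z hy hz A I)

end Homotopy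

/-! ### The homotopy formula and its singular limit -/

section HomotopyFormula

variable {n k : ℕ}

local notation "𝔼" => EuclideanSpace ℝ (Fin n)

/-- In `hrow` the image point `z` and the derivative `A` are independent variables, so that
continuity, bounds and limits follow by composition. At `z = F x`, `A = DF x` the chain rule
identifies it with an actual partial derivative. -/
theorem hrow_eq_fderiv {g : 𝔼 → ℝ} (hg : ContDiff ℝ ∞ g) {F : 𝔼 → 𝔼} {x : 𝔼}
    (hF : DifferentiableAt ℝ F x) (t : ℝ) (c : Fin n) :
    hrow g t x (F x) (fderiv ℝ F x) c
      = fderiv ℝ (fun x => g (x + t • (F x - x))) x (EuclideanSpace.single c 1) := by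
  have h1 : HasFDerivAt (fun x : 𝔼 => x + t • (F x - x))
      (ContinuousLinearMap.id ℝ 𝔼 + t • (fderiv ℝ F x - ContinuousLinearMap.id ℝ 𝔼)) x :=
    (hasFDerivAt_id x).add ((hF.hasFDerivAt.sub (hasFDerivAt_id x)).const_smul t)
  have h2 := ((hg.differentiable (by simp)) (x + t • (F x - x))).hasFDerivAt.comp x h1
  rw [show (fun x => g (x + t • (F x - x))) = g ∘ fun x : 𝔼 => x + t • (F x - x) from rfl, h2.fderiv]
  simp [hrow]

theorem fderiv_fderiv_comp {g : 𝔼 → ℝ} (hg : ContDiff ℝ ∞ g) {F : 𝔼 → 𝔼} (hF : ContDiff ℝ ∞ F)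
    (x : 𝔼) (t : ℝ) (e : 𝔼) :
    fderiv ℝ (fun x => fderiv ℝ g (x + t • (F x - x)) (F x - x)) x e
      = fderiv ℝ g (x + t • (F x - x)) (fderiv ℝ F x e - e)
        + fderiv ℝ (fderiv ℝ g) (x + t • (F x - x)) (e + t • (fderiv ℝ F x e - e)) (F x - x) := by
  have hg2 : ContDiff ℝ ∞ (fderiv ℝ g) := hg.fderiv_right (by simp)
  have hFd : DifferentiableAt ℝ F x := (hF.differentiable (by simp)) x
  have h0 : DifferentiableAt ℝ (fun x => F x - x) x := hFd.sub differentiableAt_id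
  have h1 : DifferentiableAt ℝ (fun x : 𝔼 => x + t • (F x - x)) x :=
    differentiableAt_id.add (h0.const_smul t)
  have h2 : DifferentiableAt ℝ (fderiv ℝ g) (x + t • (F x - x)) := (hg2.differentiable (by simp)) _
  have h3 : DifferentiableAt ℝ (fun x => fderiv ℝ g (x + t • (F x - x))) x := h2.comp x h1
  rw [fderiv_clm_apply h3 h0, _root_.add_apply, ContinuousLinearMap.comp_apply,
    ContinuousLinearMap.flip_apply, fderiv_fun_comp x h2 h1, ContinuousLinearMap.comp_apply,
    fderiv_fun_add differentiableAt_fun_id (h0.fun_const_smul t), fderiv_fun_const_smul h0,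
    fderiv_fun_sub hFd differentiableAt_fun_id]
  simp

/-- Time and space derivatives of `g (x + t (F x - x))` commute; this rests on the symmetry of the
second derivative of `g`. -/
theorem hasDerivAt_hrow {g : 𝔼 → ℝ} (hg : ContDiff ℝ ∞ g) {F : 𝔼 → 𝔼} (hF : ContDiff ℝ ∞ F)
    (x : 𝔼) (t : ℝ) (c : Fin n) :
    HasDerivAt (fun t => hrow g t x (F x) (fderiv ℝ F x) c)
      (fderiv ℝ (fun x => fderiv ℝ g (x + t • (F x - x)) (F x - x)) x (EuclideanSpace.single c 1))
      t := by
  have hg2 : ContDiff ℝ ∞ (fderiv ℝ g) := hg.fderiv_right (by simp)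
  rw [fderiv_fderiv_comp hg hF]
  have h2 : DifferentiableAt ℝ (fderiv ℝ g) (x + t • (F x - x)) := (hg2.differentiable (by simp)) _
  have h3 : HasDerivAt (fun t : ℝ => x + t • (F x - x)) (F x - x) t := by
    simpa using ((hasDerivAt_id t).smul_const (F x - x)).const_add x
  have h4 : HasDerivAt (fun t : ℝ => (EuclideanSpace.single c 1 : 𝔼)
      + t • (fderiv ℝ F x (EuclideanSpace.single c 1) - EuclideanSpace.single c 1))
      (fderiv ℝ F x (EuclideanSpace.single c 1) - EuclideanSpace.single c 1) t := by
    simpa using ((hasDerivAt_id t).smul_const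
      (fderiv ℝ F x (EuclideanSpace.single c 1) - EuclideanSpace.single c 1)).const_add (EuclideanSpace.single c 1 : 𝔼)
  have h6 : HasDerivAt (fun t : ℝ => fderiv ℝ g (x + t • (F x - x)))
      (fderiv ℝ (fderiv ℝ g) (x + t • (F x - x)) (F x - x)) t :=
    h2.hasFDerivAt.comp_hasDerivAt t h3
  have hsymm : IsSymmSndFDerivAt ℝ g (x + t • (F x - x)) :=
    hg.contDiffAt.isSymmSndFDerivAt (by rw [minSmoothness_of_isRCLikeNormedField]; exact WithTop.coe_le_coe.2 (le_top : (2 : ℕ∞) ≤ ⊤))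
  refine (h6.clm_apply h4).congr_deriv ?_
  rw [hsymm.eq, add_comm]

/-- The time derivative of `pullCoeff` along the linear homotopy from the identity to `F`. -/
def pullCoeffDeriv (f : EuclideanSpace ℝ (Fin n) → ℝ) (π : Fin k → EuclideanSpace ℝ (Fin n) → ℝ)
    (F : EuclideanSpace ℝ (Fin n) → EuclideanSpace ℝ (Fin n))
    (I : Fin k → Fin n) (t : ℝ) (x : EuclideanSpace ℝ (Fin n)) : ℝ :=
  fderiv ℝ f (x + t • (F x - x)) (F x - x) * ∏ a, hrow (π a) t x (F x) (fderiv ℝ F x) (I a)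
    + f (x + t • (F x - x)) * ∑ a, (∏ b ∈ Finset.univ.erase a,
        hrow (π b) t x (F x) (fderiv ℝ F x) (I b))
      * fderiv ℝ (fun x => fderiv ℝ (π a) (x + t • (F x - x)) (F x - x)) x
          (EuclideanSpace.single (I a) 1)

theorem hasDerivAt_pullCoeff {f : 𝔼 → ℝ} (hf : ContDiff ℝ ∞ f) {π : Fin k → 𝔼 → ℝ}
    (hπ : ∀ a, ContDiff ℝ ∞ (π a)) {F : 𝔼 → 𝔼} (hF : ContDiff ℝ ∞ F) (I : Fin k → Fin n)
    (t : ℝ) (x : 𝔼) :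
    HasDerivAt (fun t => pullCoeff f π I t x (F x) (fderiv ℝ F x)) (pullCoeffDeriv f π F I t x) t := by
  have h3 : HasDerivAt (fun t : ℝ => x + t • (F x - x)) (F x - x) t := by
    simpa using ((hasDerivAt_id t).smul_const (F x - x)).const_add x
  have h1 := ((hf.differentiable (by simp)) (x + t • (F x - x))).hasFDerivAt.comp_hasDerivAt t h3
  have h2 := HasDerivAt.fun_finsetProd (u := Finset.univ) fun (a : Fin k) _ =>
    hasDerivAt_hrow (hπ a) hF x t (I a)
  exact (h1.mul h2).congr_deriv (by simp only [pullCoeffDeriv, smul_eq_mul, Function.comp_apply])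

theorem continuous_pullCoeffDeriv {f : 𝔼 → ℝ} (hf : ContDiff ℝ ∞ f) {π : Fin k → 𝔼 → ℝ}
    (hπ : ∀ a, ContDiff ℝ ∞ (π a)) {F : 𝔼 → 𝔼} (hF : ContDiff ℝ ∞ F) (I : Fin k → Fin n) :
    Continuous fun p : ℝ × 𝔼 => pullCoeffDeriv f π F I p.1 p.2 := by
  have hrowc : ∀ g : 𝔼 → ℝ, ContDiff ℝ ∞ g → ∀ c,
      Continuous fun p : ℝ × 𝔼 => hrow g p.1 p.2 (F p.2) (fderiv ℝ F p.2) c := fun g hg c =>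
    (continuous_hrow hg c).comp (continuous_fst.prodMk (continuous_snd.prodMk
      ((hF.continuous.comp continuous_snd).prodMk
        ((hF.continuous_fderiv (by simp)).comp continuous_snd))))
  have hsm : ∀ g : 𝔼 → ℝ, ContDiff ℝ ∞ g → ContDiff ℝ ∞
      fun p : ℝ × 𝔼 => fderiv ℝ g (p.2 + p.1 • (F p.2 - p.2)) (F p.2 - p.2) := by
    intro g hg
    have hg2 : ContDiff ℝ ∞ (fderiv ℝ g) := hg.fderiv_right (by simp)
    fun_prop
  have hpart : ∀ g : 𝔼 → ℝ, ContDiff ℝ ∞ g → ∀ e : 𝔼, Continuous fun p : ℝ × 𝔼 =>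
      fderiv ℝ (fun x => fderiv ℝ g (x + p.1 • (F x - x)) (F x - x)) p.2 e := by
    intro g hg e
    have h := (hsm g hg).continuous_fderiv (by simp)
    -- For fixed time the derivative in `x` is the joint derivative in the direction `(0, e)`, which
    -- is continuous in both variables.
    have heq : (fun p : ℝ × 𝔼 =>
        fderiv ℝ (fun x => fderiv ℝ g (x + p.1 • (F x - x)) (F x - x)) p.2 e)
        = fun p => fderiv ℝ (fun p : ℝ × 𝔼 =>
          fderiv ℝ g (p.2 + p.1 • (F p.2 - p.2)) (F p.2 - p.2)) p (0, e) := by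
      funext p
      have h1 : HasFDerivAt (fun x : 𝔼 => (p.1, x)) (ContinuousLinearMap.inr ℝ ℝ 𝔼) p.2 :=
        hasFDerivAt_prodMk_right p.1 p.2
      have h2 := (((hsm g hg).differentiable (by simp)) (p.1, p.2)).hasFDerivAt.comp p.2 h1
      rw [show (fun x => fderiv ℝ g (x + p.1 • (F x - x)) (F x - x))
        = (fun p : ℝ × 𝔼 => fderiv ℝ g (p.2 + p.1 • (F p.2 - p.2)) (F p.2 - p.2))
          ∘ fun x : 𝔼 => (p.1, x) from rfl, h2.fderiv]
      simp
    rw [heq]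
    fun_prop
  unfold pullCoeffDeriv
  refine Continuous.add ?_ ?_
  · exact (hsm f hf).continuous.mul (continuous_finsetProd _ fun a _ => hrowc _ (hπ a) _)
  · have hfc : Continuous fun p : ℝ × 𝔼 => f (p.2 + p.1 • (F p.2 - p.2)) := by
      have := hf.continuous
      have := hF.continuous
      fun_prop
    refine hfc.mul (continuous_finsetSum _ fun a _ => ?_)
    exact (continuous_finsetProd _ fun b _ => hrowc _ (hπ b) _).mul (hpart _ (hπ a) _)

theorem prod_fderiv_update {k : ℕ} (g : Fin k → 𝔼 → ℝ) (a : Fin k) (q : 𝔼 → ℝ) (x : 𝔼)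
    (v : Fin k → 𝔼) :
    ∏ b, fderiv ℝ (Function.update g a q b) x (v b)
      = (∏ b ∈ Finset.univ.erase a, fderiv ℝ (g b) x (v b)) * fderiv ℝ q x (v a) := by
  rw [← Finset.prod_erase_mul _ _ (Finset.mem_univ a), Function.update_self]
  congr 1
  refine Finset.prod_congr rfl fun b hb => ?_
  rw [Function.update_of_ne (Finset.ne_of_mem_erase hb)]

/-- Cartan's formula for the linear homotopy from the identity to `F`: the time derivative of the
pull-back differs from `homCoeff` by the coefficients of exact forms. -/
theorem pullCoeffDeriv_eq {f : 𝔼 → ℝ} (hf : ContDiff ℝ ∞ f) {π : Fin k → 𝔼 → ℝ}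
    (hπ : ∀ a, ContDiff ℝ ∞ (π a)) {F : 𝔼 → 𝔼} (hF : ContDiff ℝ ∞ F) (I : Fin k → Fin n)
    (t : ℝ) (x : 𝔼) :
    pullCoeffDeriv f π F I t x = homCoeff f π I t x (F x) (fderiv ℝ F x)
      + ∑ a, ∏ b, fderiv ℝ (Function.update (fun b x => π b (x + t • (F x - x))) a
          (fun x => f (x + t • (F x - x)) * fderiv ℝ (π a) (x + t • (F x - x)) (F x - x)) b) x
          (EuclideanSpace.single (I b) 1) := by
  have hFx : DifferentiableAt ℝ F x := (hF.differentiable (by simp)) x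
  have hrowe : ∀ (g : 𝔼 → ℝ), ContDiff ℝ ∞ g → ∀ c, hrow g t x (F x) (fderiv ℝ F x) c
      = fderiv ℝ (fun x => g (x + t • (F x - x))) x (EuclideanSpace.single c 1) :=
    fun g hg c => hrow_eq_fderiv hg hFx t c
  unfold pullCoeffDeriv homCoeff
  rw [Finset.mul_sum, sub_add_eq_add_sub, add_sub_assoc, ← Finset.sum_sub_distrib]
  congr 1
  refine Finset.sum_congr rfl fun a _ => ?_
  have hupd : ∏ b, hrow (Function.update π a f b) t x (F x) (fderiv ℝ F x) (I b)
      = (∏ b ∈ Finset.univ.erase a, hrow (π b) t x (F x) (fderiv ℝ F x) (I b))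
        * hrow f t x (F x) (fderiv ℝ F x) (I a) := by
    rw [← Finset.prod_erase_mul _ _ (Finset.mem_univ a), Function.update_self]
    congr 1
    refine Finset.prod_congr rfl fun b hb => ?_
    rw [Function.update_of_ne (Finset.ne_of_mem_erase hb)]
  rw [hupd, prod_fderiv_update]
  have hpr : ∏ b ∈ Finset.univ.erase a, fderiv ℝ (fun x => π b (x + t • (F x - x))) x
      (EuclideanSpace.single (I b) 1)
      = ∏ b ∈ Finset.univ.erase a, hrow (π b) t x (F x) (fderiv ℝ F x) (I b) :=
    Finset.prod_congr rfl fun b _ => (hrowe _ (hπ b) _).symm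
  rw [hpr, hrowe f hf]
  have hd1 : DifferentiableAt ℝ (fun x => f (x + t • (F x - x))) x := by
    have : ContDiff ℝ ∞ (fun x => f (x + t • (F x - x))) := by fun_prop
    exact (this.differentiable (by simp)) x
  have hd2 : DifferentiableAt ℝ (fun x => fderiv ℝ (π a) (x + t • (F x - x)) (F x - x)) x := by
    have hg2 : ContDiff ℝ ∞ (fderiv ℝ (π a)) := (hπ a).fderiv_right (by simp)
    have : ContDiff ℝ ∞ (fun x => fderiv ℝ (π a) (x + t • (F x - x)) (F x - x)) := by fun_prop
    exact (this.differentiable (by simp)) x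
  -- The product rule splits the exact term of index `a` in two: one part is the corresponding
  -- summand of the time derivative, and the other cancels the summand of index `a` in `homCoeff`.
  rw [fderiv_fun_mul hd1 hd2]
  simp only [_root_.add_apply, _root_.smul_apply, smul_eq_mul]
  ring

theorem tendsto_pullCoeff {f : 𝔼 → ℝ} (hf : ContDiff ℝ ∞ f) {π : Fin k → 𝔼 → ℝ}
    (hπ : ∀ a, ContDiff ℝ ∞ (π a)) (I : Fin k → Fin n) {t : ℝ} {y z : 𝔼} {A : 𝔼 →L[ℝ] 𝔼}
    {zs : ℕ → 𝔼} {As : ℕ → 𝔼 →L[ℝ] 𝔼} (hz : Tendsto zs atTop (𝓝 z)) (hA : Tendsto As atTop (𝓝 A)) :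
    Tendsto (fun m => pullCoeff f π I t y (zs m) (As m)) atTop (𝓝 (pullCoeff f π I t y z A)) := by
  have h : Tendsto (fun m => (t, y, zs m, As m)) atTop (𝓝 (t, y, z, A)) :=
    tendsto_const_nhds.prodMk_nhds (tendsto_const_nhds.prodMk_nhds (hz.prodMk_nhds hA))
  have h2 := ((continuous_pullCoeff hf hπ I).tendsto (t, y, z, A)).comp h
  simp only [Function.comp_def] at h2
  exact h2

theorem tendsto_homCoeff {f : 𝔼 → ℝ} (hf : ContDiff ℝ ∞ f) {π : Fin k → 𝔼 → ℝ}
    (hπ : ∀ a, ContDiff ℝ ∞ (π a)) (I : Fin k → Fin n) {t : ℝ} {y z : 𝔼} {A : 𝔼 →L[ℝ] 𝔼}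
    {zs : ℕ → 𝔼} {As : ℕ → 𝔼 →L[ℝ] 𝔼} (hz : Tendsto zs atTop (𝓝 z)) (hA : Tendsto As atTop (𝓝 A)) :
    Tendsto (fun m => homCoeff f π I t y (zs m) (As m)) atTop (𝓝 (homCoeff f π I t y z A)) := by
  have h : Tendsto (fun m => (t, y, zs m, As m)) atTop (𝓝 (t, y, z, A)) :=
    tendsto_const_nhds.prodMk_nhds (tendsto_const_nhds.prodMk_nhds (hz.prodMk_nhds hA))
  have h2 := ((continuous_homCoeff hf hπ I).tendsto (t, y, z, A)).comp h
  simp only [Function.comp_def] at h2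
  exact h2

variable {Ω : Type*} [MeasurableSpace Ω] {μ : Measure Ω} {y : Ω → EuclideanSpace ℝ (Fin n)}

theorem integrable_comp_mul (hy : Measurable y) {R : ℝ} (hR : ∀ u, ‖y u‖ ≤ R) {w : Ω → ℝ}
    (hw : Integrable w μ) {c : 𝔼 → ℝ} (hc : Continuous c) :
    Integrable (fun u => c (y u) * w u) μ := by
  obtain ⟨C, hC⟩ := (isCompact_closedBall (0 : 𝔼) R).exists_bound_of_continuousOn hc.continuousOn
  refine hw.bdd_mul (c := C) (hc.measurable.comp hy).aestronglyMeasurable ?_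
  exact Eventually.of_forall fun u => hC _ (by simpa using hR u)

theorem ae_prod_Icc [SFinite μ] {p : Ω → Prop} (hp : ∀ᵐ u ∂μ, p u) :
    ∀ᵐ q ∂((volume.restrict (Icc (0 : ℝ) 1)).prod μ), q.1 ∈ Icc (0 : ℝ) 1 ∧ p q.2 := by
  refine Eventually.and ?_ ?_
  · exact Measure.quasiMeasurePreserving_fst.ae (ae_restrict_mem measurableSet_Icc)
  · exact Measure.quasiMeasurePreserving_snd.ae hp

theorem integrable_prod_comp_mul [SFinite μ] (hy : Measurable y) {R : ℝ} (hR : ∀ u, ‖y u‖ ≤ R)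
    {w : Ω → ℝ} (hw : Integrable w μ) {c : ℝ × 𝔼 → ℝ} (hc : Continuous c) :
    Integrable (fun p : ℝ × Ω => c (p.1, y p.2) * w p.2)
      ((volume.restrict (Icc (0 : ℝ) 1)).prod μ) := by
  obtain ⟨C, hC⟩ := (isCompact_Icc.prod (isCompact_closedBall (0 : 𝔼) R)).exists_bound_of_continuousOn
    hc.continuousOn
  refine (hw.comp_snd (volume.restrict (Icc (0 : ℝ) 1))).bdd_mul (c := C) ?_ ?_
  · exact (hc.measurable.comp (measurable_fst.prodMk (hy.comp measurable_snd))).aestronglyMeasurable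
  · filter_upwards [ae_prod_Icc (μ := μ) (p := fun _ => True) (by simp)] with p hp
    exact hC _ ⟨hp.1, by simpa using hR p.2⟩

/-- The homotopy formula for a smooth map `F` that is the identity outside a set on which the
boundary vanishes. -/
theorem homotopy_formula [SFinite μ] (hy : Measurable y) {R : ℝ} (hR : ∀ u, ‖y u‖ ≤ R)
    {w : (Fin k → Fin n) → Ω → ℝ} (hw : ∀ I, Integrable (w I) μ) {V : Set 𝔼}
    (hcyc : ∀ g : Fin k → 𝔼 → ℝ, (∀ a, ContDiff ℝ ∞ (g a)) → ∀ a, tsupport (g a) ⊆ V →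
      ∑ I, ∫ u, (∏ b, fderiv ℝ (g b) (y u) (EuclideanSpace.single (I b) 1)) * w I u ∂μ = 0)
    {F : 𝔼 → 𝔼} (hF : ContDiff ℝ ∞ F) (hFV : tsupport (fun x => F x - x) ⊆ V)
    {f : 𝔼 → ℝ} (hf : ContDiff ℝ ∞ f) {π : Fin k → 𝔼 → ℝ} (hπ : ∀ a, ContDiff ℝ ∞ (π a)) :
    ∑ I, ∫ u, pullCoeff f π I 1 (y u) (F (y u)) (fderiv ℝ F (y u)) * w I u ∂μ
      - ∑ I, ∫ u, pullCoeff f π I 0 (y u) (F (y u)) (fderiv ℝ F (y u)) * w I u ∂μ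
      = ∑ I, ∫ p, homCoeff f π I p.1 (y p.2) (F (y p.2)) (fderiv ℝ F (y p.2)) * w I p.2
          ∂((volume.restrict (Icc (0 : ℝ) 1)).prod μ) := by
  have hmap : Continuous fun p : ℝ × 𝔼 => (p.1, p.2, F p.2, fderiv ℝ F p.2) :=
    continuous_fst.prodMk (continuous_snd.prodMk ((hF.continuous.comp continuous_snd).prodMk
      ((hF.continuous_fderiv (by simp)).comp continuous_snd)))
  have hmap2 : ∀ t : ℝ, Continuous fun x : 𝔼 => (t, x, F x, fderiv ℝ F x) := fun t =>
    hmap.comp (continuous_const.prodMk continuous_id)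
  have hBi : ∀ I t, Integrable
      (fun u => pullCoeff f π I t (y u) (F (y u)) (fderiv ℝ F (y u)) * w I u) μ := fun I t =>
    integrable_comp_mul hy hR (hw I) ((continuous_pullCoeff hf hπ I).comp (hmap2 t))
  have hdi : ∀ I, Integrable (fun p : ℝ × Ω => pullCoeffDeriv f π F I p.1 (y p.2) * w I p.2)
      ((volume.restrict (Icc (0 : ℝ) 1)).prod μ) := fun I =>
    integrable_prod_comp_mul hy hR (hw I) (continuous_pullCoeffDeriv hf hπ hF I)
  have hhi : ∀ I, Integrable (fun p : ℝ × Ω =>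
      homCoeff f π I p.1 (y p.2) (F (y p.2)) (fderiv ℝ F (y p.2)) * w I p.2)
      ((volume.restrict (Icc (0 : ℝ) 1)).prod μ) := fun I =>
    integrable_prod_comp_mul hy hR (hw I) ((continuous_homCoeff hf hπ I).comp hmap)
  -- Fubini with the time integral innermost, followed by the fundamental theorem of calculus at
  -- each point.
  have hFTC : ∀ I, ∫ p, pullCoeffDeriv f π F I p.1 (y p.2) * w I p.2
      ∂((volume.restrict (Icc (0 : ℝ) 1)).prod μ)
      = ∫ u, pullCoeff f π I 1 (y u) (F (y u)) (fderiv ℝ F (y u)) * w I u ∂μ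
        - ∫ u, pullCoeff f π I 0 (y u) (F (y u)) (fderiv ℝ F (y u)) * w I u ∂μ := by
    intro I
    rw [integral_prod_symm _ (hdi I), ← integral_sub (hBi I 1) (hBi I 0)]
    refine integral_congr_ae (Eventually.of_forall fun u => ?_)
    simp only
    rw [integral_mul_const, ← sub_mul, integral_Icc_eq_integral_Ioc,
      ← intervalIntegral.integral_of_le zero_le_one]
    congr 1
    refine intervalIntegral.integral_eq_sub_of_hasDerivAt
      (fun t _ => hasDerivAt_pullCoeff hf hπ hF I t (y u)) ?_
    refine Continuous.intervalIntegrable ?_ _ _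
    exact (continuous_pullCoeffDeriv hf hπ hF I).comp (continuous_id.prodMk continuous_const)
  rw [← Finset.sum_sub_distrib]
  simp_rw [← hFTC]
  rw [← integral_finsetSum _ fun I _ => hdi I, ← integral_finsetSum _ fun I _ => hhi I,
    integral_prod _ (integrable_finsetSum _ fun I _ => hdi I),
    integral_prod _ (integrable_finsetSum _ fun I _ => hhi I)]
  refine integral_congr_ae (Eventually.of_forall fun t => ?_)
  simp only
  have hdi' : ∀ I, Integrable (fun u => pullCoeffDeriv f π F I t (y u) * w I u) μ := fun I =>
    integrable_comp_mul hy hR (hw I)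
      ((continuous_pullCoeffDeriv hf hπ hF I).comp (continuous_const.prodMk continuous_id))
  have hhi' : ∀ I, Integrable (fun u =>
      homCoeff f π I t (y u) (F (y u)) (fderiv ℝ F (y u)) * w I u) μ := fun I =>
    integrable_comp_mul hy hR (hw I) ((continuous_homCoeff hf hπ I).comp (hmap2 t))
  -- These tuples carry the exact terms of Cartan's formula. The entry of index `a` contains the
  -- factor `F x - x`, so its support lies in `V` and the cycle hypothesis applies.
  set g : Fin k → Fin k → 𝔼 → ℝ := fun a => Function.update (fun b x => π b (x + t • (F x - x))) a
    (fun x => f (x + t • (F x - x)) * fderiv ℝ (π a) (x + t • (F x - x)) (F x - x)) with hgdef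
  have hgs : ∀ a b, ContDiff ℝ ∞ (g a b) := by
    intro a b
    have h2 : ContDiff ℝ ∞ (fderiv ℝ (π a)) := (hπ a).fderiv_right (by simp)
    rcases eq_or_ne b a with rfl | h
    · simp only [hgdef, Function.update_self]
      fun_prop
    · simp only [hgdef, Function.update_of_ne h]
      have := hπ b
      fun_prop
  have hgi : ∀ a I, Integrable (fun u =>
      (∏ b, fderiv ℝ (g a b) (y u) (EuclideanSpace.single (I b) 1)) * w I u) μ := fun a I => by
    refine integrable_comp_mul hy hR (hw I)
      (c := fun x => ∏ b, fderiv ℝ (g a b) x (EuclideanSpace.single (I b) 1)) ?_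
    exact continuous_finsetProd _ fun b _ =>
      ((hgs a b).continuous_fderiv (by simp)).clm_apply continuous_const
  rw [integral_finsetSum _ fun I _ => hdi' I, integral_finsetSum _ fun I _ => hhi' I]
  have hsplit : ∀ I, ∫ u, pullCoeffDeriv f π F I t (y u) * w I u ∂μ
      = ∫ u, homCoeff f π I t (y u) (F (y u)) (fderiv ℝ F (y u)) * w I u ∂μ
        + ∑ a, ∫ u, (∏ b, fderiv ℝ (g a b) (y u) (EuclideanSpace.single (I b) 1)) * w I u ∂μ := by
    intro I
    rw [← integral_finsetSum _ fun a _ => hgi a I,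
      ← integral_add (hhi' I) (integrable_finsetSum _ fun a _ => hgi a I)]
    refine integral_congr_ae (Eventually.of_forall fun u => ?_)
    simp only
    rw [pullCoeffDeriv_eq hf hπ hF, add_mul, Finset.sum_mul]
  simp_rw [hsplit]
  rw [Finset.sum_add_distrib, Finset.sum_comm]
  refine add_eq_left.2 (Finset.sum_eq_zero fun a _ => ?_)
  refine hcyc (g a) (hgs a) a (Subset.trans (closure_mono fun x hx => ?_) hFV)
  simp only [hgdef, Function.update_self, Function.mem_support] at hx ⊢
  intro h0
  rw [h0] at hx
  simp at hx

/-- The homotopy formula for a singular map that is a dominated limit of smooth maps. -/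
theorem homotopy_formula_limit [SFinite μ] (hy : Measurable y) {R : ℝ} (hR : ∀ u, ‖y u‖ ≤ R)
    {w : (Fin k → Fin n) → Ω → ℝ} (hw : ∀ I, Integrable (w I) μ) {V : Set 𝔼}
    (hcyc : ∀ g : Fin k → 𝔼 → ℝ, (∀ a, ContDiff ℝ ∞ (g a)) → ∀ a, tsupport (g a) ⊆ V →
      ∑ I, ∫ u, (∏ b, fderiv ℝ (g b) (y u) (EuclideanSpace.single (I b) 1)) * w I u ∂μ = 0)
    {Fs : ℕ → 𝔼 → 𝔼} (hFs : ∀ m, ContDiff ℝ ∞ (Fs m))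
    (hFV : ∀ m, tsupport (fun x => Fs m x - x) ⊆ V) (hFR : ∀ m u, ‖Fs m (y u)‖ ≤ R)
    {F : 𝔼 → 𝔼} {G : Ω → ℝ} (hG : ∀ I, Integrable (fun u => (1 + G u) ^ k * w I u) μ)
    (hlim : ∀ᵐ u ∂μ, (∀ I, w I u = 0) ∨ (Tendsto (fun m => Fs m (y u)) atTop (𝓝 (F (y u))) ∧
      Tendsto (fun m => fderiv ℝ (Fs m) (y u)) atTop (𝓝 (fderiv ℝ F (y u))) ∧
      ∀ m, ‖fderiv ℝ (Fs m) (y u)‖ ≤ G u))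
    {f : 𝔼 → ℝ} (hf : ContDiff ℝ ∞ f) {π : Fin k → 𝔼 → ℝ} (hπ : ∀ a, ContDiff ℝ ∞ (π a)) :
    ∑ I, ∫ u, pullCoeff f π I 1 (y u) (F (y u)) (fderiv ℝ F (y u)) * w I u ∂μ
      - ∑ I, ∫ u, pullCoeff f π I 0 (y u) (F (y u)) (fderiv ℝ F (y u)) * w I u ∂μ
      = ∑ I, ∫ p, homCoeff f π I p.1 (y p.2) (F (y p.2)) (fderiv ℝ F (y p.2)) * w I p.2
          ∂((volume.restrict (Icc (0 : ℝ) 1)).prod μ) := by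
  have hmap : ∀ m, Measurable fun p : ℝ × Ω =>
      ((p.1, y p.2, Fs m (y p.2), fderiv ℝ (Fs m) (y p.2)) : ℝ × 𝔼 × 𝔼 × (𝔼 →L[ℝ] 𝔼)) := fun m =>
    have h := hy.comp (measurable_snd (α := ℝ))
    measurable_fst.prodMk (h.prodMk (((hFs m).continuous.measurable.comp h).prodMk
      (((hFs m).continuous_fderiv (by simp)).measurable.comp h)))
  have hmap2 : ∀ m (t : ℝ), Measurable fun u =>
      ((t, y u, Fs m (y u), fderiv ℝ (Fs m) (y u)) : ℝ × 𝔼 × 𝔼 × (𝔼 →L[ℝ] 𝔼)) := fun m t =>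
    (hmap m).comp measurable_prodMk_left
  obtain ⟨C, hC0, hC⟩ := exists_bound_pullCoeff (n := n) hf hπ R
  obtain ⟨D, hD0, hD⟩ := exists_bound_homCoeff (n := n) hf hπ R
  -- One domination serves the end terms and the homotopy term alike, since both coefficients grow
  -- like the `k`-th power of the derivative.
  have hbd : ∀ {c : ℝ} {A G : ℝ} {v : ℝ} {E : ℝ}, 0 ≤ E → 0 ≤ A → A ≤ G → |c| ≤ E * (1 + A) ^ k →
      ‖c * v‖ ≤ E * ‖(1 + G) ^ k * v‖ := by
    intro c A G v E hE hA hAG hc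
    rw [norm_mul, norm_mul, ← mul_assoc, Real.norm_eq_abs c]
    refine mul_le_mul_of_nonneg_right (hc.trans ?_) (norm_nonneg _)
    have hG := hA.trans hAG
    rw [Real.norm_of_nonneg (by positivity)]
    gcongr
  have h1 : ∀ t ∈ Icc (0 : ℝ) 1, ∀ I, Tendsto
      (fun m => ∫ u, pullCoeff f π I t (y u) (Fs m (y u)) (fderiv ℝ (Fs m) (y u)) * w I u ∂μ) atTop
      (𝓝 (∫ u, pullCoeff f π I t (y u) (F (y u)) (fderiv ℝ F (y u)) * w I u ∂μ)) := by
    intro t ht I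
    refine tendsto_integral_of_dominated_convergence (fun u => C * ‖(1 + G u) ^ k * w I u‖)
      (fun m => ?_) ((hG I).norm.const_mul C) (fun m => ?_) ?_
    · exact (((continuous_pullCoeff hf hπ I).measurable.comp (hmap2 m t)).aestronglyMeasurable).mul
        (hw I).aestronglyMeasurable
    · filter_upwards [hlim] with u hu
      rcases hu with hu | ⟨-, -, hu⟩
      · simp [hu I]
      · exact hbd hC0 (norm_nonneg _) (hu m) (hC t ht _ _ (hR u) (hFR m u) _ I)
    · filter_upwards [hlim] with u hu
      rcases hu with hu | ⟨ha, hb, -⟩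
      · simp [hu I]
      · refine Tendsto.mul_const _ ?_
        exact tendsto_pullCoeff hf hπ I ha hb
  have h2 : ∀ I, Tendsto
      (fun m => ∫ p, homCoeff f π I p.1 (y p.2) (Fs m (y p.2)) (fderiv ℝ (Fs m) (y p.2)) * w I p.2
          ∂((volume.restrict (Icc (0 : ℝ) 1)).prod μ)) atTop
      (𝓝 (∫ p, homCoeff f π I p.1 (y p.2) (F (y p.2)) (fderiv ℝ F (y p.2)) * w I p.2
          ∂((volume.restrict (Icc (0 : ℝ) 1)).prod μ))) := by
    intro I
    refine tendsto_integral_of_dominated_convergence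
      (fun p => D * ‖(1 + G p.2) ^ k * w I p.2‖)
      (fun m => ?_) (((hG I).norm.const_mul D).comp_snd _) (fun m => ?_) ?_
    · exact (((continuous_homCoeff hf hπ I).measurable.comp (hmap m)).aestronglyMeasurable).mul
        (hw I).aestronglyMeasurable.comp_snd
    · filter_upwards [ae_prod_Icc hlim] with p hp
      obtain ⟨ht, hu | ⟨-, -, hu⟩⟩ := hp
      · simp [hu I]
      · exact hbd hD0 (norm_nonneg _) (hu m) (hD p.1 ht _ _ (hR _) (hFR m _) _ I)
    · filter_upwards [ae_prod_Icc hlim] with p hp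
      obtain ⟨ht, hu | ⟨ha, hb, -⟩⟩ := hp
      · simp [hu I]
      · refine Tendsto.mul_const _ ?_
        exact tendsto_homCoeff hf hπ I ha hb
  refine tendsto_nhds_unique ((tendsto_finsetSum _ fun I _ => h1 1 (by simp) I).sub
    (tendsto_finsetSum _ fun I _ => h1 0 (by simp) I)) ?_
  refine (tendsto_finsetSum _ fun I _ => h2 I).congr fun m => ?_
  exact (homotopy_formula hy hR hw hcyc (hFs m) (hFV m) hf hπ).symm

end HomotopyFormula

/-! ### Determinant expansions -/

section LinearAlgebra

theorem det_cons_column_single {k : ℕ} (v : Fin (k + 1) → Fin k → ℝ) (r : Fin (k + 1)) :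
    (Matrix.of fun i => (Fin.cons ((Pi.single r 1 : Fin (k + 1) → ℝ) i) (v i) : Fin (k + 1) → ℝ)).det
      = (-1) ^ (r : ℕ) * (Matrix.of fun i => v (r.succAbove i)).det := by
  rw [Matrix.det_succ_column_zero, Finset.sum_eq_single r]
  · simp only [Matrix.of_apply, Fin.cons_zero, Pi.single_eq_same, mul_one]
    congr 2
  · intro i _ hi
    simp [hi]
  · simp

/-- Laplace expansion along the time column. In the minor omitting row `a + 1`, row `0` is moved
into the vacant place by one transposition, so every sign is `-1` and the minors have the
`Function.update` form of `homCoeff`. -/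
theorem det_cons_column {k : ℕ} (c : Fin (k + 1) → ℝ) (v : Fin (k + 1) → Fin k → ℝ) :
    (Matrix.of fun i => (Fin.cons (c i) (v i) : Fin (k + 1) → ℝ)).det
      = c 0 * (Matrix.of fun a : Fin k => v a.succ).det
        - ∑ a : Fin k, c a.succ * (Matrix.of (Function.update (fun b => v b.succ) a (v 0))).det := by
  have key : ∀ a : Fin k, (-1) ^ ((a.succ : Fin (k + 1)) : ℕ)
      * (Matrix.of fun i => v (a.succ.succAbove i)).det
      = - (Matrix.of (Function.update (fun b => v b.succ) a (v 0))).det := by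
    intro a
    rw [← det_cons_column_single, ← neg_eq_iff_eq_neg]
    have h := Matrix.det_permute (Equiv.swap 0 a.succ) (Matrix.of fun i =>
      (Fin.cons ((Pi.single a.succ 1 : Fin (k + 1) → ℝ) i) (v i) : Fin (k + 1) → ℝ))
    rw [Equiv.Perm.sign_swap (Fin.succ_ne_zero a).symm] at h
    simp only [Units.val_neg, Units.val_one, Int.cast_neg, Int.cast_one, neg_mul, one_mul] at h
    rw [← h]
    have h2 := det_cons_column_single (fun i => v (Equiv.swap 0 a.succ i)) 0
    simp only [Fin.val_zero, pow_zero, one_mul, Fin.zero_succAbove] at h2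
    convert h2 using 2
    · ext i j
      refine Fin.cases ?_ (fun j => ?_) j
      · simp only [Matrix.submatrix_apply, Matrix.of_apply, Fin.cons_zero, id_eq]
        rcases eq_or_ne i 0 with rfl | hi
        · simp
        · rcases eq_or_ne i a.succ with rfl | hi'
          · simp [hi]
          · rw [Equiv.swap_apply_of_ne_of_ne hi hi']
            simp [hi, hi']
      · simp
    · ext i j
      simp only [Matrix.of_apply]
      rcases eq_or_ne i a with rfl | hi
      · simp
      · rw [Function.update_of_ne hi, Equiv.swap_apply_of_ne_of_ne (Fin.succ_ne_zero i)
          (fun h => hi (Fin.succ_injective _ h))]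
  rw [Matrix.det_succ_column_zero, Fin.sum_univ_succ, sub_eq_add_neg, ← Finset.sum_neg_distrib]
  congr 1
  · simp only [Matrix.of_apply, Fin.val_zero, pow_zero, one_mul, Fin.cons_zero]
    congr 2
  · refine Finset.sum_congr rfl fun a _ => ?_
    rw [← mul_neg, ← key a]
    simp only [Matrix.of_apply, Fin.cons_zero]
    rw [mul_comm ((-1 : ℝ) ^ _), mul_assoc]
    congr 2

end LinearAlgebra

section Coordinates

variable {n k : ℕ}

local notation "𝔼" => EuclideanSpace ℝ (Fin n)

/-- The coordinate functions. -/
def coordFn (c : Fin n) : TestFn n (EuclideanSpace ℝ (Fin n)) :=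
  ⟨fun x => x c, (contDiff_piLp_apply (𝕜 := ℝ) (p := 2) (i := c)).contMDiff⟩

theorem TestFn.contDiff (f : TestFn n (EuclideanSpace ℝ (Fin n))) : ContDiff ℝ ∞ f :=
  f.contMDiff.contDiff

theorem clm_apply_eq_sum (L : 𝔼 →L[ℝ] ℝ) (v : 𝔼) :
    L v = ∑ c, L (EuclideanSpace.single c 1) * v c := by
  conv_lhs => rw [← (EuclideanSpace.basisFun (Fin n) ℝ).sum_repr v]
  simp [mul_comm]

/-- The determinant of the differentials of `g ∘ φ`, expanded in the coordinates of `φ`. -/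
theorem det_fderiv_comp (g : Fin k → 𝔼 → ℝ) (φ : (Fin k → ℝ) → 𝔼) (x : Fin k → ℝ)
    (hφ : DifferentiableAt ℝ φ x) (hg : ∀ a, DifferentiableAt ℝ (g a) (φ x)) :
    (Matrix.of fun a b : Fin k => fderiv ℝ (fun y => g a (φ y)) x (Pi.single b 1)).det
      = ∑ I : Fin k → Fin n, (∏ a, fderiv ℝ (g a) (φ x) (EuclideanSpace.single (I a) 1))
          * jac (fun a => coordFn (I a)) φ x := by
  have hc : ∀ c : Fin n, ∀ v, fderiv ℝ (fun y => coordFn c (φ y)) x v = fderiv ℝ φ x v c := by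
    intro c v
    have h1 : HasFDerivAt (fun y => φ y c) ((EuclideanSpace.proj c).comp (fderiv ℝ φ x)) x :=
      (EuclideanSpace.proj c : 𝔼 →L[ℝ] ℝ).hasFDerivAt.comp x hφ.hasFDerivAt
    change fderiv ℝ (fun y => φ y c) x v = _
    rw [h1.fderiv]
    rfl
  have hrow : (fun a b : Fin k => fderiv ℝ (fun y => g a (φ y)) x (Pi.single b 1))
      = fun a => ∑ c : Fin n, fderiv ℝ (g a) (φ x) (EuclideanSpace.single c 1)
          • (fun b => fderiv ℝ (fun y => coordFn c (φ y)) x (Pi.single b 1)) := by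
    funext a b
    rw [fderiv_fun_comp x (hg a) hφ, ContinuousLinearMap.comp_apply, clm_apply_eq_sum]
    simp [hc]
  -- Multilinear expansion of the rows gives a sum over all multi-indices rather than increasing
  -- ones; repeated indices contribute zero determinants.
  change Matrix.detRowAlternating.toMultilinearMap
    (fun a b : Fin k => fderiv ℝ (fun y => g a (φ y)) x (Pi.single b 1)) = _
  rw [hrow, MultilinearMap.map_sum]
  refine Finset.sum_congr rfl fun I _ => ?_
  rw [MultilinearMap.map_smul_univ]
  rfl

end Coordinates

/-! ### Chains in Euclidean space as vector-valued measures -/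

namespace RectData

section Base

variable {n k : ℕ} {M : Type*} [TopologicalSpace M] [ChartedSpace (EuclideanSpace ℝ (Fin n)) M]

instance (P : RectData n M k) : Countable P.ι := P.countable

instance (P : RectData n M k) : MeasurableSpace P.ι := ⊤

instance (P : RectData n M k) : DiscreteMeasurableSpace P.ι := ⟨fun _ => trivial⟩

/-- The disjoint union of the parameter sets, as a measure space. -/
def base (P : RectData n M k) : Measure (P.ι × (Fin k → ℝ)) :=
  Measure.sum fun j => (volume.restrict (P.E j)).map (Prod.mk j)

instance (P : RectData n M k) : SFinite P.base := by
  unfold base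
  infer_instance

theorem lintegral_base (P : RectData n M k) (g : P.ι × (Fin k → ℝ) → ENNReal) :
    ∫⁻ p, g p ∂P.base = ∑' j, ∫⁻ x in P.E j, g (j, x) := by
  rw [base, lintegral_sum_measure]
  exact tsum_congr fun j => (measurableEmbedding_prodMk_left j).lintegral_map _

theorem integral_base (P : RectData n M k) {g : P.ι × (Fin k → ℝ) → ℝ} (hg : Integrable g P.base) :
    ∫ p, g p ∂P.base = ∑' j, ∫ x in P.E j, g (j, x) := by
  rw [base, integral_sum_measure hg]
  exact tsum_congr fun j => (measurableEmbedding_prodMk_left j).integral_map _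

theorem ae_base_iff (P : RectData n M k) {q : P.ι × (Fin k → ℝ) → Prop} :
    (∀ᵐ p ∂P.base, q p) ↔ ∀ j, ∀ᵐ x ∂(volume.restrict (P.E j)), q (j, x) := by
  rw [base, Measure.ae_sum_iff]
  exact forall_congr' fun j => (measurableEmbedding_prodMk_left j).ae_map_iff

end Base

section Euclidean

variable {n k : ℕ}

local notation "𝔼" => EuclideanSpace ℝ (Fin n)

/-- The point of `ℝⁿ` with the given parameter. -/
def pt (P : RectData n (EuclideanSpace ℝ (Fin n)) k) (p : P.ι × (Fin k → ℝ)) :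
    EuclideanSpace ℝ (Fin n) :=
  -- The value `0` off `E` is not seen by `base`, but makes the map measurable and bounded
  -- everywhere.
  (P.E p.1).indicator (P.φ p.1) p.2

/-- The components of the multiplicity times the tangent `k`-vector. -/
def wt (P : RectData n (EuclideanSpace ℝ (Fin n)) k) (I : Fin k → Fin n)
    (p : P.ι × (Fin k → ℝ)) : ℝ :=
  (P.E p.1).indicator (fun x => (P.m p.1 : ℝ) * jac (fun a => coordFn (I a)) (P.φ p.1) x) p.2

theorem measurable_of_forall_continuousOn {β : Type*} [TopologicalSpace β] [MeasurableSpace β]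
    [BorelSpace β] [Zero β]
    (P : RectData n 𝔼 k) {g : P.ι → (Fin k → ℝ) → β} (hg : ∀ j, ContinuousOn (g j) (P.U j)) :
    Measurable fun p : P.ι × (Fin k → ℝ) => (P.E p.1).indicator (g p.1) p.2 := by
  classical
  refine measurable_from_prod_countable_right fun j => ?_
  have := ((hg j).mono (P.E_subset j)).measurable_piecewise (g := fun _ => 0)
    continuousOn_const (P.measurableSet_E j)
  rwa [show (fun _ => 0 : (Fin k → ℝ) → β) = 0 from rfl, piecewise_eq_indicator] at this

theorem measurable_pt (P : RectData n 𝔼 k) : Measurable P.pt :=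
  P.measurable_of_forall_continuousOn fun j => P.continuousOn_φ j

theorem measurable_wt (P : RectData n 𝔼 k) (I : Fin k → Fin n) : Measurable (P.wt I) :=
  P.measurable_of_forall_continuousOn
    (g := fun j x => (P.m j : ℝ) * jac (fun a => coordFn (I a)) (P.φ j) x)
    fun j => continuousOn_const.mul (P.continuousOn_jac j _)

theorem integrable_wt (P : RectData n 𝔼 k) (I : Fin k → Fin n) : Integrable (P.wt I) P.base := by
  refine ⟨(P.measurable_wt I).aestronglyMeasurable, ?_⟩
  rw [HasFiniteIntegral, lintegral_base]
  refine lt_top_iff_ne_top.2 (ne_top_of_le_ne_top (P.mass_finite fun a => coordFn (I a)) ?_)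
  refine ENNReal.tsum_le_tsum fun j => ?_
  refine (setLIntegral_congr_fun (P.measurableSet_E j) fun x hx => ?_).le
  simp [wt, hx]

theorem pt_of_mem (P : RectData n 𝔼 k) {j : P.ι} {x : Fin k → ℝ} (hx : x ∈ P.E j) :
    P.pt (j, x) = P.φ j x := by
  simp [pt, hx]

theorem wt_of_mem (P : RectData n 𝔼 k) (I : Fin k → Fin n) {j : P.ι} {x : Fin k → ℝ}
    (hx : x ∈ P.E j) :
    P.wt I (j, x) = (P.m j : ℝ) * jac (fun a => coordFn (I a)) (P.φ j) x := by
  simp [wt, hx]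

theorem norm_pt_le (P : RectData n 𝔼 k) {R : ℝ} (hR : 0 ≤ R) (hK : P.K ⊆ Metric.closedBall 0 R)
    (p : P.ι × (Fin k → ℝ)) : ‖P.pt p‖ ≤ R := by
  obtain ⟨j, x⟩ := p
  by_cases hx : x ∈ P.E j
  · rw [P.pt_of_mem hx]
    simpa using hK (P.mapsTo j hx)
  · simpa [pt, hx] using hR

theorem differentiableAt_φ (P : RectData n 𝔼 k) {j : P.ι} {x : Fin k → ℝ} (hx : x ∈ P.U j) :
    DifferentiableAt ℝ (P.φ j) x :=
  (((contMDiffOn_iff_contDiffOn.1 (P.contMDiffOn j)).contDiffAt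
    ((P.isOpen_U j).mem_nhds hx)).differentiableAt (by simp))

/-- The value of a rectifiable current in `ℝⁿ` in terms of the coefficients of the form. -/
theorem current_eq_sum_integral (P : RectData n 𝔼 k) (f : TestFn n 𝔼) (π : Fin k → TestFn n 𝔼)
    {z : P.ι × (Fin k → ℝ) → 𝔼} {A : P.ι × (Fin k → ℝ) → 𝔼 →L[ℝ] 𝔼} {R : ℝ} (hR : 0 ≤ R)
    (hK : P.K ⊆ Metric.closedBall 0 R) :
    P.current f π = ∑ I, ∫ p, pullCoeff f (fun a => π a) I 0 (P.pt p) (z p) (A p) * P.wt I p ∂P.base := by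
  -- At time `0` the end point `z` and the derivative `A` drop out, so both may be chosen freely to
  -- match the homotopy formula.
  have h0 : ∀ I p, pullCoeff f (fun a => π a) I 0 (P.pt p) (z p) (A p)
      = f (P.pt p) * ∏ a, fderiv ℝ (π a) (P.pt p) (EuclideanSpace.single (I a) 1) := by
    intro I p
    simp [pullCoeff, hrow]
  have hint : ∀ I, Integrable (fun p => (f (P.pt p)
      * ∏ a, fderiv ℝ (π a) (P.pt p) (EuclideanSpace.single (I a) 1)) * P.wt I p) P.base := by
    intro I
    refine integrable_comp_mul P.measurable_pt (P.norm_pt_le hR hK) (P.integrable_wt I)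
      (c := fun x => f x * ∏ a, fderiv ℝ (π a) x (EuclideanSpace.single (I a) 1)) ?_
    exact (TestFn.contDiff f).continuous.mul (continuous_finsetProd _ fun a _ =>
      ((TestFn.contDiff (π a)).continuous_fderiv (by simp)).clm_apply continuous_const)
  simp_rw [h0]
  rw [← integral_finsetSum _ fun I _ => hint I,
    P.integral_base (integrable_finsetSum _ fun I _ => hint I)]
  refine tsum_congr fun j => setIntegral_congr_fun (P.measurableSet_E j) fun x hx => ?_
  simp only [P.pt_of_mem hx, P.wt_of_mem _ hx]
  rw [jac, det_fderiv_comp (fun a => π a) (P.φ j) x (P.differentiableAt_φ (P.E_subset j hx))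
    (fun a => (TestFn.contDiff (π a)).differentiable (by simp) _), Finset.mul_sum, Finset.mul_sum]
  refine Finset.sum_congr rfl fun I _ => ?_
  ring

end Euclidean

end RectData

theorem measurableSet_borel_of_isOpen {M : Type*} [TopologicalSpace M] {B : Set M} (hB : IsOpen B) :
    MeasurableSet[borel M] B :=
  MeasurableSpace.measurableSet_generateFrom hB

/-! ### Push-forward under singular maps of finite energy -/

namespace RectData

section Singular

variable {n k : ℕ}

local notation "𝔼" => EuclideanSpace ℝ (Fin n)

theorem norm_jac_comp_le {π : Fin k → TestFn n 𝔼} {R C : ℝ}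
    (hC : ∀ t ∈ Icc (0 : ℝ) 1, ∀ y z : 𝔼, ‖y‖ ≤ R → ‖z‖ ≤ R → ∀ A (I : Fin k → Fin n),
      |∏ a, hrow (π a) t y z A (I a)| ≤ C * (1 + ‖A‖) ^ k)
    {φ : (Fin k → ℝ) → 𝔼} {x : Fin k → ℝ} (hφ : DifferentiableAt ℝ φ x) {F : 𝔼 → 𝔼}
    (hF : DifferentiableAt ℝ F (φ x)) (hy : ‖φ x‖ ≤ R) (hz : ‖F (φ x)‖ ≤ R) (m : ℝ) :
    ‖m * jac π (fun x => F (φ x)) x‖ ≤ C * ∑ I : Fin k → Fin n, ‖(1 + ‖fderiv ℝ F (φ x)‖) ^ k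
      * (m * jac (fun a => coordFn (I a)) φ x)‖ := by
  rw [jac, det_fderiv_comp (fun a y => π a (F y)) φ x hφ
    (fun a => ((TestFn.contDiff (π a)).differentiable (by simp) _).comp _ hF), Finset.mul_sum,
    Finset.mul_sum]
  refine (norm_sum_le _ _).trans (Finset.sum_le_sum fun I _ => ?_)
  have h1 : ∀ a, hrow (π a) 1 (φ x) (F (φ x)) (fderiv ℝ F (φ x)) (I a)
      = fderiv ℝ (fun y => π a (F y)) (φ x) (EuclideanSpace.single (I a) 1) := fun a => by
    rw [hrow_eq_fderiv (TestFn.contDiff (π a)) hF]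
    simp
  have h2 := hC 1 (by simp) _ _ hy hz (fderiv ℝ F (φ x)) I
  simp_rw [h1] at h2
  rw [← mul_assoc, mul_comm m, mul_assoc, norm_mul, norm_mul _ (m * _), ← mul_assoc]
  refine mul_le_mul_of_nonneg_right (h2.trans ?_) (norm_nonneg _)
  rw [Real.norm_of_nonneg (by positivity)]

/-- A bound for the mass after a deformation. -/
theorem tsum_lintegral_sum_ne_top (P : RectData n 𝔼 k) {g : 𝔼 → ℝ}
    (hG : ∀ I, Integrable (fun p => g (P.pt p) * P.wt I p) P.base) (C : ℝ) :
    ∑' j, ∫⁻ x in P.E j, ENNReal.ofReal (C * ∑ I : Fin k → Fin n, ‖g (P.φ j x)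
      * ((P.m j : ℝ) * jac (fun a => coordFn (I a)) (P.φ j) x)‖) ≠ ⊤ := by
  have h2 : ∑' j, ∫⁻ x in P.E j, ENNReal.ofReal C * ∑ I : Fin k → Fin n,
      ‖g (P.pt (j, x)) * P.wt I (j, x)‖ₑ ≠ ⊤ := by
    rw [← P.lintegral_base fun p => ENNReal.ofReal C * ∑ I : Fin k → Fin n,
      ‖g (P.pt p) * P.wt I p‖ₑ, lintegral_const_mul' _ _ ENNReal.ofReal_ne_top,
      lintegral_finsetSum' _ fun I _ => (hG I).aestronglyMeasurable.enorm]
    exact ENNReal.mul_ne_top ENNReal.ofReal_ne_top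
      (ENNReal.sum_ne_top.2 fun I _ => (hG I).2.ne)
  refine ne_top_of_le_ne_top h2 (ENNReal.tsum_le_tsum fun j => ?_)
  refine setLIntegral_mono' (P.measurableSet_E j) fun x hx => ?_
  rw [ENNReal.ofReal_mul' (Finset.sum_nonneg fun _ _ => norm_nonneg _),
    ENNReal.ofReal_sum_of_nonneg (fun _ _ => norm_nonneg _)]
  simp only [P.pt_of_mem hx, P.wt_of_mem _ hx, ofReal_norm]
  exact le_rfl

/-- The push-forward under a map that is smooth on the open set `W` and has finite energy. The part
outside `W` is dropped. -/
def pushSing (P : RectData n (EuclideanSpace ℝ (Fin n)) k)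
    {F : EuclideanSpace ℝ (Fin n) → EuclideanSpace ℝ (Fin n)} {W : Set (EuclideanSpace ℝ (Fin n))}
    (hW : IsOpen W) (hF : ContDiffOn ℝ ∞ F W) {K : Set (EuclideanSpace ℝ (Fin n))}
    (hK : IsCompact K) (hFK : ∀ y ∈ P.K, y ∈ W → F y ∈ K)
    (hG : ∀ I, Integrable (fun p => (1 + ‖fderiv ℝ F (P.pt p)‖) ^ k * P.wt I p) P.base) :
    RectData n (EuclideanSpace ℝ (Fin n)) k where
  ι := P.ι
  countable := P.countable
  U := fun j => P.U j ∩ P.φ j ⁻¹' W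
  E := fun j => P.E j ∩ P.φ j ⁻¹' W
  φ := fun j x => F (P.φ j x)
  m := P.m
  K := K
  isOpen_U := fun j => (P.continuousOn_φ j).isOpen_inter_preimage (P.isOpen_U j) hW
  measurableSet_E := fun j => P.measurableSet_inter_preimage j
    (measurableSet_borel_of_isOpen hW)
  E_subset := fun j => inter_subset_inter_left _ (P.E_subset j)
  contMDiffOn := fun j => (hF.contMDiffOn.of_le (by simp)).comp
    ((P.contMDiffOn j).mono inter_subset_left) fun _ hx => hx.2
  isCompact_K := hK
  mapsTo := fun j x hx => hFK _ (P.mapsTo j hx.1) hx.2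
  mass_finite π := by
    obtain ⟨R, hR⟩ := (P.isCompact_K.union hK).isBounded.subset_closedBall 0
    obtain ⟨C, -, hC⟩ := exists_bound_prod_hrow (fun a => TestFn.contDiff (π a)) R
    refine ne_top_of_le_ne_top (P.tsum_lintegral_sum_ne_top
      (g := fun y => (1 + ‖fderiv ℝ F y‖) ^ k) hG C) (ENNReal.tsum_le_tsum fun j => ?_)
    refine le_trans ?_ (lintegral_mono_set (inter_subset_left (t := P.φ j ⁻¹' W)))
    refine setLIntegral_mono' (P.measurableSet_inter_preimage j
      (measurableSet_borel_of_isOpen hW)) fun x hx => ?_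
    rw [← ofReal_norm]
    refine ENNReal.ofReal_le_ofReal (norm_jac_comp_le hC (P.differentiableAt_φ (P.E_subset j hx.1))
      ((hF.contDiffAt (hW.mem_nhds hx.2)).differentiableAt (by simp)) ?_ ?_ _)
    · simpa using hR (Or.inl (P.mapsTo j hx.1))
    · simpa using hR (Or.inr (hFK _ (P.mapsTo j hx.1) hx.2))

theorem integrable_coeff_mul {Ω : Type*} [MeasurableSpace Ω] {μ : Measure Ω} {c w g : Ω → ℝ}
    (hc : Measurable c) (hw : Measurable w) (hg : Integrable (fun u => g u * w u) μ) {C : ℝ}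
    (h : ∀ᵐ u ∂μ, |c u| ≤ C * |g u| ∨ w u = 0) : Integrable (fun u => c u * w u) μ := by
  refine (hg.norm.const_mul C).mono' (hc.mul hw).aestronglyMeasurable ?_
  filter_upwards [h] with u hu
  rcases hu with hu | hu
  · rw [norm_mul, norm_mul, ← mul_assoc]
    exact mul_le_mul_of_nonneg_right hu (norm_nonneg _)
  · simp [hu]

theorem measurable_energy (P : RectData n 𝔼 k) (F : 𝔼 → 𝔼) (I : Fin k → Fin n) :
    Measurable fun p => (1 + ‖fderiv ℝ F (P.pt p)‖) ^ k * P.wt I p :=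
  ((((measurable_fderiv ℝ F).comp P.measurable_pt).norm.const_add 1).pow_const k).mul
    (P.measurable_wt I)

/-- By `hnull` the part of the chain outside `W` has zero weight almost everywhere, so dropping it
loses nothing and the integral may run over the whole base. On `W` the formula is the chain rule,
expanded in coordinates. -/
theorem pushSing_current (P : RectData n 𝔼 k) {F : 𝔼 → 𝔼} (hFm : Measurable F) {W : Set 𝔼}
    (hW : IsOpen W) (hF : ContDiffOn ℝ ∞ F W) {K : Set 𝔼}
    (hK : IsCompact K) (hFK : ∀ y ∈ P.K, y ∈ W → F y ∈ K)
    (hG : ∀ I, Integrable (fun p => (1 + ‖fderiv ℝ F (P.pt p)‖) ^ k * P.wt I p) P.base)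
    (hnull : ∀ j, ∀ᵐ x ∂(volume.restrict (P.E j)), P.φ j x ∈ W ∨ ∀ I, P.wt I (j, x) = 0)
    (f : TestFn n 𝔼) (π : Fin k → TestFn n 𝔼) :
    (P.pushSing hW hF hK hFK hG).current f π = ∑ I, ∫ p, pullCoeff f (fun a => π a) I 1 (P.pt p)
      (F (P.pt p)) (fderiv ℝ F (P.pt p)) * P.wt I p ∂P.base := by
  obtain ⟨R, hR⟩ := (P.isCompact_K.union hK).isBounded.subset_closedBall 0
  obtain ⟨C, hC0, hC⟩ := exists_bound_pullCoeff (TestFn.contDiff f)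
    (fun a => TestFn.contDiff (π a)) R
  have hmap : Measurable fun p =>
      (((1 : ℝ), P.pt p, F (P.pt p), fderiv ℝ F (P.pt p)) : ℝ × 𝔼 × 𝔼 × (𝔼 →L[ℝ] 𝔼)) :=
    measurable_const.prodMk (P.measurable_pt.prodMk ((hFm.comp P.measurable_pt).prodMk
      ((measurable_fderiv ℝ F).comp P.measurable_pt)))
  have hint : ∀ I, Integrable (fun p => pullCoeff f (fun a => π a) I 1 (P.pt p)
      (F (P.pt p)) (fderiv ℝ F (P.pt p)) * P.wt I p) P.base := by
    intro I
    refine integrable_coeff_mul (C := C) ((continuous_pullCoeff (TestFn.contDiff f)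
      (fun a => TestFn.contDiff (π a)) I).measurable.comp hmap) (P.measurable_wt I) (hG I) ?_
    rw [P.ae_base_iff]
    intro j
    filter_upwards [hnull j, ae_restrict_mem (P.measurableSet_E j)] with x hx hxE
    refine hx.imp (fun hx => ?_) (fun hx => hx I)
    have h1 : ‖P.φ j x‖ ≤ R := by simpa using hR (Or.inl (P.mapsTo j hxE))
    have h2 : ‖F (P.φ j x)‖ ≤ R := by simpa using hR (Or.inr (hFK _ (P.mapsTo j hxE) hx))
    rw [P.pt_of_mem hxE]
    refine (hC 1 (by simp) _ _ h1 h2 _ I).trans ?_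
    exact mul_le_mul_of_nonneg_left (le_abs_self _) hC0
  rw [← integral_finsetSum _ fun I _ => hint I,
    P.integral_base (integrable_finsetSum _ fun I _ => hint I)]
  refine tsum_congr fun j => ?_
  rw [setIntegral_eq_of_subset_of_ae_sdiff_eq_zero (s := P.E j ∩ P.φ j ⁻¹' W)
    (P.measurableSet_E j).nullMeasurableSet inter_subset_left]
  · refine setIntegral_congr_fun (P.measurableSet_inter_preimage j
      (measurableSet_borel_of_isOpen hW)) fun x hx => ?_
    have hd := (hF.contDiffAt (hW.mem_nhds hx.2)).differentiableAt (by simp)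
    simp only [P.pt_of_mem hx.1, P.wt_of_mem _ hx.1]
    change (P.m j : ℝ) * (f (F (P.φ j x)) * jac π (fun x => F (P.φ j x)) x) = _
    rw [jac, det_fderiv_comp (fun a y => π a (F y)) (P.φ j) x
      (P.differentiableAt_φ (P.E_subset j hx.1))
      (fun a => ((TestFn.contDiff (π a)).differentiable (by simp) _).comp _ hd), Finset.mul_sum,
      Finset.mul_sum]
    refine Finset.sum_congr rfl fun I _ => ?_
    have h1 : ∀ a, hrow (π a) 1 (P.φ j x) (F (P.φ j x)) (fderiv ℝ F (P.φ j x)) (I a)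
        = fderiv ℝ (fun y => π a (F y)) (P.φ j x) (EuclideanSpace.single (I a) 1) := fun a => by
      rw [hrow_eq_fderiv (TestFn.contDiff (π a)) hd]
      simp
    simp only [pullCoeff, h1, one_smul, add_sub_cancel]
    ring
  · have h := hnull j
    rw [ae_restrict_iff' (P.measurableSet_E j)] at h
    filter_upwards [h] with x hx hxE
    have h0 := (hx hxE.1).resolve_left fun hW => hxE.2 ⟨hxE.1, hW⟩
    simp [h0]

/-- The trace of the linear homotopy from the identity to a singular map. -/
theorem jac_homotopy {φ : (Fin k → ℝ) → 𝔼} {F : 𝔼 → 𝔼} {z : Fin (k + 1) → ℝ}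
    (hφ : DifferentiableAt ℝ φ (Fin.tail z)) (hF : DifferentiableAt ℝ F (φ (Fin.tail z)))
    (f : TestFn n 𝔼) (π : Fin k → TestFn n 𝔼) :
    jac (Fin.cons f π : Fin (k + 1) → TestFn n 𝔼)
      (fun z => φ (Fin.tail z) + z 0 • (F (φ (Fin.tail z)) - φ (Fin.tail z))) z
      = ∑ I, homCoeff f (fun a => π a) I (z 0) (φ (Fin.tail z)) (F (φ (Fin.tail z)))
          (fderiv ℝ F (φ (Fin.tail z))) * jac (fun a => coordFn (I a)) φ (Fin.tail z) := by
  set x := Fin.tail z with hx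
  -- The homotopy frozen at the time `z 0`: the space columns of the Jacobian only see this map.
  set G : 𝔼 → 𝔼 := fun y => y + z 0 • (F y - y) with hGdef
  have hG : DifferentiableAt ℝ G (φ x) :=
    differentiableAt_fun_id.fun_add ((hF.fun_sub differentiableAt_fun_id).fun_const_smul _)
  let T : (Fin (k + 1) → ℝ) →L[ℝ] (Fin k → ℝ) :=
    ContinuousLinearMap.pi fun b : Fin k => ContinuousLinearMap.proj b.succ
  have hT0 : T (Pi.single 0 1) = 0 := by
    funext b
    exact Pi.single_eq_of_ne (M := fun _ => ℝ) (Fin.succ_ne_zero b) 1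
  have hTs : ∀ b : Fin k, T (Pi.single b.succ 1) = Pi.single b 1 := by
    intro b
    funext c
    change (Pi.single b.succ 1 : Fin (k + 1) → ℝ) c.succ = _
    rcases eq_or_ne c b with rfl | h
    · simp
    · rw [Pi.single_eq_of_ne h, Pi.single_eq_of_ne (fun h' => h (Fin.succ_injective _ h'))]
  have htail : HasFDerivAt (fun z : Fin (k + 1) → ℝ => (Fin.tail z : Fin k → ℝ)) T z :=
    T.hasFDerivAt
  have hz0 : HasFDerivAt (fun z : Fin (k + 1) → ℝ => z 0)
      (ContinuousLinearMap.proj (R := ℝ) (φ := fun _ : Fin (k + 1) => ℝ) 0) z :=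
    (ContinuousLinearMap.proj (R := ℝ) (φ := fun _ : Fin (k + 1) => ℝ) 0).hasFDerivAt
  have hφz : HasFDerivAt (fun z : Fin (k + 1) → ℝ => φ (Fin.tail z)) ((fderiv ℝ φ x).comp T) z :=
    HasFDerivAt.comp z (show HasFDerivAt φ (fderiv ℝ φ x) (Fin.tail z) from hφ.hasFDerivAt) htail
  have hFz : HasFDerivAt (fun z : Fin (k + 1) → ℝ => F (φ (Fin.tail z)))
      ((fderiv ℝ F (φ x)).comp ((fderiv ℝ φ x).comp T)) z :=
    HasFDerivAt.comp z (show HasFDerivAt F (fderiv ℝ F (φ x)) (φ (Fin.tail z)) from hF.hasFDerivAt)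
      hφz
  have hΨ := hφz.fun_add (hz0.fun_smul (hFz.fun_sub hφz))
  have hGφ : ∀ v, fderiv ℝ (fun x => G (φ x)) x v
      = fderiv ℝ φ x v + z 0 • (fderiv ℝ F (φ x) (fderiv ℝ φ x v) - fderiv ℝ φ x v) := by
    intro v
    rw [fderiv_fun_comp x hG hφ, hGdef, fderiv_fun_add differentiableAt_fun_id
      ((hF.fun_sub differentiableAt_fun_id).fun_const_smul _),
      fderiv_fun_const_smul (hF.fun_sub differentiableAt_fun_id),
      fderiv_fun_sub hF differentiableAt_fun_id]
    simp
  -- Each row consists of the derivative along `F - id` in the time column and the differential of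
  -- `g ∘ G ∘ φ` in the others, the shape required by `det_cons_column`.
  have hrowz : ∀ g : TestFn n 𝔼, (fun b => fderiv ℝ (fun z : Fin (k + 1) → ℝ =>
      g (φ (Fin.tail z) + z 0 • (F (φ (Fin.tail z)) - φ (Fin.tail z)))) z (Pi.single b 1))
      = (Fin.cons (fderiv ℝ g (G (φ x)) (F (φ x) - φ x))
          (fun b => fderiv ℝ (fun x => g (G (φ x))) x (Pi.single b 1)) : Fin (k + 1) → ℝ) := by
    intro g
    have hg : DifferentiableAt ℝ g (G (φ x)) := (TestFn.contDiff g).differentiable (by simp) _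
    have h1 := (HasFDerivAt.comp z (show HasFDerivAt g (fderiv ℝ g (G (φ x)))
      (φ (Fin.tail z) + z 0 • (F (φ (Fin.tail z)) - φ (Fin.tail z))) from hg.hasFDerivAt) hΨ)
    have h2 : fderiv ℝ (fun z : Fin (k + 1) → ℝ =>
      g (φ (Fin.tail z) + z 0 • (F (φ (Fin.tail z)) - φ (Fin.tail z)))) z = _ := h1.fderiv
    funext b
    rw [h2]
    refine Fin.cases ?_ (fun b => ?_) b
    · simp [hT0, hx]
    · rw [Fin.cons_succ, fderiv_fun_comp x hg (hG.fun_comp' x hφ), ContinuousLinearMap.comp_apply,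
        ContinuousLinearMap.comp_apply, hGφ]
      simp [hTs]
  have hM : (Matrix.of fun a b : Fin (k + 1) => fderiv ℝ (fun z : Fin (k + 1) → ℝ =>
      (Fin.cons f π : Fin (k + 1) → TestFn n 𝔼) a
        (φ (Fin.tail z) + z 0 • (F (φ (Fin.tail z)) - φ (Fin.tail z)))) z (Pi.single b 1))
      = Matrix.of fun a => (Fin.cons
        (fderiv ℝ ((Fin.cons f π : Fin (k + 1) → TestFn n 𝔼) a) (G (φ x)) (F (φ x) - φ x))
        (fun b => fderiv ℝ (fun x => (Fin.cons f π : Fin (k + 1) → TestFn n 𝔼) a (G (φ x))) x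
          (Pi.single b 1)) : Fin (k + 1) → ℝ) := by
    ext a b
    exact congrFun (hrowz ((Fin.cons f π : Fin (k + 1) → TestFn n 𝔼) a)) b
  have hdet : ∀ g : Fin k → TestFn n 𝔼,
      (Matrix.of fun a b : Fin k => fderiv ℝ (fun x => g a (G (φ x))) x (Pi.single b 1)).det
      = ∑ I : Fin k → Fin n, (∏ a, hrow (g a) (z 0) (φ x) (F (φ x)) (fderiv ℝ F (φ x)) (I a))
        * jac (fun a => coordFn (I a)) φ x := by
    intro g
    rw [det_fderiv_comp (fun a y => g a (G y)) φ x hφ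
      (fun a => ((TestFn.contDiff (g a)).differentiable (by simp) _).comp _ hG)]
    refine Finset.sum_congr rfl fun I _ => ?_
    congr 1
    exact Finset.prod_congr rfl fun a _ => (hrow_eq_fderiv (TestFn.contDiff (g a)) hF _ _).symm
  rw [jac, hM, det_cons_column]
  simp only [Fin.cons_zero, Fin.cons_succ]
  have hupd : ∀ a, (Matrix.of (Function.update (fun b : Fin k => fun c : Fin k =>
      fderiv ℝ (fun x => π b (G (φ x))) x (Pi.single c 1)) a
      (fun c => fderiv ℝ (fun x => f (G (φ x))) x (Pi.single c 1))))
      = Matrix.of fun b c : Fin k => fderiv ℝ (fun x => Function.update π a f b (G (φ x))) x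
        (Pi.single c 1) := by
    intro a
    ext b c
    simp only [Matrix.of_apply]
    rcases eq_or_ne b a with rfl | h
    · simp
    · simp [h]
  simp_rw [hupd]
  rw [hdet π]
  simp_rw [hdet]
  simp only [homCoeff, sub_mul, Finset.sum_mul, Finset.mul_sum, Finset.sum_sub_distrib]
  congr 1
  · exact Finset.sum_congr rfl fun I _ => by ring
  · rw [Finset.sum_comm]
    refine Finset.sum_congr rfl fun I _ => Finset.sum_congr rfl fun a _ => ?_
    have : ∀ b, (Function.update (fun a => (π a : 𝔼 → ℝ)) a f b)
        = ((Function.update π a f b : TestFn n 𝔼) : 𝔼 → ℝ) := by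
      intro b
      rcases eq_or_ne b a with rfl | h
      · simp
      · simp [h]
    simp_rw [this, mul_assoc]
    rfl

end Singular

end RectData

/-! ### Product parameter sets and the trace of a homotopy -/

section Slab

variable {k : ℕ}

theorem measurePreserving_cons_tail :
    MeasurePreserving (fun z : Fin (k + 1) → ℝ => (z 0, (Fin.tail z : Fin k → ℝ))) := by
  have h := volume_preserving_piFinSuccAbove (fun _ : Fin (k + 1) => ℝ) 0
  exact h

theorem measurableEmbedding_cons_tail :
    MeasurableEmbedding (fun z : Fin (k + 1) → ℝ => (z 0, (Fin.tail z : Fin k → ℝ))) :=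
  (MeasurableEquiv.piFinSuccAbove (fun _ : Fin (k + 1) => ℝ) 0).measurableEmbedding

/-- The product of the unit interval with `B`. -/
def slab (B : Set (Fin k → ℝ)) : Set (Fin (k + 1) → ℝ) :=
  (fun z : Fin (k + 1) → ℝ => (z 0, (Fin.tail z : Fin k → ℝ))) ⁻¹' (Icc (0 : ℝ) 1 ×ˢ B)

theorem measurableSet_slab {B : Set (Fin k → ℝ)} (hB : MeasurableSet B) :
    MeasurableSet (slab B) :=
  measurableEmbedding_cons_tail.measurable (measurableSet_Icc.prod hB)

theorem setIntegral_slab (B : Set (Fin k → ℝ)) (g : ℝ × (Fin k → ℝ) → ℝ) :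
    ∫ z in slab B, g (z 0, Fin.tail z) = ∫ p, g p ∂((volume.restrict (Icc (0 : ℝ) 1)).prod
      (volume.restrict B)) := by
  rw [Measure.prod_restrict]
  exact measurePreserving_cons_tail.setIntegral_preimage_emb measurableEmbedding_cons_tail g _

theorem setLIntegral_slab_tail (B : Set (Fin k → ℝ)) {g : (Fin k → ℝ) → ENNReal}
    (hg : Measurable g) :
    ∫⁻ z in slab B, g (Fin.tail z) = ∫⁻ x in B, g x := by
  have h := measurePreserving_cons_tail.setLIntegral_comp_preimage_emb
    (measurableEmbedding_cons_tail (k := k)) (fun p : ℝ × (Fin k → ℝ) => g p.2) (Icc (0 : ℝ) 1 ×ˢ B)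
  refine h.trans ?_
  change ∫⁻ p in _, _ ∂(volume.prod volume) = _
  rw [← Measure.prod_restrict, lintegral_prod (fun p : ℝ × (Fin k → ℝ) => g p.2)
    (hg.comp measurable_snd).aemeasurable]
  simp

end Slab

namespace RectData

section Singular

variable {n k : ℕ}

local notation "𝔼" => EuclideanSpace ℝ (Fin n)

/-- The trace of the linear homotopy from the identity to a map that is smooth on the open set `W`
and has finite energy. -/
def homSing (P : RectData n (EuclideanSpace ℝ (Fin n)) k)
    {F : EuclideanSpace ℝ (Fin n) → EuclideanSpace ℝ (Fin n)} {W : Set (EuclideanSpace ℝ (Fin n))}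
    (hW : IsOpen W) (hF : ContDiffOn ℝ ∞ F W) {R : ℝ} (hK : P.K ⊆ Metric.closedBall 0 R)
    (hFK : ∀ y ∈ P.K, y ∈ W → ‖F y‖ ≤ R)
    (hG : ∀ I, Integrable (fun p => (1 + ‖fderiv ℝ F (P.pt p)‖) ^ k * P.wt I p) P.base) :
    RectData n (EuclideanSpace ℝ (Fin n)) (k + 1) where
  ι := P.ι
  countable := P.countable
  U := fun j => Fin.tail ⁻¹' (P.U j ∩ P.φ j ⁻¹' W)
  E := fun j => slab (P.E j ∩ P.φ j ⁻¹' W)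
  φ := fun j z => P.φ j (Fin.tail z) + z 0 • (F (P.φ j (Fin.tail z)) - P.φ j (Fin.tail z))
  m := P.m
  K := Metric.closedBall 0 R
  isOpen_U := fun j => ((P.continuousOn_φ j).isOpen_inter_preimage (P.isOpen_U j) hW).preimage
    (by unfold Fin.tail; fun_prop)
  measurableSet_E := fun j => measurableSet_slab (P.measurableSet_inter_preimage j
    (measurableSet_borel_of_isOpen hW))
  E_subset := fun j z hz => ⟨P.E_subset j hz.2.1, hz.2.2⟩
  contMDiffOn := fun j => by
    rw [contMDiffOn_iff_contDiffOn]
    have htail : ContDiff ℝ 1 (fun z : Fin (k + 1) → ℝ => (Fin.tail z : Fin k → ℝ)) := by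
      unfold Fin.tail
      fun_prop
    have h1 : ContDiffOn ℝ 1 (fun z : Fin (k + 1) → ℝ => P.φ j (Fin.tail z))
        (Fin.tail ⁻¹' (P.U j ∩ P.φ j ⁻¹' W)) :=
      (contMDiffOn_iff_contDiffOn.1 (P.contMDiffOn j)).comp htail.contDiffOn fun z hz => hz.1
    have h2 : ContDiffOn ℝ 1 (fun z : Fin (k + 1) → ℝ => F (P.φ j (Fin.tail z)))
        (Fin.tail ⁻¹' (P.U j ∩ P.φ j ⁻¹' W)) :=
      (hF.of_le (by simp)).comp h1 fun z hz => hz.2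
    have h3 : ContDiffOn ℝ 1 (fun z : Fin (k + 1) → ℝ => z 0)
        (Fin.tail ⁻¹' (P.U j ∩ P.φ j ⁻¹' W)) := (contDiff_apply ℝ ℝ 0).contDiffOn
    exact h1.add (h3.smul (h2.sub h1))
  isCompact_K := isCompact_closedBall _ _
  mapsTo := fun j z hz => by
    have h1 : ‖P.φ j (Fin.tail z)‖ ≤ R := by simpa using hK (P.mapsTo j hz.2.1)
    simpa using norm_segment_le hz.1 h1 (hFK _ (P.mapsTo j hz.2.1) hz.2.2)
  mass_finite π := by
    obtain ⟨C, hC0, hC⟩ := exists_bound_homCoeff (TestFn.contDiff (π 0))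
      (fun a => TestFn.contDiff (Fin.tail π a)) R
    refine ne_top_of_le_ne_top (P.tsum_lintegral_sum_ne_top
      (g := fun y => (1 + ‖fderiv ℝ F y‖) ^ k) hG C) (ENNReal.tsum_le_tsum fun j => ?_)
    refine le_trans ?_ (lintegral_mono_set (inter_subset_left (t := P.φ j ⁻¹' W)))
    have hmeas := P.measurableSet_inter_preimage j (measurableSet_borel_of_isOpen hW)
    have hb : Measurable fun x => ENNReal.ofReal (C * ∑ I : Fin k → Fin n,
        ‖(1 + ‖fderiv ℝ F (P.pt (j, x))‖) ^ k * P.wt I (j, x)‖) :=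
      ((Finset.measurable_fun_sum _ fun I _ =>
        ((P.measurable_energy F I).comp measurable_prodMk_left).norm).const_mul C).ennreal_ofReal
    have heq : ∫⁻ x in P.E j ∩ P.φ j ⁻¹' W, ENNReal.ofReal (C * ∑ I : Fin k → Fin n,
        ‖(1 + ‖fderiv ℝ F (P.φ j x)‖) ^ k
          * ((P.m j : ℝ) * jac (fun a => coordFn (I a)) (P.φ j) x)‖)
        = ∫⁻ x in P.E j ∩ P.φ j ⁻¹' W, ENNReal.ofReal (C * ∑ I : Fin k → Fin n,
        ‖(1 + ‖fderiv ℝ F (P.pt (j, x))‖) ^ k * P.wt I (j, x)‖) :=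
      setLIntegral_congr_fun hmeas fun x hx => by
        simp only [P.pt_of_mem hx.1, P.wt_of_mem _ hx.1]
    -- The bound for the mass density does not depend on time, and the time interval has length one;
    -- so the mass is controlled by the energy integral over the original parameter set.
    rw [heq, ← setLIntegral_slab_tail _ hb]
    refine setLIntegral_mono' (measurableSet_slab hmeas) fun z hz => ?_
    have hd := (hF.contDiffAt (hW.mem_nhds hz.2.2)).differentiableAt (by simp)
    have h1 : ‖P.φ j (Fin.tail z)‖ ≤ R := by simpa using hK (P.mapsTo j hz.2.1)
    have h2 := hFK _ (P.mapsTo j hz.2.1) hz.2.2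
    rw [← ofReal_norm]
    refine ENNReal.ofReal_le_ofReal ?_
    rw [← Fin.cons_self_tail π, jac_homotopy (P.differentiableAt_φ (P.E_subset j hz.2.1)) hd,
      Finset.mul_sum, Finset.mul_sum]
    refine (norm_sum_le _ _).trans (Finset.sum_le_sum fun I _ => ?_)
    rw [P.pt_of_mem hz.2.1, P.wt_of_mem _ hz.2.1, mul_left_comm, norm_mul, norm_mul _ (_ * _),
      ← mul_assoc]
    refine mul_le_mul_of_nonneg_right ((hC (z 0) hz.1 _ _ h1 h2 _ I).trans ?_) (norm_nonneg _)
    exact mul_le_mul_of_nonneg_left (le_abs_self _) hC0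

theorem integrable_section (P : RectData n 𝔼 k) {g : P.ι × (Fin k → ℝ) → ℝ}
    (hg : Integrable g P.base) (j : P.ι) :
    Integrable (fun x => g (j, x)) (volume.restrict (P.E j)) :=
  (measurableEmbedding_prodMk_left j).integrable_map_iff.1
    (hg.mono_measure (Measure.le_sum (fun j => (volume.restrict (P.E j)).map (Prod.mk j)) j))

theorem integrable_homCoeff_mul {Ω : Type*} [MeasurableSpace Ω] {μ : Measure Ω} [SFinite μ]
    {y : Ω → 𝔼} (hy : Measurable y) {w : Ω → ℝ} (hw : Measurable w) {F : 𝔼 → 𝔼}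
    (hFm : Measurable F) {R : ℝ}
    (hG : Integrable (fun u => (1 + ‖fderiv ℝ F (y u)‖) ^ k * w u) μ)
    (hae : ∀ᵐ u ∂μ, (‖y u‖ ≤ R ∧ ‖F (y u)‖ ≤ R) ∨ w u = 0)
    (f : TestFn n 𝔼) (π : Fin k → TestFn n 𝔼) (I : Fin k → Fin n) :
    Integrable (fun p : ℝ × Ω => homCoeff f (fun a => π a) I p.1 (y p.2) (F (y p.2))
      (fderiv ℝ F (y p.2)) * w p.2) ((volume.restrict (Icc (0 : ℝ) 1)).prod μ) := by
  obtain ⟨C, hC0, hC⟩ := exists_bound_homCoeff (TestFn.contDiff f)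
    (fun a => TestFn.contDiff (π a)) R
  have hmap : Measurable fun p : ℝ × Ω =>
      ((p.1, y p.2, F (y p.2), fderiv ℝ F (y p.2)) : ℝ × 𝔼 × 𝔼 × (𝔼 →L[ℝ] 𝔼)) :=
    have h := hy.comp (measurable_snd (α := ℝ))
    measurable_fst.prodMk (h.prodMk ((hFm.comp h).prodMk ((measurable_fderiv ℝ F).comp h)))
  refine integrable_coeff_mul (C := C) ((continuous_homCoeff (TestFn.contDiff f)
    (fun a => TestFn.contDiff (π a)) I).measurable.comp hmap)
    (hw.comp measurable_snd) (hG.comp_snd _) ?_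
  filter_upwards [ae_prod_Icc hae] with p hp
  refine hp.2.imp_left fun h => ?_
  refine (hC p.1 hp.1 _ _ h.1 h.2 _ I).trans ?_
  exact mul_le_mul_of_nonneg_left (le_abs_self _) hC0

/-- The boundary is evaluated on `df ∧ dπ`, and expanding along the time column turns its Jacobian
into `homCoeff`. The two ends of the homotopy do not occur here; they enter through
`homotopy_formula_limit`. -/
theorem boundary_homSing_current (P : RectData n 𝔼 k) {F : 𝔼 → 𝔼} (hFm : Measurable F) {W : Set 𝔼}
    (hW : IsOpen W) (hF : ContDiffOn ℝ ∞ F W) {R : ℝ} (hK : P.K ⊆ Metric.closedBall 0 R)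
    (hFK : ∀ y ∈ P.K, y ∈ W → ‖F y‖ ≤ R)
    (hG : ∀ I, Integrable (fun p => (1 + ‖fderiv ℝ F (P.pt p)‖) ^ k * P.wt I p) P.base)
    (hnull : ∀ j, ∀ᵐ x ∂(volume.restrict (P.E j)), P.φ j x ∈ W ∨ ∀ I, P.wt I (j, x) = 0)
    (f : TestFn n 𝔼) (π : Fin k → TestFn n 𝔼) :
    boundary n 𝔼 k (P.homSing hW hF hK hFK hG).current f π
      = ∑ I, ∫ p, homCoeff f (fun a => π a) I p.1 (P.pt p.2) (F (P.pt p.2))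
          (fderiv ℝ F (P.pt p.2)) * P.wt I p.2
          ∂((volume.restrict (Icc (0 : ℝ) 1)).prod P.base) := by
  have hae : ∀ j, ∀ᵐ x ∂(volume.restrict (P.E j)),
      (‖P.pt (j, x)‖ ≤ R ∧ ‖F (P.pt (j, x))‖ ≤ R) ∨ ∀ I, P.wt I (j, x) = 0 := by
    intro j
    filter_upwards [hnull j, ae_restrict_mem (P.measurableSet_E j)] with x hx hxE
    refine hx.imp_left fun hx => ?_
    rw [P.pt_of_mem hxE]
    exact ⟨by simpa using hK (P.mapsTo j hxE), hFK _ (P.mapsTo j hxE) hx⟩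
  have hae' : ∀ᵐ p ∂P.base, (‖P.pt p‖ ≤ R ∧ ‖F (P.pt p)‖ ≤ R) ∨ ∀ I, P.wt I p = 0 :=
    P.ae_base_iff.2 hae
  have hint := fun I => integrable_homCoeff_mul P.measurable_pt (P.measurable_wt I) hFm (R := R)
    (hG I) (hae'.mono fun p hp => hp.imp_right fun h => h I) f π I
  have hsum := integrable_finsetSum (Finset.univ) fun I (_ : I ∈ Finset.univ) => hint I
  rw [← integral_finsetSum _ fun I _ => hint I, integral_prod_symm _ hsum,
    P.integral_base hsum.integral_prod_right]
  change ∑' j, _ = _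
  refine tsum_congr fun (j : P.ι) => ?_
  have hmeas := P.measurableSet_inter_preimage j (measurableSet_borel_of_isOpen hW)
  have hsub : volume.restrict (P.E j ∩ P.φ j ⁻¹' W) ≤ volume.restrict (P.E j) :=
    Measure.restrict_mono_set _ inter_subset_left
  have hint' := fun I => integrable_homCoeff_mul
    (P.measurable_pt.comp (measurable_prodMk_left (x := j)))
    ((P.measurable_wt I).comp (measurable_prodMk_left (x := j))) hFm (R := R)
    ((P.integrable_section (hG I) j).mono_measure hsub)
    (ae_mono hsub ((hae j).mono fun p hp => hp.imp_right fun h => h I)) f π I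
  have hsum' := integrable_finsetSum (Finset.univ) fun I (_ : I ∈ Finset.univ) => hint' I
  rw [setIntegral_eq_of_subset_of_ae_sdiff_eq_zero (s := P.E j ∩ P.φ j ⁻¹' W)
    (P.measurableSet_E j).nullMeasurableSet inter_subset_left]
  · refine Eq.trans ?_ ((setIntegral_slab _ _).trans (integral_prod_symm _ hsum'))
    refine setIntegral_congr_fun (measurableSet_slab hmeas) fun z hz => ?_
    have hd := (hF.contDiffAt (hW.mem_nhds hz.2.2)).differentiableAt (by simp)
    change (P.m j : ℝ) * (1 * jac (Fin.cons f π) (fun z => P.φ j (Fin.tail z)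
      + z 0 • (F (P.φ j (Fin.tail z)) - P.φ j (Fin.tail z))) z) = _
    rw [jac_homotopy (P.differentiableAt_φ (P.E_subset j hz.2.1)) hd, one_mul, Finset.mul_sum]
    refine Finset.sum_congr rfl fun I _ => ?_
    have e1 : (P.pt ∘ Prod.mk j) (Fin.tail z) = P.φ j (Fin.tail z) := P.pt_of_mem hz.2.1
    have e2 : (P.wt I ∘ Prod.mk j) (Fin.tail z) = _ := P.wt_of_mem I hz.2.1
    rw [e1, e2]
    ring
  · have h := hnull j
    rw [ae_restrict_iff' (P.measurableSet_E j)] at h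
    filter_upwards [h] with x hx hxE
    have h0 := (hx hxE.1).resolve_left fun hW => hxE.2 ⟨hxE.1, hW⟩
    simp [h0]

/-- A singular push-forward that is a dominated limit of smooth push-forwards is homologous to the
original current, relative to the complement of a set on which the boundary vanishes. -/
theorem pushSing_sub_eq_boundary (P : RectData n 𝔼 k) {F : 𝔼 → 𝔼} (hFm : Measurable F) {W : Set 𝔼}
    (hW : IsOpen W) (hF : ContDiffOn ℝ ∞ F W) {K : Set 𝔼}
    (hKc : IsCompact K) (hFK : ∀ y ∈ P.K, y ∈ W → F y ∈ K) {R : ℝ} (hR : 0 ≤ R)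
    (hK : P.K ⊆ Metric.closedBall 0 R) (hFR : ∀ y ∈ P.K, y ∈ W → ‖F y‖ ≤ R)
    (hG : ∀ I, Integrable (fun p => (1 + ‖fderiv ℝ F (P.pt p)‖) ^ k * P.wt I p) P.base)
    (hnull : ∀ j, ∀ᵐ x ∂(volume.restrict (P.E j)), P.φ j x ∈ W ∨ ∀ I, P.wt I (j, x) = 0)
    {V : Set 𝔼} (hcyc : ∀ π : Fin k → TestFn n 𝔼, ∀ a, tsupport (π a) ⊆ V → P.current 1 π = 0)
    {Fs : ℕ → 𝔼 → 𝔼} (hFs : ∀ m, ContDiff ℝ ∞ (Fs m))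
    (hFsV : ∀ m, tsupport (fun x => Fs m x - x) ⊆ V) (hFsR : ∀ m y, ‖y‖ ≤ R → ‖Fs m y‖ ≤ R)
    {g : P.ι × (Fin k → ℝ) → ℝ} (hg : ∀ I, Integrable (fun p => (1 + g p) ^ k * P.wt I p) P.base)
    (hlim : ∀ᵐ p ∂P.base, (∀ I, P.wt I p = 0) ∨
      (Tendsto (fun m => Fs m (P.pt p)) atTop (𝓝 (F (P.pt p))) ∧
      Tendsto (fun m => fderiv ℝ (Fs m) (P.pt p)) atTop (𝓝 (fderiv ℝ F (P.pt p))) ∧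
      ∀ m, ‖fderiv ℝ (Fs m) (P.pt p)‖ ≤ g p)) :
    (P.pushSing hW hF hKc hFK hG).current - P.current
      = boundary n 𝔼 k (P.homSing hW hF hK hFR hG).current := by
  funext f π
  rw [P.boundary_homSing_current hFm hW hF hK hFR hG hnull, Pi.sub_apply, Pi.sub_apply,
    P.pushSing_current hFm hW hF hKc hFK hG hnull,
    P.current_eq_sum_integral f π (z := fun p => F (P.pt p)) (A := fun p => fderiv ℝ F (P.pt p))
      hR hK]
  refine homotopy_formula_limit P.measurable_pt (P.norm_pt_le hR hK) P.integrable_wt ?_ hFs hFsV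
    (fun m p => hFsR m _ (P.norm_pt_le hR hK p)) hg hlim (TestFn.contDiff f)
    (fun a => TestFn.contDiff (π a))
  -- The cycle condition on the current is the coefficient form of the condition, read at time `0`
  -- with `f = 1`.
  intro q hq a ha
  let q' : Fin k → TestFn n 𝔼 := fun a => ⟨q a, (hq a).contMDiff⟩
  have h := (P.current_eq_sum_integral 1 q' (z := fun _ => 0) (A := fun _ => 0) hR hK).symm.trans
    (hcyc q' a ha)
  rw [← h]
  refine Finset.sum_congr rfl fun I _ => ?_
  refine integral_congr_ae (Eventually.of_forall fun p => ?_)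
  simp [pullCoeff, hrow, q']

/-- A smooth push-forward is homologous to the original current, relative to the complement of a
set on which the boundary vanishes. -/
theorem exists_map_sub_eq_boundary (P : RectData n 𝔼 k) {R : ℝ} (hR : 0 ≤ R)
    (hK : P.K ⊆ Metric.closedBall 0 R) (F : C^∞⟮𝓡 n, 𝔼; 𝓡 n, 𝔼⟯)
    (hFR : ∀ y, ‖y‖ ≤ R → ‖F y‖ ≤ R)
    {V : Set 𝔼} (hcyc : ∀ π : Fin k → TestFn n 𝔼, ∀ a, tsupport (π a) ⊆ V → P.current 1 π = 0)
    (hFV : tsupport (fun x => F x - x) ⊆ V) :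
    ∃ S : RectData n 𝔼 (k + 1), S.K = Metric.closedBall 0 R ∧
      (P.map F).current - P.current = boundary n 𝔼 k S.current := by
  have hF : ContDiff ℝ ∞ F := F.contMDiff.contDiff
  have hG : ∀ I, Integrable (fun p => (1 + ‖fderiv ℝ F (P.pt p)‖) ^ k * P.wt I p) P.base := fun I =>
    integrable_comp_mul P.measurable_pt (P.norm_pt_le hR hK) (P.integrable_wt I)
      (c := fun y => (1 + ‖fderiv ℝ F y‖) ^ k)
      ((continuous_const.add (hF.continuous_fderiv (by simp)).norm).pow k)
  have hFR' : ∀ y ∈ P.K, y ∈ univ → ‖F y‖ ≤ R := fun y hy _ => hFR y (by simpa using hK hy)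
  -- A smooth map is the case of an empty singular set and a constant approximating sequence.
  have h := P.pushSing_sub_eq_boundary hF.continuous.measurable isOpen_univ hF.contDiffOn
    (isCompact_closedBall (0 : 𝔼) R) (fun y hy _ => by simpa using hFR' y hy trivial) hR hK hFR' hG
    (fun j => Eventually.of_forall fun x => Or.inl (mem_univ _)) hcyc (Fs := fun _ => F)
    (fun _ => hF) (fun _ => hFV) (fun _ => hFR) hG (Eventually.of_forall fun p =>
      Or.inr ⟨tendsto_const_nhds, tendsto_const_nhds, fun _ => le_rfl⟩)
  refine ⟨_, rfl, Eq.trans ?_ h⟩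
  congr 1
  funext f π
  refine tsum_congr fun (j : P.ι) => ?_
  change _ = ∫ x in P.E j ∩ P.φ j ⁻¹' univ, _
  rw [preimage_univ, inter_univ]
  rfl

end Singular

end RectData

/-! ### The regularised radial projection away from a point -/

section Projection

/-- The radial factor of the regularised projection away from a point. -/
def radialFactor (r s e v : ℝ) : ℝ :=
  -- For `r ^ 2 < s ^ 2` the cut-off is `1` if `v ≤ r ^ 2` and `0` if `v ≥ s ^ 2`. Where it is `1`,
  -- the point is sent to `p + s (x - p) / √(|x - p|² + e)`: onto the sphere of radius `s` if `e =
  -- 0`, and smoothly across `p` if `e > 0`.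
  Real.smoothTransition ((s ^ 2 - v) / (s ^ 2 - r ^ 2)) * (s * (√(v + e))⁻¹ - 1)

theorem contDiff_smoothTransition_comp (c d : ℝ) :
    ContDiff ℝ ∞ fun v : ℝ => Real.smoothTransition ((c - v) / d) :=
  Real.smoothTransition.contDiff.comp ((contDiff_const.sub contDiff_id).div_const _)

/-- The derivative of `radialFactor`. -/
def radialFactorDeriv (r s e v : ℝ) : ℝ :=
  deriv (fun v : ℝ => Real.smoothTransition ((s ^ 2 - v) / (s ^ 2 - r ^ 2))) v
      * (s * (√(v + e))⁻¹ - 1)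
    + Real.smoothTransition ((s ^ 2 - v) / (s ^ 2 - r ^ 2))
      * (s * (-(1 / (2 * √(v + e))) / √(v + e) ^ 2))

theorem hasDerivAt_radialFactor (r s : ℝ) {e v : ℝ} (h : 0 < v + e) :
    HasDerivAt (radialFactor r s e) (radialFactorDeriv r s e v) v := by
  have h1 : HasDerivAt (fun v => √(v + e)) (1 / (2 * √(v + e))) v :=
    ((hasDerivAt_id v).add_const e).sqrt h.ne'
  have h2 := (h1.inv (Real.sqrt_pos.2 h).ne').const_mul s
  exact (((contDiff_smoothTransition_comp (s ^ 2) (s ^ 2 - r ^ 2)).differentiable (by simp)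
    v).hasDerivAt).mul (h2.sub_const 1)

theorem contDiffAt_radialFactor (r s : ℝ) {e v : ℝ} (h : 0 < v + e) :
    ContDiffAt ℝ ∞ (radialFactor r s e) v := by
  refine (contDiff_smoothTransition_comp (s ^ 2) (s ^ 2 - r ^ 2)).contDiffAt.mul ?_
  have h1 : ContDiffAt ℝ ∞ (fun v => √(v + e)) v := (contDiffAt_id.add contDiffAt_const).sqrt h.ne'
  exact (contDiffAt_const.mul (h1.inv (Real.sqrt_pos.2 h).ne')).sub contDiffAt_const

theorem tendsto_sqrt_add {v : ℝ} {l : Filter ℕ} {e : ℕ → ℝ}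
    (he : Tendsto e l (𝓝 0)) : Tendsto (fun m => √(v + e m)) l (𝓝 √(v + 0)) :=
  (Real.continuous_sqrt.tendsto _).comp (tendsto_const_nhds.add he)

theorem tendsto_radialFactor (r s : ℝ) {v : ℝ} (hv : 0 < v) {e : ℕ → ℝ}
    (he : Tendsto e atTop (𝓝 0)) :
    Tendsto (fun m => radialFactor r s (e m) v) atTop (𝓝 (radialFactor r s 0 v)) := by
  have h0 : √(v + 0) ≠ 0 := by simpa using (Real.sqrt_pos.2 hv).ne'
  exact tendsto_const_nhds.mul
    ((tendsto_const_nhds.mul ((tendsto_sqrt_add he).inv₀ h0)).sub tendsto_const_nhds)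

theorem tendsto_radialFactorDeriv (r s : ℝ) {v : ℝ} (hv : 0 < v) {e : ℕ → ℝ}
    (he : Tendsto e atTop (𝓝 0)) :
    Tendsto (fun m => radialFactorDeriv r s (e m) v) atTop (𝓝 (radialFactorDeriv r s 0 v)) := by
  have h0 : √(v + 0) ≠ 0 := by simpa using (Real.sqrt_pos.2 hv).ne'
  have h := tendsto_sqrt_add (v := v) he
  refine (tendsto_const_nhds.mul
    ((tendsto_const_nhds.mul (h.inv₀ h0)).sub tendsto_const_nhds)).add
    (tendsto_const_nhds.mul (tendsto_const_nhds.mul (Tendsto.div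
      (tendsto_const_nhds.div (tendsto_const_nhds.mul h) ?_).neg (h.pow 2) ?_)))
  · simpa using h0
  · exact pow_ne_zero 2 h0

theorem abs_radialFactor_le {r s : ℝ} (hs : 0 ≤ s) {e t : ℝ} (he : 0 ≤ e) (ht : 0 < t) :
    |radialFactor r s e (t ^ 2)| ≤ 1 + s * t⁻¹ := by
  have h1 : t ≤ √(t ^ 2 + e) := Real.le_sqrt_of_sq_le (by linarith)
  have h2 : (√(t ^ 2 + e))⁻¹ ≤ t⁻¹ := inv_anti₀ ht h1
  have h3 : 0 ≤ (√(t ^ 2 + e))⁻¹ := by positivity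
  rw [radialFactor, abs_mul, abs_of_nonneg (Real.smoothTransition.nonneg _)]
  have h4 : |s * (√(t ^ 2 + e))⁻¹ - 1| ≤ 1 + s * t⁻¹ := by
    rw [abs_le]
    have := mul_nonneg hs h3
    have := mul_le_mul_of_nonneg_left h2 hs
    constructor <;> linarith [mul_nonneg hs (h3.trans h2)]
  calc _ ≤ 1 * |s * (√(t ^ 2 + e))⁻¹ - 1| :=
        mul_le_mul_of_nonneg_right (Real.smoothTransition.le_one _) (abs_nonneg _)
    _ ≤ _ := by rwa [one_mul]

/-- In the derivative of the projection this term is multiplied by `x - p` twice, whence the weight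
`t ^ 2`. Uniformity in `e` comes from `√(t ^ 2 + e) ≥ t`. -/
theorem exists_bound_radialFactorDeriv (r s R : ℝ) (hs : 0 ≤ s) :
    ∃ C, 0 ≤ C ∧ ∀ e t, 0 ≤ e → 0 < t → t ≤ R →
      |radialFactorDeriv r s e (t ^ 2)| * t ^ 2 ≤ C * (1 + t⁻¹) := by
  obtain ⟨B, hB⟩ := (isCompact_Icc (a := (0 : ℝ)) (b := R ^ 2)).exists_bound_of_continuousOn
    ((contDiff_smoothTransition_comp (s ^ 2) (s ^ 2 - r ^ 2)).continuous_deriv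
      (by simp)).continuousOn
  refine ⟨max B 0 * R ^ 2 * (1 + s) + s, by positivity, fun e t he ht htR => ?_⟩
  have h1 : t ≤ √(t ^ 2 + e) := Real.le_sqrt_of_sq_le (by linarith)
  have h2 : (√(t ^ 2 + e))⁻¹ ≤ t⁻¹ := inv_anti₀ ht h1
  have h3 : 0 ≤ (√(t ^ 2 + e))⁻¹ := by positivity
  have h4 : |s * (√(t ^ 2 + e))⁻¹ - 1| ≤ 1 + s * t⁻¹ := by
    rw [abs_le]
    have := mul_nonneg hs h3
    have := mul_le_mul_of_nonneg_left h2 hs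
    constructor <;> linarith [mul_nonneg hs (h3.trans h2)]
  have htR2 : t ^ 2 ≤ R ^ 2 := by gcongr
  have h5 := (hB (t ^ 2) ⟨by positivity, htR2⟩).trans (le_max_left B 0)
  rw [Real.norm_eq_abs] at h5
  have hti : 0 < t⁻¹ := by positivity
  have h6 : |s * (-(1 / (2 * √(t ^ 2 + e))) / √(t ^ 2 + e) ^ 2)| * t ^ 2 ≤ s * t⁻¹ := by
    have e1 : s * (-(1 / (2 * √(t ^ 2 + e))) / √(t ^ 2 + e) ^ 2)
        = -(s * ((√(t ^ 2 + e))⁻¹ * ((√(t ^ 2 + e))⁻¹) ^ 2 / 2)) := by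
      field_simp
    rw [e1, abs_neg, abs_of_nonneg (by positivity)]
    calc _ ≤ s * (t⁻¹ * t⁻¹ ^ 2 / 2) * t ^ 2 := by gcongr
      _ = s * t⁻¹ / 2 := by field_simp
      _ ≤ _ := by linarith [mul_nonneg hs hti.le]
  rw [radialFactorDeriv]
  have h7 : 1 + s * t⁻¹ ≤ (1 + s) * (1 + t⁻¹) := by nlinarith
  have h8 := Real.smoothTransition.le_one ((s ^ 2 - t ^ 2) / (s ^ 2 - r ^ 2))
  have h9 := Real.smoothTransition.nonneg ((s ^ 2 - t ^ 2) / (s ^ 2 - r ^ 2))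
  calc _ ≤ (max B 0 * ((1 + s) * (1 + t⁻¹))
        + 1 * |s * (-(1 / (2 * √(t ^ 2 + e))) / √(t ^ 2 + e) ^ 2)|) * t ^ 2 := by
        refine mul_le_mul_of_nonneg_right ((abs_add_le _ _).trans (add_le_add ?_ ?_)) (by positivity)
        · rw [abs_mul]
          exact mul_le_mul h5 (h4.trans h7) (abs_nonneg _) (le_max_right _ _)
        · rw [abs_mul, abs_of_nonneg h9]
          exact mul_le_mul_of_nonneg_right h8 (abs_nonneg _)
    _ = max B 0 * t ^ 2 * ((1 + s) * (1 + t⁻¹))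
        + |s * (-(1 / (2 * √(t ^ 2 + e))) / √(t ^ 2 + e) ^ 2)| * t ^ 2 := by ring
    _ ≤ max B 0 * R ^ 2 * ((1 + s) * (1 + t⁻¹)) + s * t⁻¹ := by gcongr
    _ ≤ _ := by nlinarith

variable {n k : ℕ}

local notation "𝔼" => EuclideanSpace ℝ (Fin n)

/-- The projection away from `p`, regularised if `e > 0`. -/
def radialProj (r s e : ℝ) (p x : EuclideanSpace ℝ (Fin n)) : EuclideanSpace ℝ (Fin n) :=
  x + radialFactor r s e (‖x - p‖ ^ 2) • (x - p)

theorem radialProj_of_le {r s e : ℝ} (hrs : r ^ 2 < s ^ 2) (hs : 0 ≤ s) {p x : 𝔼}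
    (hx : s ≤ ‖x - p‖) : radialProj r s e p x = x := by
  have : (s ^ 2 - ‖x - p‖ ^ 2) / (s ^ 2 - r ^ 2) ≤ 0 :=
    div_nonpos_of_nonpos_of_nonneg (by nlinarith [norm_nonneg (x - p)]) (by linarith)
  simp [radialProj, radialFactor, Real.smoothTransition.zero_of_nonpos this]

/-- The point `radialProj r s e p x - p` is a convex combination of `x - p` and a multiple of it. -/
theorem radialProj_sub (r s e : ℝ) (p x : 𝔼) :
    radialProj r s e p x - p = ((1 - Real.smoothTransition
      ((s ^ 2 - ‖x - p‖ ^ 2) / (s ^ 2 - r ^ 2))) + Real.smoothTransition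
      ((s ^ 2 - ‖x - p‖ ^ 2) / (s ^ 2 - r ^ 2)) * (s * (√(‖x - p‖ ^ 2 + e))⁻¹)) • (x - p) := by
  rw [radialProj, radialFactor]
  module

theorem norm_radialProj_sub (r s e : ℝ) (hs : 0 ≤ s) (p x : 𝔼) :
    ‖radialProj r s e p x - p‖ = (1 - Real.smoothTransition
      ((s ^ 2 - ‖x - p‖ ^ 2) / (s ^ 2 - r ^ 2))) * ‖x - p‖ + Real.smoothTransition
      ((s ^ 2 - ‖x - p‖ ^ 2) / (s ^ 2 - r ^ 2)) * (s * (√(‖x - p‖ ^ 2 + e))⁻¹ * ‖x - p‖) := by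
  have h8 := Real.smoothTransition.le_one ((s ^ 2 - ‖x - p‖ ^ 2) / (s ^ 2 - r ^ 2))
  have h9 := Real.smoothTransition.nonneg ((s ^ 2 - ‖x - p‖ ^ 2) / (s ^ 2 - r ^ 2))
  have h10 : 0 ≤ s * (√(‖x - p‖ ^ 2 + e))⁻¹ := by positivity
  rw [radialProj_sub, norm_smul, Real.norm_eq_abs, abs_of_nonneg (by nlinarith)]
  ring

theorem norm_radialProj_sub_le {r s e : ℝ} (hs : 0 ≤ s) (he : 0 ≤ e) {p x : 𝔼}
    (hx : ‖x - p‖ ≤ s) : ‖radialProj r s e p x - p‖ ≤ s := by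
  have h8 := Real.smoothTransition.le_one ((s ^ 2 - ‖x - p‖ ^ 2) / (s ^ 2 - r ^ 2))
  have h9 := Real.smoothTransition.nonneg ((s ^ 2 - ‖x - p‖ ^ 2) / (s ^ 2 - r ^ 2))
  have h1 : (√(‖x - p‖ ^ 2 + e))⁻¹ * ‖x - p‖ ≤ 1 := by
    rw [inv_mul_eq_div]
    exact div_le_one_of_le₀ (Real.le_sqrt_of_sq_le (by linarith)) (Real.sqrt_nonneg _)
  have h2 := mul_le_mul_of_nonneg_left h1 hs
  rw [norm_radialProj_sub _ _ _ hs, mul_assoc s]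
  nlinarith

/-- For `e = 0` the distance of the image from `p` is a convex combination of `‖x - p‖` and `s`.
Both are at least `r` when `‖x - p‖ ≥ r`; otherwise the cut-off is `1` and the distance equals `s`.
-/
theorem le_norm_radialProj_sub {r s : ℝ} (hr : 0 ≤ r) (hrs : r < s) {p x : 𝔼} (hx : x ≠ p) :
    r ≤ ‖radialProj r s 0 p x - p‖ := by
  have h8 := Real.smoothTransition.le_one ((s ^ 2 - ‖x - p‖ ^ 2) / (s ^ 2 - r ^ 2))
  have h9 := Real.smoothTransition.nonneg ((s ^ 2 - ‖x - p‖ ^ 2) / (s ^ 2 - r ^ 2))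
  have hpos : 0 < ‖x - p‖ := norm_pos_iff.2 (sub_ne_zero.2 hx)
  have h1 : s * (√(‖x - p‖ ^ 2 + 0))⁻¹ * ‖x - p‖ = s := by
    rw [add_zero, Real.sqrt_sq hpos.le]
    field_simp
  rw [norm_radialProj_sub _ _ _ (hr.trans hrs.le), h1]
  rcases le_total r ‖x - p‖ with h | h
  · nlinarith
  · rw [Real.smoothTransition.one_of_one_le]
    · linarith
    · rw [one_le_div (by nlinarith)]
      nlinarith

/-- The derivative of `radialProj`. -/
def radialProjDeriv (r s e : ℝ) (p x : EuclideanSpace ℝ (Fin n)) :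
    EuclideanSpace ℝ (Fin n) →L[ℝ] EuclideanSpace ℝ (Fin n) :=
  ContinuousLinearMap.id ℝ _ + (radialFactor r s e (‖x - p‖ ^ 2) • ContinuousLinearMap.id ℝ _
    + (radialFactorDeriv r s e (‖x - p‖ ^ 2) • (2 • innerSL ℝ (x - p))).smulRight (x - p))

theorem hasFDerivAt_radialProj {r s e : ℝ} {p x : 𝔼} (h : 0 < ‖x - p‖ ^ 2 + e) :
    HasFDerivAt (radialProj r s e p) (radialProjDeriv r s e p x) x := by
  have h1 : HasFDerivAt (fun x : 𝔼 => x - p) (ContinuousLinearMap.id ℝ 𝔼) x :=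
    (hasFDerivAt_id x).sub_const p
  have h2 : HasFDerivAt (fun x : 𝔼 => ‖x - p‖ ^ 2) (2 • innerSL ℝ (x - p)) x := by
    simpa using h1.norm_sq
  have h3 : HasFDerivAt (fun x : 𝔼 => radialFactor r s e (‖x - p‖ ^ 2))
      (radialFactorDeriv r s e (‖x - p‖ ^ 2) • (2 • innerSL ℝ (x - p))) x :=
    HasDerivAt.comp_hasFDerivAt x (f := fun x : 𝔼 => ‖x - p‖ ^ 2)
      (hasDerivAt_radialFactor r s h) h2
  exact (hasFDerivAt_id x).add (h3.smul h1)

theorem contDiffAt_radialProj {r s e : ℝ} {p x : 𝔼} (h : 0 < ‖x - p‖ ^ 2 + e) :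
    ContDiffAt ℝ ∞ (radialProj r s e p) x := by
  have h1 : ContDiffAt ℝ ∞ (fun x : 𝔼 => x - p) x := contDiffAt_id.sub contDiffAt_const
  exact contDiffAt_id.add (((contDiffAt_radialFactor r s h).comp x (h1.norm_sq ℝ)).smul h1)

/-- The bound is uniform in the regularisation, so it dominates the approximating maps and the
singular map together, and reduces the energy to the integrability of `‖x - p‖⁻¹ ^ k`. -/
theorem exists_bound_radialProjDeriv (r s R : ℝ) (hs : 0 ≤ s) :
    ∃ C, 0 ≤ C ∧ ∀ (e : ℝ) (p x : 𝔼), 0 ≤ e → x ≠ p → ‖x - p‖ ≤ R →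
      ‖radialProjDeriv r s e p x‖ ≤ C * (1 + ‖x - p‖⁻¹) := by
  obtain ⟨C, hC0, hC⟩ := exists_bound_radialFactorDeriv r s R hs
  refine ⟨1 + (1 + s) + 2 * C, by positivity, fun e p x he hx hR => ?_⟩
  have hpos : 0 < ‖x - p‖ := norm_pos_iff.2 (sub_ne_zero.2 hx)
  have hid : ‖ContinuousLinearMap.id ℝ 𝔼‖ ≤ 1 := ContinuousLinearMap.norm_id_le
  have h1 := abs_radialFactor_le (r := r) hs he hpos
  have h2 := hC e _ he hpos hR
  have h3 : ‖radialFactor r s e (‖x - p‖ ^ 2) • ContinuousLinearMap.id ℝ 𝔼‖ ≤ 1 + s * ‖x - p‖⁻¹ := by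
    rw [norm_smul, Real.norm_eq_abs]
    nlinarith [abs_nonneg (radialFactor r s e (‖x - p‖ ^ 2))]
  have h4 : ‖(radialFactorDeriv r s e (‖x - p‖ ^ 2) • (2 • innerSL ℝ (x - p))).smulRight (x - p)‖
      ≤ 2 * (C * (1 + ‖x - p‖⁻¹)) := by
    rw [ContinuousLinearMap.norm_smulRight_apply, norm_smul, Real.norm_eq_abs, two_nsmul]
    have : ‖innerSL ℝ (x - p) + innerSL ℝ (x - p)‖ ≤ 2 * ‖x - p‖ := by
      refine (norm_add_le _ _).trans ?_
      rw [innerSL_apply_norm]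
      linarith
    calc _ ≤ |radialFactorDeriv r s e (‖x - p‖ ^ 2)| * (2 * ‖x - p‖) * ‖x - p‖ := by gcongr
      _ = 2 * (|radialFactorDeriv r s e (‖x - p‖ ^ 2)| * ‖x - p‖ ^ 2) := by ring
      _ ≤ _ := by linarith
  have h5 : 0 ≤ ‖x - p‖⁻¹ := by positivity
  calc _ ≤ 1 + ((1 + s * ‖x - p‖⁻¹) + 2 * (C * (1 + ‖x - p‖⁻¹))) :=
        (norm_add_le _ _).trans (add_le_add hid ((norm_add_le _ _).trans (add_le_add h3 h4)))
    _ ≤ _ := by nlinarith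

theorem tendsto_radialProj (r s : ℝ) {p x : 𝔼} (hx : x ≠ p) {e : ℕ → ℝ}
    (he : Tendsto e atTop (𝓝 0)) :
    Tendsto (fun m => radialProj r s (e m) p x) atTop (𝓝 (radialProj r s 0 p x)) := by
  have hpos : 0 < ‖x - p‖ := norm_pos_iff.2 (sub_ne_zero.2 hx)
  exact tendsto_const_nhds.add
    ((tendsto_radialFactor r s (by positivity) he).smul tendsto_const_nhds)

theorem tendsto_radialProjDeriv (r s : ℝ) {p x : 𝔼} (hx : x ≠ p) {e : ℕ → ℝ}
    (he : Tendsto e atTop (𝓝 0)) :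
    Tendsto (fun m => radialProjDeriv r s (e m) p x) atTop (𝓝 (radialProjDeriv r s 0 p x)) := by
  have hpos : 0 < ‖x - p‖ := norm_pos_iff.2 (sub_ne_zero.2 hx)
  refine tendsto_const_nhds.add
    (((tendsto_radialFactor r s (by positivity) he).smul tendsto_const_nhds).add ?_)
  have h : Continuous fun t : ℝ => (t • (2 • innerSL ℝ (x - p))).smulRight (x - p) := by
    have : (fun t : ℝ => (t • (2 • innerSL ℝ (x - p))).smulRight (x - p))
        = fun t : ℝ => t • ((2 • innerSL ℝ (x - p)).smulRight (x - p)) := by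
      funext t
      ext v
      simp only [ContinuousLinearMap.smulRight_apply, smul_apply, smul_assoc]
    rw [this]
    fun_prop
  exact (h.tendsto _).comp (tendsto_radialFactorDeriv r s (by positivity) he)

end Projection

/-! ### Choice of the centre and pushing chains out of a ball -/

section Average

variable {n k : ℕ}

local notation "𝔼" => EuclideanSpace ℝ (Fin n)

/-- In polar coordinates the integrand is `t ^ (n - 1 - k)`, with a nonnegative exponent because `k
< n`. This is where the argument uses that the chain has positive codimension. -/
theorem lintegral_ball_enorm_inv_pow_lt_top (hk : k < n) (R : ℝ) :
    ∫⁻ z in Metric.ball (0 : 𝔼) R, (‖z‖ₑ⁻¹) ^ k < ⊤ := by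
  have hn : 0 < n := by omega
  have : Nonempty (Fin n) := ⟨⟨0, hn⟩⟩
  have : Nontrivial 𝔼 := inferInstance
  have hint : Integrable (fun z : 𝔼 => (Iio R).indicator (fun t : ℝ => (t⁻¹) ^ k) ‖z‖) volume := by
    rw [integrable_fun_norm_addHaar volume (f := (Iio R).indicator fun t : ℝ => (t⁻¹) ^ k)]
    have h1 : IntegrableOn (fun t : ℝ => t ^ (n - 1 - k)) (Ioo 0 R) :=
      (Continuous.integrableOn_Icc (by fun_prop)).mono_set Ioo_subset_Icc_self
    have h2 : Integrable ((Ioo 0 R).indicator fun t : ℝ => t ^ (n - 1 - k)) volume :=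
      (integrable_indicator_iff measurableSet_Ioo).2 h1
    refine (h2.integrableOn (s := Ioi 0)).congr_fun (fun t (ht : 0 < t) => ?_) measurableSet_Ioi
    by_cases htR : t < R
    · have : n - 1 = (n - 1 - k) + k := by omega
      simp only [indicator, mem_Ioo, ht, htR, and_self, if_true, mem_Iio, finrank_euclideanSpace,
        Fintype.card_fin, smul_eq_mul]
      conv_rhs => rw [this, pow_add, mul_assoc, ← mul_pow, mul_inv_cancel₀ ht.ne', one_pow, mul_one]
    · simp [indicator, htR]
  refine lt_of_le_of_lt ?_ hint.hasFiniteIntegral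
  rw [← lintegral_indicator Metric.isOpen_ball.measurableSet]
  have hne : ∀ᵐ z : 𝔼, z ≠ 0 := by
    simp [ae_iff]
  refine lintegral_mono_ae (hne.mono fun z hz => ?_)
  by_cases hzR : ‖z‖ < R
  · have hz' : ‖z‖ ≠ 0 := norm_ne_zero_iff.2 hz
    simp [indicator, hzR, enorm_inv (pow_ne_zero k hz'), enorm_pow, ENNReal.inv_pow]
  · simp [indicator, hzR]

theorem setLIntegral_ball_enorm_sub_le {y : 𝔼} {R η : ℝ} (hy : ‖y‖ ≤ R) :
    ∫⁻ p in Metric.ball (0 : 𝔼) η, (‖y - p‖ₑ⁻¹) ^ k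
      ≤ ∫⁻ z in Metric.ball (0 : 𝔼) (R + η), (‖z‖ₑ⁻¹) ^ k := by
  rw [← lintegral_indicator Metric.isOpen_ball.measurableSet,
    ← lintegral_indicator Metric.isOpen_ball.measurableSet,
    ← lintegral_sub_left_eq_self ((Metric.ball (0 : 𝔼) (R + η)).indicator
      fun z => (‖z‖ₑ⁻¹) ^ k) y]
  refine lintegral_mono fun p => ?_
  by_cases hp : ‖p‖ < η
  · have : ‖y - p‖ < R + η := (norm_sub_le _ _).trans_lt (by linarith)
    simp [indicator, hp, this]
  · simp [indicator, hp]

namespace RectData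

/-- Almost every point `p` near the origin is such that `‖x - p‖⁻ᵏ` is integrable with respect to
a rectifiable current of dimension `k < n`. -/
theorem exists_center (P : RectData n 𝔼 k) (hk : k < n) {R : ℝ} (hR : 0 ≤ R)
    (hK : P.K ⊆ Metric.closedBall 0 R) {η : ℝ} (hη : 0 < η) :
    ∃ p : 𝔼, ‖p‖ < η ∧ ∀ I, ∫⁻ q, (‖P.pt q - p‖ₑ⁻¹) ^ k * ‖P.wt I q‖ₑ ∂P.base < ⊤ := by
  have hae : ∀ I, ∀ᵐ p ∂(volume.restrict (Metric.ball (0 : 𝔼) η)),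
      ∫⁻ q, (‖P.pt q - p‖ₑ⁻¹) ^ k * ‖P.wt I q‖ₑ ∂P.base < ⊤ := by
    intro I
    have hm : Measurable (Function.uncurry fun (p : 𝔼) q => (‖P.pt q - p‖ₑ⁻¹) ^ k * ‖P.wt I q‖ₑ) :=
      ((((P.measurable_pt.comp measurable_snd).sub measurable_fst).enorm.inv.pow_const k).mul
        ((P.measurable_wt I).comp measurable_snd).enorm)
    refine ae_lt_top (hm.lintegral_prod_right') ?_
    -- By Tonelli the centre is integrated first. The inner integral is bounded uniformly along the
    -- chain, so the average over centres is finite and almost every centre is admissible.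
    rw [lintegral_lintegral_swap hm.aemeasurable]
    have hb : ∀ q, ∫⁻ p in Metric.ball (0 : 𝔼) η, (‖P.pt q - p‖ₑ⁻¹) ^ k * ‖P.wt I q‖ₑ
        ≤ (∫⁻ z in Metric.ball (0 : 𝔼) (R + η), (‖z‖ₑ⁻¹) ^ k) * ‖P.wt I q‖ₑ := by
      intro q
      rw [lintegral_mul_const' _ _ enorm_ne_top]
      exact mul_le_mul' (setLIntegral_ball_enorm_sub_le (P.norm_pt_le hR hK q)) le_rfl
    refine ne_top_of_le_ne_top ?_ (lintegral_mono hb)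
    rw [lintegral_const_mul _ (P.measurable_wt I).enorm]
    exact ENNReal.mul_ne_top (lintegral_ball_enorm_inv_pow_lt_top hk _).ne
      (P.integrable_wt I).hasFiniteIntegral.ne
  have hne : (volume.restrict (Metric.ball (0 : 𝔼) η)) ≠ 0 := by
    rw [Ne, Measure.restrict_eq_zero]
    exact (Metric.measure_ball_pos volume _ hη).ne'
  have : NeBot (ae (volume.restrict (Metric.ball (0 : 𝔼) η))) := ae_neBot.2 hne
  obtain ⟨p, hp, hpη⟩ := ((ae_all_iff.2 hae).and
    (ae_restrict_mem Metric.isOpen_ball.measurableSet)).exists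
  exact ⟨p, by simpa using hpη, hp⟩

/-- A current of dimension `k < n` whose boundary vanishes in a ball can be pushed out of any
smaller ball. -/
theorem exists_push_out (P : RectData n 𝔼 k) (hk0 : k ≠ 0) (hk : k < n) {r s : ℝ} (hr : 0 < r)
    (hrs : r < s) (hK : P.K ⊆ Metric.closedBall 0 s)
    (hcyc : ∀ π : Fin k → TestFn n 𝔼, ∀ a, tsupport (π a) ⊆ Metric.ball 0 s → P.current 1 π = 0) :
    ∃ (Q : RectData n 𝔼 k) (S : RectData n 𝔼 (k + 1)),
      Q.K ⊆ {x | r ≤ ‖x‖ ∧ ‖x‖ ≤ s} ∧ S.K ⊆ Metric.closedBall 0 s ∧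
      Q.current - P.current = boundary n 𝔼 k S.current := by
  -- The centre is within `η` of the origin. Radius `r + η` about it covers the ball of radius `r`
  -- about `0`, and radius `s - 2η` about it stays strictly inside the ball of radius `s`. Any `η`
  -- below `(s - r) / 3` would do.
  obtain ⟨η, hη, hηs⟩ : ∃ η, 0 < η ∧ r + η < s - 2 * η :=
    ⟨(s - r) / 4, by linarith, by linarith⟩
  have hs0 : 0 < s := hr.trans hrs
  obtain ⟨p, hp, hfin⟩ := P.exists_center hk hs0.le hK hη
  set r₁ := r + η with hr₁
  set s₁ := s - 2 * η with hs₁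
  have hr₁0 : 0 < r₁ := by positivity
  have hs₁0 : 0 < s₁ := hr₁0.trans hηs
  have hsq : r₁ ^ 2 < s₁ ^ 2 := by gcongr
  obtain ⟨C, hC0, hC⟩ := exists_bound_radialProjDeriv (n := n) r₁ s₁ (s + η) hs₁0.le
  have hpt := P.norm_pt_le hs0.le hK
  have hsub : ∀ q, ‖P.pt q - p‖ ≤ s + η := fun q =>
    (norm_sub_le _ _).trans (add_le_add (hpt q) hp.le)
  -- the estimates for the projections
  have hnorm : ∀ e, 0 ≤ e → ∀ y : 𝔼, ‖y‖ ≤ s → ‖radialProj r₁ s₁ e p y‖ ≤ s := by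
    intro e he y hy
    rcases le_total s₁ ‖y - p‖ with h | h
    · rwa [radialProj_of_le hsq hs₁0.le h]
    · have h1 := norm_radialProj_sub_le (r := r₁) hs₁0.le he h
      have h2 := norm_sub_norm_le (radialProj r₁ s₁ e p y) p
      linarith
  have hsupp : ∀ e, tsupport (fun x => radialProj r₁ s₁ e p x - x) ⊆ Metric.ball (0 : 𝔼) s := by
    intro e
    have h1 : tsupport (fun x => radialProj r₁ s₁ e p x - x) ⊆ Metric.closedBall p s₁ := by
      refine closure_minimal (fun x hx => ?_) Metric.isClosed_closedBall
      by_contra hx'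
      refine hx ?_
      change radialProj r₁ s₁ e p x - x = 0
      rw [radialProj_of_le hsq hs₁0.le, sub_self]
      rw [mem_closedBall_iff_norm, not_le] at hx'
      exact hx'.le
    refine h1.trans fun x hx => ?_
    rw [mem_closedBall_iff_norm] at hx
    rw [mem_ball_zero_iff]
    have h2 := norm_sub_norm_le x p
    linarith
  set W : Set 𝔼 := {p}ᶜ with hWdef
  have hW : IsOpen W := isOpen_compl_singleton
  have hpos : ∀ x ∈ W, 0 < ‖x - p‖ ^ 2 + 0 := fun x hx => by
    have : 0 < ‖x - p‖ := norm_pos_iff.2 (sub_ne_zero.2 hx)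
    positivity
  have hF : ContDiffOn ℝ ∞ (radialProj r₁ s₁ 0 p) W := fun x hx =>
    (contDiffAt_radialProj (hpos x hx)).contDiffWithinAt
  have hFm : Measurable (radialProj r₁ s₁ 0 p) := by
    have h1 : Measurable fun x : 𝔼 => ‖x - p‖ ^ 2 := by fun_prop
    have h2 : Measurable fun x : 𝔼 => radialFactor r₁ s₁ 0 (‖x - p‖ ^ 2) :=
      ((contDiff_smoothTransition_comp _ _).continuous.measurable.comp h1).mul
        (((Real.continuous_sqrt.measurable.comp (h1.add_const 0)).inv.const_mul s₁).sub_const 1)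
    have h3 : Measurable fun x : 𝔼 => radialFactor r₁ s₁ 0 (‖x - p‖ ^ 2) • (x - p) := by fun_prop
    exact measurable_id.add h3
  -- integrability
  have hfinite : ∀ I, ∀ᵐ q ∂P.base, P.pt q ≠ p ∨ P.wt I q = 0 := by
    intro I
    have hm : Measurable fun q => (‖P.pt q - p‖ₑ⁻¹) ^ k * ‖P.wt I q‖ₑ :=
      ((P.measurable_pt.sub_const p).enorm.inv.pow_const k).mul (P.measurable_wt I).enorm
    filter_upwards [ae_lt_top hm (hfin I).ne] with q hq
    by_contra! h
    -- At the centre the integrand is `⊤ ^ k` times the weight. As `k ≠ 0`, finiteness forces the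
    -- weight to vanish there almost everywhere.
    simp [h.1, h.2, hk0, ENNReal.top_mul] at hq
  have hnull' : ∀ᵐ q ∂P.base, P.pt q ∈ W ∨ ∀ I, P.wt I q = 0 := by
    filter_upwards [ae_all_iff.2 hfinite] with q hq
    by_cases h : P.pt q = p
    · exact Or.inr fun I => (hq I).resolve_left (not_not.2 h)
    · exact Or.inl h
  have hnull : ∀ j, ∀ᵐ x ∂(volume.restrict (P.E j)), P.φ j x ∈ W ∨ ∀ I, P.wt I (j, x) = 0 := by
    intro j
    filter_upwards [P.ae_base_iff.1 hnull' j, ae_restrict_mem (P.measurableSet_E j)] with x hx hxE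
    rwa [P.pt_of_mem hxE] at hx
  have hinv : ∀ I, Integrable (fun q => (‖P.pt q - p‖⁻¹) ^ k * P.wt I q) P.base := by
    intro I
    refine ⟨(((P.measurable_pt.sub_const p).norm.inv.pow_const k).mul
      (P.measurable_wt I)).aestronglyMeasurable, lt_of_le_of_lt (lintegral_mono fun q => ?_) (hfin I)⟩
    rw [enorm_mul, enorm_pow]
    gcongr
    by_cases h : ‖P.pt q - p‖ = 0
    · simp [h]
    · simp [enorm_inv h]
  set g : P.ι × (Fin k → ℝ) → ℝ := fun q => C * (1 + ‖P.pt q - p‖⁻¹) with hgdef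
  have hgm : Measurable g := (((P.measurable_pt.sub_const p).norm.inv).const_add 1).const_mul C
  have hg0 : ∀ q, 0 ≤ g q := fun q => by positivity
  have hg : ∀ I, Integrable (fun q => (1 + g q) ^ k * P.wt I q) P.base := by
    intro I
    -- From `1 + g ≤ (1 + C) (1 + t)` and `(1 + t) ^ k ≤ 2 ^ (k - 1) (1 + t ^ k)` with `t = ‖x -
    -- p‖⁻¹`, only the powers `0` and `k` of `t` need to be integrable.
    have hdom : Integrable (fun q => ((1 + C) ^ k * 2 ^ (k - 1)) *
        (‖P.wt I q‖ + ‖(‖P.pt q - p‖⁻¹) ^ k * P.wt I q‖)) P.base :=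
      ((P.integrable_wt I).norm.add (hinv I).norm).const_mul _
    refine hdom.mono' (((hgm.const_add 1).pow_const k).mul
      (P.measurable_wt I)).aestronglyMeasurable (Eventually.of_forall fun q => ?_)
    have ht : 0 ≤ ‖P.pt q - p‖⁻¹ := by positivity
    set t := ‖P.pt q - p‖⁻¹
    have h1 : (1 + g q) ^ k ≤ (1 + C) ^ k * (1 + t) ^ k := by
      rw [← mul_pow]
      have : 1 + g q ≤ (1 + C) * (1 + t) := by
        change 1 + C * (1 + t) ≤ _
        nlinarith
      have := hg0 q
      gcongr
    have h2 : (1 + t) ^ k ≤ 2 ^ (k - 1) * (1 + t ^ k) := by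
      simpa using add_pow_le zero_le_one ht k
    have h3 : 0 ≤ (1 + g q) ^ k := by have := hg0 q; positivity
    rw [norm_mul, Real.norm_eq_abs ((1 + g q) ^ k), abs_of_nonneg h3, norm_mul, norm_pow,
      Real.norm_of_nonneg ht]
    calc _ ≤ ((1 + C) ^ k * (2 ^ (k - 1) * (1 + t ^ k))) * ‖P.wt I q‖ := by gcongr; nlinarith [h1, h2, pow_nonneg (by linarith : 0 ≤ 1 + C) k]
      _ = _ := by ring
  have hderiv : ∀ (e : ℝ) (x : 𝔼), 0 ≤ e → x ≠ p → fderiv ℝ (radialProj r₁ s₁ e p) x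
      = radialProjDeriv r₁ s₁ e p x := fun e x he hx =>
    (hasFDerivAt_radialProj ((hpos x hx).trans_le (by linarith))).fderiv
  have hbound : ∀ (e : ℝ) q, 0 ≤ e → P.pt q ≠ p →
      ‖fderiv ℝ (radialProj r₁ s₁ e p) (P.pt q)‖ ≤ g q := fun e q he hq => by
    rw [hderiv e _ he hq]
    exact hC e p _ he hq (hsub q)
  have hG : ∀ I, Integrable
      (fun q => (1 + ‖fderiv ℝ (radialProj r₁ s₁ 0 p) (P.pt q)‖) ^ k * P.wt I q) P.base := by
    intro I
    refine (hg I).mono (P.measurable_energy _ I).aestronglyMeasurable ?_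
    filter_upwards [hfinite I] with q hq
    rcases hq with hq | hq
    · have h1 := hbound 0 q le_rfl hq
      have h2 := norm_nonneg (fderiv ℝ (radialProj r₁ s₁ 0 p) (P.pt q))
      have h3 := hg0 q
      rw [norm_mul, norm_mul, Real.norm_of_nonneg (r := (1 + g q) ^ k) (by positivity),
        Real.norm_of_nonneg (r := (1 + _) ^ k) (by positivity)]
      gcongr
    · simp [hq]
  have he : Tendsto (fun m : ℕ => 1 / ((m : ℝ) + 1)) atTop (𝓝 0) :=
    tendsto_one_div_add_atTop_nhds_zero_nat
  have hepos : ∀ m : ℕ, 0 < 1 / ((m : ℝ) + 1) := fun m => by positivity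
  have hKc : IsCompact {x : 𝔼 | r ≤ ‖x‖ ∧ ‖x‖ ≤ s} := by
    refine Metric.isCompact_of_isClosed_isBounded
      ((isClosed_le continuous_const continuous_norm).inter
        (isClosed_le continuous_norm continuous_const)) ?_
    exact Metric.isBounded_closedBall.subset fun x hx => mem_closedBall_zero_iff.2 hx.2
  have hPK : ∀ y ∈ P.K, ‖y‖ ≤ s := fun y hy => by simpa using hK hy
  have hFK : ∀ y ∈ P.K, y ∈ W → radialProj r₁ s₁ 0 p y ∈ {x : 𝔼 | r ≤ ‖x‖ ∧ ‖x‖ ≤ s} := by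
    intro y hy hyW
    refine ⟨?_, hnorm 0 le_rfl y (hPK y hy)⟩
    have h1 := le_norm_radialProj_sub hr₁0.le hηs (x := y) (p := p) hyW
    have h2 := norm_sub_le (radialProj r₁ s₁ 0 p y) p
    linarith
  have key := P.pushSing_sub_eq_boundary hFm hW hF hKc hFK hs0.le hK
    (fun y hy hyW => hnorm 0 le_rfl y (hPK y hy)) hG hnull hcyc
    (Fs := fun m => radialProj r₁ s₁ (1 / ((m : ℝ) + 1)) p)
    (fun m => contDiff_iff_contDiffAt.2 fun x => contDiffAt_radialProj
      (add_pos_of_nonneg_of_pos (by positivity) (hepos m)))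
    (fun m => hsupp _) (fun m => hnorm _ (hepos m).le) hg (by
      filter_upwards [hnull'] with q hq
      refine hq.symm.imp_right fun hq => ⟨tendsto_radialProj r₁ s₁ hq he, ?_,
        fun m => hbound _ q (hepos m).le hq⟩
      rw [hderiv 0 _ le_rfl hq]
      simp_rw [fun m : ℕ => hderiv _ _ (hepos m).le hq]
      exact tendsto_radialProjDeriv r₁ s₁ hq he)
  exact ⟨_, _, le_rfl, le_rfl, key⟩

end RectData

end Average

/-! ### Functions with vanishing distributional derivative -/

section Constancy

open scoped Convolution

variable {G : Type*} [NormedAddCommGroup G] [NormedSpace ℝ G] [FiniteDimensional ℝ G]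
  [MeasurableSpace G] [BorelSpace G] {μ : Measure G} [μ.IsAddHaarMeasure]

/-- A locally integrable function on a ball whose distributional derivatives vanish is constant. -/
theorem ae_eq_const_of_integral_fderiv_eq_zero {N : G → ℝ} (hN : LocallyIntegrable N μ) {s : ℝ}
    (hs : 0 < s)
    (h : ∀ g : G → ℝ, ContDiff ℝ ∞ g → HasCompactSupport g → tsupport g ⊆ Metric.ball 0 s →
      ∀ v, ∫ x, N x * fderiv ℝ g x v ∂μ = 0) :
    ∃ x₀ ∈ Metric.ball (0 : G) s, ∀ᵐ x ∂μ, x ∈ Metric.ball 0 s → N x = N x₀ := by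
  obtain ⟨u, -, hu0, hu⟩ := exists_seq_strictAnti_tendsto' hs
  let φ : ℕ → ContDiffBump (0 : G) := fun i => ⟨u i / 2, u i, half_pos (hu0 i).1, half_lt_self (hu0 i).1⟩
  have hlim := ContDiffBump.ae_convolution_tendsto_right_of_locallyIntegrable (μ := μ) (φ := φ)
    (l := atTop) (K := 2) hu (Eventually.of_forall fun i => by
      change u i ≤ 2 * (u i / 2)
      linarith) hN
  -- Mollification at scale `u i` is tested only against bumps supported in the given ball when the
  -- point is at distance more than `u i` from its boundary; there the mollified function has zero
  -- derivative.
  have hderiv : ∀ i, ∀ x ∈ Metric.ball (0 : G) (s - u i),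
      HasFDerivAt ((φ i).normed μ ⋆[ContinuousLinearMap.lsmul ℝ ℝ, μ] N) (0 : G →L[ℝ] ℝ) x := by
    intro i x hx
    have h1 := (φ i).hasCompactSupport_normed (μ := μ) |>.hasFDerivAt_convolution_left
      (ContinuousLinearMap.lsmul ℝ ℝ) ((φ i).contDiff_normed (n := 1)) hN x
    refine h1.congr_fderiv ?_
    have hcs : HasCompactSupport (fderiv ℝ ((φ i).normed μ)) :=
      ((φ i).hasCompactSupport_normed (μ := μ)).fderiv ℝ
    have hex : ConvolutionExistsAt (fderiv ℝ ((φ i).normed μ)) N x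
        ((ContinuousLinearMap.lsmul ℝ ℝ).precompL G) μ :=
      hcs.convolutionExists_left _
        (((φ i).contDiff_normed (n := 1)).continuous_fderiv (by simp)) hN x
    ext v
    rw [convolution_def, ContinuousLinearMap.integral_apply hex.integrable]
    simp only [ContinuousLinearMap.precompL_apply, ContinuousLinearMap.lsmul_apply, smul_eq_mul,
      zero_apply]
    rw [← integral_sub_left_eq_self _ μ x]
    have hg : ContDiff ℝ ∞ fun t => (φ i).normed μ (x - t) :=
      (φ i).contDiff_normed.comp (contDiff_const.sub contDiff_id)
    have hsupp : tsupport (fun t => (φ i).normed μ (x - t)) ⊆ Metric.closedBall x (u i) := by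
      refine closure_minimal (fun t ht => ?_) Metric.isClosed_closedBall
      have : x - t ∈ Function.support ((φ i).normed μ) := ht
      rw [(φ i).support_normed_eq, mem_ball_zero_iff] at this
      rw [Metric.mem_closedBall, dist_comm, dist_eq_norm]
      exact this.le
    have h2 := h _ hg (HasCompactSupport.intro' (isCompact_closedBall x (u i))
      Metric.isClosed_closedBall fun t ht => by
        by_contra hne
        exact ht (hsupp (subset_tsupport _ hne))) (hsupp.trans fun t ht => by
        rw [mem_ball_zero_iff] at hx ⊢
        rw [mem_closedBall_iff_norm] at ht
        linarith [norm_sub_norm_le t x]) (-v)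
    rw [← h2]
    refine integral_congr_ae (Eventually.of_forall fun t => ?_)
    have hf : fderiv ℝ (fun t => (φ i).normed μ (x - t)) t = -fderiv ℝ ((φ i).normed μ) (x - t) := by
      have hd : HasFDerivAt ((φ i).normed μ) (fderiv ℝ ((φ i).normed μ) (x - t)) (x - t) :=
        ((φ i).contDiff_normed (n := 1)).differentiable (by simp) _ |>.hasFDerivAt
      have h3 : HasFDerivAt (fun t => (φ i).normed μ (x - t)) _ t :=
        hd.comp t ((hasFDerivAt_id t).const_sub x)
      rw [h3.fderiv]
      ext
      simp
    simp [hf, mul_comm]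
  have hconst : ∀ i, ∀ x ∈ Metric.ball (0 : G) (s - u i), ∀ y ∈ Metric.ball (0 : G) (s - u i),
      ((φ i).normed μ ⋆[ContinuousLinearMap.lsmul ℝ ℝ, μ] N) x
        = ((φ i).normed μ ⋆[ContinuousLinearMap.lsmul ℝ ℝ, μ] N) y := by
    intro i x hx y hy
    refine (convex_ball (0 : G) (s - u i)).is_const_of_fderivWithin_eq_zero (𝕜 := ℝ)
      (fun z hz => (hderiv i z hz).differentiableAt.differentiableWithinAt) (fun z hz => ?_) hx hy
    rw [fderivWithin_of_isOpen Metric.isOpen_ball hz, (hderiv i z hz).fderiv]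
  have hev : ∀ x ∈ Metric.ball (0 : G) s, ∀ᶠ i in atTop, x ∈ Metric.ball (0 : G) (s - u i) := by
    intro x hx
    rw [mem_ball_zero_iff] at hx
    filter_upwards [hu.eventually (gt_mem_nhds (sub_pos.2 hx))] with i hi
    rw [mem_ball_zero_iff]
    linarith
  have hne : μ.restrict (Metric.ball (0 : G) s) ≠ 0 := by
    rw [Ne, Measure.restrict_eq_zero]
    exact (Metric.measure_ball_pos μ _ hs).ne'
  have : NeBot (ae (μ.restrict (Metric.ball (0 : G) s))) := ae_neBot.2 hne
  obtain ⟨x₀, hx₀, hx₀s⟩ := ((ae_restrict_of_ae (s := Metric.ball (0 : G) s) hlim).and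
    (ae_restrict_mem Metric.isOpen_ball.measurableSet)).exists
  refine ⟨x₀, hx₀s, ?_⟩
  -- The mollified functions converge almost everywhere to `N` and, from some index on, take equal
  -- values at any two points of the ball.
  filter_upwards [hlim] with x hx hxs
  refine tendsto_nhds_unique hx (hx₀.congr' ?_)
  filter_upwards [hev x hxs, hev x₀ hx₀s] with i h1 h2
  exact hconst i _ h2 _ h1

end Constancy

/-! ### The signed area formula and integer densities -/

section Area

variable {F : Type*} [NormedAddCommGroup F] [NormedSpace ℝ F] [FiniteDimensional ℝ F]
  [MeasurableSpace F] [BorelSpace F] {μ : Measure F} [μ.IsAddHaarMeasure]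

/-- On countably many pieces `f` is close to an invertible linear map, with an error smaller than
the inverse norm of its inverse; such a map is injective. -/
theorem exists_partition_injOn {f : F → F} {E : Set F} (hf : ∀ x ∈ E, DifferentiableAt ℝ f x)
    (hdet : ∀ x ∈ E, (fderiv ℝ f x).det ≠ 0) :
    ∃ t : ℕ → Set F, Pairwise (Function.onFun Disjoint t) ∧ (∀ i, MeasurableSet (t i)) ∧
      E ⊆ ⋃ i, t i ∧ ∀ i, InjOn f (E ∩ t i) := by
  classical
  rcases E.eq_empty_or_nonempty with rfl | hne
  · exact ⟨fun _ => ∅, fun _ _ _ => disjoint_bot_left, fun _ => MeasurableSet.empty, by simp, by simp⟩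
  -- The tolerance must be positive for every linear map, so the degenerate cases get the value `1`.
  -- The pieces only use invertible derivatives at points of `E`.
  let r : (F →L[ℝ] F) → NNReal := fun A =>
    if h : A.det ≠ 0 then
      if Subsingleton F then 1 else
        (‖((A.toContinuousLinearEquivOfDetNeZero h).symm : F →L[ℝ] F)‖₊)⁻¹ / 2 else 1
  have hr : ∀ (A : F →L[ℝ] F) (h : A.det ≠ 0), ¬ Subsingleton F →
      0 < ‖((A.toContinuousLinearEquivOfDetNeZero h).symm : F →L[ℝ] F)‖₊ := by
    intro A h hF
    rcases (A.toContinuousLinearEquivOfDetNeZero h).subsingleton_or_nnnorm_symm_pos with h' | h'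
    · exact absurd h' hF
    · exact h'
  have hr0 : ∀ A, r A ≠ 0 := by
    intro A
    by_cases h : A.det ≠ 0
    · by_cases hF : Subsingleton F
      · simp [r, hF]
      · have := hr A h hF
        simp only [r, h, hF, dif_pos, if_false, not_false_eq_true, ne_eq]
        positivity
    · have h' : A.det = 0 := not_not.1 h
      simp [r, h']
  obtain ⟨t, A, h1, h2, h3, h4, h5⟩ := exists_partition_approximatesLinearOn_of_hasFDerivWithinAt f E
    (fderiv ℝ f) (fun x hx => (hf x hx).hasFDerivAt.hasFDerivWithinAt) r hr0
  refine ⟨t, h1, h2, h3, fun i => ?_⟩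
  obtain ⟨y, hy, hAy⟩ := h5 hne i
  have hA : (A i).det ≠ 0 := by rw [hAy]; exact hdet y hy
  have h6 := h4 i
  by_cases hF : Subsingleton F
  · exact fun x _ y _ _ => Subsingleton.elim _ _
  · have h7 : ApproximatesLinearOn f
        (((A i).toContinuousLinearEquivOfDetNeZero hA : F ≃L[ℝ] F) : F →L[ℝ] F) (E ∩ t i) (r (A i)) := by
      simpa using h6
    refine h7.injOn (Or.inr ?_)
    simp only [r, hA, hF, dif_pos, if_false, not_false_eq_true, ne_eq]
    exact half_lt_self (inv_pos.2 (hr _ hA hF))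

/-- The signed area formula, in terms of countably many sets with signs. -/
theorem exists_area_decomposition {f : F → F} {E : Set F} (hE : MeasurableSet E)
    (hf : ∀ x ∈ E, DifferentiableAt ℝ f x) :
    ∃ (B : ℤˣ × ℕ → Set F), (∀ l, MeasurableSet (B l)) ∧ (∀ l, B l ⊆ f '' E) ∧
      ∑' l, μ (B l) ≤ ∫⁻ x in E, ‖(fderiv ℝ f x).det‖ₑ ∂μ ∧
      ∀ h : F → ℝ, IntegrableOn (fun x => h (f x) * (fderiv ℝ f x).det) E μ →
        ∫ x in E, h (f x) * (fderiv ℝ f x).det ∂μ = ∑' l, ((l.1 : ℤ) : ℝ) * ∫ y in B l, h y ∂μ := by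
  have hdetm : Measurable fun x => (fderiv ℝ f x).det :=
    ContinuousLinearMap.continuous_det.measurable.comp (measurable_fderiv ℝ f)
  -- The parts where the determinant has sign `σ`. The remaining part, with zero determinant,
  -- contributes nothing to the integral.
  let Eσ : ℤˣ → Set F := fun σ => E ∩ {x | 0 < ((σ : ℤ) : ℝ) * (fderiv ℝ f x).det}
  have hEσ : ∀ σ, MeasurableSet (Eσ σ) := fun σ =>
    hE.inter (measurableSet_lt measurable_const (hdetm.const_mul _))
  have hpart := fun σ => exists_partition_injOn (f := f) (E := Eσ σ) (fun x hx => hf x hx.1)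
    (fun x hx h0 => by simpa [h0] using hx.2)
  choose t ht1 ht2 ht3 ht4 using hpart
  let p : ℤˣ × ℕ → Set F := fun l => Eσ l.1 ∩ t l.1 l.2
  have hp : ∀ l, MeasurableSet (p l) := fun l => (hEσ _).inter (ht2 _ _)
  have hdisj : Pairwise (Function.onFun Disjoint p) := by
    rintro ⟨σ, i⟩ ⟨τ, j⟩ hne
    refine Set.disjoint_left.2 fun x hx hx' => ?_
    have hστ : σ = τ := by
      have h1 := hx.1.2
      have h2 := hx'.1.2
      simp only [mem_ofPred_eq] at h1 h2
      rcases Int.units_eq_one_or σ with rfl | rfl <;> rcases Int.units_eq_one_or τ with rfl | rfl <;>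
        first | rfl | (exfalso; simp at h1 h2; linarith)
    subst hστ
    have hij : i ≠ j := fun h => hne (by rw [h])
    exact Set.disjoint_left.1 (ht1 σ hij) hx.2 hx'.2
  have hsub : (⋃ l, p l) ⊆ E := iUnion_subset fun l x hx => hx.1.1
  have hd' : ∀ l, ∀ x ∈ p l, HasFDerivWithinAt f (fderiv ℝ f x) (p l) x := fun l x hx =>
    (hf x hx.1.1).hasFDerivAt.hasFDerivWithinAt
  refine ⟨fun l => f '' p l, fun l => measurable_image_of_fderivWithin (hp l) (hd' l) (ht4 _ _),
    fun l => image_mono fun x hx => hx.1.1, ?_, fun h hint => ?_⟩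
  · calc ∑' l, μ (f '' p l) = ∑' l, ∫⁻ x in p l, ‖(fderiv ℝ f x).det‖ₑ ∂μ := by
          refine tsum_congr fun l => ?_
          rw [← lintegral_abs_det_fderiv_eq_addHaar_image μ (hp l) (hd' l) (ht4 _ _)]
          simp [Real.enorm_eq_ofReal_abs]
      _ = ∫⁻ x in ⋃ l, p l, ‖(fderiv ℝ f x).det‖ₑ ∂μ := (lintegral_iUnion hp hdisj _).symm
      _ ≤ _ := lintegral_mono_set hsub
  · rw [setIntegral_eq_of_subset_of_forall_sdiff_eq_zero hE hsub, integral_iUnion hp hdisj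
      (hint.mono_set hsub)]
    · refine tsum_congr fun l => ?_
      rw [integral_image_eq_integral_abs_det_fderiv_smul μ (hp l) (hd' l) (ht4 _ _),
        ← integral_const_mul]
      refine setIntegral_congr_fun (hp l) fun x hx => ?_
      have h1 := hx.1.2
      simp only [mem_ofPred_eq] at h1
      simp only [smul_eq_mul]
      rcases Int.units_eq_one_or l.1 with h2 | h2 <;> rw [h2] at h1 ⊢ <;> simp at h1 ⊢
      · rw [abs_of_pos h1, mul_comm]
      · rw [abs_of_neg h1]; ring
    · rintro x ⟨hxE, hx⟩
      have : (fderiv ℝ f x).det = 0 := by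
        by_contra h0
        refine hx ?_
        obtain ⟨σ, hσ⟩ : ∃ σ : ℤˣ, 0 < ((σ : ℤ) : ℝ) * (fderiv ℝ f x).det := by
          rcases lt_or_gt_of_ne h0 with h0 | h0
          · exact ⟨-1, by simpa using h0⟩
          · exact ⟨1, by simpa using h0⟩
        obtain ⟨i, hi⟩ := mem_iUnion.1 (ht3 σ ⟨hxE, hσ⟩)
        exact mem_iUnion.2 ⟨(σ, i), ⟨hxE, hσ⟩, hi⟩
      rw [this, mul_zero]

/-- The finite partial sums are integers, and the integers are closed in `ℝ`. -/
theorem exists_int_eq_tsum {ι : Type*} {z : ι → ℤ} (h : Summable fun i => (z i : ℝ)) :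
    ∃ m : ℤ, ∑' i, (z i : ℝ) = m := by
  have h1 : ∑' i, (z i : ℝ) ∈ range (Int.cast : ℤ → ℝ) := by
    refine Int.isClosedEmbedding_coe_real.isClosed_range.mem_of_tendsto h.hasSum
      (Eventually.of_forall fun s => ⟨∑ i ∈ s, z i, by simp⟩)
  obtain ⟨m, hm⟩ := h1
  exact ⟨m, hm.symm⟩

end Area

section IntegerDensity

variable {F : Type*} [MeasurableSpace F] {μ : Measure F}

/-- A sum of integer multiples of indicator functions with finite total mass. -/
theorem exists_integer_density {ι : Type*} [Countable ι] {B : ι → Set F}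
    (hB : ∀ l, MeasurableSet (B l)) {c : ι → ℤ} (hfin : ∑' l, ‖(c l : ℝ)‖ₑ * μ (B l) ≠ ⊤) :
    ∃ N : F → ℝ, Integrable N μ ∧ (∀ᵐ x ∂μ, ∃ m : ℤ, N x = m) ∧
      ∀ (h : F → ℝ) (C : ℝ), Measurable h → (∀ l, ∀ x ∈ B l, |h x| ≤ C) →
        Summable (fun l => (c l : ℝ) * ∫ x in B l, h x ∂μ) ∧
        ∑' l, (c l : ℝ) * ∫ x in B l, h x ∂μ = ∫ x, N x * h x ∂μ := by
  classical
  let z : ι → F → ℤ := fun l => (B l).indicator fun _ => c l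
  let N : F → ℝ := fun x => ∑' l, (z l x : ℝ)
  have hz : ∀ l x, (z l x : ℝ) = (B l).indicator (fun _ => (c l : ℝ)) x := by
    intro l x
    by_cases hx : x ∈ B l <;> simp [z, hx]
  have hm : ∀ l, Measurable fun x => (z l x : ℝ) := by
    intro l
    simp only [hz]
    exact measurable_const.indicator (hB l)
  have hlint : ∀ l, ∫⁻ x, ‖(z l x : ℝ)‖ₑ ∂μ = ‖(c l : ℝ)‖ₑ * μ (B l) := by
    intro l
    simp only [hz, enorm_indicator_eq_indicator_enorm]
    rw [lintegral_indicator_const (hB l)]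
  have htot : ∫⁻ x, ∑' l, ‖(z l x : ℝ)‖ₑ ∂μ ≠ ⊤ := by
    rw [lintegral_tsum fun l => (hm l).enorm.aemeasurable]
    simpa only [hlint] using hfin
  have hsum : ∀ᵐ x ∂μ, Summable fun l => (z l x : ℝ) := by
    filter_upwards [ae_lt_top' (AEMeasurable.tsum fun l => (hm l).enorm.aemeasurable) htot]
      with x hx
    exact Summable.of_enorm hx.ne
  have hsum' : ∀ᵐ x ∂μ, HasSum (fun l => (z l x : ℝ)) (N x) := hsum.mono fun x hx => hx.hasSum
  have hNm : AEStronglyMeasurable N μ :=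
    (Measurable.tsum hm).aestronglyMeasurable
  have hN : Integrable N μ := by
    refine ⟨hNm, lt_of_le_of_lt (lintegral_mono fun x => ?_) (lt_top_iff_ne_top.2 htot)⟩
    exact enorm_tsum_le_tsum_enorm
  refine ⟨N, hN, hsum.mono fun x hx => exists_int_eq_tsum hx, fun h C hh hC => ?_⟩
  have hterm : ∀ l, (c l : ℝ) * ∫ x in B l, h x ∂μ = ∫ x, (z l x : ℝ) * h x ∂μ := by
    intro l
    rw [← integral_const_mul, ← integral_indicator (hB l)]
    refine integral_congr_ae (Eventually.of_forall fun x => ?_)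
    by_cases hx : x ∈ B l <;> simp [hz, hx]
  have hbd : ∀ l, ∫⁻ x, ‖(z l x : ℝ) * h x‖ₑ ∂μ ≤ ENNReal.ofReal C * (‖(c l : ℝ)‖ₑ * μ (B l)) := by
    intro l
    rw [← hlint, ← lintegral_const_mul' _ _ ENNReal.ofReal_ne_top]
    refine lintegral_mono fun x => ?_
    by_cases hx : x ∈ B l
    · rw [enorm_mul, mul_comm, Real.enorm_eq_ofReal_abs (h x)]
      gcongr
      exact hC l x hx
    · simp [z, hx]
  have hfin' : ∑' l, ∫⁻ x, ‖(z l x : ℝ) * h x‖ₑ ∂μ ≠ ⊤ := by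
    refine ne_top_of_le_ne_top ?_ (ENNReal.tsum_le_tsum hbd)
    rw [ENNReal.tsum_mul_left]
    exact ENNReal.mul_ne_top ENNReal.ofReal_ne_top hfin
  have hmeas : ∀ l, AEStronglyMeasurable (fun x => (z l x : ℝ) * h x) μ := fun l =>
    ((hm l).mul hh).aestronglyMeasurable
  simp only [hterm]
  refine ⟨Summable.of_enorm (ne_top_of_le_ne_top hfin'
    (ENNReal.tsum_le_tsum fun l => enorm_integral_le_lintegral_enorm _)), ?_⟩
  rw [← integral_tsum hmeas hfin']
  refine integral_congr_ae ?_
  filter_upwards [hsum'] with x hx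
  exact (hx.mul_right (h x)).tsum_eq

end IntegerDensity

/-! ### The constancy theorem for chains of top dimension in Euclidean space -/

section Chain

variable {n k : ℕ} {M : Type*} [TopologicalSpace M] [ChartedSpace (EuclideanSpace ℝ (Fin n)) M]

theorem clm_det_eq_matrix_det {k : ℕ} (L : (Fin k → ℝ) →L[ℝ] (Fin k → ℝ)) :
    L.det = (Matrix.of fun a b : Fin k => L (Pi.single b 1) a).det := by
  rw [ContinuousLinearMap.det, ← LinearMap.det_toMatrix']
  congr 1

theorem jac_comp {π : Fin k → TestFn n M} {θ : (Fin k → ℝ) → M} {ψ : (Fin k → ℝ) → Fin k → ℝ}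
    {x : Fin k → ℝ} (hθ : ∀ a, DifferentiableAt ℝ (fun y => π a (θ y)) (ψ x))
    (hψ : DifferentiableAt ℝ ψ x) :
    jac π (fun y => θ (ψ y)) x = jac π θ (ψ x) * (fderiv ℝ ψ x).det := by
  rw [clm_det_eq_matrix_det, jac, jac, ← Matrix.det_mul]
  congr 1
  ext a b
  have h1 := (hθ a).hasFDerivAt.comp x hψ.hasFDerivAt
  simp only [Matrix.of_apply, Matrix.mul_apply]
  change fderiv ℝ ((fun y => π a (θ y)) ∘ ψ) x _ = _
  rw [h1.fderiv, ContinuousLinearMap.comp_apply]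
  conv_lhs => rw [← Finset.univ_sum_single (fderiv ℝ ψ x (Pi.single b 1)), map_sum]
  refine Finset.sum_congr rfl fun c _ => ?_
  have h2 : (Pi.single c (fderiv ℝ ψ x (Pi.single b 1) c) : Fin k → ℝ)
      = fderiv ℝ ψ x (Pi.single b 1) c • Pi.single c 1 := by
    rw [← Pi.single_smul', smul_eq_mul, mul_one]
  rw [h2, map_smul, smul_eq_mul, mul_comm]

end Chain

section Top

variable {n : ℕ}

local notation "𝔼" => EuclideanSpace ℝ (Fin n)

theorem contDiff_toLp : ContDiff ℝ ∞ (WithLp.toLp 2 : (Fin n → ℝ) → 𝔼) :=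
  (EuclideanSpace.equiv (Fin n) ℝ).symm.contDiff

theorem contDiff_ofLp : ContDiff ℝ ∞ (WithLp.ofLp : 𝔼 → Fin n → ℝ) :=
  (EuclideanSpace.equiv (Fin n) ℝ).contDiff

theorem jac_coordFn {φ : (Fin n → ℝ) → 𝔼} {x : Fin n → ℝ} (hφ : DifferentiableAt ℝ φ x) :
    jac coordFn φ x = (fderiv ℝ (fun y => WithLp.ofLp (φ y)) x).det := by
  rw [clm_det_eq_matrix_det, jac]
  congr 1
  ext a b
  have h1 : DifferentiableAt ℝ (fun y => WithLp.ofLp (φ y)) x :=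
    (contDiff_ofLp.differentiable (by simp)).differentiableAt.comp x hφ
  simp only [Matrix.of_apply]
  have h2 := (ContinuousLinearMap.proj (R := ℝ) (φ := fun _ : Fin n => ℝ) a).hasFDerivAt.comp x
    h1.hasFDerivAt
  exact congrArg (fun L => L (Pi.single b 1)) h2.fderiv

theorem differentiable_comp_toLp (g : TestFn n 𝔼) :
    Differentiable ℝ fun y : Fin n → ℝ => g (WithLp.toLp 2 y) :=
  ((TestFn.contDiff g).comp contDiff_toLp).differentiable (by simp)

theorem continuous_jac_toLp (π : Fin n → TestFn n 𝔼) :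
    Continuous (jac π (WithLp.toLp 2 : (Fin n → ℝ) → 𝔼)) := by
  refine Continuous.matrix_det (continuous_matrix fun a b => ?_)
  exact (((TestFn.contDiff (π a)).comp contDiff_toLp).continuous_fderiv (by simp)).clm_apply
    continuous_const

theorem fderiv_comp_toLp (u : TestFn n 𝔼) (x : Fin n → ℝ) (b : Fin n) :
    fderiv ℝ (fun y : Fin n → ℝ => u (WithLp.toLp 2 y)) x (Pi.single b 1)
      = fderiv ℝ u (WithLp.toLp 2 x) (EuclideanSpace.single b 1) := by
  have h := ((TestFn.contDiff u).differentiable (by simp) (WithLp.toLp 2 x)).hasFDerivAt.comp x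
    ((EuclideanSpace.equiv (Fin n) ℝ).symm : (Fin n → ℝ) →L[ℝ] 𝔼).hasFDerivAt
  exact congrArg (fun L => L (Pi.single b 1)) h.fderiv

/-- With all coordinates but one left in place, the form `dπ` is a single partial derivative of `g`
times the volume form. Testing with such tuples turns the absence of boundary into vanishing
distributional derivatives of the density. -/
theorem jac_update_coordFn (g : TestFn n 𝔼) (c : Fin n) (x : Fin n → ℝ) :
    jac (Function.update coordFn c g) (WithLp.toLp 2 : (Fin n → ℝ) → 𝔼) x
      = fderiv ℝ g (WithLp.toLp 2 x) (EuclideanSpace.single c 1) := by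
  have hmat : (Matrix.of fun a b : Fin n => fderiv ℝ
      (fun y : Fin n → ℝ => Function.update coordFn c g a (WithLp.toLp 2 y)) x (Pi.single b 1))
      = (1 : Matrix (Fin n) (Fin n) ℝ).updateRow c (∑ b,
        (fderiv ℝ g (WithLp.toLp 2 x) (EuclideanSpace.single b 1)) • (1 : Matrix _ _ ℝ) b) := by
    ext a b
    simp only [Matrix.of_apply]
    rw [fderiv_comp_toLp]
    by_cases hac : a = c
    · subst hac
      rw [Matrix.updateRow_self, Function.update_self, Finset.sum_apply,
        Finset.sum_eq_single b (fun i _ hi => by simp [hi]) (by simp)]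
      simp
    · rw [Matrix.updateRow_ne hac, Function.update_of_ne hac]
      change fderiv ℝ (EuclideanSpace.proj a : 𝔼 →L[ℝ] ℝ) _ _ = _
      rw [ContinuousLinearMap.fderiv]
      simp [Matrix.one_apply]
  rw [jac, hmat, Matrix.det_updateRow_sum]
  simp

namespace RectData

/-- The current of a top-dimensional chain in `ℝⁿ` is given by an integer-valued density. -/
theorem exists_density (P : RectData n 𝔼 n) :
    ∃ N : (Fin n → ℝ) → ℝ, Integrable N ∧ (∀ᵐ x, ∃ m : ℤ, N x = m) ∧
      ∀ (B : Set 𝔼) (hB : MeasurableSet[borel 𝔼] B) f π, (P.restrict B hB).current f π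
        = ∫ x in WithLp.toLp 2 ⁻¹' B,
          N x * (f (WithLp.toLp 2 x) * jac π (WithLp.toLp 2 : (Fin n → ℝ) → 𝔼) x) := by
  let ψ : P.ι → (Fin n → ℝ) → Fin n → ℝ := fun j x => WithLp.ofLp (P.φ j x)
  have hφ : ∀ j, ∀ x ∈ P.E j, DifferentiableAt ℝ (P.φ j) x := fun j x hx =>
    P.differentiableAt_φ (P.E_subset j hx)
  have hψ : ∀ j, ∀ x ∈ P.E j, DifferentiableAt ℝ (ψ j) x := fun j x hx =>
    (contDiff_ofLp.differentiable (by simp)).differentiableAt.comp x (hφ j x hx)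
  choose B hB1 hB2 hB3 hB4 using fun j =>
    exists_area_decomposition (μ := volume) (P.measurableSet_E j) (hψ j)
  -- The density is a sum over the parametrized pieces and their injective signed parts, with
  -- multiplicity times sign on each image. Finite mass is tested on the coordinate functions, whose
  -- Jacobian is the determinant in the area formula.
  have hfin : ∑' l : P.ι × (ℤˣ × ℕ), ‖((P.m l.1 * l.2.1 : ℤ) : ℝ)‖ₑ * volume (B l.1 l.2) ≠ ⊤ := by
    have h1 : ∀ l : P.ι × (ℤˣ × ℕ), ‖((P.m l.1 * l.2.1 : ℤ) : ℝ)‖ₑ = ‖(P.m l.1 : ℝ)‖ₑ := by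
      intro l
      rcases Int.units_eq_one_or l.2.1 with h | h <;> simp [h]
    simp only [h1]
    rw [ENNReal.tsum_prod']
    simp only [ENNReal.tsum_mul_left]
    refine ne_top_of_le_ne_top (P.mass_finite coordFn) (ENNReal.tsum_le_tsum fun j => ?_)
    refine (mul_le_mul_right (hB3 j) _).trans ?_
    rw [← lintegral_const_mul' _ _ enorm_ne_top]
    refine (setLIntegral_congr_fun (P.measurableSet_E j) fun x hx => ?_).le
    rw [jac_coordFn (hφ j x hx), enorm_mul]
  obtain ⟨N, hN, hNint, hNh⟩ := exists_integer_density (μ := volume)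
    (fun l : P.ι × (ℤˣ × ℕ) => hB1 l.1 l.2) hfin
  refine ⟨N, hN, hNint, fun B' hB' f π => ?_⟩
  have hB'm : MeasurableSet (WithLp.toLp 2 ⁻¹' B' : Set (Fin n → ℝ)) := by
    rw [← BorelSpace.measurable_eq (α := 𝔼)] at hB'
    exact contDiff_toLp.continuous.measurable hB'
  set h₀ : (Fin n → ℝ) → ℝ := fun x =>
    f (WithLp.toLp 2 x) * jac π (WithLp.toLp 2 : (Fin n → ℝ) → 𝔼) x with hh₀
  set h : (Fin n → ℝ) → ℝ := (WithLp.toLp 2 ⁻¹' B').indicator h₀ with hh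
  have hcont : Continuous h₀ :=
    ((TestFn.contDiff f).continuous.comp contDiff_toLp.continuous).mul (continuous_jac_toLp π)
  obtain ⟨C, hC⟩ := (P.isCompact_K.image (contDiff_ofLp (n := n)).continuous).exists_bound_of_continuousOn
    hcont.continuousOn
  obtain ⟨hs, ht⟩ := hNh h C (hcont.measurable.indicator hB'm) (fun l x hx => by
    obtain ⟨y, hy, rfl⟩ := hB2 l.1 l.2 hx
    exact (norm_indicator_le_norm_self _ _).trans (hC _ ⟨_, P.mapsTo l.1 hy, rfl⟩))
  have hind : ∫ x in WithLp.toLp 2 ⁻¹' B', N x * h₀ x = ∫ x, N x * h x := by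
    rw [← integral_indicator hB'm]
    refine integral_congr_ae (Eventually.of_forall fun x => ?_)
    by_cases hx : x ∈ (WithLp.toLp 2 ⁻¹' B' : Set (Fin n → ℝ)) <;> simp [hh, hx]
  rw [hind, ← ht, hs.tsum_prod]
  refine tsum_congr fun (j : P.ι) => ?_
  have hjac : ∀ x ∈ P.E j, (P.φ j ⁻¹' B').indicator (fun x => f (P.φ j x) * jac π (P.φ j) x) x
      = h (ψ j x) * (fderiv ℝ (ψ j) x).det := by
    intro x hx
    have h1 := jac_comp (π := π) (θ := (WithLp.toLp 2 : (Fin n → ℝ) → 𝔼)) (ψ := ψ j) (x := x)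
      (fun a => differentiable_comp_toLp _ _) (hψ j x hx)
    by_cases hxB : P.φ j x ∈ B'
    · have hxB' : ψ j x ∈ (WithLp.toLp 2 ⁻¹' B' : Set (Fin n → ℝ)) := hxB
      have hxB'' : x ∈ P.φ j ⁻¹' B' := hxB
      rw [hh, indicator_of_mem hxB', indicator_of_mem hxB'', hh₀, mul_assoc, ← h1]
    · have hxB' : ψ j x ∉ (WithLp.toLp 2 ⁻¹' B' : Set (Fin n → ℝ)) := hxB
      have hxB'' : x ∉ P.φ j ⁻¹' B' := hxB
      rw [hh, indicator_of_notMem hxB', indicator_of_notMem hxB'', zero_mul]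
  have hpiece := P.measurableSet_inter_preimage j hB'
  have hrestr : ∀ c : ℝ, ∫ x in P.E j ∩ P.φ j ⁻¹' B', c * (f (P.φ j x) * jac π (P.φ j) x)
      = ∫ x in P.E j, c * (h (ψ j x) * (fderiv ℝ (ψ j) x).det) := by
    intro c
    rw [setIntegral_eq_of_subset_of_forall_sdiff_eq_zero (P.measurableSet_E j)
      (s := P.E j ∩ P.φ j ⁻¹' B') inter_subset_left]
    · refine setIntegral_congr_fun hpiece fun x hx => ?_
      rw [← hjac x hx.1, indicator_of_mem hx.2]
    · intro x hx
      rw [← hjac x hx.1, indicator_of_notMem fun h => hx.2 ⟨hx.1, h⟩, mul_zero]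
  -- Finiteness of mass controls the integrand only after multiplication by `m j`. For `m j = 0`
  -- both sides vanish; otherwise one may divide.
  rcases eq_or_ne (P.m j) 0 with hm | hm
  · have : (P.restrict B' hB').m j = 0 := hm
    simp [hm, this]
  have hint : IntegrableOn (fun x => h (ψ j x) * (fderiv ℝ (ψ j) x).det) (P.E j) := by
    have h1 := (P.integrableOn j f π).const_mul ((P.m j : ℝ)⁻¹)
    have h2 : IntegrableOn (fun x => f (P.φ j x) * jac π (P.φ j) x) (P.E j) := by
      refine IntegrableOn.congr_fun h1 (fun x hx => ?_) (P.measurableSet_E j)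
      have : (P.m j : ℝ) ≠ 0 := by exact_mod_cast hm
      rw [inv_mul_cancel_left₀ this]
    refine IntegrableOn.congr_fun (Integrable.indicator h2 hpiece)
      (fun x hx => ?_) (P.measurableSet_E j)
    rw [← hjac x hx]
    by_cases hxB : x ∈ P.φ j ⁻¹' B'
    · rw [indicator_of_mem hxB, indicator_of_mem (show x ∈ P.E j ∩ P.φ j ⁻¹' B' from ⟨hx, hxB⟩)]
    · rw [indicator_of_notMem hxB,
        indicator_of_notMem (show x ∉ P.E j ∩ P.φ j ⁻¹' B' from fun h => hxB h.2)]
  refine (hrestr (P.m j)).trans ?_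
  rw [integral_const_mul, hB4 j h hint, ← tsum_mul_left]
  refine tsum_congr fun l => ?_
  push_cast
  ring

/-- The constancy theorem with integer multiplicity. -/
theorem exists_multiplicity (P : RectData n 𝔼 n) {s : ℝ} (hs : 0 < s)
    (hcyc : ∀ π : Fin n → TestFn n 𝔼, ∀ a, tsupport (π a) ⊆ Metric.ball 0 s → P.current 1 π = 0) :
    ∃ m : ℤ, ∀ (B : Set 𝔼) (hB : MeasurableSet[borel 𝔼] B), B ⊆ Metric.ball 0 s → ∀ f π,
      (P.restrict B hB).current f π = m * ∫ x in WithLp.toLp 2 ⁻¹' B,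
        f (WithLp.toLp 2 x) * jac π (WithLp.toLp 2 : (Fin n → ℝ) → 𝔼) x := by
  obtain ⟨N, hN, hNint, hPB⟩ := P.exists_density
  have hP : ∀ f π, P.current f π
      = ∫ x, N x * (f (WithLp.toLp 2 x) * jac π (WithLp.toLp 2 : (Fin n → ℝ) → 𝔼) x) := by
    intro f π
    have huniv := measurableSet_borel_of_isOpen (isOpen_univ (X := 𝔼))
    rw [← P.current_restrict_of_forall huniv
      (measurableSet_borel_of_isOpen (by simp)) (fun j x _ h => absurd (mem_univ _) h), hPB]
    simp
  have hmp := PiLp.volume_preserving_ofLp (Fin n)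
  have hemb : MeasurableEmbedding (WithLp.ofLp : 𝔼 → Fin n → ℝ) :=
    (MeasurableEquiv.toLp 2 (Fin n → ℝ)).symm.measurableEmbedding
  have hN' : Integrable (fun y : 𝔼 => N (WithLp.ofLp y)) volume :=
    (hmp.integrable_comp_emb hemb).2 hN
  have htr : ∀ h : 𝔼 → ℝ, ∫ y : 𝔼, N (WithLp.ofLp y) * h y = ∫ x, N x * h (WithLp.toLp 2 x) := by
    intro h
    rw [← hmp.integral_comp hemb]
  -- The directions of the standard basis are handled by `jac_update_coordFn`; a general direction
  -- `v` follows by linearity.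
  obtain ⟨x₀, hx₀, hconst⟩ := ae_eq_const_of_integral_fderiv_eq_zero hN'.locallyIntegrable hs
    (fun g hg hgc hgs v => by
      have hbasis : ∀ c, ∫ y : 𝔼, N (WithLp.ofLp y) * fderiv ℝ g y (EuclideanSpace.single c 1) = 0 := by
        intro c
        obtain ⟨G, hG⟩ : ∃ G : TestFn n 𝔼, ⇑G = g := ⟨⟨g, hg.contMDiff⟩, rfl⟩
        have h1 := hcyc (Function.update coordFn c G) c (by rwa [Function.update_self, hG])
        rw [hP] at h1
        rw [htr, ← h1]
        refine integral_congr_ae (Eventually.of_forall fun x => ?_)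
        change _ = N x * (1 * _)
        rw [jac_update_coordFn, hG, one_mul]
      have hint : ∀ c, Integrable (fun y : 𝔼 =>
          N (WithLp.ofLp y) * fderiv ℝ g y (EuclideanSpace.single c 1) * v c) volume := by
        intro c
        refine Integrable.mul_const ?_ _
        have hc : Continuous fun y : 𝔼 => fderiv ℝ g y (EuclideanSpace.single c 1) :=
          (hg.continuous_fderiv (by simp)).clm_apply continuous_const
        have hcs : HasCompactSupport fun y : 𝔼 => fderiv ℝ g y (EuclideanSpace.single c 1) :=
          hgc.fderiv_apply ℝ _
        obtain ⟨C, hC⟩ := hcs.exists_bound_of_continuous hc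
        exact hN'.mul_bdd (c := C) hc.aestronglyMeasurable (Eventually.of_forall hC)
      calc _ = ∫ y : 𝔼, ∑ c, N (WithLp.ofLp y) * fderiv ℝ g y (EuclideanSpace.single c 1) * v c := by
            refine integral_congr_ae (Eventually.of_forall fun y => ?_)
            simp only
            rw [clm_apply_eq_sum, Finset.mul_sum]
            simp only [mul_assoc]
        _ = 0 := by
            rw [integral_finsetSum _ fun c _ => hint c]
            refine Finset.sum_eq_zero fun c _ => ?_
            rw [integral_mul_const, hbasis, zero_mul])
  have hint' : ∀ᵐ y : 𝔼, ∃ m : ℤ, N (WithLp.ofLp y) = m :=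
    hmp.quasiMeasurePreserving.ae hNint
  have hne : (volume : Measure 𝔼).restrict (Metric.ball (0 : 𝔼) s) ≠ 0 := by
    rw [Ne, Measure.restrict_eq_zero]
    exact (Metric.measure_ball_pos volume _ hs).ne'
  have : NeBot (ae ((volume : Measure 𝔼).restrict (Metric.ball (0 : 𝔼) s))) := ae_neBot.2 hne
  -- The ball has positive measure, so at some point the density is both an integer and equal to the
  -- constant; the constant is therefore an integer.
  obtain ⟨y, ⟨⟨m, hm⟩, hy⟩, hys⟩ := ((ae_restrict_of_ae (s := Metric.ball (0 : 𝔼) s) hint').and (ae_restrict_of_ae hconst)).and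
    (ae_restrict_mem Metric.isOpen_ball.measurableSet) |>.exists
  refine ⟨m, fun B hB hBs f π => ?_⟩
  have hBm : MeasurableSet (WithLp.toLp 2 ⁻¹' B : Set (Fin n → ℝ)) := by
    rw [← BorelSpace.measurable_eq (α := 𝔼)] at hB
    exact contDiff_toLp.continuous.measurable hB
  have hconst' : ∀ᵐ x : Fin n → ℝ, WithLp.toLp 2 x ∈ Metric.ball (0 : 𝔼) s → N x = m := by
    filter_upwards [(PiLp.volume_preserving_toLp (Fin n)).quasiMeasurePreserving.ae hconst] with x hx hxs
    rw [← hm, hy hys]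
    exact hx hxs
  rw [hPB, ← integral_const_mul]
  refine setIntegral_congr_ae hBm ?_
  filter_upwards [hconst'] with x hx hxB
  rw [hx (hBs hxB)]

end RectData

end Top

/-! ### Stokes' theorem with compact support -/

section Stokes

variable {n : ℕ}

theorem sum_perm_sign_eq_zero (T : Equiv.Perm (Fin n) → ℝ) {a b : Fin n} (hab : a ≠ b)
    (h : ∀ σ, T (σ * Equiv.swap a b) = T σ) :
    ∑ σ : Equiv.Perm (Fin n), ((Equiv.Perm.sign σ : ℤ) : ℝ) * T σ = 0 := by
  have h1 : ∑ σ : Equiv.Perm (Fin n), ((Equiv.Perm.sign σ : ℤ) : ℝ) * T σ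
      = -∑ σ : Equiv.Perm (Fin n), ((Equiv.Perm.sign σ : ℤ) : ℝ) * T σ := by
    conv_lhs => rw [← Equiv.sum_comp (Equiv.mulRight (Equiv.swap a b))]
    rw [← Finset.sum_neg_distrib]
    refine Finset.sum_congr rfl fun σ _ => ?_
    rw [Equiv.coe_mulRight, h, Equiv.Perm.sign_mul, Equiv.Perm.sign_swap hab]
    simp
  linarith

/-- Stokes' theorem for forms with compact support. -/
theorem integral_det_fderiv_eq_zero {G : Fin n → (Fin n → ℝ) → ℝ} (hG : ∀ a, ContDiff ℝ ∞ (G a))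
    (a₀ : Fin n) (hc : HasCompactSupport (G a₀)) :
    ∫ x, (Matrix.of fun a b : Fin n => fderiv ℝ (G a) x (Pi.single b 1)).det = 0 := by
  classical
  let D : Fin n → Fin n → (Fin n → ℝ) → ℝ := fun a b x => fderiv ℝ (G a) x (Pi.single b 1)
  have hD : ∀ a b, ContDiff ℝ ∞ (D a b) := fun a b =>
    ((hG a).fderiv_right (m := ∞) (by simp)).clm_apply contDiff_const
  let w : Equiv.Perm (Fin n) → (Fin n → ℝ) → ℝ := fun σ x => ∏ a ∈ Finset.univ.erase a₀, D a (σ a) x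
  have hw : ∀ σ, ContDiff ℝ ∞ (w σ) := fun σ => contDiff_prod fun a _ => hD a (σ a)
  have hcD : ∀ b, HasCompactSupport (D a₀ b) := fun b => hc.fderiv_apply ℝ _
  have hdet : ∀ x, (Matrix.of fun a b : Fin n => fderiv ℝ (G a) x (Pi.single b 1)).det
      = ∑ σ : Equiv.Perm (Fin n), ((Equiv.Perm.sign σ : ℤ) : ℝ) * (w σ x * D a₀ (σ a₀) x) := by
    intro x
    rw [← Matrix.det_transpose, Matrix.det_apply']
    refine Finset.sum_congr rfl fun σ _ => ?_
    rw [mul_comm (w σ x), ← Finset.mul_prod_erase _ _ (Finset.mem_univ a₀)]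
    rfl
  have hint1 : ∀ σ, Integrable (fun x => w σ x * D a₀ (σ a₀) x) := fun σ =>
    ((hw σ).continuous.mul (hD _ _).continuous).integrable_of_hasCompactSupport (hcD _).mul_left
  have hint2 : ∀ σ, Integrable (fun x => fderiv ℝ (w σ) x (Pi.single (σ a₀) 1) * G a₀ x) := fun σ =>
    ((((hw σ).continuous_fderiv (by simp)).clm_apply continuous_const).mul
      (hG a₀).continuous).integrable_of_hasCompactSupport hc.mul_left
  have hint3 : ∀ σ, Integrable (fun x => w σ x * G a₀ x) := fun σ =>
    ((hw σ).continuous.mul (hG a₀).continuous).integrable_of_hasCompactSupport hc.mul_left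
  -- Each Leibniz term is integrated by parts in the row of the compactly supported function, so
  -- that every boundary term vanishes.
  have hparts : ∀ σ, ∫ x, w σ x * D a₀ (σ a₀) x
      = -∫ x, fderiv ℝ (w σ) x (Pi.single (σ a₀) 1) * G a₀ x := fun σ =>
    integral_mul_fderiv_eq_neg_fderiv_mul_of_integrable (hint2 σ) (hint1 σ) (hint3 σ)
      (fun x _ => (hw σ).differentiable (by simp) x) (fun x _ => (hG a₀).differentiable (by simp) x)
  simp only [hdet]
  rw [integral_finsetSum _ fun σ _ => (hint1 σ).const_mul _]
  simp only [integral_const_mul, hparts]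
  simp only [mul_neg, Finset.sum_neg_distrib, neg_eq_zero]
  simp only [← integral_const_mul]
  rw [← integral_finsetSum _ fun σ _ => (hint2 σ).const_mul _]
  refine integral_eq_zero_of_ae (Eventually.of_forall fun x => ?_)
  have hderiv : ∀ σ, fderiv ℝ (w σ) x (Pi.single (σ a₀) 1) = ∑ b ∈ Finset.univ.erase a₀,
      (∏ a ∈ (Finset.univ.erase a₀).erase b, D a (σ a) x)
        * fderiv ℝ (fderiv ℝ (G b)) x (Pi.single (σ a₀) 1) (Pi.single (σ b) 1) := by
    intro σ
    have h1 : HasFDerivAt (w σ) _ x := HasFDerivAt.finsetProd (u := Finset.univ.erase a₀)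
      fun a _ => ((hD a (σ a)).differentiable (by simp) x).hasFDerivAt
    rw [h1.fderiv, sum_apply]
    refine Finset.sum_congr rfl fun b _ => ?_
    rw [smul_apply, smul_eq_mul]
    congr 1
    have h2 : HasFDerivAt (fderiv ℝ (G b)) _ x :=
      (((hG b).fderiv_right (m := ∞) (by simp)).differentiable (by simp) x).hasFDerivAt
    have h3 := h2.clm_apply (hasFDerivAt_const (Pi.single (σ b) (1 : ℝ) : Fin n → ℝ) x)
    change fderiv ℝ (fun y => fderiv ℝ (G b) y (Pi.single (σ b) 1)) x _ = _
    rw [h3.fderiv]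
    simp
  simp only [hderiv, Pi.zero_apply, ← mul_assoc]
  rw [← Finset.sum_mul]
  simp only [Finset.mul_sum]
  rw [Finset.sum_comm, Finset.sum_eq_zero, zero_mul]
  intro b hb
  have hab : a₀ ≠ b := (Finset.ne_of_mem_erase hb).symm
  -- After the integration by parts, the term in which row `b` is differentiated twice is symmetric
  -- under exchanging `σ a₀` and `σ b`, while the sign changes.
  refine sum_perm_sign_eq_zero (fun σ => (∏ a ∈ (Finset.univ.erase a₀).erase b, D a (σ a) x)
        * fderiv ℝ (fderiv ℝ (G b)) x (Pi.single (σ a₀) 1) (Pi.single (σ b) 1)) hab fun σ => ?_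
  have hsymm : IsSymmSndFDerivAt ℝ (G b) x :=
    (hG b).contDiffAt.isSymmSndFDerivAt
      (by rw [minSmoothness_of_isRCLikeNormedField]; exact WithTop.coe_le_coe.2 (le_top : (2 : ℕ∞) ≤ ⊤))
  simp only [Equiv.Perm.mul_apply, Equiv.swap_apply_left, Equiv.swap_apply_right]
  rw [hsymm.eq]
  congr 1
  refine Finset.prod_congr rfl fun a ha => ?_
  have h1 := Finset.ne_of_mem_erase ha
  have h2 := Finset.ne_of_mem_erase (Finset.mem_of_mem_erase ha)
  rw [Equiv.swap_apply_of_ne_of_ne h2 h1]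

end Stokes

/-! ### Partial diffeomorphisms and transport of chains -/

section PartialDiffeo

variable {n : ℕ} {N M : Type*}
  [TopologicalSpace N] [ChartedSpace (EuclideanSpace ℝ (Fin n)) N]
  [TopologicalSpace M] [ChartedSpace (EuclideanSpace ℝ (Fin n)) M]

/-- A local diffeomorphism that is injective on an open set is a partial diffeomorphism. -/
theorem exists_partialDiffeomorph [Nonempty N] {f : N → M} {U : Set N} (hU : IsOpen U)
    (hf : IsLocalDiffeomorphOn (𝓡 n) (𝓡 n) ∞ f U) (hinj : InjOn f U) :
    ∃ Φ : PartialDiffeomorph (𝓡 n) (𝓡 n) N M ∞, Φ.source = U ∧ Φ.target = f '' U ∧ ∀ x, Φ x = f x := by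
  have hloc : ∀ x ∈ U, ∃ Ψ : PartialDiffeomorph (𝓡 n) (𝓡 n) N M ∞, x ∈ Ψ.source ∧ EqOn f Ψ Ψ.source :=
    fun x hx => hf ⟨x, hx⟩
  -- Continuity keeps a local inverse inside `U` near `f x`. By injectivity it then coincides with
  -- the global inverse, which gives openness of the image and smoothness of the inverse.
  have hnear : ∀ x ∈ U, ∃ Ψ : PartialDiffeomorph (𝓡 n) (𝓡 n) N M ∞,
      ∀ᶠ y in 𝓝 (f x), ∃ z ∈ U, Ψ.toPartialEquiv.symm y = z ∧ f z = y ∧ y ∈ Ψ.target := by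
    intro x hx
    obtain ⟨Ψ, hxΨ, hΨ⟩ := hloc x hx
    refine ⟨Ψ, ?_⟩
    have hfx : f x ∈ Ψ.target := by
      rw [hΨ hxΨ]
      exact Ψ.map_source hxΨ
    have hc : ContinuousAt Ψ.toPartialEquiv.symm (f x) :=
      (Ψ.contMDiffOn_invFun.continuousOn).continuousAt (Ψ.open_target.mem_nhds hfx)
    have hx' : Ψ.toPartialEquiv.symm (f x) = x := by
      rw [hΨ hxΨ]
      exact Ψ.left_inv hxΨ
    have hUx : U ∈ 𝓝 (Ψ.toPartialEquiv.symm (f x)) := by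
      rw [hx']
      exact hU.mem_nhds hx
    filter_upwards [hc.preimage_mem_nhds hUx, Ψ.open_target.mem_nhds hfx] with y hy hyt
    refine ⟨_, hy, rfl, ?_, hyt⟩
    rw [hΨ (Ψ.map_target hyt)]
    exact Ψ.right_inv hyt
  have hopen : IsOpen (f '' U) := by
    rw [isOpen_iff_mem_nhds]
    rintro _ ⟨x, hx, rfl⟩
    obtain ⟨Ψ, hΨ⟩ := hnear x hx
    filter_upwards [hΨ] with y hy
    obtain ⟨z, hz, -, hzy, -⟩ := hy
    exact ⟨z, hz, hzy⟩
  have hinv : ∀ x ∈ U, Function.invFunOn f U (f x) = x := fun x hx => hinj.leftInvOn_invFunOn hx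
  refine ⟨⟨⟨f, Function.invFunOn f U, U, f '' U, fun x hx => mem_image_of_mem f hx, ?_,
    fun x hx => hinv x hx, ?_⟩, hU, hopen, hf.contMDiffOn, ?_⟩, rfl, rfl, fun _ => rfl⟩
  · rintro _ ⟨x, hx, rfl⟩
    rw [hinv x hx]
    exact hx
  · rintro _ ⟨x, hx, rfl⟩
    rw [hinv x hx]
  · rintro _ ⟨x, hx, rfl⟩
    obtain ⟨Ψ, hΨ⟩ := hnear x hx
    obtain ⟨_, _, _, _, ht⟩ := hΨ.self_of_nhds
    refine ContMDiffAt.contMDiffWithinAt ?_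
    refine (Ψ.contMDiffOn_invFun.contMDiffAt (Ψ.open_target.mem_nhds ht)).congr_of_eventuallyEq ?_
    filter_upwards [hΨ] with y hy
    obtain ⟨z, hz, h1, h2, -⟩ := hy
    change Function.invFunOn f U y = Ψ.toPartialEquiv.symm y
    rw [h1, ← h2, hinv z hz]

end PartialDiffeo

section Transport

variable {l n k : ℕ} {N M : Type*}
  [TopologicalSpace N] [ChartedSpace (EuclideanSpace ℝ (Fin l)) N]
  [TopologicalSpace M] [ChartedSpace (EuclideanSpace ℝ (Fin n)) M]

/-- Smooth functions on `M` can be pulled back, near a compact set, by a map that is smooth there. -/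
theorem exists_pullback_near [T2Space N] [SecondCountableTopology N] [IsManifold (𝓡 l) ∞ N]
    {K W : Set N} (hK : IsCompact K) (hW : IsOpen W) (hKW : K ⊆ W) {G : N → M}
    (hG : ContMDiffOn (𝓡 l) (𝓡 n) ∞ G W) (g : TestFn n M) :
    ∃ g' : TestFn l N, (∀ᶠ x in 𝓝ˢ K, g' x = g (G x)) ∧ ∀ x, g' x ≠ 0 → x ∈ W ∧ g (G x) ≠ 0 :=
  exists_testFn_eq_near hK hW hKW (g := fun x => g (G x)) (g.contMDiff.comp_contMDiffOn hG)

namespace RectData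

theorem current_comp_perm (P : RectData n M k) (f : TestFn n M) (π : Fin k → TestFn n M)
    (σ : Equiv.Perm (Fin k)) :
    P.current f (π ∘ σ) = (Equiv.Perm.sign σ : ℤ) * P.current f π := by
  unfold current
  rw [← tsum_mul_left]
  refine tsum_congr fun j => ?_
  rw [← integral_const_mul]
  refine integral_congr_ae (Eventually.of_forall fun x => ?_)
  simp only [jac_comp_perm]
  ring

/-- A boundary sees the support of the first differential only. Antisymmetry moves any `π a` into
the first place, at the cost of a sign. -/
theorem current_one_eq_zero_of_boundary (P : RectData n M (k + 1)) {V : Set M}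
    (h : ∀ (f : TestFn n M) π, tsupport f ⊆ V → boundary n M k P.current f π = 0)
    (π : Fin (k + 1) → TestFn n M) (a : Fin (k + 1)) (ha : tsupport (π a) ⊆ V) :
    P.current 1 π = 0 := by
  have h1 := h ((π ∘ Equiv.swap 0 a) 0) (Fin.tail (π ∘ Equiv.swap 0 a)) (by simpa using ha)
  have h2 : boundary n M k P.current ((π ∘ Equiv.swap 0 a) 0) (Fin.tail (π ∘ Equiv.swap 0 a))
      = P.current 1 (π ∘ Equiv.swap 0 a) := by
    change P.current 1 (Fin.cons _ _) = _
    rw [Fin.cons_self_tail]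
  rw [h2, current_comp_perm] at h1
  refine (mul_eq_zero.1 h1).resolve_left ?_
  rcases Int.units_eq_one_or (Equiv.Perm.sign (Equiv.swap 0 a)) with h | h <;> simp [h]

theorem mapOn_congr [T2Space N] [SecondCountableTopology N] [IsManifold (𝓡 l) ∞ N] (P : RectData l N k) {G G' : N → M} {W W' O : Set N} (hW : IsOpen W)
    (hG : ContMDiffOn (𝓡 l) (𝓡 n) ∞ G W) (hK : P.K ⊆ W) (hW' : IsOpen W')
    (hG' : ContMDiffOn (𝓡 l) (𝓡 n) ∞ G' W') (hK' : P.K ⊆ W') (hO : IsOpen O) (hKO : P.K ⊆ O)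
    (h : ∀ x ∈ O, G x = G' x) :
    (P.mapOn hW hG hK).current = (P.mapOn hW' hG' hK').current := by
  funext f π
  unfold current
  refine tsum_congr fun j => setIntegral_congr_fun (P.measurableSet_E j) fun x hx => ?_
  have hxO : P.φ j x ∈ O := hKO (P.mapsTo j hx)
  change _ * (f (G (P.φ j x)) * jac π (fun x => G (P.φ j x)) x)
    = _ * (f (G' (P.φ j x)) * jac π (fun x => G' (P.φ j x)) x)
  rw [h _ hxO]
  congr 2
  refine jac_congr fun a => ?_
  filter_upwards [(P.continuousAt_φ hx).preimage_mem_nhds (hO.mem_nhds hxO)] with y hy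
  rw [h _ hy]

theorem mapOn_eq_self [T2Space M] [SecondCountableTopology M] [IsManifold (𝓡 n) ∞ M] (P : RectData n M k) {G : M → M} {W O : Set M} (hW : IsOpen W)
    (hG : ContMDiffOn (𝓡 n) (𝓡 n) ∞ G W) (hK : P.K ⊆ W) (hO : IsOpen O) (hKO : P.K ⊆ O)
    (h : ∀ x ∈ O, G x = x) : (P.mapOn hW hG hK).current = P.current :=
  P.mapOn_congr hW hG hK isOpen_univ (contMDiff_id.contMDiffOn) (subset_univ _) hO hKO h

section

variable [T2Space N] [SecondCountableTopology N] [IsManifold (𝓡 l) ∞ N] {G : N → M} {W : Set N}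

/-- The local push-forward depends on the current and not on its parametrization: both sides are
evaluated on the same pull-backs, chosen near the union of the two carriers. -/
theorem mapOn_current_eq_of_eq (P Q : RectData l N k) (hW : IsOpen W)
    (hG : ContMDiffOn (𝓡 l) (𝓡 n) ∞ G W) (hP : P.K ⊆ W) (hQ : Q.K ⊆ W)
    (h : P.current = Q.current) : (P.mapOn hW hG hP).current = (Q.mapOn hW hG hQ).current := by
  funext f π
  have hK := P.isCompact_K.union Q.isCompact_K
  have hKW := union_subset hP hQ
  obtain ⟨f', hf', -⟩ := exists_pullback_near hK hW hKW hG f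
  choose π' hπ' _ using fun a => exists_pullback_near hK hW hKW hG (π a)
  rw [P.mapOn_current hW hG hP (f' := f') (π' := π')
      (fun x hx => (eventually_nhdsSet_iff_forall.1 hf' x (Or.inl hx)).self_of_nhds)
      (fun a => (hπ' a).filter_mono (nhdsSet_mono subset_union_left)),
    Q.mapOn_current hW hG hQ (f' := f') (π' := π')
      (fun x hx => (eventually_nhdsSet_iff_forall.1 hf' x (Or.inr hx)).self_of_nhds)
      (fun a => (hπ' a).filter_mono (nhdsSet_mono subset_union_right)), h]

/-- The boundary of the image of a chain, in terms of functions pulled back near the chain. -/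
theorem boundary_mapOn_current (S : RectData l N (k + 1)) (hW : IsOpen W)
    (hG : ContMDiffOn (𝓡 l) (𝓡 n) ∞ G W) (hS : S.K ⊆ W) {f : TestFn n M}
    {π : Fin k → TestFn n M} {f' : TestFn l N} {π' : Fin k → TestFn l N}
    (hf : ∀ᶠ x in 𝓝ˢ S.K, f' x = f (G x)) (hπ : ∀ a, ∀ᶠ x in 𝓝ˢ S.K, π' a x = π a (G x)) :
    boundary n M k (S.mapOn hW hG hS).current f π = boundary l N k S.current f' π' := by
  refine S.mapOn_current hW hG hS (f' := 1) (π' := Fin.cons f' π') (fun x _ => rfl) fun a => ?_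
  refine Fin.cases ?_ (fun a => ?_) a
  · simpa using hf
  · simpa using hπ a

theorem mapOn_sub_eq_boundary (P Q : RectData l N k) (S : RectData l N (k + 1)) (hW : IsOpen W)
    (hG : ContMDiffOn (𝓡 l) (𝓡 n) ∞ G W) (hP : P.K ⊆ W) (hQ : Q.K ⊆ W) (hS : S.K ⊆ W)
    (h : P.current - Q.current = boundary l N k S.current) :
    (P.mapOn hW hG hP).current - (Q.mapOn hW hG hQ).current
      = boundary n M k (S.mapOn hW hG hS).current := by
  funext f π
  have hK := (P.isCompact_K.union Q.isCompact_K).union S.isCompact_K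
  have hKW := union_subset (union_subset hP hQ) hS
  obtain ⟨f', hf', -⟩ := exists_pullback_near hK hW hKW hG f
  choose π' hπ' _ using fun a => exists_pullback_near hK hW hKW hG (π a)
  rw [Pi.sub_apply, Pi.sub_apply, P.mapOn_current hW hG hP (f' := f') (π' := π')
      (fun x hx => (eventually_nhdsSet_iff_forall.1 hf' x (Or.inl (Or.inl hx))).self_of_nhds)
      (fun a => (hπ' a).filter_mono
        (nhdsSet_mono (subset_union_left.trans subset_union_left))),
    Q.mapOn_current hW hG hQ (f' := f') (π' := π')
      (fun x hx => (eventually_nhdsSet_iff_forall.1 hf' x (Or.inl (Or.inr hx))).self_of_nhds)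
      (fun a => (hπ' a).filter_mono
        (nhdsSet_mono (subset_union_right.trans subset_union_left))),
    S.boundary_mapOn_current hW hG hS (f' := f') (π' := π')
      (hf'.filter_mono (nhdsSet_mono subset_union_right))
      (fun a => (hπ' a).filter_mono (nhdsSet_mono subset_union_right)), ← h]
  rfl

theorem boundary_mapOn_eq_zero (S : RectData l N (k + 1)) (hW : IsOpen W)
    (hG : ContMDiffOn (𝓡 l) (𝓡 n) ∞ G W) (hS : S.K ⊆ W) (h : boundary l N k S.current = 0) :
    boundary n M k (S.mapOn hW hG hS).current = 0 := by
  funext f π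
  obtain ⟨f', hf', -⟩ := exists_pullback_near S.isCompact_K hW hS hG f
  choose π' hπ' _ using fun a => exists_pullback_near S.isCompact_K hW hS hG (π a)
  rw [S.boundary_mapOn_current hW hG hS hf' hπ', h]
  rfl

end

end RectData

end Transport

/-! ### Chains inside an embedded ball -/

section Ball

variable {n k : ℕ} {X : Type*} [TopologicalSpace X] [T2Space X] [SecondCountableTopology X]
  [ChartedSpace (EuclideanSpace ℝ (Fin n)) X] [IsManifold (𝓡 n) ∞ X]

local notation "𝔼" => EuclideanSpace ℝ (Fin n)

theorem isCompact_image_closedBall (Φ : PartialDiffeomorph (𝓡 n) (𝓡 n) 𝔼 X ∞) {R s : ℝ}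
    (hΦ : Φ.source = Metric.ball 0 R) (hs : s < R) : IsCompact (Φ '' Metric.closedBall 0 s) :=
  (isCompact_closedBall (0 : 𝔼) s).image_of_continuousOn (Φ.contMDiffOn.continuousOn.mono
    (hΦ ▸ Metric.closedBall_subset_ball hs))

theorem isOpen_image_ball (Φ : PartialDiffeomorph (𝓡 n) (𝓡 n) 𝔼 X ∞) {R s : ℝ}
    (hΦ : Φ.source = Metric.ball 0 R) (hs : s ≤ R) : IsOpen (Φ '' Metric.ball 0 s) :=
  Φ.toOpenPartialHomeomorph.isOpen_image_of_subset_source Metric.isOpen_ball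
    (hΦ ▸ Metric.ball_subset_ball hs)

/-- The part of a chain in an embedded ball, as a chain in `ℝⁿ`. -/
def RectData.inBall (P : RectData n X k) (Φ : PartialDiffeomorph (𝓡 n) (𝓡 n)
    (EuclideanSpace ℝ (Fin n)) X ∞) {R s : ℝ} (hΦ : Φ.source = Metric.ball 0 R) (hs : s < R) :
    RectData n (EuclideanSpace ℝ (Fin n)) k :=
  (P.restrict (Φ '' Metric.ball 0 s)
      (measurableSet_borel_of_isOpen (isOpen_image_ball Φ hΦ hs.le))).mapOn
    Φ.open_target Φ.contMDiffOn_invFun (by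
      refine inter_subset_right.trans ((closure_minimal (image_mono Metric.ball_subset_closedBall)
        (isCompact_image_closedBall Φ hΦ hs).isClosed).trans ?_)
      rintro _ ⟨x, hx, rfl⟩
      exact Φ.map_source (hΦ ▸ Metric.closedBall_subset_ball hs hx))

theorem closure_image_ball_subset (Φ : PartialDiffeomorph (𝓡 n) (𝓡 n) 𝔼 X ∞) {R s : ℝ}
    (hΦ : Φ.source = Metric.ball 0 R) (hs : s < R) :
    closure (Φ '' Metric.ball 0 s) ⊆ Φ '' Metric.closedBall 0 s :=
  closure_minimal (image_mono Metric.ball_subset_closedBall)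
    (isCompact_image_closedBall Φ hΦ hs).isClosed

theorem RectData.inBall_K_subset (P : RectData n X k)
    (Φ : PartialDiffeomorph (𝓡 n) (𝓡 n) 𝔼 X ∞) {R s : ℝ} (hΦ : Φ.source = Metric.ball 0 R) (hs : s < R) :
    (P.inBall Φ hΦ hs).K ⊆ Metric.closedBall 0 s := by
  rintro _ ⟨_, hx, rfl⟩
  obtain ⟨y, hy, rfl⟩ := closure_image_ball_subset Φ hΦ hs hx.2
  change Φ.toPartialEquiv.symm (Φ y) ∈ _
  rwa [Φ.left_inv (hΦ ▸ Metric.closedBall_subset_ball hs hy)]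

theorem RectData.inBall_mapOn_current (P : RectData n X k)
    (Φ : PartialDiffeomorph (𝓡 n) (𝓡 n) 𝔼 X ∞) {R s : ℝ} (hΦ : Φ.source = Metric.ball 0 R) (hs : s < R) (hK : (P.inBall Φ hΦ hs).K ⊆ Φ.source) :
    ((P.inBall Φ hΦ hs).mapOn Φ.open_source Φ.contMDiffOn hK).current
      = (P.restrict (Φ '' Metric.ball 0 s)
          (measurableSet_borel_of_isOpen (isOpen_image_ball Φ hΦ hs.le))).current := by
  have hK' : (P.restrict (Φ '' Metric.ball 0 s)
      (measurableSet_borel_of_isOpen (isOpen_image_ball Φ hΦ hs.le))).K ⊆ Φ.target := by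
    refine inter_subset_right.trans ((closure_image_ball_subset Φ hΦ hs).trans ?_)
    rintro _ ⟨x, hx, rfl⟩
    exact Φ.map_source (hΦ ▸ Metric.closedBall_subset_ball hs hx)
  exact (P.restrict _ _).mapOn_eq_self (G := fun x => Φ (Φ.toPartialEquiv.symm x)) Φ.open_target
    (Φ.contMDiffOn.comp Φ.contMDiffOn_invFun fun x hx => Φ.map_target hx) hK' Φ.open_target hK'
    fun x hx => Φ.right_inv hx

/-- The part of a chain in an embedded ball has no boundary in this ball if the chain has none. -/
theorem RectData.inBall_current_one (P : RectData n X (k + 1))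
    (Φ : PartialDiffeomorph (𝓡 n) (𝓡 n) 𝔼 X ∞) {R s : ℝ} (hΦ : Φ.source = Metric.ball 0 R) (hs : s < R)
    (h : ∀ (f : TestFn n X) π, tsupport f ⊆ Φ '' Metric.ball 0 s → boundary n X k P.current f π = 0)
    (π : Fin (k + 1) → TestFn n 𝔼) (a : Fin (k + 1)) (ha : tsupport (π a) ⊆ Metric.ball 0 s) :
    (P.inBall Φ hΦ hs).current 1 π = 0 := by
  have hB := measurableSet_borel_of_isOpen (isOpen_image_ball Φ hΦ hs.le)
  set P₁ := P.restrict (Φ '' Metric.ball 0 s) hB with hP₁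
  have hK : P₁.K ⊆ Φ.target := by
    refine inter_subset_right.trans ((closure_image_ball_subset Φ hΦ hs).trans ?_)
    rintro _ ⟨x, hx, rfl⟩
    exact Φ.map_source (hΦ ▸ Metric.closedBall_subset_ball hs hx)
  choose π' hπ' hne using fun a =>
    exists_pullback_near P₁.isCompact_K Φ.open_target hK Φ.contMDiffOn_invFun (π a)
  have h1 : (P.inBall Φ hΦ hs).current 1 π = P₁.current 1 π' :=
    P₁.mapOn_current Φ.open_target Φ.contMDiffOn_invFun hK (fun x _ => rfl) hπ'
  have hsource : Metric.closedBall 0 s ⊆ Φ.source := hΦ ▸ Metric.closedBall_subset_ball hs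
  have hcomp : IsCompact (tsupport (π a)) :=
    (isCompact_closedBall (0 : 𝔼) s).of_isClosed_subset (isClosed_tsupport _)
      (ha.trans Metric.ball_subset_closedBall)
  -- The support of `π a` is compact, so its image is closed in `X`, and the closure cannot leave
  -- the embedded ball.
  have hsupp : tsupport (π' a) ⊆ Φ '' Metric.ball 0 s := by
    have h2 : tsupport (π' a) ⊆ Φ '' tsupport (π a) := by
      refine closure_minimal (fun x hx => ?_) (hcomp.image_of_continuousOn
        (Φ.contMDiffOn.continuousOn.mono ((ha.trans Metric.ball_subset_closedBall).trans
          hsource))).isClosed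
      obtain ⟨h3, h4⟩ := hne a x hx
      exact ⟨Φ.toPartialEquiv.symm x, subset_tsupport _ h4, Φ.right_inv h3⟩
    exact h2.trans (image_mono ha)
  -- Outside the embedded ball `π' a` vanishes locally, so the Jacobian is zero there. The
  -- restricted chain and the full chain agree on this form, and the new boundary on the sphere is
  -- not seen.
  rw [h1, P.current_restrict_of_forall hB
    (by
      have : MeasurableSet[borel X] (Φ '' Metric.ball 0 s)ᶜ := MeasurableSet.compl hB
      exact this)]
  · exact P.current_one_eq_zero_of_boundary h π' a hsupp
  · intro j x hx hxB
    have h3 : ∀ᶠ y in 𝓝 x, π' a (P.φ j y) = 0 := by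
      refine (P.continuousAt_φ hx).eventually (p := fun y => π' a y = 0) ?_
      exact notMem_tsupport_iff_eventuallyEq.1 fun h => hxB (hsupp h)
    rw [jac_eq_zero a 0 h3, mul_zero]

/-- A chain of dimension less than `n` whose boundary vanishes in an embedded ball is homologous
to a chain outside a smaller ball. -/
theorem RectData.exists_push_off (P : RectData n X (k + 1))
    (Φ : PartialDiffeomorph (𝓡 n) (𝓡 n) 𝔼 X ∞) {R s : ℝ} (hΦ : Φ.source = Metric.ball 0 R) (hs : s < R) (hk : k + 1 < n) {r : ℝ} (hr : 0 < r)
    (hrs : r < s)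
    (h : ∀ (f : TestFn n X) π, tsupport f ⊆ Φ '' Metric.ball 0 s → boundary n X k P.current f π = 0) :
    ∃ (Q : RectData n X (k + 1)) (S : RectData n X (k + 2)),
      Q.K ⊆ Φ '' {x | r ≤ ‖x‖ ∧ ‖x‖ ≤ s} ∧
      Q.current - (P.restrict (Φ '' Metric.ball 0 s)
          (measurableSet_borel_of_isOpen (isOpen_image_ball Φ hΦ hs.le))).current
        = boundary n X (k + 1) S.current := by
  have hsource : Metric.closedBall 0 s ⊆ Φ.source := hΦ ▸ Metric.closedBall_subset_ball hs
  have hPK := P.inBall_K_subset Φ hΦ hs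
  obtain ⟨Q, S, hQ, hS, hQS⟩ := (P.inBall Φ hΦ hs).exists_push_out (by simp) hk hr hrs hPK
    (P.inBall_current_one Φ hΦ hs h)
  have hQ' : Q.K ⊆ Φ.source := hQ.trans fun x hx => hsource (by simpa using hx.2)
  have h1 := Q.mapOn_sub_eq_boundary (P.inBall Φ hΦ hs) S Φ.open_source Φ.contMDiffOn hQ'
    (hPK.trans hsource) (hS.trans hsource) hQS
  rw [P.inBall_mapOn_current Φ hΦ hs] at h1
  exact ⟨_, _, image_mono hQ, h1⟩

end Ball

/-! ### Rectifiable representatives of homology classes -/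

section HomologyBasics

variable {n l k : ℕ} {M N : Type*} [TopologicalSpace M] [ChartedSpace (EuclideanSpace ℝ (Fin n)) M]
  [TopologicalSpace N] [ChartedSpace (EuclideanSpace ℝ (Fin l)) N]

theorem boundary_boundary (S : RectData n M (k + 2)) :
    boundary n M k (boundary n M (k + 1) S.current) = 0 := by
  funext f π
  exact rectifiable_one_cons_one ⟨S, rfl⟩ 1 _

/-- The part `∂S` of a flat filling `R + ∂S` has no boundary, so fillings may be taken rectifiable
and all constructions can work with parametrized data. -/
theorem mem_boundaries_iff {T : Functional n M k} :
    T ∈ boundaries n M k ↔ ∃ S : RectData n M (k + 1), boundary n M k S.current = T := by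
  constructor
  · rintro ⟨T, hT, rfl⟩
    obtain ⟨_, ⟨R, rfl⟩, _, ⟨_, ⟨S, rfl⟩, rfl⟩, rfl⟩ := AddSubgroup.mem_sup.1 hT
    exact ⟨R, by rw [map_add, boundary_boundary, add_zero]⟩
  · rintro ⟨S, rfl⟩
    exact ⟨S.current, AddSubgroup.mem_sup_left ⟨S, rfl⟩, rfl⟩

theorem cls_eq_zero_iff {T : cycles n M k} : cls T = 0 ↔ T.1 ∈ boundaries n M k :=
  QuotientAddGroup.eq_zero_iff T

theorem cls_add (T T' : cycles n M k) : cls (T + T') = cls T + cls T' := rfl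

theorem cls_sub (T T' : cycles n M k) : cls (T - T') = cls T - cls T' := rfl

theorem cls_eq_of_sub {T T' : cycles n M k} (S : RectData n M (k + 1))
    (h : T.1 - T'.1 = boundary n M k S.current) : cls T = cls T' := by
  rw [← sub_eq_zero, ← cls_sub, cls_eq_zero_iff, mem_boundaries_iff]
  exact ⟨S, h.symm⟩

theorem cls_surjective (c : Homology n M k) : ∃ T : cycles n M k, cls T = c :=
  QuotientAddGroup.mk_surjective c

theorem homologyMap_cls (F : C^∞⟮𝓡 l, N; 𝓡 n, M⟯) (T : cycles l N k) :
    homologyMap F k (cls T) = cls (pushCycles F k T) := rfl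

/-- The cycle given by a rectifiable current without boundary. -/
def RectData.toCycle (P : RectData n M (k + 1)) (h : boundary n M k P.current = 0) :
    cycles n M (k + 1) :=
  ⟨P.current, AddSubgroup.mem_sup_left ⟨P, rfl⟩, h⟩

/-- Every homology class is represented by a rectifiable cycle. -/
theorem exists_rectifiable_cycle (c : Homology n M (k + 1)) :
    ∃ (P : RectData n M (k + 1)) (h : boundary n M k P.current = 0), cls (P.toCycle h) = c := by
  obtain ⟨⟨T, hT, hbT⟩, rfl⟩ := cls_surjective c
  obtain ⟨_, ⟨P, rfl⟩, _, ⟨_, ⟨S, rfl⟩, rfl⟩, rfl⟩ := AddSubgroup.mem_sup.1 hT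
  have hP : boundary n M k P.current = 0 := by
    have h : boundary n M k (P.current + boundary n M (k + 1) S.current) = 0 := hbT
    rwa [map_add, boundary_boundary, add_zero] at h
  refine ⟨P, hP, (cls_eq_of_sub S ?_).symm⟩
  exact add_sub_cancel_left _ _

theorem boundary_map (F : C^∞⟮𝓡 l, N; 𝓡 n, M⟯) (P : RectData l N (k + 1)) :
    boundary n M k (P.map F).current = push F k (boundary l N k P.current) :=
  (push_boundary F k P.current).symm

theorem boundary_map_eq_zero (F : C^∞⟮𝓡 l, N; 𝓡 n, M⟯) (P : RectData l N (k + 1))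
    (h : boundary l N k P.current = 0) : boundary n M k (P.map F).current = 0 := by
  rw [boundary_map, h, map_zero]

theorem homologyMap_toCycle (F : C^∞⟮𝓡 l, N; 𝓡 n, M⟯) (P : RectData l N (k + 1))
    (h : boundary l N k P.current = 0) :
    homologyMap F (k + 1) (cls (P.toCycle h))
      = cls ((P.map F).toCycle (boundary_map_eq_zero F P h)) := rfl

theorem homologyMap_comp {q : ℕ} {L : Type*} [TopologicalSpace L]
    [ChartedSpace (EuclideanSpace ℝ (Fin q)) L] (F : C^∞⟮𝓡 l, N; 𝓡 n, M⟯) (G : C^∞⟮𝓡 q, L; 𝓡 l, N⟯)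
    (c : Homology q L k) :
    homologyMap (F.comp G) k c = homologyMap F k (homologyMap G k c) := by
  obtain ⟨T, rfl⟩ := cls_surjective c
  rfl

theorem isClosed_spt (T : Functional n M k) : IsClosed (spt T) := by
  rw [← isOpen_compl_iff, isOpen_iff_forall_mem_open]
  intro x hx
  simp only [spt, mem_compl_iff, mem_ofPred_eq, not_forall] at hx
  obtain ⟨W, hW, hxW, h⟩ := hx
  exact ⟨W, fun y hy hyT => h (hyT W hW hy), hW, hxW⟩

end HomologyBasics

/-! ### Supports of flat chains -/

section Support

variable {n k : ℕ} {M : Type*} [TopologicalSpace M] [T2Space M] [SecondCountableTopology M]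
  [ChartedSpace (EuclideanSpace ℝ (Fin n)) M] [IsManifold (𝓡 n) ∞ M]

/-- A general `Functional` is an arbitrary function of its arguments. Additivity in `f`, on which
localisation by partitions of unity rests, holds for flat chains. -/
theorem flatChain_add_left {T : Functional n M k} (hT : T ∈ flatChains n M k) (f g : TestFn n M)
    (π : Fin k → TestFn n M) : T (f + g) π = T f π + T g π := by
  obtain ⟨_, ⟨R, rfl⟩, _, ⟨_, ⟨S, rfl⟩, rfl⟩, rfl⟩ := AddSubgroup.mem_sup.1 hT
  simp only [Pi.add_apply]
  rw [R.current_add_left, S.boundary_add_left]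
  ring

/-- A flat chain is carried by a compact set. -/
theorem exists_carrier {T : Functional n M k} (hT : T ∈ flatChains n M k) :
    ∃ K : Set M, IsCompact K ∧ ∀ (f : TestFn n M) π, tsupport f ⊆ Kᶜ → T f π = 0 := by
  obtain ⟨_, ⟨R, rfl⟩, _, ⟨_, ⟨S, rfl⟩, rfl⟩, rfl⟩ := AddSubgroup.mem_sup.1 hT
  refine ⟨R.K ∪ S.K, R.isCompact_K.union S.isCompact_K, fun f π hf => ?_⟩
  have h1 : R.current f π = 0 := R.current_eq_zero fun j x hx => by
    rw [image_eq_zero_of_notMem_tsupport fun h => hf h (Or.inl (R.mapsTo j hx)), zero_mul]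
  have h2 : boundary n M k S.current f π = 0 := S.current_eq_zero fun j x hx => by
    rw [jac_eq_zero 0 0, mul_zero]
    refine (S.continuousAt_φ hx).eventually (p := fun y => (Fin.cons f π : _ → TestFn n M) 0 y = 0) ?_
    exact notMem_tsupport_iff_eventuallyEq.1 fun h => hf h (Or.inr (S.mapsTo j hx))
  rw [Pi.add_apply, Pi.add_apply, h1, h2, add_zero]

/-- The function is split by a cut-off supported in `O₁` that is `1` near the part of the support
outside `O₂`, so the two summands are supported in `O₁` and in `O₂`. -/
theorem vanishes_union {T : Functional n M k} (hT : T ∈ flatChains n M k) {O₁ O₂ : Set M}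
    (hO₁ : IsOpen O₁) (hO₂ : IsOpen O₂)
    (h₁ : ∀ (f : TestFn n M) π, tsupport f ⊆ O₁ → T f π = 0)
    (h₂ : ∀ (f : TestFn n M) π, tsupport f ⊆ O₂ → T f π = 0)
    (f : TestFn n M) (π : Fin k → TestFn n M) (hf : tsupport f ⊆ O₁ ∪ O₂) : T f π = 0 := by
  obtain ⟨χ, hχ1, hχ⟩ := exists_cutoff (n := n) (K := tsupport f \ O₂) (W := O₁)
    ((isClosed_tsupport f).sdiff hO₂) hO₁ fun x hx => (hf hx.1).resolve_right hx.2
  have hsplit : f = χ * f + (1 - χ) * f := by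
    ext x
    simp
    ring
  have e1 : tsupport (χ * f : TestFn n M) ⊆ O₁ := by
    refine (closure_mono ?_).trans hχ
    intro x hx
    exact left_ne_zero_of_mul hx
  have e2 : tsupport ((1 - χ) * f : TestFn n M) ⊆ O₂ := by
    intro x hx
    have hxf : x ∈ tsupport f := closure_mono (fun y hy => right_ne_zero_of_mul hy) hx
    by_contra hxO
    have h3 := eventually_nhdsSet_iff_forall.1 hχ1 x ⟨hxf, hxO⟩
    refine (notMem_tsupport_iff_eventuallyEq.2 ?_) hx
    filter_upwards [h3] with y hy
    change (1 - χ y) * f y = 0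
    rw [hy, sub_self, zero_mul]
  rw [hsplit, flatChain_add_left hT, h₁ _ π e1, h₂ _ π e2, add_zero]

/-- A flat chain vanishes on forms supported away from its support. -/
theorem eq_zero_of_disjoint_spt {T : Functional n M k} (hT : T ∈ flatChains n M k)
    (f : TestFn n M) (π : Fin k → TestFn n M) (hf : Disjoint (tsupport f) (spt T)) : T f π = 0 := by
  obtain ⟨K, hK, hTK⟩ := exists_carrier hT
  have hcomp : IsCompact (tsupport f ∩ K) := hK.inter_left (isClosed_tsupport f)
  obtain ⟨O, hO, hsub, hTO⟩ : ∃ O : Set M, IsOpen O ∧ tsupport f ∩ K ⊆ O ∧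
      ∀ (g : TestFn n M) ϖ, tsupport g ⊆ O → T g ϖ = 0 := by
    -- Vanishing sets combine only finitely many at a time, so compactness is needed. The part of
    -- the support of `f` outside the compact carrier is covered by one further open set.
    refine hcomp.induction_on (p := fun s => ∃ O : Set M, IsOpen O ∧ s ⊆ O ∧
      ∀ (g : TestFn n M) ϖ, tsupport g ⊆ O → T g ϖ = 0) ?_ ?_ ?_ ?_
    · exact ⟨Kᶜ, hK.isClosed.isOpen_compl, empty_subset _, hTK⟩
    · rintro s t hst ⟨O, hO, h1, h2⟩
      exact ⟨O, hO, hst.trans h1, h2⟩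
    · rintro s t ⟨O, hO, h1, h2⟩ ⟨O', hO', h1', h2'⟩
      exact ⟨O ∪ O', hO.union hO', union_subset_union h1 h1', vanishes_union hT hO hO' h2 h2'⟩
    · rintro x ⟨hxf, -⟩
      have hx : x ∉ spt T := fun h => disjoint_left.1 hf hxf h
      simp only [spt, mem_ofPred_eq, not_forall] at hx
      obtain ⟨W, hW, hxW, h⟩ := hx
      push Not at h
      exact ⟨W, mem_nhdsWithin_of_mem_nhds (hW.mem_nhds hxW), W, hW, subset_rfl, h⟩
  refine vanishes_union hT hO hK.isClosed.isOpen_compl hTO hTK f π fun x hx => ?_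
  by_cases hxK : x ∈ K
  · exact Or.inl (hsub ⟨hx, hxK⟩)
  · exact Or.inr hxK

theorem isCompact_spt {T : Functional n M k} (hT : T ∈ flatChains n M k) : IsCompact (spt T) := by
  obtain ⟨K, hK, hTK⟩ := exists_carrier hT
  refine hK.of_isClosed_subset (isClosed_spt T) fun x hx => ?_
  by_contra hxK
  obtain ⟨f, π, hf, hne⟩ := hx Kᶜ hK.isClosed.isOpen_compl hxK
  exact hne (hTK f π hf)

theorem spt_current_subset (P : RectData n M k) : spt P.current ⊆ P.K := by
  intro x hx
  by_contra hxK
  obtain ⟨f, π, hf, hne⟩ := hx P.Kᶜ P.isCompact_K.isClosed.isOpen_compl hxK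
  refine hne (P.current_eq_zero fun j x hx => ?_)
  rw [image_eq_zero_of_notMem_tsupport fun h => hf h (P.mapsTo j hx), zero_mul]

/-- A flat chain vanishes on `f dπ` if one of the functions `π a` is constant near its support. -/
theorem eq_zero_of_const_near_spt {T : Functional n M k} (hT : T ∈ flatChains n M k)
    (f : TestFn n M) (π : Fin k → TestFn n M) {O : Set M} (hO : IsOpen O) (hsub : spt T ⊆ O)
    (a : Fin k) (c : ℝ) (hc : ∀ x ∈ O, π a x = c) : T f π = 0 := by
  obtain ⟨χ, hχ1, hχ⟩ := exists_cutoff (n := n) (isClosed_spt T) hO hsub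
  have hsplit : f = χ * f + (1 - χ) * f := by
    ext x
    simp
    ring
  have e1 : tsupport (χ * f : TestFn n M) ⊆ O := by
    refine (closure_mono ?_).trans hχ
    intro x hx
    exact left_ne_zero_of_mul hx
  have h2 : T ((1 - χ) * f) π = 0 := by
    refine eq_zero_of_disjoint_spt hT _ _ (disjoint_left.2 fun x hx hxT => ?_)
    have h3 := eventually_nhdsSet_iff_forall.1 hχ1 x hxT
    refine (notMem_tsupport_iff_eventuallyEq.2 ?_) hx
    filter_upwards [h3] with y hy
    change (1 - χ y) * f y = 0
    rw [hy, sub_self, zero_mul]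
  -- For the part supported in `O`, the two rectifiable summands are treated pointwise: in `O` the
  -- row of `π a` vanishes, and outside `O` so does `χ * f`, even locally.
  have h1 : T (χ * f) π = 0 := by
    obtain ⟨_, ⟨R, rfl⟩, _, ⟨_, ⟨S, rfl⟩, rfl⟩, rfl⟩ := AddSubgroup.mem_sup.1 hT
    have h1 : R.current (χ * f) π = 0 := R.current_eq_zero fun j x hx => by
      by_cases hxO : R.φ j x ∈ O
      · rw [jac_eq_zero a c, mul_zero]
        exact (R.continuousAt_φ hx).eventually
          (eventually_of_mem (hO.mem_nhds hxO) fun y hy => hc y hy)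
      · rw [image_eq_zero_of_notMem_tsupport fun h => hxO (e1 h), zero_mul]
    have h2 : boundary n M k S.current (χ * f) π = 0 := S.current_eq_zero fun j x hx => by
      by_cases hxO : S.φ j x ∈ O
      · rw [jac_eq_zero a.succ c, mul_zero]
        exact (S.continuousAt_φ hx).eventually
          (eventually_of_mem (hO.mem_nhds hxO) fun y hy => by simpa using hc y hy)
      · rw [jac_eq_zero 0 0, mul_zero]
        refine (S.continuousAt_φ hx).eventually
          (p := fun y => (Fin.cons (χ * f) π : _ → TestFn n M) 0 y = 0) ?_
        exact notMem_tsupport_iff_eventuallyEq.1 fun h => hxO (e1 h)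
    rw [Pi.add_apply, Pi.add_apply, h1, h2, add_zero]
  rw [hsplit, flatChain_add_left hT, h1, h2, add_zero]

end Support

/-! ### Collapsing a ball by a map homotopic to the identity -/

section Collapse

variable {n : ℕ}

local notation "𝔼" => EuclideanSpace ℝ (Fin n)

/-- The radial map of `ℝⁿ` that is `0` on the ball of radius `r` and the identity outside the ball
of radius `s`. -/
def radialCollapse (r s : ℝ) (x : EuclideanSpace ℝ (Fin n)) : EuclideanSpace ℝ (Fin n) :=
  Real.smoothTransition ((‖x‖ ^ 2 - r ^ 2) / (s ^ 2 - r ^ 2)) • x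

theorem contDiff_radialCollapse (r s : ℝ) : ContDiff ℝ ∞ (radialCollapse (n := n) r s) :=
  (Real.smoothTransition.contDiff.comp
    (((contDiff_norm_sq ℝ).sub contDiff_const).div_const _)).smul contDiff_id

theorem radialCollapse_of_le {r s : ℝ} (hr : 0 ≤ r) (hrs : r < s) {x : 𝔼} (hx : ‖x‖ ≤ r) :
    radialCollapse r s x = 0 := by
  have : (‖x‖ ^ 2 - r ^ 2) / (s ^ 2 - r ^ 2) ≤ 0 :=
    div_nonpos_of_nonpos_of_nonneg (by nlinarith [norm_nonneg x]) (by nlinarith)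
  rw [radialCollapse, Real.smoothTransition.zero_of_nonpos this, zero_smul]

theorem radialCollapse_of_ge {r s : ℝ} (hr : 0 ≤ r) (hrs : r < s) {x : 𝔼} (hx : s ≤ ‖x‖) :
    radialCollapse r s x = x := by
  have : 1 ≤ (‖x‖ ^ 2 - r ^ 2) / (s ^ 2 - r ^ 2) := by
    rw [one_le_div (by nlinarith)]
    nlinarith
  rw [radialCollapse, Real.smoothTransition.one_of_one_le this, one_smul]

theorem norm_radialCollapse_le (r s : ℝ) (x : 𝔼) : ‖radialCollapse r s x‖ ≤ ‖x‖ := by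
  rw [radialCollapse, norm_smul, Real.norm_of_nonneg (Real.smoothTransition.nonneg _)]
  exact mul_le_of_le_one_left (norm_nonneg _) (Real.smoothTransition.le_one _)

variable {X : Type*} [TopologicalSpace X] [T2Space X] [SecondCountableTopology X]
  [ChartedSpace (EuclideanSpace ℝ (Fin n)) X] [IsManifold (𝓡 n) ∞ X]

/-- A smooth map that collapses an embedded ball to its centre, is the identity outside a larger
ball, and induces the identity on homology. -/
theorem exists_collapse (Φ : PartialDiffeomorph (𝓡 n) (𝓡 n) 𝔼 X ∞) {R r s : ℝ}
    (hΦ : Φ.source = Metric.ball 0 R) (hr : 0 ≤ r) (hrs : r < s) (hs : s < R) :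
    ∃ C : C^∞⟮𝓡 n, X; 𝓡 n, X⟯, (∀ x, ‖x‖ ≤ r → C (Φ x) = Φ 0) ∧
      (∀ p ∉ Φ '' Metric.ball 0 s, C p = p) ∧
      (∀ x ∈ Metric.ball 0 R, ∃ y, ‖y‖ ≤ ‖x‖ ∧ C (Φ x) = Φ y) ∧
      ∀ k (c : Homology n X (k + 1)), homologyMap C (k + 1) c = c := by
  classical
  have hsource : Metric.closedBall 0 s ⊆ Φ.source := hΦ ▸ Metric.closedBall_subset_ball hs
  have hsR : Metric.ball (0 : 𝔼) s ⊆ Metric.closedBall 0 s := Metric.ball_subset_closedBall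
  let C₀ : X → X := fun p =>
    if p ∈ Φ '' Metric.ball 0 s then Φ (radialCollapse r s (Φ.toPartialEquiv.symm p)) else p
  have hmaps : ∀ x ∈ Φ.source, radialCollapse r s x ∈ Φ.source := by
    intro x hx
    rw [hΦ, mem_ball_zero_iff] at hx ⊢
    exact (norm_radialCollapse_le r s x).trans_lt hx
  have hin : ∀ x ∈ Φ.source, C₀ (Φ x) = Φ (radialCollapse r s x) := by
    intro x hx
    by_cases h : Φ x ∈ Φ '' Metric.ball 0 s
    · simp only [C₀, if_pos h]
      rw [Φ.left_inv hx]
    · simp only [C₀, if_neg h]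
      rw [radialCollapse_of_ge hr hrs]
      by_contra! hlt
      exact h ⟨x, by simpa using hlt, rfl⟩
  have hout : ∀ p ∉ Φ '' Metric.ball 0 s, C₀ p = p := fun p hp => if_neg hp
  have hcl : IsClosed (Φ '' Metric.closedBall 0 s) := (isCompact_image_closedBall Φ hΦ hs).isClosed
  have hsm : ContMDiff (𝓡 n) (𝓡 n) ∞ C₀ := by
    intro p
    by_cases hp : p ∈ Φ.target
    · have h1 : ContMDiffOn (𝓡 n) (𝓡 n) ∞
          (fun p => Φ (radialCollapse r s (Φ.toPartialEquiv.symm p))) Φ.target :=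
        Φ.contMDiffOn.comp ((contDiff_radialCollapse r s).contMDiff.comp_contMDiffOn
          Φ.contMDiffOn_invFun) fun q hq => hmaps _ (Φ.map_target hq)
      refine (h1.contMDiffAt (Φ.open_target.mem_nhds hp)).congr_of_eventuallyEq ?_
      filter_upwards [Φ.open_target.mem_nhds hp] with q hq
      have h2 := hin _ (Φ.map_target hq)
      rwa [Φ.right_inv hq] at h2
    · have hp' : p ∉ Φ '' Metric.closedBall 0 s := by
        rintro ⟨x, hx, rfl⟩
        exact hp (Φ.map_source (hsource hx))
      refine contMDiffAt_id.congr_of_eventuallyEq ?_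
      filter_upwards [hcl.isOpen_compl.mem_nhds hp'] with q hq
      exact hout q fun h => hq (image_mono hsR h)
  obtain ⟨C, hC⟩ : ∃ C : C^∞⟮𝓡 n, X; 𝓡 n, X⟯, ∀ p, C p = C₀ p := ⟨⟨C₀, hsm⟩, fun _ => rfl⟩
  clear_value C₀
  obtain rfl : ⇑C = C₀ := funext hC
  refine ⟨C, fun x hx => ?_, hout, fun x hx => ⟨radialCollapse r s x,
    norm_radialCollapse_le r s x, hin x (hΦ ▸ hx)⟩, fun k c => ?_⟩
  · have hxs : x ∈ Φ.source := hsource (by simpa using hx.trans hrs.le)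

    rw [hin x hxs, radialCollapse_of_le hr hrs hx]
  obtain ⟨P, hP, rfl⟩ := exists_rectifiable_cycle c
  -- The chain is cut along a sphere slightly outside the region that moves. The collapse is then
  -- the identity near the closure of the outer part, and the support of `F - id` lies inside the
  -- open ball of radius `s'`.
  obtain ⟨s', hss', hs'R⟩ := exists_between hs
  have hs'0 : 0 ≤ s' := hr.trans (hrs.le.trans hss'.le)
  have hsource' : Metric.closedBall 0 s' ⊆ Φ.source := hΦ ▸ Metric.closedBall_subset_ball hs'R
  rw [homologyMap_toCycle]
  have hB := measurableSet_borel_of_isOpen (isOpen_image_ball Φ hΦ hs'R.le)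
  have hBc : MeasurableSet[borel X] (Φ '' Metric.ball 0 s')ᶜ :=
    @MeasurableSet.compl X _ (borel X) hB
  have hdecomp := P.current_restrict_add hB hBc
  have hPK := P.inBall_K_subset Φ hΦ hs'R
  let F : C^∞⟮𝓡 n, 𝔼; 𝓡 n, 𝔼⟯ := ⟨radialCollapse r s, (contDiff_radialCollapse r s).contMDiff⟩
  have hFle : ∀ y : 𝔼, ‖y‖ ≤ s' → ‖F y‖ ≤ s' := fun y hy => (norm_radialCollapse_le r s y).trans hy
  obtain ⟨S, hSK, hS⟩ := (P.inBall Φ hΦ hs'R).exists_map_sub_eq_boundary hs'0 hPK F hFle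
    (P.inBall_current_one Φ hΦ hs'R (fun f π _ => by rw [hP]; rfl)) (by
      have h1 : tsupport (fun x : 𝔼 => F x - x) ⊆ Metric.closedBall 0 s := by
        refine closure_minimal (fun x hx => ?_) Metric.isClosed_closedBall
        by_contra hxs
        rw [mem_closedBall_zero_iff, not_le] at hxs
        refine hx ?_
        change radialCollapse r s x - x = 0
        rw [radialCollapse_of_ge hr hrs hxs.le, sub_self]
      exact h1.trans (Metric.closedBall_subset_ball hss'))
  have hmK : ((P.inBall Φ hΦ hs'R).map F).K ⊆ Φ.source := by
    rintro _ ⟨y, hy, rfl⟩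
    exact hsource' (mem_closedBall_zero_iff.2 (hFle y (by simpa using hPK hy)))
  have h1 := RectData.mapOn_sub_eq_boundary _ _ S Φ.open_source Φ.contMDiffOn hmK
    (hPK.trans hsource') (hSK.le.trans hsource') hS
  rw [P.inBall_mapOn_current Φ hΦ hs'R] at h1
  refine cls_eq_of_sub _ (Eq.trans ?_ h1)
  -- Inside, the collapse is the radial map read through `Φ`, to which the Euclidean homotopy
  -- formula applies; outside, nothing changes.
  have e1 : ((P.restrict _ hB).map C).current
      = (((P.inBall Φ hΦ hs'R).map F).mapOn Φ.open_source Φ.contMDiffOn hmK).current := by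
    have hK' : (P.restrict (Φ '' Metric.ball 0 s') hB).K ⊆ Φ.target := by
      refine inter_subset_right.trans ((closure_image_ball_subset Φ hΦ hs'R).trans ?_)
      rintro _ ⟨x, hx, rfl⟩
      exact Φ.map_source (hsource' hx)
    refine (P.restrict _ hB).mapOn_congr (G := C)
      (G' := fun p => Φ (F (Φ.toPartialEquiv.symm p))) isOpen_univ hsm.contMDiffOn
      (subset_univ _) Φ.open_target ?_ hK' Φ.open_target hK' fun p hp => ?_
    · exact Φ.contMDiffOn.comp ((contDiff_radialCollapse r s).contMDiff.comp_contMDiffOn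
          Φ.contMDiffOn_invFun) fun q hq => hmaps _ (Φ.map_target hq)
    · have h2 := hin _ (Φ.map_target hp)
      rwa [Φ.right_inv hp] at h2
  have e2 : ((P.restrict _ hBc).map C).current = (P.restrict _ hBc).current := by
    refine (P.restrict _ hBc).mapOn_eq_self (G := C) isOpen_univ hsm.contMDiffOn (subset_univ _)
      hcl.isOpen_compl ?_ fun p hp => hout p fun h => hp (image_mono hsR h)
    intro p hp hps
    have h3 : closure (Φ '' Metric.ball 0 s')ᶜ = (Φ '' Metric.ball 0 s')ᶜ :=
      (isOpen_image_ball Φ hΦ hs'R.le).isClosed_compl.closure_eq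
    have h4 := hp.2
    rw [h3] at h4
    exact h4 (image_mono (Metric.closedBall_subset_ball hss') hps)
  have e3 : (P.map C).current
      = ((P.restrict _ hB).map C).current + ((P.restrict _ hBc).map C).current := by
    change push _ _ P.current = _
    rw [← hdecomp, map_add]
    rfl
  change (P.map C).current - P.current = _
  rw [e3, e1, e2]
  rw [← hdecomp]
  abel

end Collapse

/-! ### Integration of forms in parametrizations -/

section ChangeOfVariables

variable {n : ℕ} {M : Type*} [TopologicalSpace M] [ChartedSpace (EuclideanSpace ℝ (Fin n)) M]

/-- Change of variables for the integral of a form over a parametrized set. -/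
theorem setIntegral_jac_eq {θ θ' : (Fin n → ℝ) → M} {ψ : (Fin n → ℝ) → Fin n → ℝ}
    {S : Set (Fin n → ℝ)} (hS : MeasurableSet S) (hψ : ∀ x ∈ S, DifferentiableAt ℝ ψ x)
    (hinj : InjOn ψ S) (hθ : ∀ x ∈ S, ∀ᶠ y in 𝓝 x, θ y = θ' (ψ y)) {κ : ℤ} (hκ : κ * κ = 1)
    (hdet : ∀ x ∈ S, 0 < κ * (fderiv ℝ ψ x).det) (f : TestFn n M) (π : Fin n → TestFn n M)
    (hd : ∀ x ∈ S, ∀ a, DifferentiableAt ℝ (fun y => π a (θ' y)) (ψ x)) :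
    ∫ x in S, f (θ x) * jac π θ x = κ * ∫ y in ψ '' S, f (θ' y) * jac π θ' y := by
  rw [integral_image_eq_integral_abs_det_fderiv_smul volume hS
    (fun x hx => (hψ x hx).hasFDerivAt.hasFDerivWithinAt) hinj, ← integral_const_mul]
  refine setIntegral_congr_fun hS fun x hx => ?_
  have h1 : jac π θ x = jac π θ' (ψ x) * (fderiv ℝ ψ x).det := by
    rw [← jac_comp (hd x hx) (hψ x hx)]
    exact jac_congr fun a => (hθ x hx).mono fun y hy => congrArg (π a) hy
  have hκ' : (κ : ℝ) * κ = 1 := by exact_mod_cast hκ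
  have h2 : |(fderiv ℝ ψ x).det| = κ * (fderiv ℝ ψ x).det := by
    rw [← abs_of_pos (hdet x hx), abs_mul]
    have : |(κ : ℝ)| = 1 := by
      rw [← sq_eq_sq₀ (abs_nonneg _) zero_le_one, sq_abs, sq, hκ', one_pow]
    rw [this, one_mul]
  simp only [smul_eq_mul]
  rw [h1, h2, (hθ x hx).self_of_nhds]
  linear_combination (-(f (θ' (ψ x)) * jac π θ' (ψ x) * (fderiv ℝ ψ x).det)) * hκ'

end ChangeOfVariables

theorem measurableSet_inter_preimage_of_continuousOn {A M : Type*} [TopologicalSpace A]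
    [TopologicalSpace M] {φ : A → M} {U : Set A} (hU : IsOpen U) (hφ : ContinuousOn φ U) {B : Set M}
    (hB : MeasurableSet[borel M] B) : MeasurableSet[borel A] (U ∩ φ ⁻¹' B) := by
  borelize M A
  have h1 : MeasurableSet (U.domRestrict φ ⁻¹' B) :=
    (continuousOn_iff_continuous_domRestrict.1 hφ).measurable hB
  have h2 := hU.measurableSet.subtype_image h1
  have h3 : U ∩ φ ⁻¹' B = Subtype.val '' (U.domRestrict φ ⁻¹' B) := by
    ext x
    simp [and_comm]
  rwa [h3]

section ChartIntegral

variable {n : ℕ} {M : Type*} [TopologicalSpace M] [ChartedSpace (EuclideanSpace ℝ (Fin n)) M]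

local notation "𝔼" => EuclideanSpace ℝ (Fin n)

/-- The set in `ℝⁿ` that parametrizes the part of `B` in the range of `Θ`. -/
def chartSet (Θ : PartialDiffeomorph (𝓡 n) (𝓡 n) (EuclideanSpace ℝ (Fin n)) M ∞) (B : Set M) :
    Set (Fin n → ℝ) :=
  {x | WithLp.toLp 2 x ∈ Θ.source ∧ Θ (WithLp.toLp 2 x) ∈ B}

/-- The integral of a form over `B` in the parametrization `Θ`. -/
def chartInt (Θ : PartialDiffeomorph (𝓡 n) (𝓡 n) (EuclideanSpace ℝ (Fin n)) M ∞) (B : Set M)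
    (f : TestFn n M) (π : Fin n → TestFn n M) : ℝ :=
  ∫ x in chartSet Θ B, f (Θ (WithLp.toLp 2 x)) * jac π (fun y => Θ (WithLp.toLp 2 y)) x

variable (Θ Θ' : PartialDiffeomorph (𝓡 n) (𝓡 n) (EuclideanSpace ℝ (Fin n)) M ∞)

theorem isOpen_toLp_preimage : IsOpen {x : Fin n → ℝ | WithLp.toLp 2 x ∈ Θ.source} :=
  Θ.open_source.preimage contDiff_toLp.continuous

theorem contMDiffOn_comp_toLp : ContMDiffOn 𝓘(ℝ, Fin n → ℝ) (𝓡 n) ∞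
    (fun x : Fin n → ℝ => Θ (WithLp.toLp 2 x)) {x | WithLp.toLp 2 x ∈ Θ.source} :=
  Θ.contMDiffOn.comp contDiff_toLp.contMDiff.contMDiffOn fun _ hx => hx

theorem measurableSet_chartSet {B : Set M} (hB : MeasurableSet[borel M] B) :
    MeasurableSet (chartSet Θ B) := by
  have := measurableSet_inter_preimage_of_continuousOn (isOpen_toLp_preimage Θ)
    (contMDiffOn_comp_toLp Θ).continuousOn hB
  rwa [← BorelSpace.measurable_eq] at this

theorem contDiffOn_testFn_comp (g : TestFn n M) :
    ContDiffOn ℝ ∞ (fun x : Fin n → ℝ => g (Θ (WithLp.toLp 2 x))) {x | WithLp.toLp 2 x ∈ Θ.source} := by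
  rw [← contMDiffOn_iff_contDiffOn]
  exact g.contMDiff.comp_contMDiffOn (contMDiffOn_comp_toLp Θ)

theorem continuousOn_jac_comp_toLp (π : Fin n → TestFn n M) :
    ContinuousOn (jac π (fun y => Θ (WithLp.toLp 2 y))) {x | WithLp.toLp 2 x ∈ Θ.source} := by
  unfold jac
  refine (continuous_id.matrix_det).comp_continuousOn ?_
  refine continuousOn_pi.2 fun a => continuousOn_pi.2 fun b => ?_
  exact ((contDiffOn_testFn_comp Θ (π a)).continuousOn_fderiv_of_isOpen (isOpen_toLp_preimage Θ)
    (by simp)).clm_apply continuousOn_const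

theorem isCompact_chartSet {B : Set M} (hB : IsCompact B) (hBt : B ⊆ Θ.target) :
    IsCompact (chartSet Θ B) := by
  have h : chartSet Θ B = WithLp.ofLp '' (Θ.toPartialEquiv.symm '' B) := by
    ext x
    constructor
    · rintro ⟨h1, h2⟩
      exact ⟨_, ⟨_, h2, Θ.left_inv h1⟩, rfl⟩
    · rintro ⟨_, ⟨p, hp, rfl⟩, rfl⟩
      refine ⟨Θ.map_target (hBt hp), ?_⟩
      change Θ (Θ.toPartialEquiv.symm p) ∈ B
      rwa [Θ.right_inv (hBt hp)]
  rw [h]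
  exact (hB.image_of_continuousOn (Θ.contMDiffOn_invFun.continuousOn.mono hBt)).image
    contDiff_ofLp.continuous

theorem integrableOn_chartSet {B : Set M} (hB : IsCompact B) (hBt : B ⊆ Θ.target)
    (f : TestFn n M) (π : Fin n → TestFn n M) :
    IntegrableOn (fun x => f (Θ (WithLp.toLp 2 x)) * jac π (fun y => Θ (WithLp.toLp 2 y)) x)
      (chartSet Θ B) := by
  refine ContinuousOn.integrableOn_compact (isCompact_chartSet Θ hB hBt) ?_
  have hsub : chartSet Θ B ⊆ {x | WithLp.toLp 2 x ∈ Θ.source} := fun x hx => hx.1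
  exact ((contDiffOn_testFn_comp Θ f).continuousOn.mono hsub).mul
    ((continuousOn_jac_comp_toLp Θ π).mono hsub)

theorem det_fderiv_conj_toLp {g : 𝔼 → 𝔼} {x : Fin n → ℝ}
    (hg : DifferentiableAt ℝ g (WithLp.toLp 2 x)) :
    (fderiv ℝ (fun y : Fin n → ℝ => WithLp.ofLp (g (WithLp.toLp 2 y))) x).det
      = (fderiv ℝ g (WithLp.toLp 2 x)).det := by
  have h := ((EuclideanSpace.equiv (Fin n) ℝ : 𝔼 →L[ℝ] (Fin n → ℝ)).hasFDerivAt
    (x := g (WithLp.toLp 2 x))).comp x (hg.hasFDerivAt.comp x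
    ((EuclideanSpace.equiv (Fin n) ℝ).symm : (Fin n → ℝ) →L[ℝ] 𝔼).hasFDerivAt)
  have h' := h.fderiv
  have h'' : fderiv ℝ (fun y : Fin n → ℝ => WithLp.ofLp (g (WithLp.toLp 2 y))) x = _ := h'
  rw [h'', ContinuousLinearMap.det, ContinuousLinearMap.det]
  exact LinearMap.det_conj (fderiv ℝ g (WithLp.toLp 2 x)).toLinearMap
    (EuclideanSpace.equiv (Fin n) ℝ).toLinearEquiv

theorem contDiffOn_transition : ContDiffOn ℝ ∞ (fun z => Θ'.toPartialEquiv.symm (Θ z))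
    (Θ.source ∩ Θ ⁻¹' Θ'.target) := by
  rw [← contMDiffOn_iff_contDiffOn]
  exact Θ'.contMDiffOn_invFun.comp (Θ.contMDiffOn.mono inter_subset_left) fun z hz => hz.2

theorem isOpen_transition : IsOpen (Θ.source ∩ Θ ⁻¹' Θ'.target) :=
  Θ.contMDiffOn.continuousOn.isOpen_inter_preimage Θ.open_source Θ'.open_target

theorem differentiableAt_transition {z : 𝔼} (hz : z ∈ Θ.source) (hz' : Θ z ∈ Θ'.target) :
    DifferentiableAt ℝ (fun z => Θ'.toPartialEquiv.symm (Θ z)) z :=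
  ((contDiffOn_transition Θ Θ').contDiffAt
    ((isOpen_transition Θ Θ').mem_nhds ⟨hz, hz'⟩)).differentiableAt (by simp)

/-- The integral of a form does not depend on the parametrization, up to orientation. -/
theorem chartInt_eq {B : Set M} (hB : MeasurableSet[borel M] B) (hBΘ : B ⊆ Θ.target)
    (hBΘ' : B ⊆ Θ'.target) {κ : ℤ}
    (hκ : κ * κ = 1) (hdet : ∀ z ∈ Θ.source, Θ z ∈ Θ'.target →
      0 < κ * (fderiv ℝ (fun z => Θ'.toPartialEquiv.symm (Θ z)) z).det)
    (f : TestFn n M) (π : Fin n → TestFn n M) :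
    chartInt Θ B f π = κ * chartInt Θ' B f π := by
  let ψ : (Fin n → ℝ) → Fin n → ℝ := fun x =>
    WithLp.ofLp (Θ'.toPartialEquiv.symm (Θ (WithLp.toLp 2 x)))
  have himage : ψ '' chartSet Θ B = chartSet Θ' B := by
    ext y
    constructor
    · rintro ⟨x, ⟨h1, h2⟩, rfl⟩
      refine ⟨Θ'.map_target (hBΘ' h2), ?_⟩
      change Θ' (Θ'.toPartialEquiv.symm (Θ (WithLp.toLp 2 x))) ∈ B
      rwa [Θ'.right_inv (hBΘ' h2)]
    · rintro ⟨h1, h2⟩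
      refine ⟨WithLp.ofLp (Θ.toPartialEquiv.symm (Θ' (WithLp.toLp 2 y))),
        ⟨Θ.map_target (hBΘ h2), ?_⟩, ?_⟩
      · change Θ (Θ.toPartialEquiv.symm (Θ' (WithLp.toLp 2 y))) ∈ B
        rwa [Θ.right_inv (hBΘ h2)]
      · change WithLp.ofLp (Θ'.toPartialEquiv.symm (Θ (Θ.toPartialEquiv.symm
          (Θ' (WithLp.toLp 2 y))))) = y
        rw [Θ.right_inv (hBΘ h2), Θ'.left_inv h1]
  have hnear : ∀ x ∈ chartSet Θ B, ∀ᶠ y in 𝓝 x,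
      WithLp.toLp 2 y ∈ Θ.source ∩ Θ ⁻¹' Θ'.target := fun x hx =>
    contDiff_toLp.continuous.continuousAt.preimage_mem_nhds
      ((isOpen_transition Θ Θ').mem_nhds ⟨hx.1, hBΘ' hx.2⟩)
  unfold chartInt
  rw [← himage]
  refine setIntegral_jac_eq (ψ := ψ) (measurableSet_chartSet Θ hB) (fun x hx => ?_) ?_
    (fun x hx => ?_) hκ (fun x hx => ?_) f π fun x hx a => ?_
  · exact (contDiff_ofLp.differentiable (by simp)).differentiableAt.comp x
      ((differentiableAt_transition Θ Θ' hx.1 (hBΘ' hx.2)).comp x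
        (contDiff_toLp.differentiable (by simp)).differentiableAt)
  · intro x hx x' hx' h
    have h1 : Θ (WithLp.toLp 2 x) = Θ (WithLp.toLp 2 x') :=
      Θ'.toPartialEquiv.symm.injOn (hBΘ' hx.2) (hBΘ' hx'.2) (WithLp.ofLp_injective 2 h)
    exact WithLp.toLp_injective 2 (Θ.injOn hx.1 hx'.1 h1)
  · filter_upwards [hnear x hx] with y hy
    exact (Θ'.right_inv hy.2).symm
  · rw [det_fderiv_conj_toLp (g := fun z => Θ'.toPartialEquiv.symm (Θ z))
      (differentiableAt_transition Θ Θ' hx.1 (hBΘ' hx.2))]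
    exact hdet _ hx.1 (hBΘ' hx.2)
  · have h1 : ψ x ∈ {x | WithLp.toLp 2 x ∈ Θ'.source} := Θ'.map_target (hBΘ' hx.2)
    exact ((contDiffOn_testFn_comp Θ' (π a)).contDiffAt
      ((isOpen_toLp_preimage Θ').mem_nhds h1)).differentiableAt (by simp)

end ChartIntegral

namespace RectData

variable {n k : ℕ} {M : Type*} [TopologicalSpace M] [ChartedSpace (EuclideanSpace ℝ (Fin n)) M]

/-- Multiplication of all multiplicities by an integer. -/
def smul (c : ℤ) (P : RectData n M k) : RectData n M k where
  __ := P
  m := fun j => c * P.m j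
  mass_finite π := by
    simp only [Int.cast_mul, mul_assoc, enorm_mul]
    have h : ∀ j, ∫⁻ x in P.E j, ‖(c : ℝ)‖ₑ * (‖(P.m j : ℝ)‖ₑ * ‖jac π (P.φ j) x‖ₑ)
        = ‖(c : ℝ)‖ₑ * ∫⁻ x in P.E j, ‖(P.m j : ℝ)‖ₑ * ‖jac π (P.φ j) x‖ₑ := fun j =>
      lintegral_const_mul' _ _ enorm_ne_top
    rw [tsum_congr h, ENNReal.tsum_mul_left]
    refine ENNReal.mul_ne_top enorm_ne_top ?_
    simpa only [enorm_mul] using P.mass_finite π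

theorem smul_current (c : ℤ) (P : RectData n M k) (f : TestFn n M) (π : Fin k → TestFn n M) :
    (P.smul c).current f π = c * P.current f π := by
  unfold current
  rw [← tsum_mul_left]
  refine tsum_congr fun j => ?_
  rw [← integral_const_mul]
  refine integral_congr_ae (Eventually.of_forall fun x => ?_)
  simp only [smul, Int.cast_mul]
  ring

end RectData

/-! ### Oriented tilings and the fundamental cycle -/

section Stokes

variable {n : ℕ} {M : Type*} [TopologicalSpace M] [ChartedSpace (EuclideanSpace ℝ (Fin n)) M]

local notation "𝔼" => EuclideanSpace ℝ (Fin n)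

variable (Θ : PartialDiffeomorph (𝓡 n) (𝓡 n) (EuclideanSpace ℝ (Fin n)) M ∞)

/-- Stokes' theorem in one parametrization. The pull-back of `π a₀` has compact support. The other
functions are pulled back only near that support, and away from it the row of `a₀` makes the
determinant vanish. -/
theorem chartInt_one_eq_zero (π : Fin n → TestFn n M) (a₀ : Fin n)
    (hc : IsCompact (tsupport (π a₀))) (hs : tsupport (π a₀) ⊆ Θ.target) :
    chartInt Θ (tsupport (π a₀)) 1 π = 0 := by
  have hK : IsCompact (Θ.toPartialEquiv.symm '' tsupport (π a₀)) :=
    hc.image_of_continuousOn (Θ.contMDiffOn_invFun.continuousOn.mono hs)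
  have hKs : Θ.toPartialEquiv.symm '' tsupport (π a₀) ⊆ Θ.source := by
    rintro _ ⟨p, hp, rfl⟩
    exact Θ.map_target (hs hp)
  choose g hg hg0 using fun a => exists_pullback_near hK Θ.open_source hKs Θ.contMDiffOn (π a)
  let G : Fin n → (Fin n → ℝ) → ℝ := fun a x => g a (WithLp.toLp 2 x)
  have hG : ∀ a, ContDiff ℝ ∞ (G a) := fun a => (TestFn.contDiff (g a)).comp contDiff_toLp
  have hcomp := isCompact_chartSet Θ hc hs
  have hG0 : ∀ x ∉ chartSet Θ (tsupport (π a₀)), G a₀ x = 0 := by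
    intro x hx
    by_contra hne
    obtain ⟨h1, h2⟩ := hg0 a₀ _ hne
    exact hx ⟨h1, subset_tsupport _ h2⟩
  have hstokes := integral_det_fderiv_eq_zero hG a₀ (HasCompactSupport.intro hcomp hG0)
  rw [← hstokes, ← setIntegral_eq_integral_of_forall_compl_eq_zero
    (s := chartSet Θ (tsupport (π a₀)))]
  · refine setIntegral_congr_fun hcomp.measurableSet fun x hx => ?_
    change 1 * jac π _ x = _
    rw [one_mul, jac]
    congr 1
    ext a b
    simp only [Matrix.of_apply]
    have h1 : (fun y : Fin n → ℝ => π a (Θ (WithLp.toLp 2 y))) =ᶠ[𝓝 x] G a := by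
      have hx' : WithLp.toLp 2 x ∈ Θ.toPartialEquiv.symm '' tsupport (π a₀) :=
        ⟨_, hx.2, Θ.left_inv hx.1⟩
      filter_upwards [contDiff_toLp.continuous.continuousAt.eventually
        (eventually_nhdsSet_iff_forall.1 (hg a) _ hx')] with y hy
      exact hy.symm
    rw [h1.fderiv_eq]
  · intro x hx
    refine Matrix.det_eq_zero_of_row_eq_zero a₀ fun b => ?_
    have h1 : G a₀ =ᶠ[𝓝 x] fun _ => 0 := by
      filter_upwards [hcomp.isClosed.isOpen_compl.mem_nhds hx] with y hy
      exact hG0 y hy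
    simp only [Matrix.of_apply]
    rw [h1.fderiv_eq]
    simp

end Stokes

section Tiles

variable {n : ℕ} {M : Type*} [TopologicalSpace M] [ChartedSpace (EuclideanSpace ℝ (Fin n)) M]

local notation "𝔼" => EuclideanSpace ℝ (Fin n)

/-- The rectifiable current made of finitely many parametrized Borel sets. -/
theorem exists_rectData_of_tiles {N : ℕ} (Θ : Fin N → PartialDiffeomorph (𝓡 n) (𝓡 n) 𝔼 M ∞)
    {B C : Fin N → Set M} (hB : ∀ l, MeasurableSet[borel M] (B l)) (hC : ∀ l, IsCompact (C l))
    (hBC : ∀ l, B l ⊆ C l) (hCt : ∀ l, C l ⊆ (Θ l).target) :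
    ∃ F : RectData n M n, ∀ (B' : Set M) (hB' : MeasurableSet[borel M] B') f π,
      (F.restrict B' hB').current f π = ∑ l, chartInt (Θ l) (B l ∩ B') f π := by
  let F : RectData n M n :=
    { ι := Fin N
      countable := inferInstance
      U := fun l => {x | WithLp.toLp 2 x ∈ (Θ l).source}
      E := fun l => chartSet (Θ l) (B l)
      φ := fun l x => Θ l (WithLp.toLp 2 x)
      m := fun _ => 1
      K := ⋃ l, C l
      isOpen_U := fun l => isOpen_toLp_preimage (Θ l)
      measurableSet_E := fun l => measurableSet_chartSet (Θ l) (hB l)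
      E_subset := fun l x hx => hx.1
      contMDiffOn := fun l => (contMDiffOn_comp_toLp (Θ l)).of_le (by simp)
      isCompact_K := isCompact_iUnion hC
      mapsTo := fun l x hx => mem_iUnion.2 ⟨l, hBC l hx.2⟩
      mass_finite := fun π => by
        rw [tsum_fintype]
        refine ENNReal.sum_ne_top.2 fun l _ => ?_
        have h1 := (integrableOn_chartSet (Θ l) (hC l) (hCt l) 1 π).mono_set
          (s := chartSet (Θ l) (B l)) fun x hx => ⟨hx.1, hBC l hx.2⟩
        refine ne_of_eq_of_ne (lintegral_congr fun x => ?_) h1.2.ne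
        congr 1
        simp }
  refine ⟨F, fun B' hB' f π => ?_⟩
  have hsum : (F.restrict B' hB').current f π = ∑' l : Fin N, ∫ x in chartSet (Θ l) (B l) ∩
      (fun x => Θ l (WithLp.toLp 2 x)) ⁻¹' B', ((1 : ℤ) : ℝ) * (f (Θ l (WithLp.toLp 2 x))
        * jac π (fun y => Θ l (WithLp.toLp 2 y)) x) := rfl
  rw [hsum, tsum_fintype]
  refine Finset.sum_congr rfl fun l _ => ?_
  have h1 : chartSet (Θ l) (B l) ∩ (fun x => Θ l (WithLp.toLp 2 x)) ⁻¹' B'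
      = chartSet (Θ l) (B l ∩ B') := by
    ext x
    simp [chartSet, and_assoc]
  unfold chartInt
  rw [← h1]
  refine integral_congr_ae (Eventually.of_forall fun x => ?_)
  simp

/-- The parametrizations are inverses of oriented charts. The compact sets inside their targets,
finitely many by compactness of `M`, make all integrals over the tiles finite. -/
theorem exists_oriented_cover [T2Space M] [CompactSpace M] [IsManifold (𝓡 n) ∞ M]
    (hM : IsOrientable n M) :
    ∃ (N : ℕ) (Θ : Fin N → PartialDiffeomorph (𝓡 n) (𝓡 n) 𝔼 M ∞) (C : Fin N → Set M),
      (∀ l, IsCompact (C l)) ∧ (∀ l, C l ⊆ (Θ l).target) ∧ (∀ p, ∃ l, p ∈ C l) ∧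
      ∀ l l', ∀ z ∈ (Θ l).source, Θ l z ∈ (Θ l').target →
        0 < (fderiv ℝ (fun z => (Θ l').toPartialEquiv.symm (Θ l z)) z).det := by
  obtain ⟨A, hA, hcov, hdet⟩ := hM
  choose e heA he using hcov
  have hnb : ∀ p, ∃ C : Set M, IsCompact C ∧ C ∈ 𝓝 p ∧ C ⊆ (e p).source := fun p => by
    obtain ⟨C, hC, h1, h2⟩ := exists_compact_subset (e p).open_source (he p)
    exact ⟨C, hC, mem_interior_iff_mem_nhds.1 h1, h2⟩
  choose C hC hCn hCs using hnb
  obtain ⟨t, -, ht⟩ := isCompact_univ.elim_nhds_subcover C fun p _ => hCn p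
  let q : Fin t.card → M := fun l => (t.equivFin.symm l : M)
  let Θ : M → PartialDiffeomorph (𝓡 n) (𝓡 n) 𝔼 M ∞ := fun p =>
    ⟨(e p).symm.toPartialEquiv, (e p).open_target, (e p).open_source,
      contMDiffOn_symm_of_mem_maximalAtlas (hA (heA p)),
      contMDiffOn_of_mem_maximalAtlas (hA (heA p))⟩
  refine ⟨t.card, fun l => Θ (q l), fun l => C (q l), fun l => hC _, fun l => hCs _, fun p => ?_,
    fun l l' z hz hz' => ?_⟩
  · obtain ⟨p', hp', hpC⟩ := mem_iUnion₂.1 (ht (mem_univ p))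
    exact ⟨t.equivFin ⟨p', hp'⟩, by simpa [q] using hpC⟩
  · refine hdet (e (q l)) (heA _) (e (q l')) (heA _) z ?_
    rw [OpenPartialHomeomorph.trans_source]
    exact ⟨hz, hz'⟩

theorem det_fderiv_transition_mul (Θ₁ Θ₂ Θ₃ : PartialDiffeomorph (𝓡 n) (𝓡 n) 𝔼 M ∞) {z : 𝔼}
    (hz : z ∈ Θ₁.source) (h2 : Θ₁ z ∈ Θ₂.target) (h3 : Θ₁ z ∈ Θ₃.target) :
    (fderiv ℝ (fun z => Θ₃.toPartialEquiv.symm (Θ₁ z)) z).det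
      = (fderiv ℝ (fun z => Θ₃.toPartialEquiv.symm (Θ₂ z)) (Θ₂.toPartialEquiv.symm (Θ₁ z))).det
        * (fderiv ℝ (fun z => Θ₂.toPartialEquiv.symm (Θ₁ z)) z).det := by
  have h1 : (fun z => Θ₃.toPartialEquiv.symm (Θ₁ z)) =ᶠ[𝓝 z]
      (fun z => Θ₃.toPartialEquiv.symm (Θ₂ z)) ∘ fun z => Θ₂.toPartialEquiv.symm (Θ₁ z) := by
    filter_upwards [(isOpen_transition Θ₁ Θ₂).mem_nhds ⟨hz, h2⟩] with w hw
    exact congrArg Θ₃.toPartialEquiv.symm (Θ₂.right_inv hw.2).symm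
  have h4 : Θ₂ (Θ₂.toPartialEquiv.symm (Θ₁ z)) = Θ₁ z := Θ₂.right_inv h2
  rw [h1.fderiv_eq, fderiv_comp z (differentiableAt_transition Θ₂ Θ₃ (Θ₂.map_target h2)
    (by rw [h4]; exact h3)) (differentiableAt_transition Θ₁ Θ₂ hz h2)]
  exact LinearMap.det_comp _ _

theorem det_fderiv_transition_ne_zero (Θ₁ Θ₂ : PartialDiffeomorph (𝓡 n) (𝓡 n) 𝔼 M ∞) {z : 𝔼}
    (hz : z ∈ Θ₁.source) (h2 : Θ₁ z ∈ Θ₂.target) :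
    (fderiv ℝ (fun z => Θ₂.toPartialEquiv.symm (Θ₁ z)) z).det ≠ 0 := by
  have h := det_fderiv_transition_mul Θ₁ Θ₂ Θ₁ hz h2 (Θ₁.map_source hz)
  have h1 : (fun z => Θ₁.toPartialEquiv.symm (Θ₁ z)) =ᶠ[𝓝 z] id := by
    filter_upwards [Θ₁.open_source.mem_nhds hz] with w hw
    exact Θ₁.left_inv hw
  rw [h1.fderiv_eq, fderiv_id] at h
  intro h0
  rw [h0, mul_zero, ContinuousLinearMap.det] at h
  simp at h

/-- A parametrization of a connected set either preserves or reverses the orientation. -/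
theorem exists_orientation_sign {N : ℕ} (Θ : Fin N → PartialDiffeomorph (𝓡 n) (𝓡 n) 𝔼 M ∞)
    (hcov : ∀ p, ∃ l, p ∈ (Θ l).target)
    (hor : ∀ l l', ∀ z ∈ (Θ l).source, Θ l z ∈ (Θ l').target →
        0 < (fderiv ℝ (fun z => (Θ l').toPartialEquiv.symm (Θ l z)) z).det)
    (Φ : PartialDiffeomorph (𝓡 n) (𝓡 n) 𝔼 M ∞) (hΦ : IsPreconnected Φ.source) :
    ∃ κ : ℤ, κ * κ = 1 ∧ ∀ l, ∀ z ∈ Φ.source, Φ z ∈ (Θ l).target →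
      0 < κ * (fderiv ℝ (fun z => (Θ l).toPartialEquiv.symm (Φ z)) z).det := by
  let δ : Fin N → 𝔼 → ℝ := fun l z => (fderiv ℝ (fun z => (Θ l).toPartialEquiv.symm (Φ z)) z).det
  have hcont : ∀ l, ContinuousOn (δ l) (Φ.source ∩ Φ ⁻¹' (Θ l).target) := fun l => by
    have := (contDiffOn_transition Φ (Θ l)).continuousOn_fderiv_of_isOpen
      (isOpen_transition Φ (Θ l)) (by simp)
    exact ContinuousLinearMap.continuous_det.comp_continuousOn this
  have hopen : ∀ c : ℝ, IsOpen {z | ∃ l, z ∈ Φ.source ∩ Φ ⁻¹' (Θ l).target ∧ 0 < c * δ l z} := by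
    intro c
    have : {z | ∃ l, z ∈ Φ.source ∩ Φ ⁻¹' (Θ l).target ∧ 0 < c * δ l z}
        = ⋃ l, (Φ.source ∩ Φ ⁻¹' (Θ l).target) ∩ (fun z => c * δ l z) ⁻¹' Ioi 0 := by
      ext z
      simp
    rw [this]
    exact isOpen_iUnion fun l => ((continuousOn_const.mul (hcont l)).isOpen_inter_preimage
      (isOpen_transition Φ (Θ l)) isOpen_Ioi)
  have hsame : ∀ l l' z, z ∈ Φ.source → Φ z ∈ (Θ l).target → Φ z ∈ (Θ l').target → ∀ c : ℝ,
      0 < c * δ l z → 0 < c * δ l' z := by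
    intro l l' z hz h1 h2 c hc
    have h3 := det_fderiv_transition_mul Φ (Θ l) (Θ l') hz h1 h2
    have h4 : Θ l ((Θ l).toPartialEquiv.symm (Φ z)) = Φ z := (Θ l).right_inv h1
    have h5 := hor l l' _ ((Θ l).map_target h1) (by rw [h4]; exact h2)
    have h6 : c * δ l' z = (fderiv ℝ (fun z => (Θ l').toPartialEquiv.symm (Θ l z))
      ((Θ l).toPartialEquiv.symm (Φ z))).det * (c * δ l z) := by
      simp only [δ]
      rw [h3]
      ring
    rw [h6]
    exact mul_pos h5 hc
  -- By `hsame` the sign does not depend on the oriented chart used to test it. The sets of positive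
  -- and of negative sign are open, disjoint and cover the preconnected source.
  have hdisj : Disjoint {z | ∃ l, z ∈ Φ.source ∩ Φ ⁻¹' (Θ l).target ∧ 0 < (1 : ℝ) * δ l z}
      {z | ∃ l, z ∈ Φ.source ∩ Φ ⁻¹' (Θ l).target ∧ 0 < (-1 : ℝ) * δ l z} := by
    rw [disjoint_left]
    rintro z ⟨l, ⟨hz, h1⟩, h2⟩ ⟨l', ⟨-, h1'⟩, h2'⟩
    have := hsame l l' z hz h1 h1' 1 h2
    linarith
  have hsub : Φ.source ⊆ {z | ∃ l, z ∈ Φ.source ∩ Φ ⁻¹' (Θ l).target ∧ 0 < (1 : ℝ) * δ l z}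
      ∪ {z | ∃ l, z ∈ Φ.source ∩ Φ ⁻¹' (Θ l).target ∧ 0 < (-1 : ℝ) * δ l z} := by
    intro z hz
    obtain ⟨l, hl⟩ := hcov (Φ z)
    rcases lt_or_gt_of_ne (det_fderiv_transition_ne_zero Φ (Θ l) hz hl) with h | h
    · exact Or.inr ⟨l, ⟨hz, hl⟩, by linarith⟩
    · exact Or.inl ⟨l, ⟨hz, hl⟩, by linarith⟩
  rcases hΦ.subset_or_subset (hopen 1) (hopen (-1)) hdisj hsub with h | h
  · refine ⟨1, by norm_num, fun l z hz hzl => ?_⟩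
    obtain ⟨l', ⟨-, h1⟩, h2⟩ := h hz
    have := hsame l' l z hz h1 hzl 1 h2
    exact_mod_cast this
  · refine ⟨-1, by norm_num, fun l z hz hzl => ?_⟩
    obtain ⟨l', ⟨-, h1⟩, h2⟩ := h hz
    have := hsame l' l z hz h1 hzl (-1) h2
    exact_mod_cast this

end Tiles

section Fundamental

variable {k : ℕ} {Y : Type*} [TopologicalSpace Y] [T2Space Y] [CompactSpace Y]
  [SecondCountableTopology Y]
  [ChartedSpace (EuclideanSpace ℝ (Fin (k + 1))) Y] [IsManifold (𝓡 (k + 1)) ∞ Y]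

local notation "𝔼" => EuclideanSpace ℝ (Fin (k + 1))

/-- The multiples of the fundamental class of a closed oriented manifold: cycles of top dimension
that have a given multiplicity in a given connected chart. -/
theorem exists_fundamental_cycle (hY : IsOrientable (k + 1) Y)
    (Φ : PartialDiffeomorph (𝓡 (k + 1)) (𝓡 (k + 1)) 𝔼 Y ∞) (hΦ : IsPreconnected Φ.source) (μ : ℤ) :
    ∃ F : RectData (k + 1) Y (k + 1), boundary (k + 1) Y k F.current = 0 ∧
      ∀ (B : Set Y) (hB : MeasurableSet[borel Y] B) (C : Set Y), IsCompact C → B ⊆ C →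
        C ⊆ Φ.target → ∀ f π, (F.restrict B hB).current f π = μ * chartInt Φ B f π := by
  obtain ⟨N, Θ, C, hC, hCt, hcov, hor⟩ := exists_oriented_cover hY
  -- Removing the earlier sets makes the cover a partition into Borel tiles, so every point is
  -- counted once.
  let B : Fin N → Set Y := fun l => C l \ ⋃ l' : {l' // l' < l}, C l'
  have hBm : ∀ l, MeasurableSet[borel Y] (B l) := fun l => by
    borelize Y
    exact (hC l).isClosed.measurableSet.diff
      (MeasurableSet.iUnion fun l' => (hC l').isClosed.measurableSet)
  have hBdisj : Pairwise (Function.onFun Disjoint B) := by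
    have h1 : ∀ l l', l < l' → Disjoint (B l) (B l') := fun l l' h =>
      disjoint_left.2 fun p hp hp' => hp'.2 (mem_iUnion.2 ⟨⟨l, h⟩, hp.1⟩)
    intro l l' h
    rcases lt_or_gt_of_ne h with h | h
    · exact h1 _ _ h
    · exact (h1 _ _ h).symm
  have hBcov : ∀ p, ∃ l, p ∈ B l := by
    classical
    intro p
    obtain ⟨l, hl⟩ := hcov p
    let T : Finset (Fin N) := Finset.univ.filter fun l => p ∈ C l
    have hT : T.Nonempty := ⟨l, by simp [T, hl]⟩
    have hmin := T.min'_mem hT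
    refine ⟨T.min' hT, by simpa [T] using hmin, fun h => ?_⟩
    obtain ⟨⟨l', hl'⟩, hp⟩ := mem_iUnion.1 h
    exact absurd (T.min'_le l' (by simpa [T] using hp)) (not_le.2 hl')
  obtain ⟨F, hF⟩ := exists_rectData_of_tiles Θ hBm hC (fun l => sdiff_subset) hCt
  -- In any parametrization of constant sign `κ` the tiled current is `κ` times integration over the
  -- parametrized set; the artificial edges of the tiles leave no trace.
  have hlocal : ∀ (Θ' : PartialDiffeomorph (𝓡 (k + 1)) (𝓡 (k + 1)) 𝔼 Y ∞) (κ : ℤ), κ * κ = 1 →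
      (∀ l, ∀ z ∈ Θ'.source, Θ' z ∈ (Θ l).target →
        0 < κ * (fderiv ℝ (fun z => (Θ l).toPartialEquiv.symm (Θ' z)) z).det) →
      ∀ (B' : Set Y) (hB' : MeasurableSet[borel Y] B') (C' : Set Y), IsCompact C' → B' ⊆ C' →
        C' ⊆ Θ'.target → ∀ f π, (F.restrict B' hB').current f π = κ * chartInt Θ' B' f π := by
    intro Θ' κ hκ hsign B' hB' C' hC' hBC' hCt' f π
    have hκ' : (κ : ℝ) * κ = 1 := by exact_mod_cast hκ
    have hm : ∀ l, MeasurableSet[borel Y] (B l ∩ B') := fun l => by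
      borelize Y
      exact (hBm l).inter hB'
    have h1 : ∀ l, chartInt (Θ l) (B l ∩ B') f π = κ * chartInt Θ' (B l ∩ B') f π := fun l => by
      rw [chartInt_eq Θ' (Θ l) (hm l) (inter_subset_right.trans (hBC'.trans hCt'))
        (inter_subset_left.trans (sdiff_subset.trans (hCt l))) hκ (hsign l), ← mul_assoc, hκ', one_mul]
    rw [hF, Finset.sum_congr rfl fun l _ => h1 l, ← Finset.mul_sum]
    congr 1
    have h2 : chartSet Θ' B' = ⋃ l, chartSet Θ' (B l ∩ B') := by
      ext x
      simp only [chartSet, mem_iUnion, mem_ofPred_eq, mem_inter_iff]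
      constructor
      · rintro ⟨h3, h4⟩
        obtain ⟨l, hl⟩ := hBcov (Θ' (WithLp.toLp 2 x))
        exact ⟨l, h3, hl, h4⟩
      · rintro ⟨l, h3, -, h4⟩
        exact ⟨h3, h4⟩
    unfold chartInt
    rw [h2, integral_iUnion_fintype (fun l => measurableSet_chartSet Θ' (hm l))]
    · intro l l' hll'
      exact disjoint_left.2 fun x hx hx' => disjoint_left.1 (hBdisj hll') hx.2.1 hx'.2.1
    · intro l
      exact (integrableOn_chartSet Θ' hC' hCt' f π).mono_set fun x hx => ⟨hx.1, hBC' hx.2.2⟩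
  have hcyc : boundary (k + 1) Y k F.current = 0 := by
    have hflat : boundary (k + 1) Y k F.current ∈ flatChains (k + 1) Y k :=
      AddSubgroup.mem_sup_right ⟨_, ⟨F, rfl⟩, rfl⟩
    funext f π
    -- A flat chain with empty support is zero, so the boundary need only be tested on forms
    -- supported in one oriented chart, where Stokes' theorem applies.
    refine eq_zero_of_disjoint_spt hflat f π (disjoint_left.2 fun p _ hp => ?_)
    obtain ⟨l, hl⟩ := hcov p
    obtain ⟨g, ϖ, hg, hne⟩ := hp (Θ l).target (Θ l).open_target (hCt l hl)
    refine hne ?_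
    change F.current 1 (Fin.cons g ϖ) = 0
    have hclosed := isClosed_tsupport ((Fin.cons g ϖ : Fin (k + 1) → TestFn (k + 1) Y) 0)
    have hm : MeasurableSet[borel Y] (tsupport ((Fin.cons g ϖ : Fin (k + 1) → TestFn (k + 1) Y) 0)) := by
      borelize Y
      exact hclosed.measurableSet
    rw [← F.current_restrict_of_forall hm (by borelize Y; exact hm.compl), hlocal (Θ l) 1 (by norm_num)
      (fun l' z hz hz' => by simpa using hor l l' z hz hz') _ hm _ hclosed.isCompact subset_rfl hg,
      chartInt_one_eq_zero (Θ l) _ 0 hclosed.isCompact hg, mul_zero]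
    intro j x hx hxs
    rw [jac_eq_zero 0 0, mul_zero]
    exact (F.continuousAt_φ hx).eventually (notMem_tsupport_iff_eventuallyEq.1 hxs)
  obtain ⟨κ, hκ, hsign⟩ := exists_orientation_sign Θ
    (fun p => (hcov p).imp fun l hl => hCt l hl) hor Φ hΦ
  -- The factor `κ` compensates for the orientation of the prescribed chart, since `κ * κ = 1`.
  refine ⟨F.smul (μ * κ), ?_, fun B' hB' C' hC' hBC hCt' f π => ?_⟩
  · funext f π
    refine (F.smul_current (μ * κ) 1 (Fin.cons f π)).trans ?_
    have : F.current 1 (Fin.cons f π) = 0 := congrFun (congrFun hcyc f) π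
    rw [this, mul_zero]
    rfl
  · refine ((F.restrict B' hB').smul_current (μ * κ) f π).trans ?_
    rw [hlocal Φ κ hκ hsign B' hB' C' hC' hBC hCt' f π]
    have hκ' : (κ : ℝ) * κ = 1 := by exact_mod_cast hκ
    push_cast
    linear_combination (μ * chartInt Φ B' f π) * hκ'

end Fundamental

/-! ### Integer multiplicity in an embedded ball -/

section Multiplicity

variable {k : ℕ} {X : Type*} [TopologicalSpace X] [T2Space X] [SecondCountableTopology X]
  [ChartedSpace (EuclideanSpace ℝ (Fin (k + 1))) X] [IsManifold (𝓡 (k + 1)) ∞ X]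

local notation "𝔼" => EuclideanSpace ℝ (Fin (k + 1))

/-- A chain of top dimension without boundary in an embedded ball has constant multiplicity there. -/
theorem RectData.exists_multiplicity_inBall (S : RectData (k + 1) X (k + 1))
    (Φ : PartialDiffeomorph (𝓡 (k + 1)) (𝓡 (k + 1)) 𝔼 X ∞) {R s : ℝ}
    (hΦ : Φ.source = Metric.ball 0 R) (hs0 : 0 < s) (hs : s < R)
    (h : ∀ (f : TestFn (k + 1) X) π, tsupport f ⊆ Φ '' Metric.ball 0 s →
      boundary (k + 1) X k S.current f π = 0) :
    ∃ m : ℤ, ∀ (B : Set X) (hB : MeasurableSet[borel X] B), B ⊆ Φ '' Metric.ball 0 s → ∀ f π,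
      (S.restrict B hB).current f π = m * chartInt Φ B f π := by
  obtain ⟨m, hm⟩ := (S.inBall Φ hΦ hs).exists_multiplicity hs0 (S.inBall_current_one Φ hΦ hs h)
  refine ⟨m, fun B hB hBs f π => ?_⟩
  have hsource : Metric.closedBall 0 s ⊆ Φ.source := hΦ ▸ Metric.closedBall_subset_ball hs
  have hsource' : Metric.ball 0 s ⊆ Φ.source := Metric.ball_subset_closedBall.trans hsource
  obtain ⟨f', hf', -⟩ := exists_pullback_near (isCompact_closedBall (0 : 𝔼) s) Φ.open_source hsource
    Φ.contMDiffOn f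
  choose π' hπ' _ using fun a => exists_pullback_near (isCompact_closedBall (0 : 𝔼) s)
    Φ.open_source hsource Φ.contMDiffOn (π a)
  have hBb : MeasurableSet[borel 𝔼] (Φ.source ∩ Φ ⁻¹' B) :=
    measurableSet_inter_preimage_of_continuousOn Φ.open_source Φ.contMDiffOn.continuousOn hB
  have hBbs : Φ.source ∩ Φ ⁻¹' B ⊆ Metric.ball 0 s := by
    rintro z ⟨hz, hzB⟩
    obtain ⟨w, hw, hwz⟩ := hBs hzB
    rwa [← Φ.injOn (hsource' hw) hz hwz]
  have hK : (S.restrict B hB).K ⊆ Φ '' Metric.closedBall 0 s :=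
    inter_subset_right.trans ((closure_mono hBs).trans (closure_image_ball_subset Φ hΦ hs))
  have hKt : (S.restrict B hB).K ⊆ Φ.target := hK.trans (by
    rintro _ ⟨x, hx, rfl⟩
    exact Φ.map_source (hsource hx))
  have hnear : ∀ (g : TestFn (k + 1) X) (g' : TestFn (k + 1) 𝔼),
      (∀ᶠ x in 𝓝ˢ (Metric.closedBall (0 : 𝔼) s), g' x = g (Φ x)) →
      ∀ᶠ p in 𝓝ˢ (S.restrict B hB).K, g p = g' (Φ.toPartialEquiv.symm p) := by
    intro g g' hg
    rw [eventually_nhdsSet_iff_forall] at hg ⊢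
    intro p hp
    obtain ⟨x, hx, rfl⟩ := hK hp
    have hc : ContinuousAt Φ.toPartialEquiv.symm (Φ x) := Φ.contMDiffOn_invFun.continuousOn.continuousAt
      (Φ.open_target.mem_nhds (hKt hp))
    have h1 := hg x hx
    have h2 : Φ.toPartialEquiv.symm (Φ x) = x := Φ.left_inv (hsource hx)
    rw [← h2] at h1
    filter_upwards [hc.eventually h1, Φ.open_target.mem_nhds (hKt hp)] with q hq hqt
    rw [hq]
    exact congrArg g (Φ.right_inv hqt).symm
  have e1 : ((S.restrict B hB).mapOn Φ.open_target Φ.contMDiffOn_invFun hKt).current f' π'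
      = (S.restrict B hB).current f π :=
    (S.restrict B hB).mapOn_current Φ.open_target Φ.contMDiffOn_invFun hKt
      (fun p hp => ((hnear f f' hf').self_of_nhdsSet) p hp) fun a => hnear _ _ (hπ' a)
  -- Because `B` lies in the ball, restricting before or after the passage to `ℝⁿ` leaves the same
  -- parameter sets, and the sums of integrals are identical.
  have e2 : ((S.inBall Φ hΦ hs).restrict _ hBb).current f' π'
      = ((S.restrict B hB).mapOn Φ.open_target Φ.contMDiffOn_invFun hKt).current f' π' := by
    unfold current
    refine tsum_congr fun (j : S.ι) => ?_
    have h1 : (S.E j ∩ S.φ j ⁻¹' (Φ '' Metric.ball 0 s)) ∩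
        (fun x => Φ.toPartialEquiv.symm (S.φ j x)) ⁻¹' (Φ.source ∩ Φ ⁻¹' B) = S.E j ∩ S.φ j ⁻¹' B := by
      ext x
      constructor
      · rintro ⟨⟨h1, ⟨z, hz, hzx⟩⟩, -, h3⟩
        refine ⟨h1, ?_⟩
        have h4 : Φ (Φ.toPartialEquiv.symm (S.φ j x)) = S.φ j x := by
          refine Φ.right_inv ?_
          rw [← hzx]
          exact Φ.map_source (hsource' hz)
        change Φ (Φ.toPartialEquiv.symm (S.φ j x)) ∈ B at h3
        rwa [h4] at h3
      · rintro ⟨h1, h2⟩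
        obtain ⟨z, hz, hzx⟩ := hBs h2
        have h5 : S.φ j x ∈ Φ.target := by
          rw [← hzx]
          exact Φ.map_source (hsource' hz)
        refine ⟨⟨h1, ⟨z, hz, hzx⟩⟩, Φ.map_target h5, ?_⟩
        have h4 : Φ (Φ.toPartialEquiv.symm (S.φ j x)) = S.φ j x := Φ.right_inv h5
        change Φ (Φ.toPartialEquiv.symm (S.φ j x)) ∈ B
        rwa [h4]
    exact congrArg (fun E => ∫ x in E, (S.m j : ℝ) * (f' (Φ.toPartialEquiv.symm (S.φ j x))
      * jac π' (fun x => Φ.toPartialEquiv.symm (S.φ j x)) x)) h1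
  rw [← e1, ← e2, hm _ hBb hBbs]
  congr 1
  refine setIntegral_congr_fun (measurableSet_chartSet Φ hB) fun x hx => ?_
  have hx' : WithLp.toLp 2 x ∈ Metric.closedBall (0 : 𝔼) s :=
    Metric.ball_subset_closedBall (hBbs hx)
  have h1 := eventually_nhdsSet_iff_forall.1 hf' _ hx'
  change f' (WithLp.toLp 2 x) * _ = _
  rw [h1.self_of_nhds]
  congr 1
  refine jac_congr fun a => ?_
  exact contDiff_toLp.continuous.continuousAt.eventually
    (eventually_nhdsSet_iff_forall.1 (hπ' a) _ hx')

end Multiplicity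

/-! ### Open subsets and cycles avoiding a ball -/

section OpenSubsets

variable {n k : ℕ} {X : Type*} [TopologicalSpace X] [T2Space X] [SecondCountableTopology X]
  [ChartedSpace (EuclideanSpace ℝ (Fin n)) X] [IsManifold (𝓡 n) ∞ X]

/-- The inclusion of an open subset as a smooth map. -/
def opensVal (U : TopologicalSpace.Opens X) : C^∞⟮𝓡 n, U; 𝓡 n, X⟯ :=
  ⟨Subtype.val, contMDiff_subtype_val⟩

/-- The smooth inverse of the inclusion of an open subset. -/
theorem exists_opens_retract (U : TopologicalSpace.Opens X) [Nonempty U] :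
    ∃ g : X → U, ContMDiffOn (𝓡 n) (𝓡 n) ∞ g U ∧ ∀ p : U, g p = p := by
  classical
  let g : X → U := fun x => if h : x ∈ U then ⟨x, h⟩ else Classical.arbitrary U
  have hg : ∀ p : U, g p = p := fun p => dif_pos p.2
  refine ⟨g, fun x hx => ContMDiffAt.contMDiffWithinAt ?_, hg⟩
  rw [← contMDiffAt_subtype_iff (x := (⟨x, hx⟩ : U))]
  exact contMDiffAt_id.congr_of_eventuallyEq (Eventually.of_forall hg)

/-- A cycle carried by an open subset is a cycle of this subset. -/
theorem RectData.exists_cycle_lift (P : RectData n X (k + 1)) (hP : boundary n X k P.current = 0)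
    (U : TopologicalSpace.Opens X) [Nonempty U] (hK : P.K ⊆ U) :
    ∃ P' : RectData n U (k + 1), boundary n U k P'.current = 0 ∧
      (P'.map (opensVal U)).current = P.current ∧ Subtype.val '' P'.K = P.K := by
  obtain ⟨g, hg, hgU⟩ := exists_opens_retract (n := n) U
  have hval : ∀ x ∈ U, (g x : X) = x := fun x hx => congrArg Subtype.val (hgU ⟨x, hx⟩)
  refine ⟨P.mapOn U.isOpen hg hK, P.boundary_mapOn_eq_zero U.isOpen hg hK hP, ?_, ?_⟩
  · exact P.mapOn_eq_self (G := fun x => (g x : X)) U.isOpen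
      ((contMDiff_subtype_val (n := ∞)).comp_contMDiffOn hg) hK U.isOpen hK hval
  · change Subtype.val '' (g '' P.K) = P.K
    rw [image_image]
    refine (image_congr fun x hx => hval x (hK hx)).trans (image_id' _)

end OpenSubsets

section PushOff

variable {n k : ℕ} {X : Type*} [TopologicalSpace X] [T2Space X] [SecondCountableTopology X]
  [ChartedSpace (EuclideanSpace ℝ (Fin n)) X] [IsManifold (𝓡 n) ∞ X]

local notation "𝔼" => EuclideanSpace ℝ (Fin n)

theorem measurableSet_borel_compl {A : Type*} [TopologicalSpace A] {B : Set A}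
    (hB : MeasurableSet[borel A] B) : MeasurableSet[borel A] Bᶜ := by
  borelize A
  exact hB.compl

theorem RectData.restrict_compl_K_subset (P : RectData n X k) {B : Set X} (hB : IsOpen B)
    (h : MeasurableSet[borel X] Bᶜ) : (P.restrict Bᶜ h).K ⊆ Bᶜ :=
  inter_subset_right.trans hB.isClosed_compl.closure_eq.subset

/-- A chain of dimension less than `n` whose boundary vanishes in an embedded ball is homologous
to a chain that avoids a smaller ball. -/
theorem RectData.exists_avoiding (P : RectData n X (k + 1))
    (Φ : PartialDiffeomorph (𝓡 n) (𝓡 n) 𝔼 X ∞) {R s : ℝ} (hΦ : Φ.source = Metric.ball 0 R)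
    (hs : s < R) (hk : k + 1 < n) {r : ℝ} (hr : 0 < r) (hrs : r < s)
    (h : ∀ (f : TestFn n X) π, tsupport f ⊆ Φ '' Metric.ball 0 s → boundary n X k P.current f π = 0) :
    ∃ (P' : RectData n X (k + 1)) (S : RectData n X (k + 2)), P'.K ⊆ (Φ '' Metric.ball 0 r)ᶜ ∧
      P'.current - P.current = boundary n X (k + 1) S.current := by
  obtain ⟨Q, S, hQ, hQS⟩ := P.exists_push_off Φ hΦ hs hk hr hrs h
  have hO := isOpen_image_ball Φ hΦ hs.le
  have hB := measurableSet_borel_of_isOpen hO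
  have hBc := measurableSet_borel_compl hB
  -- The part outside the larger ball is kept, and the part inside is replaced by its projection to
  -- the shell.
  refine ⟨(P.restrict _ hBc).add Q, S, union_subset ?_ ?_, ?_⟩
  · exact (P.restrict_compl_K_subset hO hBc).trans
      (compl_subset_compl.2 (image_mono (Metric.ball_subset_ball hrs.le)))
  · refine hQ.trans ?_
    rintro _ ⟨x, hx, rfl⟩ ⟨y, hy, hyx⟩
    have hy' : ‖y‖ < r := by simpa using hy
    have h1 : y = x := by
      refine Φ.injOn ?_ ?_ hyx <;> rw [hΦ, mem_ball_zero_iff]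
      · linarith
      · linarith [hx.2]
    rw [h1] at hy'
    exact absurd hx.1 (not_le.2 hy')
  · rw [RectData.add_current, ← P.current_restrict_add hB hBc, ← hQS]
    abel

/-- A cycle satisfies the boundary hypothesis of `exists_avoiding` on every ball. This underlies
surjectivity of the inclusion of a punctured manifold on homology. -/
theorem exists_cycle_avoiding (Φ : PartialDiffeomorph (𝓡 n) (𝓡 n) 𝔼 X ∞) {R r : ℝ}
    (hΦ : Φ.source = Metric.ball 0 R) (hk : k + 1 < n) (hr : 0 < r) (hrR : r < R)
    (c : Homology n X (k + 1)) :
    ∃ (P : RectData n X (k + 1)) (h : boundary n X k P.current = 0), cls (P.toCycle h) = c ∧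
      P.K ⊆ (Φ '' Metric.ball 0 r)ᶜ := by
  obtain ⟨s, hrs, hsR⟩ := exists_between hrR
  obtain ⟨P, hP, rfl⟩ := exists_rectifiable_cycle c
  obtain ⟨P', S, hK, hS⟩ := P.exists_avoiding Φ hΦ hsR hk hr hrs fun f π _ => by rw [hP]; rfl
  have hP' : boundary n X k P'.current = 0 := by
    rw [sub_eq_iff_eq_add] at hS
    rw [hS, map_add, boundary_boundary, hP, add_zero]
  exact ⟨P', hP', cls_eq_of_sub S hS, hK⟩

theorem exists_subset_ball_of_isCompact {R : ℝ} (hR : 0 < R) {K : Set 𝔼} (hK : IsCompact K)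
    (hKR : K ⊆ Metric.ball 0 R) : ∃ s, 0 ≤ s ∧ s < R ∧ K ⊆ Metric.ball 0 s := by
  rcases K.eq_empty_or_nonempty with rfl | hne
  · exact ⟨0, le_rfl, hR, empty_subset _⟩
  obtain ⟨x, hx, hmax⟩ := hK.exists_isMaxOn hne continuous_norm.continuousOn
  obtain ⟨s, h1, h2⟩ := exists_between (show ‖x‖ < R by simpa using hKR hx)
  refine ⟨s, (norm_nonneg x).trans h1.le, h2, fun y hy => ?_⟩
  have : ‖y‖ ≤ ‖x‖ := hmax hy
  simpa using this.trans_lt h1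

variable {M : Type*} [TopologicalSpace M] [T2Space M] [SecondCountableTopology M]
  [ChartedSpace (EuclideanSpace ℝ (Fin n)) M] [IsManifold (𝓡 n) ∞ M]

/-- A smooth map kills the class of a cycle whose support it maps into an embedded ball. -/
theorem homologyMap_eq_zero_of_spt (Φ : PartialDiffeomorph (𝓡 n) (𝓡 n) 𝔼 X ∞) {R : ℝ} (hR : 0 < R)
    (hΦ : Φ.source = Metric.ball 0 R) (c : C^∞⟮𝓡 n, M; 𝓡 n, X⟯) (T : cycles n M (k + 1))
    (hT : ∀ p ∈ spt T.1, c p ∈ Φ '' Metric.ball 0 R) : homologyMap c (k + 1) (cls T) = 0 := by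
  have hflat : T.1 ∈ flatChains n M (k + 1) := T.2.1
  have hK : IsCompact (Φ.toPartialEquiv.symm '' (c '' spt T.1)) := by
    refine ((isCompact_spt hflat).image c.contMDiff.continuous).image_of_continuousOn
      (Φ.contMDiffOn_invFun.continuousOn.mono ?_)
    rintro _ ⟨p, hp, rfl⟩
    obtain ⟨x, hx, hxp⟩ := hT p hp
    rw [← hxp]
    exact Φ.map_source (hΦ ▸ hx)
  obtain ⟨s, hs0, hsR, hs⟩ := exists_subset_ball_of_isCompact hR hK (by
    rintro _ ⟨_, ⟨p, hp, rfl⟩, rfl⟩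
    obtain ⟨x, hx, hxp⟩ := hT p hp
    rw [← hxp]
    have h1 : Φ.toPartialEquiv.symm (Φ x) = x := Φ.left_inv (hΦ ▸ hx)
    rwa [h1])
  obtain ⟨s', hss', hs'R⟩ := exists_between hsR
  -- The compact image of the support lies in a smaller ball. A collapse of that ball to a point
  -- does not change homology, but makes the composite map constant near the support.
  obtain ⟨G, hG0, -, -, hGid⟩ := exists_collapse Φ hΦ hs0 hss' hs'R
  have hO : IsOpen (c ⁻¹' (Φ '' Metric.ball 0 s)) :=
    (isOpen_image_ball Φ hΦ hsR.le).preimage c.contMDiff.continuous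
  have hsub : spt T.1 ⊆ c ⁻¹' (Φ '' Metric.ball 0 s) := by
    intro p hp
    obtain ⟨x, hx, hxp⟩ := hT p hp
    have h1 : Φ.toPartialEquiv.symm (c p) = x := by
      rw [← hxp]
      exact Φ.left_inv (hΦ ▸ hx)
    exact ⟨x, hs ⟨_, ⟨p, hp, rfl⟩, h1⟩, hxp⟩
  rw [← hGid k (homologyMap c (k + 1) (cls T)), ← homologyMap_comp]
  have hzero : pushCycles (G.comp c) (k + 1) T = 0 := by
    refine Subtype.ext (funext fun f => funext fun π => ?_)
    -- The dimension `k + 1` is positive, so there is a differential `dπ₀`, and its pull-back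
    -- vanishes near the support.
    refine eq_zero_of_const_near_spt hflat _ _ hO hsub 0 (π 0 (Φ 0)) fun p hp => ?_
    obtain ⟨x, hx, hxp⟩ := hp
    change π 0 (G (c p)) = _
    rw [← hxp, hG0 x (by simpa using (mem_ball_zero_iff.1 hx).le)]
  rw [homologyMap_cls, hzero]
  rfl

end PushOff

/-! ### The inversion and glued manifolds -/

section Inversion

variable {n : ℕ}

local notation "𝔼" => EuclideanSpace ℝ (Fin n)

theorem norm_inversion (x : 𝔼) : ‖(‖x‖ ^ 2)⁻¹ • x‖ = ‖x‖⁻¹ := by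
  rcases eq_or_ne x 0 with rfl | hx
  · simp
  · have : ‖x‖ ≠ 0 := norm_ne_zero_iff.2 hx
    rw [norm_smul, norm_inv, norm_pow, norm_norm]
    field_simp

theorem inversion_inversion (x : 𝔼) :
    (‖(‖x‖ ^ 2)⁻¹ • x‖ ^ 2)⁻¹ • ((‖x‖ ^ 2)⁻¹ • x) = x := by
  rcases eq_or_ne x 0 with rfl | hx
  · simp
  · have : ‖x‖ ≠ 0 := norm_ne_zero_iff.2 hx
    rw [norm_inversion, smul_smul]
    have h : ((‖x‖⁻¹) ^ 2)⁻¹ * (‖x‖ ^ 2)⁻¹ = 1 := by field_simp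
    rw [h, one_smul]

theorem inversion_shell {x : 𝔼} (h1 : 1 / 2 < ‖x‖) (h2 : ‖x‖ < 2) :
    1 / 2 < ‖(‖x‖ ^ 2)⁻¹ • x‖ ∧ ‖(‖x‖ ^ 2)⁻¹ • x‖ < 2 := by
  have h0 : 0 < ‖x‖ := by linarith
  rw [norm_inversion]
  constructor
  · rw [one_div, inv_lt_inv₀ (by norm_num) h0]
    exact h2
  · rw [inv_lt_comm₀ h0 (by norm_num)]
    linarith

end Inversion

/-- A manifold `M` glued from the complements of two embedded balls: `Φ` and `Ψ` parametrize the
balls of radius `2`, while `J` and `L` embed the complements of the closed balls of radius `1 / 2`. -/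
structure GluePair {n : ℕ} {X Y M : Type*}
    [TopologicalSpace X] [ChartedSpace (EuclideanSpace ℝ (Fin n)) X]
    [TopologicalSpace Y] [ChartedSpace (EuclideanSpace ℝ (Fin n)) Y]
    [TopologicalSpace M] [ChartedSpace (EuclideanSpace ℝ (Fin n)) M]
    (Φ : PartialDiffeomorph (𝓡 n) (𝓡 n) (EuclideanSpace ℝ (Fin n)) X ∞)
    (Ψ : PartialDiffeomorph (𝓡 n) (𝓡 n) (EuclideanSpace ℝ (Fin n)) Y ∞)
    (J : PartialDiffeomorph (𝓡 n) (𝓡 n) X M ∞)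
    (L : PartialDiffeomorph (𝓡 n) (𝓡 n) Y M ∞) : Prop where
  source_left : Φ.source = Metric.ball 0 2
  source_right : Ψ.source = Metric.ball 0 2
  source_J : J.source = (Φ '' Metric.closedBall 0 (1 / 2))ᶜ
  source_L : L.source = (Ψ '' Metric.closedBall 0 (1 / 2))ᶜ
  cover : ∀ p, p ∈ J.target ∨ p ∈ L.target
  glue : ∀ p ∈ J.source, ∀ q ∈ L.source, J p = L q ↔ ∃ x : EuclideanSpace ℝ (Fin n),
    1 / 2 < ‖x‖ ∧ ‖x‖ < 2 ∧ p = Φ x ∧ q = Ψ ((‖x‖ ^ 2)⁻¹ • x)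

namespace GluePair

variable {n k : ℕ} {X Y M : Type*}
  [TopologicalSpace X] [ChartedSpace (EuclideanSpace ℝ (Fin n)) X]
  [TopologicalSpace Y] [ChartedSpace (EuclideanSpace ℝ (Fin n)) Y]
  [TopologicalSpace M] [ChartedSpace (EuclideanSpace ℝ (Fin n)) M]
  {Φ : PartialDiffeomorph (𝓡 n) (𝓡 n) (EuclideanSpace ℝ (Fin n)) X ∞}
  {Ψ : PartialDiffeomorph (𝓡 n) (𝓡 n) (EuclideanSpace ℝ (Fin n)) Y ∞}
  {J : PartialDiffeomorph (𝓡 n) (𝓡 n) X M ∞}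
  {L : PartialDiffeomorph (𝓡 n) (𝓡 n) Y M ∞}

local notation "𝔼" => EuclideanSpace ℝ (Fin n)

section Basic

/-- The inversion is an involution of the shell, so the gluing is symmetric and every one-sided
result applies to both pieces. -/
theorem symm (h : GluePair Φ Ψ J L) : GluePair Ψ Φ L J where
  source_left := h.source_right
  source_right := h.source_left
  source_J := h.source_L
  source_L := h.source_J
  cover p := (h.cover p).symm
  glue q hq p hp := by
    rw [eq_comm, h.glue p hp q hq]
    constructor
    · rintro ⟨x, h1, h2, h3, h4⟩
      obtain ⟨h5, h6⟩ := inversion_shell h1 h2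
      exact ⟨_, h5, h6, h4, by rw [inversion_inversion]; exact h3⟩
    · rintro ⟨x, h1, h2, h3, h4⟩
      obtain ⟨h5, h6⟩ := inversion_shell h1 h2
      exact ⟨_, h5, h6, h4, by rw [inversion_inversion]; exact h3⟩

theorem mem_source (h : GluePair Φ Ψ J L) {x : 𝔼} (hx : ‖x‖ < 2) : x ∈ Φ.source := by
  rw [h.source_left]
  simpa using hx

theorem injective (h : GluePair Φ Ψ J L) {x y : 𝔼} (hx : ‖x‖ < 2) (hy : ‖y‖ < 2)
    (hxy : Φ x = Φ y) : x = y :=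
  Φ.injOn (h.mem_source hx) (h.mem_source hy) hxy

theorem mem_image_ball (h : GluePair Φ Ψ J L) {x : 𝔼} (hx : ‖x‖ < 2) {r : ℝ} (hr : r ≤ 2) :
    Φ x ∈ Φ '' Metric.ball 0 r ↔ ‖x‖ < r := by
  constructor
  · rintro ⟨y, hy, hyx⟩
    have hy' : ‖y‖ < r := by simpa using hy
    rwa [← h.injective (by linarith) hx hyx]
  · intro hxr
    exact ⟨x, by simpa using hxr, rfl⟩

theorem mem_image_closedBall (h : GluePair Φ Ψ J L) {x : 𝔼} (hx : ‖x‖ < 2) {r : ℝ} (hr : r < 2) :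
    Φ x ∈ Φ '' Metric.closedBall 0 r ↔ ‖x‖ ≤ r := by
  constructor
  · rintro ⟨y, hy, hyx⟩
    have hy' : ‖y‖ ≤ r := by simpa using hy
    rwa [← h.injective (by linarith) hx hyx]
  · intro hxr
    exact ⟨x, by simpa using hxr, rfl⟩

theorem mem_J_source (h : GluePair Φ Ψ J L) {x : 𝔼} (hx : ‖x‖ < 2) : Φ x ∈ J.source ↔ 1 / 2 < ‖x‖ := by
  rw [h.source_J, mem_compl_iff, h.mem_image_closedBall hx (by norm_num), not_le]

theorem compl_ball_subset (h : GluePair Φ Ψ J L) {r : ℝ} (hr : 1 / 2 < r) :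
    (Φ '' Metric.ball 0 r)ᶜ ⊆ J.source := by
  rw [h.source_J]
  exact compl_subset_compl.2 (image_mono (Metric.closedBall_subset_ball hr))

theorem J_eq_L (h : GluePair Φ Ψ J L) {x : 𝔼} (h1 : 1 / 2 < ‖x‖) (h2 : ‖x‖ < 2) :
    J (Φ x) = L (Ψ ((‖x‖ ^ 2)⁻¹ • x)) := by
  obtain ⟨h3, h4⟩ := inversion_shell h1 h2
  exact (h.glue _ ((h.mem_J_source h2).2 h1) _ ((h.symm.mem_J_source h4).2 h3)).2 ⟨x, h1, h2, rfl, rfl⟩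

/-- A point of `M` outside the image of the first piece comes from outside the second ball. -/
theorem exists_of_notMem_target (h : GluePair Φ Ψ J L) {p : M} (hp : p ∉ J.target) :
    ∃ q ∈ L.source, L q = p ∧ q ∉ Ψ '' Metric.ball 0 2 := by
  have hpL := (h.cover p).resolve_left hp
  refine ⟨L.toPartialEquiv.symm p, L.map_target hpL, L.right_inv hpL, ?_⟩
  rintro ⟨y, hy, hyp⟩
  have hy2 : ‖y‖ < 2 := by simpa using hy
  have hyL : Ψ y ∈ L.source := by
    rw [hyp]
    exact L.map_target hpL
  have hy1 := (h.symm.mem_J_source hy2).1 hyL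
  have h1 := h.symm.J_eq_L hy1 hy2
  rw [hyp] at h1
  have h2 : L (L.toPartialEquiv.symm p) = p := L.right_inv hpL
  rw [h2] at h1
  refine hp ?_
  rw [h1]
  obtain ⟨h3, h4⟩ := inversion_shell hy1 hy2
  exact J.map_source ((h.mem_J_source h4).2 h3)

end Basic

/-! ### Collapsing one piece, and splitting cycles -/

section Retract

variable [T2Space X] [SecondCountableTopology X] [IsManifold (𝓡 n) ∞ X]
  [T2Space Y] [SecondCountableTopology Y] [IsManifold (𝓡 n) ∞ Y]
  [T2Space M] [SecondCountableTopology M] [IsManifold (𝓡 n) ∞ M]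

/-- The map of `M` to the first manifold that collapses the other piece to a point. -/
theorem exists_retract (h : GluePair Φ Ψ J L) :
    ∃ (c : C^∞⟮𝓡 n, M; 𝓡 n, X⟯) (C : C^∞⟮𝓡 n, X; 𝓡 n, X⟯), (∀ p ∈ J.source, c (J p) = C p) ∧
      (∀ p ∉ J.target, c p = Φ 0) ∧ (∀ p ∉ Φ '' Metric.ball 0 1, C p = p) ∧
      (∀ x ∈ Metric.ball 0 2, ∃ y, ‖y‖ ≤ ‖x‖ ∧ C (Φ x) = Φ y) ∧
      ∀ k (a : Homology n X (k + 1)), homologyMap C (k + 1) a = a := by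
  classical
  -- The collapsed radius must exceed `1 / 2`, so that the map is already constant on part of the
  -- gluing shell and extends smoothly by a constant over the other piece.
  obtain ⟨C, hC0, hC1, hC2, hCid⟩ := exists_collapse Φ h.source_left (r := 3 / 4) (s := 1)
    (by norm_num) (by norm_num) (by norm_num)
  let c₀ : M → X := fun p => if p ∈ J.target then C (J.toPartialEquiv.symm p) else Φ 0
  have hin : ∀ p ∈ J.source, c₀ (J p) = C p := by
    intro p hp
    have h1 : J.toPartialEquiv.symm (J p) = p := J.left_inv hp
    simp only [c₀, if_pos (J.map_source hp)]
    rw [h1]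
  have hsm : ContMDiff (𝓡 n) (𝓡 n) ∞ c₀ := by
    intro p
    by_cases hp : p ∈ J.target
    · have h1 : ContMDiffOn (𝓡 n) (𝓡 n) ∞ (fun p => C (J.toPartialEquiv.symm p)) J.target :=
        C.contMDiff.comp_contMDiffOn J.contMDiffOn_invFun
      refine (h1.contMDiffAt (J.open_target.mem_nhds hp)).congr_of_eventuallyEq ?_
      filter_upwards [J.open_target.mem_nhds hp] with q hq
      exact if_pos hq
    · obtain ⟨q, hq, hqp, hqΨ⟩ := h.exists_of_notMem_target hp
      -- In the coordinates of the other ball the radius `3 / 4` becomes `4 / 3`: outside this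
      -- closed ball the map is constant, also on the overlap.
      have hcl : IsClosed (Ψ '' Metric.closedBall 0 (4 / 3)) :=
        (isCompact_image_closedBall Ψ h.source_right (by norm_num)).isClosed
      have hO : IsOpen (L '' (L.source ∩ (Ψ '' Metric.closedBall 0 (4 / 3))ᶜ)) :=
        L.toOpenPartialHomeomorph.isOpen_image_of_subset_source
          (L.open_source.inter hcl.isOpen_compl) inter_subset_left
      have hpO : p ∈ L '' (L.source ∩ (Ψ '' Metric.closedBall 0 (4 / 3))ᶜ) :=
        ⟨q, ⟨hq, fun hq' => hqΨ (image_mono (Metric.closedBall_subset_ball (by norm_num)) hq')⟩, hqp⟩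
      refine (contMDiffAt_const (c := Φ 0)).congr_of_eventuallyEq ?_
      filter_upwards [hO.mem_nhds hpO] with p' hp'
      obtain ⟨q', ⟨hq', hqb⟩, rfl⟩ := hp'
      by_cases hJ : L q' ∈ J.target
      · have h2 : J (J.toPartialEquiv.symm (L q')) = L q' := J.right_inv hJ
        obtain ⟨x, h3, h4, h5, h6⟩ := (h.glue _ (J.map_target hJ) q' hq').1 h2
        simp only [c₀, if_pos hJ]
        rw [h5]
        refine hC0 x ?_
        obtain ⟨h7, h8⟩ := inversion_shell h3 h4
        rw [h6, mem_compl_iff, h.symm.mem_image_closedBall h8 (by norm_num), norm_inversion, not_le,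
          lt_inv_comm₀ (by norm_num) (by linarith)] at hqb
        norm_num at hqb
        exact hqb.le
      · exact if_neg hJ
  exact ⟨⟨c₀, hsm⟩, C, hin, fun p hp => if_neg hp, hC1, hC2, hCid⟩

/-- Every cycle of dimension less than `n` is the sum of a cycle in the first piece and a cycle in
the second piece. -/
theorem exists_decomposition [CompactSpace Y] (h : GluePair Φ Ψ J L) (hk : k + 1 < n)
    (P : RectData n M (k + 1)) (hP : boundary n M k P.current = 0) :
    ∃ (T : RectData n X (k + 1)) (V : RectData n Y (k + 1)) (hT : T.K ⊆ J.source)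
      (hV : V.K ⊆ L.source), boundary n X k T.current = 0 ∧ boundary n Y k V.current = 0 ∧
      P.current = (T.mapOn J.open_source J.contMDiffOn hT).current
        + (V.mapOn L.open_source L.contMDiffOn hV).current := by
  obtain ⟨c, C, hcJ, hc0, hC1, hC2, -⟩ := h.exists_retract
  have h0 : (0 : 𝔼) ∈ Metric.ball (0 : 𝔼) (3 / 2) := by simp
  have hcP := boundary_map_eq_zero c P hP
  -- The collapsed cycle is pushed off the ball of radius `3 / 4 > 1 / 2`, hence back into the first
  -- piece. The cut at `3 / 2` lies outside the radius `1` up to which the collapse moves points, so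
  -- outside it `J ∘ c` is the identity.
  obtain ⟨Q, S, hQ, hQS⟩ := (P.map c).exists_push_off Φ h.source_left (s := 3 / 2) (by norm_num) hk
    (r := 3 / 4) (by norm_num) (by norm_num) fun f π _ => by rw [hcP]; rfl
  have hopen := isOpen_image_ball Φ h.source_left (s := 3 / 2) (by norm_num)
  have hB := measurableSet_borel_of_isOpen hopen
  have hBc := measurableSet_borel_compl hB
  have hOM : IsOpen (c ⁻¹' (Φ '' Metric.ball 0 (3 / 2))) := hopen.preimage c.contMDiff.continuous
  have hA := measurableSet_borel_of_isOpen hOM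
  have hAc := measurableSet_borel_compl hA
  have hcin : ∀ p ∈ J.target, c p = C (J.toPartialEquiv.symm p) := by
    intro p hp
    have h1 : J (J.toPartialEquiv.symm p) = p := J.right_inv hp
    rw [← hcJ _ (J.map_target hp), h1]
  -- points mapped outside the ball of radius one
  have hfix : ∀ p, c p ∉ Φ '' Metric.closedBall 0 1 → c p ∈ J.source ∧ J (c p) = p := by
    intro p hp
    have hpJ : p ∈ J.target := by
      by_contra hpJ
      rw [hc0 p hpJ] at hp
      exact hp ⟨0, by simp, rfl⟩
    have h1 : J.toPartialEquiv.symm p ∉ Φ '' Metric.ball 0 1 := by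
      rintro ⟨x, hx, hxp⟩
      have hx' : ‖x‖ < 1 := by simpa using hx
      obtain ⟨y, hy, hyx⟩ := hC2 x (by simpa using hx'.trans (by norm_num))
      rw [hcin p hpJ, ← hxp, hyx] at hp
      exact hp ⟨y, by simpa using hy.trans hx'.le, rfl⟩
    rw [hcin p hpJ, hC1 _ h1]
    exact ⟨J.map_target hpJ, J.right_inv hpJ⟩
  -- points mapped into the ball of radius `3 / 2`
  have hballL : c ⁻¹' (Φ '' Metric.ball 0 (3 / 2)) ⊆ L '' (Ψ '' Metric.ball 0 (2 / 3))ᶜ := by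
    intro p hp
    by_cases hpJ : p ∈ J.target
    · have h1 : J.toPartialEquiv.symm p ∈ Φ '' Metric.ball 0 (3 / 2) := by
        by_contra h1
        rw [mem_preimage, hcin p hpJ, hC1 _ fun h2 =>
          h1 (image_mono (Metric.ball_subset_ball (by norm_num)) h2)] at hp
        exact h1 hp
      obtain ⟨x, hx, hxp⟩ := h1
      have hx1 : ‖x‖ < 3 / 2 := by simpa using hx
      have hx2 : ‖x‖ < 2 := hx1.trans (by norm_num)
      have hx3 : 1 / 2 < ‖x‖ := by
        rw [← h.mem_J_source hx2, hxp]
        exact J.map_target hpJ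
      have h2 := h.J_eq_L hx3 hx2
      have h3 : J (J.toPartialEquiv.symm p) = p := J.right_inv hpJ
      rw [hxp, h3] at h2
      refine ⟨_, ?_, h2.symm⟩
      rw [mem_compl_iff, h.symm.mem_image_ball (inversion_shell hx3 hx2).2 (by norm_num),
        norm_inversion, not_lt, le_inv_comm₀ (by norm_num) (by linarith)]
      norm_num
      exact hx1.le
    · obtain ⟨q, hq, hqp, hqΨ⟩ := h.exists_of_notMem_target hpJ
      exact ⟨q, fun hq' => hqΨ (image_mono (Metric.ball_subset_ball (by norm_num)) hq'), hqp⟩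
  -- The radius `3 / 2` reads `2 / 3` in the second ball. Compactness of `Y` makes this set compact,
  -- so the carrier of the part cut out of `P` stays inside the second piece after taking its
  -- closure.
  have hLc : IsCompact (L '' (Ψ '' Metric.ball 0 (2 / 3))ᶜ) := by
    refine IsCompact.image_of_continuousOn ?_ (L.contMDiffOn.continuousOn.mono
      (h.symm.compl_ball_subset (by norm_num)))
    exact (isOpen_image_ball Ψ h.source_right (by norm_num)).isClosed_compl.isCompact
  have hLt : L '' (Ψ '' Metric.ball 0 (2 / 3))ᶜ ⊆ L.target := by
    rintro _ ⟨q, hq, rfl⟩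
    exact L.map_source (h.symm.compl_ball_subset (by norm_num) hq)
  have hQJ : Q.K ⊆ J.source := by
    refine hQ.trans ?_
    rintro _ ⟨x, ⟨hx1, hx2⟩, rfl⟩
    exact (h.mem_J_source (by linarith)).2 (by linarith)
  have hT1 : ((P.map c).restrict _ hBc).K ⊆ J.source :=
    ((P.map c).restrict_compl_K_subset hopen hBc).trans (h.compl_ball_subset (by norm_num))
  have hT : (((P.map c).restrict _ hBc).add Q).K ⊆ J.source := union_subset hT1 hQJ
  have hTcyc : boundary n X k (((P.map c).restrict _ hBc).add Q).current = 0 := by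
    rw [sub_eq_iff_eq_add] at hQS
    have h1 : ((P.map c).restrict _ hBc).current + Q.current
        = (P.map c).current + boundary n X (k + 1) S.current := by
      rw [hQS, ← (P.map c).current_restrict_add hB hBc]
      abel
    rw [RectData.add_current, h1, map_add, hcP, boundary_boundary, add_zero]
  have hTJ : ((((P.map c).restrict _ hBc).add Q).mapOn J.open_source J.contMDiffOn hT).current
      = (P.restrict _ hAc).current + (Q.mapOn J.open_source J.contMDiffOn hQJ).current := by
    have h1 : ((((P.map c).restrict _ hBc).add Q).mapOn J.open_source J.contMDiffOn hT).current
        = (((P.map c).restrict _ hBc).mapOn J.open_source J.contMDiffOn hT1).current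
          + (Q.mapOn J.open_source J.contMDiffOn hQJ).current := by
      refine Eq.trans ?_ (RectData.add_current _ _)
      funext f π
      refine tsum_congr fun j => ?_
      rcases j with j | j <;> rfl
    rw [h1]
    congr 1
    have hO : IsOpen (c ⁻¹' (Φ '' Metric.closedBall 0 1)ᶜ) :=
      ((isCompact_image_closedBall Φ h.source_left (by norm_num)).isClosed.isOpen_compl).preimage
        c.contMDiff.continuous
    have hKO : (P.restrict _ hAc).K ⊆ c ⁻¹' (Φ '' Metric.closedBall 0 1)ᶜ :=
      (P.restrict_compl_K_subset hOM hAc).trans fun p hp hp' =>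
        hp (image_mono (Metric.closedBall_subset_ball (by norm_num)) hp')
    exact (P.restrict _ hAc).mapOn_eq_self (G := fun p => J (c p)) hO
      (J.contMDiffOn.comp c.contMDiff.contMDiffOn fun p hp => (hfix p hp).1) hKO hO hKO
      fun p hp => (hfix p hp).2
  -- What remains of `P` after the cycle of the first piece has been subtracted. It is a cycle as a
  -- difference of cycles, and lies in the second piece.
  set R := (P.restrict _ hA).add (Q.mapOn J.open_source J.contMDiffOn hQJ).neg with hR
  have hRt : R.K ⊆ L.target := by
    refine union_subset ?_ ?_
    · exact (inter_subset_right.trans (closure_minimal hballL hLc.isClosed)).trans hLt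
    · rintro _ ⟨p, hp, rfl⟩
      obtain ⟨x, ⟨hx1, hx2⟩, rfl⟩ := hQ hp
      rw [h.J_eq_L (by linarith) (by linarith)]
      obtain ⟨h3, h4⟩ := inversion_shell (show 1 / 2 < ‖x‖ by linarith) (by linarith)
      exact L.map_source ((h.symm.mem_J_source h4).2 h3)
  have hsum : P.current = ((((P.map c).restrict _ hBc).add Q).mapOn J.open_source J.contMDiffOn
      hT).current + R.current := by
    rw [hTJ, hR, RectData.add_current, RectData.neg_current, ← P.current_restrict_add hA hAc]
    abel
  have hRcyc : boundary n M k R.current = 0 := by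
    have h1 := RectData.boundary_mapOn_eq_zero _ J.open_source J.contMDiffOn hT hTcyc
    have h2 := congrArg (boundary n M k) hsum
    rw [map_add, h1, hP, zero_add] at h2
    exact h2.symm
  have hVs : (R.mapOn L.open_target L.contMDiffOn_invFun hRt).K ⊆ L.source := by
    rintro _ ⟨p, hp, rfl⟩
    exact L.map_target (hRt hp)
  refine ⟨_, R.mapOn L.open_target L.contMDiffOn_invFun hRt, hT, hVs, hTcyc,
    RectData.boundary_mapOn_eq_zero _ _ _ _ hRcyc, ?_⟩
  have hback : ((R.mapOn L.open_target L.contMDiffOn_invFun hRt).mapOn L.open_source L.contMDiffOn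
      hVs).current = R.current :=
    R.mapOn_eq_self (G := fun p => L (L.toPartialEquiv.symm p)) L.open_target
      (L.contMDiffOn.comp L.contMDiffOn_invFun fun p hp => L.map_target hp) hRt L.open_target hRt
      fun p hp => L.right_inv hp
  rw [hback]
  exact hsum

end Retract

end GluePair

/-! ### Orientation reversal across the gluing shell -/

section Inversion

variable {n : ℕ}

local notation "𝔼" => EuclideanSpace ℝ (Fin n)

theorem hasFDerivAt_unit_inversion {x : 𝔼} (hx : x ≠ 0) :
    HasFDerivAt (fun x : 𝔼 => (‖x‖ ^ 2)⁻¹ • x)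
      ((‖x‖⁻¹) ^ 2 • ((ℝ ∙ x)ᗮ.reflection : 𝔼 →L[ℝ] 𝔼)) x := by
  have h := EuclideanGeometry.hasFDerivAt_inversion (c := (0 : 𝔼)) (R := 1) hx
  simp only [sub_zero, dist_zero_right, one_div] at h
  refine h.congr_of_eventuallyEq (Eventually.of_forall fun y => ?_)
  simp [EuclideanGeometry.inversion]

/-- The derivative is a positive multiple of the reflection in the hyperplane orthogonal to `x`. The
gluing therefore reverses the orientations given by the two balls. -/
theorem det_fderiv_unit_inversion_neg {x : 𝔼} (hx : x ≠ 0) :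
    (fderiv ℝ (fun x : 𝔼 => (‖x‖ ^ 2)⁻¹ • x) x).det < 0 := by
  rw [(hasFDerivAt_unit_inversion hx).fderiv, ContinuousLinearMap.det]
  have h1 : ((((‖x‖⁻¹) ^ 2 • ((ℝ ∙ x)ᗮ.reflection : 𝔼 →L[ℝ] 𝔼) : 𝔼 →L[ℝ] 𝔼)) : 𝔼 →ₗ[ℝ] 𝔼)
      = (‖x‖⁻¹) ^ 2 • (ℝ ∙ x)ᗮ.reflection.toLinearMap := rfl
  rw [h1, LinearMap.det_smul, Submodule.det_reflection, Submodule.orthogonal_orthogonal,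
    finrank_span_singleton hx]
  have : 0 < ‖x‖ := norm_pos_iff.2 hx
  have h2 : 0 < ((‖x‖⁻¹) ^ 2) ^ Module.finrank ℝ 𝔼 := by positivity
  linarith

end Inversion

namespace RectData

section RestrictMore

variable {n k : ℕ} {M : Type*} [TopologicalSpace M] [ChartedSpace (EuclideanSpace ℝ (Fin n)) M]

theorem restrict_current_congr (P : RectData n M k) {B B' : Set M} (hB : MeasurableSet[borel M] B)
    (hB' : MeasurableSet[borel M] B') (h : B = B') :
    (P.restrict B hB).current = (P.restrict B' hB').current := by
  subst h
  rfl

theorem restrict_restrict_current (P : RectData n M k) {B B' : Set M}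
    (hB : MeasurableSet[borel M] B) (hB' : MeasurableSet[borel M] B')
    (hBB' : MeasurableSet[borel M] (B ∩ B')) :
    ((P.restrict B hB).restrict B' hB').current = (P.restrict (B ∩ B') hBB').current := by
  funext f π
  refine tsum_congr fun (j : P.ι) => ?_
  have h : (P.E j ∩ P.φ j ⁻¹' B) ∩ P.φ j ⁻¹' B' = P.E j ∩ P.φ j ⁻¹' (B ∩ B') := by
    rw [inter_assoc, preimage_inter]
  exact congrArg (fun E => ∫ x in E, (P.m j : ℝ) * (f (P.φ j x) * jac π (P.φ j) x)) h

theorem current_restrict_eq_add_sdiff (P : RectData n M k) {B B' : Set M}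
    (hB : MeasurableSet[borel M] B) (hB' : MeasurableSet[borel M] B')
    (hd : MeasurableSet[borel M] (B \ B')) (h : B' ⊆ B) :
    (P.restrict B hB).current = (P.restrict B' hB').current + (P.restrict (B \ B') hd).current := by
  have hi : MeasurableSet[borel M] (B ∩ B') := by rwa [inter_eq_right.2 h]
  rw [← (P.restrict B hB).current_restrict_add hB' (measurableSet_borel_compl hB'),
    P.restrict_restrict_current hB hB' hi, P.restrict_restrict_current hB (measurableSet_borel_compl hB') hd,
    P.restrict_current_congr hi hB' (inter_eq_right.2 h)]
  rfl

theorem add_restrict_current (P Q : RectData n M k) {B : Set M} (hB : MeasurableSet[borel M] B) :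
    ((P.add Q).restrict B hB).current = (P.restrict B hB).current + (Q.restrict B hB).current := by
  refine Eq.trans ?_ (RectData.add_current _ _)
  funext f π
  refine tsum_congr fun j => ?_
  rcases j with j | j <;> rfl

end RestrictMore

section BoundaryMapOn

variable {l n k : ℕ} {X M : Type*} [TopologicalSpace X] [T2Space X] [SecondCountableTopology X]
  [ChartedSpace (EuclideanSpace ℝ (Fin l)) X] [IsManifold (𝓡 l) ∞ X]
  [TopologicalSpace M] [ChartedSpace (EuclideanSpace ℝ (Fin n)) M]

theorem boundary_mapOn_eq_zero_of_disjoint (S : RectData l X (k + 1)) {G : X → M} {W : Set X}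
    (hW : IsOpen W) (hG : ContMDiffOn (𝓡 l) (𝓡 n) ∞ G W) (hS : S.K ⊆ W) (f : TestFn n M)
    (π : Fin k → TestFn n M) (hf : ∀ j, ∀ x ∈ S.E j, G (S.φ j x) ∉ tsupport f) :
    boundary n M k (S.mapOn hW hG hS).current f π = 0 := by
  refine (S.mapOn hW hG hS).current_eq_zero fun j x hx => ?_
  rw [jac_eq_zero 0 0, mul_zero]
  exact ((S.mapOn hW hG hS).continuousAt_φ hx).eventually
    (p := fun y => (Fin.cons f π : Fin (k + 1) → TestFn n M) 0 y = 0)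
    (notMem_tsupport_iff_eventuallyEq.1 (hf j x hx))

/-- The pull-back of a function supported in the image of a set. -/
theorem exists_pullback_of_tsupport {W C : Set X} (hW : IsOpen W) {G : X → M}
    (hG : ContMDiffOn (𝓡 l) (𝓡 n) ∞ G W) (hC : closure C ⊆ W) (f : TestFn n M)
    (hf : ∀ x ∈ W, x ∉ C → G x ∉ tsupport f) :
    ∃ f' : TestFn l X, (∀ x ∈ W, f' x = f (G x)) ∧ ∀ x ∉ C, ∀ᶠ y in 𝓝 x, f' y = 0 := by
  classical
  let f₀ : X → ℝ := fun x => if x ∈ W then f (G x) else 0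
  have hzero : ∀ x ∉ C, ∀ᶠ y in 𝓝 x, f₀ y = 0 := by
    intro x hx
    by_cases hxW : x ∈ W
    · have h1 := notMem_tsupport_iff_eventuallyEq.1 (hf x hxW hx)
      filter_upwards [(hG.continuousOn.continuousAt (hW.mem_nhds hxW)).eventually h1,
        hW.mem_nhds hxW] with y hy hyW
      simp only [f₀, if_pos hyW]
      exact hy
    · filter_upwards [isClosed_closure.isOpen_compl.mem_nhds fun h => hxW (hC h)] with y hy
      by_cases hyW : y ∈ W
      · simp only [f₀, if_pos hyW]
        exact image_eq_zero_of_notMem_tsupport (hf y hyW fun h => hy (subset_closure h))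
      · exact if_neg hyW
  have hsm : ContMDiff (𝓡 l) 𝓘(ℝ, ℝ) ∞ f₀ := by
    intro x
    by_cases hxW : x ∈ W
    · refine ((f.contMDiff.comp_contMDiffOn hG).contMDiffAt (hW.mem_nhds hxW)).congr_of_eventuallyEq ?_
      filter_upwards [hW.mem_nhds hxW] with y hy
      exact if_pos hy
    · exact contMDiffAt_const.congr_of_eventuallyEq
        (hzero x fun h => hxW (hC (subset_closure h)))
  exact ⟨⟨f₀, hsm⟩, fun x hx => if_pos hx, hzero⟩

/-- Cutting `S` along the edge of `C` creates new boundary, but the form is supported away from the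
image of the points outside `C`. Its pull-back extends by zero to a global function, on which the
cut and the uncut chain have the same boundary. -/
theorem exists_boundary_restrict_mapOn (S : RectData l X (k + 1)) {W C K' : Set X} (hW : IsOpen W)
    {G : X → M} (hG : ContMDiffOn (𝓡 l) (𝓡 n) ∞ G W) (hC : closure C ⊆ W)
    (hCm : MeasurableSet[borel X] C) (hK : (S.restrict C hCm).K ⊆ W) (hK' : IsCompact K')
    (hK'W : K' ⊆ W) (f : TestFn n M) (π : Fin k → TestFn n M)
    (hf : ∀ x ∈ W, x ∉ C → G x ∉ tsupport f) :
    ∃ (f' : TestFn l X) (π' : Fin k → TestFn l X), (∀ x ∈ W, f' x = f (G x)) ∧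
      (∀ a, ∀ᶠ x in 𝓝ˢ K', π' a x = π a (G x)) ∧
      boundary n M k ((S.restrict C hCm).mapOn hW hG hK).current f π
        = boundary l X k S.current f' π' := by
  obtain ⟨f', hf', hf0⟩ := exists_pullback_of_tsupport hW hG hC f hf
  choose π' hπ' _ using fun a => exists_pullback_near ((S.restrict C hCm).isCompact_K.union hK') hW
    (union_subset hK hK'W) hG (π a)
  refine ⟨f', π', hf', fun a => (hπ' a).filter_mono (nhdsSet_mono subset_union_right), ?_⟩
  rw [(S.restrict C hCm).boundary_mapOn_current hW hG hK (f' := f') (π' := π')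
    (eventually_nhdsSet_iff_forall.2 fun x hx => by
      filter_upwards [hW.mem_nhds (hK hx)] with y hy
      exact hf' y hy)
    (fun a => (hπ' a).filter_mono (nhdsSet_mono subset_union_left))]
  refine S.current_restrict_of_forall hCm (measurableSet_borel_compl hCm) fun j x hx hxC => ?_
  rw [jac_eq_zero 0 0, mul_zero]
  exact (S.continuousAt_φ hx).eventually
    (p := fun y => (Fin.cons f' π' : Fin (k + 1) → TestFn l X) 0 y = 0) (hf0 _ hxC)

end BoundaryMapOn

end RectData

namespace GluePair

variable {n k : ℕ} {X Y M : Type*}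
  [TopologicalSpace X] [ChartedSpace (EuclideanSpace ℝ (Fin n)) X]
  [TopologicalSpace Y] [ChartedSpace (EuclideanSpace ℝ (Fin n)) Y]
  [TopologicalSpace M] [ChartedSpace (EuclideanSpace ℝ (Fin n)) M]
  {Φ : PartialDiffeomorph (𝓡 n) (𝓡 n) (EuclideanSpace ℝ (Fin n)) X ∞}
  {Ψ : PartialDiffeomorph (𝓡 n) (𝓡 n) (EuclideanSpace ℝ (Fin n)) Y ∞}
  {J : PartialDiffeomorph (𝓡 n) (𝓡 n) X M ∞}
  {L : PartialDiffeomorph (𝓡 n) (𝓡 n) Y M ∞}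

local notation "𝔼" => EuclideanSpace ℝ (Fin n)

/-- A compact subset of the first piece avoids a ball of radius greater than `1 / 2`. -/
theorem exists_radius [T2Space X] (h : GluePair Φ Ψ J L) {K : Set X} (hK : IsCompact K)
    (hKJ : K ⊆ J.source) : ∃ s, 1 / 2 < s ∧ s < 2 ∧ K ⊆ (Φ '' Metric.closedBall 0 s)ᶜ := by
  have hO : IsOpen (Φ.source ∩ Φ ⁻¹' Kᶜ) :=
    Φ.contMDiffOn.continuousOn.isOpen_inter_preimage Φ.open_source hK.isClosed.isOpen_compl
  have hsub : Metric.closedBall (0 : 𝔼) (1 / 2) ⊆ Φ.source ∩ Φ ⁻¹' Kᶜ := by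
    intro x hx
    have hx' : ‖x‖ ≤ 1 / 2 := by simpa using hx
    refine ⟨h.mem_source (by linarith), fun hxK => ?_⟩
    have h1 := hKJ hxK
    rw [h.source_J] at h1
    exact h1 ⟨x, hx, rfl⟩
  obtain ⟨δ, hδ, hδO⟩ := (isCompact_closedBall (0 : 𝔼) (1 / 2)).exists_cthickening_subset_open hO hsub
  rw [cthickening_closedBall hδ.le (by norm_num)] at hδO
  refine ⟨1 / 2 + min δ 1, by have := lt_min hδ one_pos; linarith,
    by have := min_le_right δ 1; linarith, fun p hp => ?_⟩
  rintro ⟨x, hx, rfl⟩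
  refine (hδO (a := x) ?_).2 hp
  rw [mem_closedBall_zero_iff] at hx ⊢
  linarith [min_le_left δ 1]

/-- The shells of the two pieces are glued with reversal of the orientation. -/
theorem chartInt_shell (h : GluePair Φ Ψ J L) {t₁ t₂ : ℝ} (h1 : 1 / 2 < t₁) (h12 : t₁ < t₂) (h2 : t₂ < 2)
    (f : TestFn n M) (π : Fin n → TestFn n M)
    {f₁ : TestFn n X} {π₁ : Fin n → TestFn n X} {f₂ : TestFn n Y} {π₂ : Fin n → TestFn n Y}
    (hf₁ : ∀ p ∈ Φ '' Metric.ball 0 t₂ \ Φ '' Metric.ball 0 t₁, f₁ p = f (J p))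
    (hπ₁ : ∀ a, ∀ p ∈ Φ '' Metric.ball 0 t₂ \ Φ '' Metric.ball 0 t₁, ∀ᶠ q in 𝓝 p, π₁ a q = π a (J q))
    (hf₂ : ∀ p ∈ Ψ '' Metric.closedBall 0 t₁⁻¹ \ Ψ '' Metric.closedBall 0 t₂⁻¹, f₂ p = f (L p))
    (hπ₂ : ∀ a, ∀ p ∈ Ψ '' Metric.closedBall 0 t₁⁻¹ \ Ψ '' Metric.closedBall 0 t₂⁻¹,
      ∀ᶠ q in 𝓝 p, π₂ a q = π a (L q))
    (hm₁ : MeasurableSet[borel X] (Φ '' Metric.ball 0 t₂ \ Φ '' Metric.ball 0 t₁))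
    (hm₂ : MeasurableSet[borel Y] (Ψ '' Metric.closedBall 0 t₁⁻¹ \ Ψ '' Metric.closedBall 0 t₂⁻¹)) :
    chartInt Φ (Φ '' Metric.ball 0 t₂ \ Φ '' Metric.ball 0 t₁) f₁ π₁
      = -chartInt Ψ (Ψ '' Metric.closedBall 0 t₁⁻¹ \ Ψ '' Metric.closedBall 0 t₂⁻¹) f₂ π₂ := by
  have ht₁ : 0 < t₁ := by linarith
  have ht₂ : 0 < t₂ := by linarith
  have hinv₁ : t₁⁻¹ < 2 := by
    rw [inv_lt_comm₀ ht₁ (by norm_num)]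
    linarith
  have hinv₂ : t₂⁻¹ < 2 := ((inv_lt_inv₀ ht₂ ht₁).2 h12).trans hinv₁
  have hA : ∀ x : Fin n → ℝ, x ∈ chartSet Φ (Φ '' Metric.ball 0 t₂ \ Φ '' Metric.ball 0 t₁) ↔
      t₁ ≤ ‖(WithLp.toLp 2 x : 𝔼)‖ ∧ ‖(WithLp.toLp 2 x : 𝔼)‖ < t₂ := by
    intro x
    constructor
    · rintro ⟨hx, hx1, hx2⟩
      rw [h.source_left, mem_ball_zero_iff] at hx
      rw [h.mem_image_ball hx h2.le] at hx1
      rw [h.mem_image_ball hx (by linarith), not_lt] at hx2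
      exact ⟨hx2, hx1⟩
    · rintro ⟨hx1, hx2⟩
      have hx : ‖(WithLp.toLp 2 x : 𝔼)‖ < 2 := hx2.trans h2
      refine ⟨h.mem_source hx, (h.mem_image_ball hx h2.le).2 hx2, ?_⟩
      rw [h.mem_image_ball hx (by linarith), not_lt]
      exact hx1
  -- The inversion carries `t₁ ≤ ‖x‖ < t₂` to `t₂⁻¹ < ‖y‖ ≤ t₁⁻¹`; this is why open balls are
  -- removed on one side and closed balls on the other.
  have hB : ∀ y : Fin n → ℝ,
      y ∈ chartSet Ψ (Ψ '' Metric.closedBall 0 t₁⁻¹ \ Ψ '' Metric.closedBall 0 t₂⁻¹) ↔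
      t₂⁻¹ < ‖(WithLp.toLp 2 y : 𝔼)‖ ∧ ‖(WithLp.toLp 2 y : 𝔼)‖ ≤ t₁⁻¹ := by
    intro y
    constructor
    · rintro ⟨hy, hy1, hy2⟩
      rw [h.source_right, mem_ball_zero_iff] at hy
      rw [h.symm.mem_image_closedBall hy hinv₁] at hy1
      rw [h.symm.mem_image_closedBall hy hinv₂, not_le] at hy2
      exact ⟨hy2, hy1⟩
    · rintro ⟨hy1, hy2⟩
      have hy : ‖(WithLp.toLp 2 y : 𝔼)‖ < 2 := hy2.trans_lt hinv₁
      refine ⟨h.symm.mem_source hy, (h.symm.mem_image_closedBall hy hinv₁).2 hy2, ?_⟩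
      rw [h.symm.mem_image_closedBall hy hinv₂, not_le]
      exact hy1
  let θ : (Fin n → ℝ) → M := fun x => J (Φ (WithLp.toLp 2 x))
  let θ' : (Fin n → ℝ) → M := fun y => L (Ψ (WithLp.toLp 2 y))
  let ψ : (Fin n → ℝ) → Fin n → ℝ := fun x =>
    WithLp.ofLp ((‖(WithLp.toLp 2 x : 𝔼)‖ ^ 2)⁻¹ • (WithLp.toLp 2 x : 𝔼))
  have hψ2 : ∀ x, ψ (ψ x) = x := fun x => by
    change WithLp.ofLp _ = x
    rw [show (WithLp.toLp 2 (ψ x) : 𝔼) = (‖(WithLp.toLp 2 x : 𝔼)‖ ^ 2)⁻¹ • (WithLp.toLp 2 x : 𝔼)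
      from rfl, inversion_inversion]
  have hψn : ∀ x, ‖(WithLp.toLp 2 (ψ x) : 𝔼)‖ = ‖(WithLp.toLp 2 x : 𝔼)‖⁻¹ := fun x =>
    norm_inversion _
  have himage : ψ '' chartSet Φ (Φ '' Metric.ball 0 t₂ \ Φ '' Metric.ball 0 t₁)
      = chartSet Ψ (Ψ '' Metric.closedBall 0 t₁⁻¹ \ Ψ '' Metric.closedBall 0 t₂⁻¹) := by
    ext y
    constructor
    · rintro ⟨x, hx, rfl⟩
      rw [hA] at hx
      have hx0 : 0 < ‖(WithLp.toLp 2 x : 𝔼)‖ := ht₁.trans_le hx.1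
      rw [hB, hψn, inv_lt_inv₀ ht₂ hx0, inv_le_inv₀ hx0 ht₁]
      exact ⟨hx.2, hx.1⟩
    · intro hy
      rw [hB] at hy
      have hy0 : 0 < ‖(WithLp.toLp 2 y : 𝔼)‖ := (inv_pos.2 ht₂).trans hy.1
      refine ⟨ψ y, ?_, hψ2 y⟩
      rw [hA, hψn, le_inv_comm₀ ht₁ hy0, inv_lt_comm₀ hy0 ht₂]
      exact ⟨hy.2, hy.1⟩
  have e1 : chartInt Φ (Φ '' Metric.ball 0 t₂ \ Φ '' Metric.ball 0 t₁) f₁ π₁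
      = ∫ x in chartSet Φ (Φ '' Metric.ball 0 t₂ \ Φ '' Metric.ball 0 t₁), f (θ x) * jac π θ x := by
    refine setIntegral_congr_fun (measurableSet_chartSet Φ hm₁) fun x hx => ?_
    have hc : ContinuousAt (fun y : Fin n → ℝ => Φ (WithLp.toLp 2 y)) x :=
      (contMDiffOn_comp_toLp Φ).continuousOn.continuousAt ((isOpen_toLp_preimage Φ).mem_nhds hx.1)
    simp only [hf₁ _ hx.2]
    congr 1
    exact jac_congr fun a => hc.eventually (hπ₁ a _ hx.2)
  have e2 : chartInt Ψ (Ψ '' Metric.closedBall 0 t₁⁻¹ \ Ψ '' Metric.closedBall 0 t₂⁻¹) f₂ π₂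
      = ∫ y in chartSet Ψ (Ψ '' Metric.closedBall 0 t₁⁻¹ \ Ψ '' Metric.closedBall 0 t₂⁻¹),
        f (θ' y) * jac π θ' y := by
    refine setIntegral_congr_fun (measurableSet_chartSet Ψ hm₂) fun x hx => ?_
    have hc : ContinuousAt (fun y : Fin n → ℝ => Ψ (WithLp.toLp 2 y)) x :=
      (contMDiffOn_comp_toLp Ψ).continuousOn.continuousAt ((isOpen_toLp_preimage Ψ).mem_nhds hx.1)
    simp only [hf₂ _ hx.2]
    congr 1
    exact jac_congr fun a => hc.eventually (hπ₂ a _ hx.2)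
  have hne : ∀ x : Fin n → ℝ, x ∈ chartSet Φ (Φ '' Metric.ball 0 t₂ \ Φ '' Metric.ball 0 t₁) →
      (WithLp.toLp 2 x : 𝔼) ≠ 0 := fun x hx =>
    norm_pos_iff.1 (ht₁.trans_le ((hA x).1 hx).1)
  have hL : ContMDiffOn 𝓘(ℝ, Fin n → ℝ) (𝓡 n) ∞ θ'
      {y | WithLp.toLp 2 y ∈ Ψ.source ∩ Ψ ⁻¹' L.source} :=
    L.contMDiffOn.comp ((contMDiffOn_comp_toLp Ψ).mono fun y hy => hy.1) fun y hy => hy.2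
  have hLo : IsOpen {y : Fin n → ℝ | WithLp.toLp 2 y ∈ Ψ.source ∩ Ψ ⁻¹' L.source} :=
    (Ψ.contMDiffOn.continuousOn.isOpen_inter_preimage Ψ.open_source L.open_source).preimage
      contDiff_toLp.continuous
  -- Change of variables along the inversion, with `κ = -1` because its determinant is negative.
  rw [e1, e2, ← himage]
  refine (setIntegral_jac_eq (ψ := ψ) (θ' := θ') (κ := -1)
    (measurableSet_chartSet Φ hm₁) (fun x hx => ?_) ?_ (fun x hx => ?_) (by norm_num)
    (fun x hx => ?_) f π fun x hx a => ?_).trans (by push_cast; ring)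
  · exact (contDiff_ofLp.differentiable (by simp)).differentiableAt.comp x
      ((hasFDerivAt_unit_inversion (hne x hx)).differentiableAt.comp x
        (contDiff_toLp.differentiable (by simp)).differentiableAt)
  · exact fun x _ y _ hxy => by rw [← hψ2 x, ← hψ2 y, hxy]
  · have hx' := (hA x).1 hx
    have hcn : Continuous fun y : Fin n → ℝ => ‖(WithLp.toLp 2 y : 𝔼)‖ :=
      contDiff_toLp.continuous.norm
    filter_upwards [hcn.continuousAt.eventually (lt_mem_nhds (h1.trans_le hx'.1)),
      hcn.continuousAt.eventually (gt_mem_nhds (hx'.2.trans h2))] with y hy1 hy2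
    exact h.J_eq_L hy1 hy2
  · rw [det_fderiv_conj_toLp (g := fun z : 𝔼 => (‖z‖ ^ 2)⁻¹ • z)
      (hasFDerivAt_unit_inversion (hne x hx)).differentiableAt]
    have := det_fderiv_unit_inversion_neg (hne x hx)
    push_cast
    linarith
  · have hy : ψ x ∈ chartSet Ψ (Ψ '' Metric.closedBall 0 t₁⁻¹ \ Ψ '' Metric.closedBall 0 t₂⁻¹) := by
      rw [← himage]
      exact mem_image_of_mem ψ hx
    have hy' := (hB _).1 hy
    have h3 : 1 / 2 < t₂⁻¹ := by
      rw [one_div, inv_lt_inv₀ (by norm_num) ht₂]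
      exact h2
    have hyL : ψ x ∈ {y : Fin n → ℝ | WithLp.toLp 2 y ∈ Ψ.source ∩ Ψ ⁻¹' L.source} :=
      ⟨hy.1, (h.symm.mem_J_source (hy'.2.trans_lt hinv₁)).2 (h3.trans hy'.1)⟩
    have h4 : ContDiffOn ℝ ∞ (fun y => π a (θ' y))
        {y : Fin n → ℝ | WithLp.toLp 2 y ∈ Ψ.source ∩ Ψ ⁻¹' L.source} := by
      rw [← contMDiffOn_iff_contDiffOn]
      exact (π a).contMDiff.comp_contMDiffOn hL
    exact (h4.contDiffAt (hLo.mem_nhds hyL)).differentiableAt (by simp)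

end GluePair

/-! ### Fillings of cycles of a piece -/

namespace GluePair

section LowDimension

variable {n k : ℕ} {X Y M : Type*}
  [TopologicalSpace X] [ChartedSpace (EuclideanSpace ℝ (Fin n)) X]
  [TopologicalSpace Y] [ChartedSpace (EuclideanSpace ℝ (Fin n)) Y]
  [TopologicalSpace M] [ChartedSpace (EuclideanSpace ℝ (Fin n)) M]
  {Φ : PartialDiffeomorph (𝓡 n) (𝓡 n) (EuclideanSpace ℝ (Fin n)) X ∞}
  {Ψ : PartialDiffeomorph (𝓡 n) (𝓡 n) (EuclideanSpace ℝ (Fin n)) Y ∞}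
  {J : PartialDiffeomorph (𝓡 n) (𝓡 n) X M ∞}
  {L : PartialDiffeomorph (𝓡 n) (𝓡 n) Y M ∞}
  [T2Space X] [SecondCountableTopology X] [IsManifold (𝓡 n) ∞ X]

theorem boundary_eq_zero_of_tsupport {P : RectData n X k} {S : RectData n X (k + 1)}
    (hS : boundary n X k S.current = P.current) {V : Set X} (hV : P.K ⊆ Vᶜ) (f : TestFn n X)
    (π : Fin k → TestFn n X) (hf : tsupport f ⊆ V) : boundary n X k S.current f π = 0 := by
  rw [hS]
  refine P.current_eq_zero fun j x hx => ?_
  rw [image_eq_zero_of_notMem_tsupport fun h => hV (P.mapsTo j hx) (hf h), zero_mul]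

/-- In codimension at least two, a chain of a piece that bounds in the manifold bounds in the
piece. -/
theorem exists_boundary_of_lt (h : GluePair Φ Ψ J L) (hk : k + 2 < n) (P : RectData n X (k + 1))
    (hP : P.K ⊆ J.source) (S : RectData n X (k + 2))
    (hS : boundary n X (k + 1) S.current = P.current) :
    ∃ S' : RectData n X (k + 2), S'.K ⊆ J.source ∧ boundary n X (k + 1) S'.current = P.current := by
  obtain ⟨s, hs1, hs2, hPs⟩ := h.exists_radius P.isCompact_K hP
  obtain ⟨r, hr1, hrs⟩ := exists_between hs1
  obtain ⟨S', T, hS'K, hT⟩ := S.exists_avoiding Φ h.source_left hs2 hk (r := r) (by linarith) hrs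
    (boundary_eq_zero_of_tsupport hS (hPs.trans
      (compl_subset_compl.2 (image_mono Metric.ball_subset_closedBall))))
  refine ⟨S', hS'K.trans (h.compl_ball_subset hr1), ?_⟩
  rw [sub_eq_iff_eq_add] at hT
  rw [hT, map_add, boundary_boundary, zero_add, hS]

end LowDimension

section TopDimension

variable {k : ℕ} {X Y M : Type*}
  [TopologicalSpace X] [ChartedSpace (EuclideanSpace ℝ (Fin (k + 2))) X]
  [TopologicalSpace Y] [ChartedSpace (EuclideanSpace ℝ (Fin (k + 2))) Y]
  [TopologicalSpace M] [ChartedSpace (EuclideanSpace ℝ (Fin (k + 2))) M]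
  {Φ : PartialDiffeomorph (𝓡 (k + 2)) (𝓡 (k + 2)) (EuclideanSpace ℝ (Fin (k + 2))) X ∞}
  {Ψ : PartialDiffeomorph (𝓡 (k + 2)) (𝓡 (k + 2)) (EuclideanSpace ℝ (Fin (k + 2))) Y ∞}
  {J : PartialDiffeomorph (𝓡 (k + 2)) (𝓡 (k + 2)) X M ∞}
  {L : PartialDiffeomorph (𝓡 (k + 2)) (𝓡 (k + 2)) Y M ∞}
  [T2Space X] [SecondCountableTopology X] [IsManifold (𝓡 (k + 2)) ∞ X]

local notation "𝔼" => EuclideanSpace ℝ (Fin (k + 2))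

theorem isPreconnected_source (h : GluePair Φ Ψ J L) : IsPreconnected Φ.source := by
  rw [h.source_left]
  exact (convex_ball _ _).isPreconnected

theorem image_closedBall_subset_target (h : GluePair Φ Ψ J L) {r : ℝ} (hr : r < 2) :
    Φ '' Metric.closedBall 0 r ⊆ Φ.target := by
  rintro _ ⟨x, hx, rfl⟩
  have hx' : ‖x‖ ≤ r := by simpa using hx
  exact Φ.map_source (h.mem_source (by linarith))

/-- In a closed oriented manifold, a chain of codimension one in the complement of a ball that
bounds in the manifold bounds in this complement. -/
theorem exists_boundary_of_compact [CompactSpace X] (h : GluePair Φ Ψ J L)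
    (hX : IsOrientable (k + 2) X) (P : RectData (k + 2) X (k + 1)) (hP : P.K ⊆ J.source)
    (S : RectData (k + 2) X (k + 2)) (hS : boundary (k + 2) X (k + 1) S.current = P.current) :
    ∃ S' : RectData (k + 2) X (k + 2), S'.K ⊆ J.source ∧
      boundary (k + 2) X (k + 1) S'.current = P.current := by
  obtain ⟨s, hs1, hs2, hPs⟩ := h.exists_radius P.isCompact_K hP
  obtain ⟨t, ht1, hts⟩ := exists_between hs1
  obtain ⟨m, hm⟩ := S.exists_multiplicity_inBall Φ h.source_left (by linarith) hs2
    (boundary_eq_zero_of_tsupport hS (hPs.trans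
      (compl_subset_compl.2 (image_mono Metric.ball_subset_closedBall))))
  obtain ⟨F, hF0, hF⟩ := exists_fundamental_cycle hX Φ h.isPreconnected_source m
  have hO := isOpen_image_ball Φ h.source_left (s := t) (by linarith)
  have hB := measurableSet_borel_of_isOpen hO
  have hBc := measurableSet_borel_compl hB
  refine ⟨(S.add F.neg).restrict _ hBc, ((S.add F.neg).restrict_compl_K_subset hO hBc).trans
    (h.compl_ball_subset ht1), ?_⟩
  -- On the ball both chains have multiplicity `m`. Subtracting the multiple of the fundamental
  -- cycle makes the filling vanish there without changing its boundary.
  have hzero : ((S.add F.neg).restrict _ hB).current = 0 := by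
    rw [RectData.add_restrict_current]
    have h1 : (F.neg.restrict _ hB).current = -(F.restrict _ hB).current :=
      (F.restrict _ hB).neg_current
    rw [h1]
    funext f π
    rw [Pi.add_apply, Pi.add_apply, Pi.neg_apply, Pi.neg_apply,
      hm _ hB (image_mono (Metric.ball_subset_ball hts.le)),
      hF _ hB _ (isCompact_image_closedBall Φ h.source_left (s := t) (by linarith))
        (image_mono Metric.ball_subset_closedBall) (h.image_closedBall_subset_target (by linarith)),
      add_neg_cancel]
    rfl
  have hsum := (S.add F.neg).current_restrict_add hB hBc
  rw [hzero, zero_add] at hsum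
  rw [hsum, RectData.add_current, RectData.neg_current, map_add, map_neg, hF0, neg_zero, add_zero, hS]

variable [T2Space Y] [SecondCountableTopology Y] [IsManifold (𝓡 (k + 2)) ∞ Y]
  [T2Space M] [SecondCountableTopology M] [IsManifold (𝓡 (k + 2)) ∞ M]

/-- If the second manifold is closed and oriented, a chain of codimension one in the first piece
that bounds in the first manifold bounds in the glued manifold. -/
theorem exists_boundary_glued [CompactSpace Y] (h : GluePair Φ Ψ J L)
    (hY : IsOrientable (k + 2) Y) (P : RectData (k + 2) X (k + 1)) (hP : P.K ⊆ J.source)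
    (S : RectData (k + 2) X (k + 2)) (hS : boundary (k + 2) X (k + 1) S.current = P.current) :
    ∃ U : RectData (k + 2) M (k + 2), boundary (k + 2) M (k + 1) U.current
      = (P.mapOn J.open_source J.contMDiffOn hP).current := by
  obtain ⟨s, hs1, hs2, hPs⟩ := h.exists_radius P.isCompact_K hP
  obtain ⟨m, hm⟩ := S.exists_multiplicity_inBall Φ h.source_left (by linarith) hs2
    (boundary_eq_zero_of_tsupport hS (hPs.trans
      (compl_subset_compl.2 (image_mono Metric.ball_subset_closedBall))))
  -- The sign compensates for the orientation reversal of the inversion: on the shell, multiplicity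
  -- `-m` in the coordinates of `Ψ` is multiplicity `m` in those of `Φ`.
  obtain ⟨F, hF0, hF⟩ := exists_fundamental_cycle hY Ψ h.symm.isPreconnected_source (-m)
  have hAo : ∀ t, t < 2 → IsOpen (Φ '' Metric.ball 0 t) := fun t ht =>
    isOpen_image_ball Φ h.source_left ht.le
  have hAm : ∀ t, t < 2 → MeasurableSet[borel X] (Φ '' Metric.ball 0 t) := fun t ht =>
    measurableSet_borel_of_isOpen (hAo t ht)
  have hAc : ∀ t, t < 2 → closure (Φ '' Metric.ball 0 t)ᶜ ⊆ (Φ '' Metric.ball 0 t)ᶜ := fun t ht =>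
    (hAo t ht).isClosed_compl.closure_eq.subset
  have hAK : ∀ t, 1 / 2 < t → ∀ ht : t < 2,
      (S.restrict _ (measurableSet_borel_compl (hAm t ht))).K ⊆ J.source := fun t h1 ht =>
    (inter_subset_right.trans (hAc t ht)).trans (h.compl_ball_subset h1)
  have hinv : ∀ t : ℝ, 1 / 2 < t → t < 2 → 1 / 2 < t⁻¹ ∧ t⁻¹ < 2 := by
    intro t h1 h2
    constructor
    · rw [one_div, inv_lt_inv₀ (by norm_num) (by linarith)]
      exact h2
    · rw [inv_lt_comm₀ (by linarith) (by norm_num)]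
      linarith
  have hBcl : ∀ t, t < 2 → IsCompact (Ψ '' Metric.closedBall 0 t) := fun t ht =>
    isCompact_image_closedBall Ψ h.source_right ht
  have hBm : ∀ t, t < 2 → MeasurableSet[borel Y] (Ψ '' Metric.closedBall 0 t)ᶜ := fun t ht =>
    measurableSet_borel_of_isOpen (hBcl t ht).isClosed.isOpen_compl
  have hBo : ∀ t, t < 2 → IsOpen (Ψ '' Metric.ball 0 t) := fun t ht =>
    isOpen_image_ball Ψ h.source_right ht.le
  have hBc : ∀ t, t < 2 → closure (Ψ '' Metric.closedBall 0 t)ᶜ ⊆ (Ψ '' Metric.ball 0 t)ᶜ :=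
    fun t ht => closure_minimal (compl_subset_compl.2 (image_mono Metric.ball_subset_closedBall))
      (hBo t ht).isClosed_compl
  have hBs : ∀ t, 1 / 2 < t → t < 2 → closure (Ψ '' Metric.closedBall 0 t)ᶜ ⊆ L.source :=
    fun t h1 ht => (hBc t ht).trans (h.symm.compl_ball_subset h1)
  have hBK : ∀ t, 1 / 2 < t → ∀ ht : t < 2, (F.restrict _ (hBm t ht)).K ⊆ L.source := fun t h1 ht =>
    inter_subset_right.trans (hBs t h1 ht)
  -- Cut at the sphere of radius `t`, read as `t⁻¹` from the other side: `U₁` is the filling `S`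
  -- outside, and `U₂` is the multiple of the fundamental cycle of `Y` beyond the sphere.
  let U₁ : ∀ t : ℝ, 1 / 2 < t → t < 2 → RectData (k + 2) M (k + 2) := fun t h1 h2 =>
    (S.restrict _ (measurableSet_borel_compl (hAm t h2))).mapOn J.open_source J.contMDiffOn
      (hAK t h1 h2)
  let U₂ : ∀ t : ℝ, 1 / 2 < t → t < 2 → RectData (k + 2) M (k + 2) := fun t h1 h2 =>
    (F.restrict _ (hBm t⁻¹ (hinv t h1 h2).2)).mapOn L.open_source L.contMDiffOn
      (hBK t⁻¹ (hinv t h1 h2).1 (hinv t h1 h2).2)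
  -- the glued chain does not depend on the radius
  have hindep : ∀ t₁ t₂ (h1 : 1 / 2 < t₁) (h1' : t₁ < 2) (h2 : 1 / 2 < t₂) (h2' : t₂ < 2),
      t₁ < t₂ → t₂ < s →
      ((U₁ t₁ h1 h1').add (U₂ t₁ h1 h1')).current = ((U₁ t₂ h2 h2').add (U₂ t₂ h2 h2')).current := by
    intro t₁ t₂ h1 h1' h2 h2' h12 h2s
    rw [RectData.add_current, RectData.add_current]
    funext f π
    have ht₁ : 0 < t₁ := by linarith
    have ht₂ : 0 < t₂ := by linarith
    have h12' : t₂⁻¹ < t₁⁻¹ := (inv_lt_inv₀ ht₂ ht₁).2 h12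
    obtain ⟨hi1, hi1'⟩ := hinv t₁ h1 h1'
    obtain ⟨hi2, hi2'⟩ := hinv t₂ h2 h2'
    have hAcomp : IsCompact (Φ '' Metric.closedBall 0 t₂ ∩ (Φ '' Metric.ball 0 t₁)ᶜ) :=
      (isCompact_image_closedBall Φ h.source_left h2').inter_right (hAo t₁ h1').isClosed_compl
    have hKX : IsCompact (S.K ∩ (Φ '' Metric.ball 0 t₁)ᶜ ∪
        Φ '' Metric.closedBall 0 t₂ ∩ (Φ '' Metric.ball 0 t₁)ᶜ) :=
      (S.isCompact_K.inter_right (hAo t₁ h1').isClosed_compl).union hAcomp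
    have hKXs : S.K ∩ (Φ '' Metric.ball 0 t₁)ᶜ ∪
        Φ '' Metric.closedBall 0 t₂ ∩ (Φ '' Metric.ball 0 t₁)ᶜ ⊆ J.source :=
      (union_subset inter_subset_right inter_subset_right).trans (h.compl_ball_subset h1)
    have hKY : IsCompact (Ψ '' Metric.ball 0 t₂⁻¹)ᶜ := (hBo _ hi2').isClosed_compl.isCompact
    have hKYs : (Ψ '' Metric.ball 0 t₂⁻¹)ᶜ ⊆ L.source := h.symm.compl_ball_subset hi2
    obtain ⟨f₁, hf₁, -⟩ := exists_pullback_near hKX J.open_source hKXs J.contMDiffOn f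
    choose π₁ hπ₁ _ using fun a => exists_pullback_near hKX J.open_source hKXs J.contMDiffOn (π a)
    obtain ⟨f₂, hf₂, -⟩ := exists_pullback_near hKY L.open_source hKYs L.contMDiffOn f
    choose π₂ hπ₂ _ using fun a => exists_pullback_near hKY L.open_source hKYs L.contMDiffOn (π a)
    have hsub1 : (S.restrict _ (measurableSet_borel_compl (hAm t₁ h1'))).K ⊆
        S.K ∩ (Φ '' Metric.ball 0 t₁)ᶜ ∪ Φ '' Metric.closedBall 0 t₂ ∩ (Φ '' Metric.ball 0 t₁)ᶜ :=
      fun p hp => Or.inl ⟨hp.1, hAc t₁ h1' hp.2⟩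
    have hsub2 : (S.restrict _ (measurableSet_borel_compl (hAm t₂ h2'))).K ⊆
        S.K ∩ (Φ '' Metric.ball 0 t₁)ᶜ ∪ Φ '' Metric.closedBall 0 t₂ ∩ (Φ '' Metric.ball 0 t₁)ᶜ :=
      fun p hp => Or.inl ⟨hp.1, fun hp' => hAc t₂ h2' hp.2
        (image_mono (Metric.ball_subset_ball h12.le) hp')⟩
    have hsub3 : (F.restrict _ (hBm t₁⁻¹ hi1')).K ⊆ (Ψ '' Metric.ball 0 t₂⁻¹)ᶜ :=
      fun p hp hp' => hBc _ hi1' hp.2 (image_mono (Metric.ball_subset_ball h12'.le) hp')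
    have hsub4 : (F.restrict _ (hBm t₂⁻¹ hi2')).K ⊆ (Ψ '' Metric.ball 0 t₂⁻¹)ᶜ :=
      fun p hp => hBc _ hi2' hp.2
    have e1 : (U₁ t₁ h1 h1').current f π
        = (S.restrict _ (measurableSet_borel_compl (hAm t₁ h1'))).current f₁ π₁ :=
      RectData.mapOn_current _ _ _ _ (fun x hx => hf₁.self_of_nhdsSet x (hsub1 hx))
        fun a => (hπ₁ a).filter_mono (nhdsSet_mono hsub1)
    have e2 : (U₁ t₂ h2 h2').current f π
        = (S.restrict _ (measurableSet_borel_compl (hAm t₂ h2'))).current f₁ π₁ :=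
      RectData.mapOn_current _ _ _ _ (fun x hx => hf₁.self_of_nhdsSet x (hsub2 hx))
        fun a => (hπ₁ a).filter_mono (nhdsSet_mono hsub2)
    have e3 : (U₂ t₁ h1 h1').current f π = (F.restrict _ (hBm t₁⁻¹ hi1')).current f₂ π₂ :=
      RectData.mapOn_current _ _ _ _ (fun x hx => hf₂.self_of_nhdsSet x (hsub3 hx))
        fun a => (hπ₂ a).filter_mono (nhdsSet_mono hsub3)
    have e4 : (U₂ t₂ h2 h2').current f π = (F.restrict _ (hBm t₂⁻¹ hi2')).current f₂ π₂ :=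
      RectData.mapOn_current _ _ _ _ (fun x hx => hf₂.self_of_nhdsSet x (hsub4 hx))
        fun a => (hπ₂ a).filter_mono (nhdsSet_mono hsub4)
    have hm1 : MeasurableSet[borel X] (Φ '' Metric.ball 0 t₂ \ Φ '' Metric.ball 0 t₁) := by
      borelize X
      exact (hAm t₂ h2').diff (hAm t₁ h1')
    have hm1' : MeasurableSet[borel X] ((Φ '' Metric.ball 0 t₁)ᶜ \ (Φ '' Metric.ball 0 t₂)ᶜ) := by
      rwa [compl_sdiff_compl]
    have hm2 : MeasurableSet[borel Y]
        (Ψ '' Metric.closedBall 0 t₁⁻¹ \ Ψ '' Metric.closedBall 0 t₂⁻¹) := by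
      borelize Y
      exact (hBcl _ hi1').isClosed.measurableSet.diff (hBcl _ hi2').isClosed.measurableSet
    have hm2' : MeasurableSet[borel Y]
        ((Ψ '' Metric.closedBall 0 t₂⁻¹)ᶜ \ (Ψ '' Metric.closedBall 0 t₁⁻¹)ᶜ) := by
      rwa [compl_sdiff_compl]
    have d1 := congrFun (congrFun (S.current_restrict_eq_add_sdiff
      (measurableSet_borel_compl (hAm t₁ h1')) (measurableSet_borel_compl (hAm t₂ h2')) hm1'
      (compl_subset_compl.2 (image_mono (Metric.ball_subset_ball h12.le)))) f₁) π₁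
    have d2 := congrFun (congrFun (F.current_restrict_eq_add_sdiff (hBm t₂⁻¹ hi2') (hBm t₁⁻¹ hi1')
      hm2' (compl_subset_compl.2 (image_mono (Metric.closedBall_subset_closedBall h12'.le)))) f₂) π₂
    rw [Pi.add_apply, Pi.add_apply, S.restrict_current_congr hm1' hm1 compl_sdiff_compl,
      hm _ hm1 (sdiff_subset.trans (image_mono (Metric.ball_subset_ball h2s.le)))] at d1
    rw [Pi.add_apply, Pi.add_apply, F.restrict_current_congr hm2' hm2 compl_sdiff_compl,
      hF _ hm2 _ (hBcl _ hi1') sdiff_subset (h.symm.image_closedBall_subset_target hi1')] at d2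
    have hin1 : Φ '' Metric.ball 0 t₂ \ Φ '' Metric.ball 0 t₁ ⊆ S.K ∩ (Φ '' Metric.ball 0 t₁)ᶜ ∪
        Φ '' Metric.closedBall 0 t₂ ∩ (Φ '' Metric.ball 0 t₁)ᶜ := fun p hp =>
      Or.inr ⟨image_mono Metric.ball_subset_closedBall hp.1, hp.2⟩
    have hin2 : Ψ '' Metric.closedBall 0 t₁⁻¹ \ Ψ '' Metric.closedBall 0 t₂⁻¹ ⊆
        (Ψ '' Metric.ball 0 t₂⁻¹)ᶜ := fun p hp hp' =>
      hp.2 (image_mono Metric.ball_subset_closedBall hp')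
    -- Increasing the radius from `t₁` to `t₂` removes `m` times the shell from the first part and
    -- adds `-m` times the inverted shell to the second. By orientation reversal these are the same
    -- current.
    have hshell := h.chartInt_shell h1 h12 h2' f π (f₁ := f₁) (π₁ := π₁) (f₂ := f₂) (π₂ := π₂)
      (fun p hp => hf₁.self_of_nhdsSet p (hin1 hp))
      (fun a p hp => eventually_nhdsSet_iff_forall.1 (hπ₁ a) p (hin1 hp))
      (fun p hp => hf₂.self_of_nhdsSet p (hin2 hp))
      (fun a p hp => eventually_nhdsSet_iff_forall.1 (hπ₂ a) p (hin2 hp)) hm1 hm2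
    rw [Pi.add_apply, Pi.add_apply, Pi.add_apply, Pi.add_apply, e1, e2, e3, e4, d1, d2, hshell]
    push_cast
    ring
  -- Two radii make every cut invisible: the regions `‖x‖ > t₁` and `‖x‖ < t₂` cover the shell. The
  -- boundary is computed from the chain cut at `t₁` on the first and from the one cut at `t₂` on
  -- the second.
  obtain ⟨t₂, h2, h2s⟩ := exists_between hs1
  obtain ⟨t₁, h1, h12⟩ := exists_between h2
  have h2' : t₂ < 2 := h2s.trans hs2
  have h1' : t₁ < 2 := h12.trans h2'
  have hind := hindep t₁ t₂ h1 h1' h2 h2' h12 h2s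
  have ht₁ : 0 < t₁ := by linarith
  have ht₂ : 0 < t₂ := by linarith
  obtain ⟨hi1, hi1'⟩ := hinv t₁ h1 h1'
  obtain ⟨hi2, hi2'⟩ := hinv t₂ h2 h2'
  refine ⟨(U₁ t₁ h1 h1').add (U₂ t₁ h1 h1'), ?_⟩
  have hflat : boundary (k + 2) M (k + 1) ((U₁ t₁ h1 h1').add (U₂ t₁ h1 h1')).current
      - (P.mapOn J.open_source J.contMDiffOn hP).current ∈ flatChains (k + 2) M (k + 1) :=
    sub_mem (AddSubgroup.mem_sup_right ⟨_, ⟨_, rfl⟩, rfl⟩) (AddSubgroup.mem_sup_left ⟨_, rfl⟩)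
  rw [← sub_eq_zero]
  funext f₀ π₀
  refine eq_zero_of_disjoint_spt hflat f₀ π₀ (disjoint_left.2 fun p _ hp => ?_)
  have hJ₁ : (Φ '' Metric.closedBall 0 t₁)ᶜ ⊆ J.source :=
    (compl_subset_compl.2 (image_mono Metric.ball_subset_closedBall)).trans (h.compl_ball_subset h1)
  have hL₂ : (Ψ '' Metric.closedBall 0 t₂⁻¹)ᶜ ⊆ L.source := subset_closure.trans (hBs _ hi2 hi2')
  have hW₁ : IsOpen (J '' (Φ '' Metric.closedBall 0 t₁)ᶜ) :=
    J.toOpenPartialHomeomorph.isOpen_image_of_subset_source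
      (isCompact_image_closedBall Φ h.source_left h1').isClosed.isOpen_compl hJ₁
  have hW₂ : IsOpen (L '' (Ψ '' Metric.closedBall 0 t₂⁻¹)ᶜ) :=
    L.toOpenPartialHomeomorph.isOpen_image_of_subset_source (hBcl _ hi2').isClosed.isOpen_compl hL₂
  have hcover : p ∈ J '' (Φ '' Metric.closedBall 0 t₁)ᶜ ∨ p ∈ L '' (Ψ '' Metric.closedBall 0 t₂⁻¹)ᶜ := by
    by_cases hpJ : p ∈ J.target
    · have e : J (J.toPartialEquiv.symm p) = p := J.right_inv hpJ
      by_cases hpΦ : J.toPartialEquiv.symm p ∈ Φ '' Metric.closedBall 0 t₁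
      · obtain ⟨x, hx, hxp⟩ := hpΦ
        have hx1 : ‖x‖ ≤ t₁ := by simpa using hx
        have hx2 : ‖x‖ < 2 := by linarith
        have hx3 : 1 / 2 < ‖x‖ := by
          rw [← h.mem_J_source hx2, hxp]
          exact J.map_target hpJ
        refine Or.inr ⟨Ψ ((‖x‖ ^ 2)⁻¹ • x), ?_, by rw [← h.J_eq_L hx3 hx2, hxp, e]⟩
        rw [mem_compl_iff, h.symm.mem_image_closedBall (inversion_shell hx3 hx2).2 hi2',
          norm_inversion, not_le, inv_lt_inv₀ ht₂ (by linarith)]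
        linarith
      · exact Or.inl ⟨_, hpΦ, e⟩
    · obtain ⟨q, -, hqp, hq⟩ := h.exists_of_notMem_target hpJ
      exact Or.inr ⟨q, fun hq' => hq (image_mono (Metric.closedBall_subset_ball hi2') hq'), hqp⟩
  -- the two pieces of the glued chain, seen from the open sets of the cover
  have hsep₁ : ∀ q ∈ (Ψ '' Metric.closedBall 0 t₁⁻¹)ᶜ, q ∈ L.source →
      L q ∉ J '' (Φ '' Metric.closedBall 0 t₁)ᶜ := by
    rintro q hq hqL ⟨x, hx, hxq⟩
    obtain ⟨y, hy1, hy2, rfl, rfl⟩ := (h.glue x (hJ₁ hx) q hqL).1 hxq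
    rw [mem_compl_iff, h.symm.mem_image_closedBall (inversion_shell hy1 hy2).2 hi1', norm_inversion,
      not_le, inv_lt_inv₀ ht₁ (by linarith)] at hq
    exact hx ((h.mem_image_closedBall hy2 h1').2 hq.le)
  have hsep₂ : ∀ q ∈ (Φ '' Metric.ball 0 t₂)ᶜ, q ∈ J.source →
      J q ∉ L '' (Ψ '' Metric.closedBall 0 t₂⁻¹)ᶜ := by
    rintro q hq hqJ ⟨x, hx, hxq⟩
    obtain ⟨y, hy1, hy2, rfl, rfl⟩ := (h.glue q hqJ x (hL₂ hx)).1 hxq.symm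
    rw [mem_compl_iff, h.symm.mem_image_closedBall (inversion_shell hy1 hy2).2 hi2', norm_inversion,
      not_le, inv_lt_inv₀ ht₂ (by linarith)] at hx
    exact hq ((h.mem_image_ball hy2 h2'.le).2 hx)
  rcases hcover with hp₁ | hp₂
  · obtain ⟨f, π, hf, hne⟩ := hp _ hW₁ hp₁
    refine hne ?_
    rw [RectData.add_current, map_add]
    change boundary (k + 2) M (k + 1) (U₁ t₁ h1 h1').current f π
      + boundary (k + 2) M (k + 1) (U₂ t₁ h1 h1').current f π
      - (P.mapOn J.open_source J.contMDiffOn hP).current f π = 0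
    have e2 : boundary (k + 2) M (k + 1) (U₂ t₁ h1 h1').current f π = 0 :=
      RectData.boundary_mapOn_eq_zero_of_disjoint _ _ _ _ f π fun j x hx hxf =>
        hsep₁ _ hx.2 (hBK _ hi1 hi1' ((F.restrict _ (hBm t₁⁻¹ hi1')).mapsTo j hx)) (hf hxf)
    obtain ⟨f', π', hf', hπ', e1⟩ := S.exists_boundary_restrict_mapOn J.open_source J.contMDiffOn
      ((hAc t₁ h1').trans (h.compl_ball_subset h1)) (measurableSet_borel_compl (hAm t₁ h1'))
      (hAK t₁ h1 h1') P.isCompact_K hP f π (by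
        intro x hx hxA hxf
        obtain ⟨y, hy, hyx⟩ := hf hxf
        have hyx' : y = x := J.injOn (hJ₁ hy) hx hyx
        rw [hyx'] at hy
        exact hxA fun hx' => hy (image_mono Metric.ball_subset_closedBall hx'))
    have e3 : (P.mapOn J.open_source J.contMDiffOn hP).current f π = P.current f' π' :=
      P.mapOn_current _ _ _ (fun x hx => hf' x (hP hx)) hπ'
    have e1' : boundary (k + 2) M (k + 1) (U₁ t₁ h1 h1').current f π = P.current f' π' := by
      rw [← hS]
      exact e1
    rw [e1', e2, e3]
    ring
  · obtain ⟨f, π, hf, hne⟩ := hp _ hW₂ hp₂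
    refine hne ?_
    -- Here the chain cut at `t₂` is used. Its first part and `P` miss this region, and the second
    -- part is locally the whole fundamental cycle, which has no boundary.
    rw [hind, RectData.add_current, map_add]
    change boundary (k + 2) M (k + 1) (U₁ t₂ h2 h2').current f π
      + boundary (k + 2) M (k + 1) (U₂ t₂ h2 h2').current f π
      - (P.mapOn J.open_source J.contMDiffOn hP).current f π = 0
    have e1 : boundary (k + 2) M (k + 1) (U₁ t₂ h2 h2').current f π = 0 :=
      RectData.boundary_mapOn_eq_zero_of_disjoint _ _ _ _ f π fun j x hx hxf =>
        hsep₂ _ hx.2 (hAK t₂ h2 h2'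
          ((S.restrict _ (measurableSet_borel_compl (hAm t₂ h2'))).mapsTo j hx)) (hf hxf)
    obtain ⟨f', π', -, -, e2⟩ := F.exists_boundary_restrict_mapOn L.open_source L.contMDiffOn
      (hBs _ hi2 hi2') (hBm t₂⁻¹ hi2') (hBK _ hi2 hi2') isCompact_empty (empty_subset _) f π (by
        intro x hx hxA hxf
        obtain ⟨y, hy, hyx⟩ := hf hxf
        have hyx' : y = x := L.injOn (hL₂ hy) hx hyx
        rw [hyx'] at hy
        exact hxA hy)
    have e2' : boundary (k + 2) M (k + 1) (U₂ t₂ h2 h2').current f π = 0 := by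
      refine e2.trans ?_
      rw [hF0]
      rfl
    have e3 : (P.mapOn J.open_source J.contMDiffOn hP).current f π = 0 := by
      refine (P.mapOn J.open_source J.contMDiffOn hP).current_eq_zero fun j x hx => ?_
      have hxP := P.mapsTo j hx
      have : f (J (P.φ j x)) = 0 := image_eq_zero_of_notMem_tsupport fun hxf =>
        hsep₂ _ (fun hx' => hPs hxP (image_mono ((Metric.ball_subset_ball h2s.le).trans
          Metric.ball_subset_closedBall) hx')) (hP hxP) (hf hxf)
      change f (J (P.φ j x)) * _ = 0
      rw [this, zero_mul]
    rw [e1, e2', e3]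
    ring

end TopDimension

end GluePair

/-! ### Homology of the pieces and of the glued manifold -/

namespace GluePair

variable {n k : ℕ} {X Y M : Type*}
  [TopologicalSpace X] [ChartedSpace (EuclideanSpace ℝ (Fin n)) X]
  [TopologicalSpace Y] [ChartedSpace (EuclideanSpace ℝ (Fin n)) Y]
  [TopologicalSpace M] [ChartedSpace (EuclideanSpace ℝ (Fin n)) M]
  {Φ : PartialDiffeomorph (𝓡 n) (𝓡 n) (EuclideanSpace ℝ (Fin n)) X ∞}
  {Ψ : PartialDiffeomorph (𝓡 n) (𝓡 n) (EuclideanSpace ℝ (Fin n)) Y ∞}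
  {J : PartialDiffeomorph (𝓡 n) (𝓡 n) X M ∞}
  {L : PartialDiffeomorph (𝓡 n) (𝓡 n) Y M ∞}
  [T2Space X] [SecondCountableTopology X] [IsManifold (𝓡 n) ∞ X]

theorem exists_boundary_mapOn (P : RectData n X (k + 1)) (hP : P.K ⊆ J.source)
    (S : RectData n X (k + 2)) (hSK : S.K ⊆ J.source)
    (hS : boundary n X (k + 1) S.current = P.current) :
    ∃ U : RectData n M (k + 2), boundary n M (k + 1) U.current
      = (P.mapOn J.open_source J.contMDiffOn hP).current := by
  have hz : (RectData.zero : RectData n X (k + 1)).K ⊆ J.source := empty_subset _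
  have h1 := P.mapOn_sub_eq_boundary RectData.zero S J.open_source J.contMDiffOn hP hz hSK
    (by rw [RectData.zero_current, sub_zero, hS])
  have h2 : (RectData.zero.mapOn J.open_source J.contMDiffOn hz :
      RectData n M (k + 1)).current = 0 := by
    funext f π
    exact RectData.current_eq_zero _ fun j => j.elim
  rw [h2, sub_zero] at h1
  exact ⟨_, h1.symm⟩

variable [T2Space Y] [SecondCountableTopology Y] [IsManifold (𝓡 n) ∞ Y]
  [T2Space M] [SecondCountableTopology M] [IsManifold (𝓡 n) ∞ M]

/-- If the filling has dimension less than `n`, it is pushed off the ball. In top dimension `X` may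
have no fundamental cycle to subtract, so the multiplicity on the ball is continued over `Y`. -/
theorem exists_boundary_left [CompactSpace Y] (h : GluePair Φ Ψ J L) (hY : IsOrientable n Y)
    (hk : k + 1 < n) (P : RectData n X (k + 1)) (hP : P.K ⊆ J.source) (S : RectData n X (k + 2))
    (hS : boundary n X (k + 1) S.current = P.current) :
    ∃ U : RectData n M (k + 2), boundary n M (k + 1) U.current
      = (P.mapOn J.open_source J.contMDiffOn hP).current := by
  rcases (show k + 2 ≤ n from hk).eq_or_lt with rfl | hlt
  · exact h.exists_boundary_glued hY P hP S hS
  · obtain ⟨S', hS'K, hS'⟩ := h.exists_boundary_of_lt hlt P hP S hS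
    exact exists_boundary_mapOn P hP S' hS'K hS'

/-- In top dimension a multiple of the fundamental cycle of the closed manifold `Y` is subtracted,
and the filling already lives in the second piece. -/
theorem exists_boundary_right [CompactSpace Y] (h : GluePair Φ Ψ J L) (hY : IsOrientable n Y)
    (hk : k + 1 < n) (P : RectData n Y (k + 1)) (hP : P.K ⊆ L.source) (S : RectData n Y (k + 2))
    (hS : boundary n Y (k + 1) S.current = P.current) :
    ∃ U : RectData n M (k + 2), boundary n M (k + 1) U.current
      = (P.mapOn L.open_source L.contMDiffOn hP).current := by
  rcases (show k + 2 ≤ n from hk).eq_or_lt with rfl | hlt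
  · obtain ⟨S', hS'K, hS'⟩ := h.symm.exists_boundary_of_compact hY P hP S hS
    exact exists_boundary_mapOn P hP S' hS'K hS'
  · obtain ⟨S', hS'K, hS'⟩ := h.symm.exists_boundary_of_lt hlt P hP S hS
    exact exists_boundary_mapOn P hP S' hS'K hS'

/-- The collapsing map kills the cycles of the other piece. -/
theorem exists_retract_homology (h : GluePair Φ Ψ J L) (U : TopologicalSpace.Opens X)
    (hU : (U : Set X) = J.source) (j : C^∞⟮𝓡 n, U; 𝓡 n, M⟯) (hj : ∀ p : U, J p = j p) :
    ∃ c : C^∞⟮𝓡 n, M; 𝓡 n, X⟯,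
      (∀ k (a : Homology n U (k + 1)),
        homologyMap c (k + 1) (homologyMap j (k + 1) a) = homologyMap (opensVal U) (k + 1) a) ∧
      ∀ k (T : cycles n M (k + 1)), spt T.1 ⊆ L.target → homologyMap c (k + 1) (cls T) = 0 := by
  obtain ⟨c, C, hcJ, hc0, -, hC2, hCid⟩ := h.exists_retract
  refine ⟨c, fun k a => ?_, fun k T hT => ?_⟩
  · rw [← hCid k (homologyMap (opensVal U) (k + 1) a), ← homologyMap_comp, ← homologyMap_comp]
    congr 2
    ext p
    have hp : (p : X) ∈ J.source := hU ▸ p.2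
    change c (j p) = C p
    rw [← hj, hcJ _ hp]
  · refine homologyMap_eq_zero_of_spt Φ (by norm_num) h.source_left c T fun p hp => ?_
    -- A point of both pieces comes from the gluing shell, and the collapse keeps the ball of radius
    -- `2` inside itself; all other points go to the centre.
    by_cases hpJ : p ∈ J.target
    · have e1 : J (J.toPartialEquiv.symm p) = p := J.right_inv hpJ
      have e2 : L (L.toPartialEquiv.symm p) = p := L.right_inv (hT hp)
      obtain ⟨x, -, hx2, hx, -⟩ := (h.glue _ (J.map_target hpJ) _ (L.map_target (hT hp))).1
        (e1.trans e2.symm)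
      obtain ⟨y, hy, hyx⟩ := hC2 x (by simpa using hx2)
      refine ⟨y, by simpa using hy.trans_lt hx2, ?_⟩
      rw [← hyx, ← hx, ← hcJ _ (J.map_target hpJ), e1]
    · rw [hc0 p hpJ]
      exact ⟨0, by simp, rfl⟩

/-- The push-forward to the glued manifold of a chain of a piece. -/
theorem map_current_eq_mapOn (U : TopologicalSpace.Opens X) (hU : (U : Set X) = J.source)
    (j : C^∞⟮𝓡 n, U; 𝓡 n, M⟯) (hj : ∀ p : U, J p = j p) (P' : RectData n U (k + 1))
    (P : RectData n X (k + 1)) (hP : P.K ⊆ J.source)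
    (h : (P'.map (opensVal U)).current = P.current) :
    (P'.map j).current = (P.mapOn J.open_source J.contMDiffOn hP).current := by
  have hK : (P'.map (opensVal U)).K ⊆ J.source := by
    rintro _ ⟨x, -, rfl⟩
    exact hU ▸ x.2
  rw [← RectData.mapOn_current_eq_of_eq _ P J.open_source J.contMDiffOn hK hP h]
  refine P'.mapOn_congr (G := j) (G' := fun x : U => J x) isOpen_univ j.contMDiff.contMDiffOn
    (subset_univ _) isOpen_univ (j.contMDiff.congr hj).contMDiffOn (subset_univ _) isOpen_univ
    (subset_univ _) fun x _ => (hj x).symm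

/-- The radius `1` exceeds `1 / 2`, so the cycle lives in the open piece. It is also the largest
radius allowed in the anchoring statement, so the same cycle serves for every smaller `r`. -/
theorem exists_avoiding_lift (h : GluePair Φ Ψ J L) (hk : k + 1 < n) (U : TopologicalSpace.Opens X)
    [Nonempty U] (hU : (U : Set X) = J.source) (a : Homology n X (k + 1)) :
    ∃ (P : RectData n U (k + 1)) (hP : boundary n U k P.current = 0),
      homologyMap (opensVal U) (k + 1) (cls (P.toCycle hP)) = a ∧
      ∀ p ∈ P.K, (p : X) ∉ Φ '' Metric.ball 0 1 := by
  obtain ⟨P, hP, rfl, hPK⟩ := exists_cycle_avoiding Φ h.source_left hk one_pos (by norm_num) a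
  obtain ⟨P', hP', hval, hK⟩ := P.exists_cycle_lift hP U
    (hU ▸ hPK.trans (h.compl_ball_subset (by norm_num)))
  refine ⟨P', hP', ?_, fun p hp => hPK (hK ▸ mem_image_of_mem _ hp)⟩
  rw [homologyMap_toCycle]
  exact congrArg cls (Subtype.ext hval)

/-- The kernel of the inclusion into the closed-up manifold dies in `M`. The filling property `hb`
is a hypothesis because it is proved differently for the two pieces. -/
theorem homologyMap_eq_zero_of_opensVal (U : TopologicalSpace.Opens X)
    (hU : (U : Set X) = J.source) (j : C^∞⟮𝓡 n, U; 𝓡 n, M⟯) (hj : ∀ p : U, J p = j p)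
    (hb : ∀ (P : RectData n X (k + 1)) (hP : P.K ⊆ J.source) (S : RectData n X (k + 2)),
      boundary n X (k + 1) S.current = P.current →
      ∃ V : RectData n M (k + 2), boundary n M (k + 1) V.current
        = (P.mapOn J.open_source J.contMDiffOn hP).current)
    (a : Homology n U (k + 1)) (ha : homologyMap (opensVal U) (k + 1) a = 0) :
    homologyMap j (k + 1) a = 0 := by
  obtain ⟨P, hP, rfl⟩ := exists_rectifiable_cycle a
  rw [homologyMap_toCycle, cls_eq_zero_iff, mem_boundaries_iff] at ha
  obtain ⟨S, hS⟩ := ha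
  have hK : (P.map (opensVal U)).K ⊆ J.source := by
    rintro _ ⟨x, -, rfl⟩
    exact hU ▸ x.2
  obtain ⟨V, hV⟩ := hb _ hK S hS
  rw [homologyMap_toCycle, cls_eq_zero_iff, mem_boundaries_iff]
  exact ⟨V, hV.trans (map_current_eq_mapOn U hU j hj P _ hK rfl).symm⟩

theorem exists_lift_mapOn (U : TopologicalSpace.Opens X) [Nonempty U] (hU : (U : Set X) = J.source)
    (j : C^∞⟮𝓡 n, U; 𝓡 n, M⟯) (hj : ∀ p : U, J p = j p) (T : RectData n X (k + 1))
    (hT : T.K ⊆ J.source) (hTc : boundary n X k T.current = 0) :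
    ∃ a : Homology n U (k + 1), homologyMap j (k + 1) a
      = cls ((T.mapOn J.open_source J.contMDiffOn hT).toCycle
        (T.boundary_mapOn_eq_zero J.open_source J.contMDiffOn hT hTc)) := by
  obtain ⟨T', hT', hval, -⟩ := T.exists_cycle_lift hTc U (hU ▸ hT)
  refine ⟨cls (T'.toCycle hT'), ?_⟩
  rw [homologyMap_toCycle]
  exact congrArg cls (Subtype.ext (map_current_eq_mapOn U hU j hj T' T hT hval))

/-- Every class of the glued manifold is the sum of classes of the two pieces. -/
theorem exists_sum [CompactSpace Y] (h : GluePair Φ Ψ J L) (hk : k + 1 < n)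
    (U : TopologicalSpace.Opens X) [Nonempty U] (hU : (U : Set X) = J.source)
    (j : C^∞⟮𝓡 n, U; 𝓡 n, M⟯) (hj : ∀ p : U, J p = j p)
    (V : TopologicalSpace.Opens Y) [Nonempty V] (hV : (V : Set Y) = L.source)
    (l : C^∞⟮𝓡 n, V; 𝓡 n, M⟯) (hl : ∀ p : V, L p = l p) (c : Homology n M (k + 1)) :
    ∃ (a : Homology n U (k + 1)) (b : Homology n V (k + 1)),
      c = homologyMap j (k + 1) a + homologyMap l (k + 1) b := by
  obtain ⟨P, hP, rfl⟩ := exists_rectifiable_cycle c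
  obtain ⟨T, W, hT, hW, hTc, hWc, hsum⟩ := h.exists_decomposition hk P hP
  obtain ⟨a, ha⟩ := exists_lift_mapOn U hU j hj T hT hTc
  obtain ⟨b, hb⟩ := exists_lift_mapOn V hV l hl W hW hWc
  refine ⟨a, b, ?_⟩
  rw [ha, hb, ← cls_add]
  exact congrArg cls (Subtype.ext hsum)

theorem spt_map_subset (U : TopologicalSpace.Opens X) (hU : (U : Set X) = J.source)
    (j : C^∞⟮𝓡 n, U; 𝓡 n, M⟯) (hj : ∀ p : U, J p = j p) (P : RectData n U k) :
    spt (P.map j).current ⊆ J.target := by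
  refine (spt_current_subset _).trans ?_
  rintro _ ⟨x, -, rfl⟩
  rw [← hj]
  exact J.map_source (hU ▸ x.2)

end GluePair

/-! ### From connected sums to glued manifolds, and the theorem -/

section ConnectedSums

variable {n : ℕ} {X Y M : Type*}
  [TopologicalSpace X] [T2Space X] [SecondCountableTopology X]
  [ChartedSpace (EuclideanSpace ℝ (Fin n)) X] [IsManifold (𝓡 n) ∞ X]
  [TopologicalSpace Y] [T2Space Y] [SecondCountableTopology Y]
  [ChartedSpace (EuclideanSpace ℝ (Fin n)) Y] [IsManifold (𝓡 n) ∞ Y]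
  [TopologicalSpace M] [ChartedSpace (EuclideanSpace ℝ (Fin n)) M]

theorem nonempty_hat (hn : 0 < n) (a : EmbeddedBall n X) : Nonempty a.hat := by
  have hx : ‖(EuclideanSpace.single ⟨0, hn⟩ 1 : EuclideanSpace ℝ (Fin n))‖ = 1 := by simp
  refine ⟨⟨a.toFun (EuclideanSpace.single ⟨0, hn⟩ 1), ?_⟩⟩
  rintro ⟨y, hy, hyx⟩
  have hy' : ‖y‖ ≤ 1 / 2 := by simpa using hy
  have h1 := a.injOn (by simpa using hy'.trans_lt (by norm_num)) (by simp) hyx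
  rw [h1, hx] at hy'
  norm_num at hy'

/-- Viewing the embedding of `U` as a partially defined map on `X` allows chains of `X` carried by
`U` to be pushed forward without changing their ambient manifold. -/
theorem exists_partialDiffeomorph_of_opens (U : TopologicalSpace.Opens X) [Nonempty U] {j : U → M}
    (hj : IsLocalDiffeomorph (𝓡 n) (𝓡 n) ∞ j) (hinj : Function.Injective j) :
    ∃ J : PartialDiffeomorph (𝓡 n) (𝓡 n) X M ∞, J.source = U ∧ J.target = range j ∧
      ∀ p : U, J p = j p := by
  obtain ⟨g, hg, hgU⟩ := exists_opens_retract (n := n) U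
  obtain ⟨Θ, hs, ht, hΘ⟩ := exists_partialDiffeomorph isOpen_univ
    (hj.isLocalDiffeomorphOn univ) hinj.injOn
  rw [image_univ] at ht
  have hinv : ∀ p, Θ.toPartialEquiv.symm (j p) = p := fun p => by
    rw [← hΘ]
    exact Θ.left_inv (hs ▸ mem_univ p)
  have hr : ∀ q ∈ range j, j (g (Θ.toPartialEquiv.symm q : X)) = q := by
    rintro _ ⟨p, rfl⟩
    rw [hinv, hgU]
  have hsm : ContMDiffOn (𝓡 n) (𝓡 n) ∞ (fun q => (Θ.toPartialEquiv.symm q : X)) (range j) := by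
    rw [← ht]
    exact contMDiff_subtype_val.comp_contMDiffOn Θ.contMDiffOn_invFun
  refine ⟨⟨⟨fun x => j (g x), fun q => (Θ.toPartialEquiv.symm q : X), U, range j,
    fun x _ => mem_range_self _, fun q _ => Subtype.prop _, fun x hx => ?_, fun q hq => hr q hq⟩,
    U.isOpen, hj.isOpen_range, hj.contMDiff.comp_contMDiffOn hg, hsm⟩, rfl, rfl, fun p => ?_⟩
  · simp only [hinv]
    exact congrArg Subtype.val (hgU ⟨x, hx⟩)
  · exact congrArg j (hgU p)

theorem exists_gluePair (hn : 0 < n) (D : ConnectedSum n X Y M) :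
    ∃ (Φ : PartialDiffeomorph (𝓡 n) (𝓡 n) (EuclideanSpace ℝ (Fin n)) X ∞)
      (Ψ : PartialDiffeomorph (𝓡 n) (𝓡 n) (EuclideanSpace ℝ (Fin n)) Y ∞)
      (J : PartialDiffeomorph (𝓡 n) (𝓡 n) X M ∞) (L : PartialDiffeomorph (𝓡 n) (𝓡 n) Y M ∞),
      GluePair Φ Ψ J L ∧ (∀ x, Ψ x = D.ballY.toFun x) ∧
      ((D.ballX.hat : Set X) = J.source) ∧ ((D.ballY.hat : Set Y) = L.source) ∧
      J.target = D.hatX ∧ L.target = D.hatY ∧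
      (∀ p : D.ballX.hat, J p = D.jX p) ∧ ∀ q : D.ballY.hat, L q = D.jY q := by
  have := nonempty_hat hn D.ballX
  have := nonempty_hat hn D.ballY
  obtain ⟨Φ, hΦs, -, hΦ⟩ := exists_partialDiffeomorph Metric.isOpen_ball
    D.ballX.isLocalDiffeomorphOn D.ballX.injOn
  obtain ⟨Ψ, hΨs, -, hΨ⟩ := exists_partialDiffeomorph Metric.isOpen_ball
    D.ballY.isLocalDiffeomorphOn D.ballY.injOn
  obtain ⟨J, hJs, hJt, hJ⟩ := exists_partialDiffeomorph_of_opens _ D.jX_isLocalDiffeomorph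
    D.jX_injective
  obtain ⟨L, hLs, hLt, hL⟩ := exists_partialDiffeomorph_of_opens _ D.jY_isLocalDiffeomorph
    D.jY_injective
  refine ⟨Φ, Ψ, J, L, ⟨hΦs, hΨs, ?_, ?_, fun p => ?_, fun p hp q hq => ?_⟩, hΨ, hJs.symm, hLs.symm,
    hJt, hLt, hJ, hL⟩
  · rw [hJs, funext hΦ]
    rfl
  · rw [hLs, funext hΨ]
    rfl
  · rw [hJt, hLt]
    exact (D.cover ▸ mem_univ p : p ∈ range D.jX ∪ range D.jY)
  · rw [hJs] at hp
    rw [hLs] at hq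
    have h1 := D.glue ⟨p, hp⟩ ⟨q, hq⟩
    rw [← hJ, ← hL] at h1
    simp only [hΦ, hΨ]
    exact h1

end ConnectedSums

end FlatChain

end

theorem proposition2p6 {n : ℕ} {X Y M : Type*}
    [TopologicalSpace X] [T2Space X] [SecondCountableTopology X]
    [ChartedSpace (EuclideanSpace ℝ (Fin n)) X] [IsManifold (𝓡 n) ∞ X]
    [TopologicalSpace Y] [T2Space Y] [CompactSpace Y]
    [ChartedSpace (EuclideanSpace ℝ (Fin n)) Y] [IsManifold (𝓡 n) ∞ Y]
    [TopologicalSpace M] [T2Space M] [SecondCountableTopology M]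
    [ChartedSpace (EuclideanSpace ℝ (Fin n)) M] [IsManifold (𝓡 n) ∞ M]
    (hX : IsOrientable n X) (hY : IsOrientable n Y)
    (D : ConnectedSum n X Y M) (i : ℕ) (hi : 1 ≤ i) (hin : i + 1 ≤ n) :
    Function.Surjective (FlatChain.homologyMap D.ballX.incl i) ∧
    Function.Surjective (FlatChain.homologyMap D.ballY.incl i) ∧
    ∃ Φ : FlatChain.Homology n X i × FlatChain.Homology n Y i ≃+ FlatChain.Homology n M i,
      (∀ c : FlatChain.Homology n D.ballX.hat i,
        Φ (FlatChain.homologyMap D.ballX.incl i c, 0) = FlatChain.homologyMap D.embX i c) ∧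
      (∀ c : FlatChain.Homology n D.ballY.hat i,
        Φ (0, FlatChain.homologyMap D.ballY.incl i c) = FlatChain.homologyMap D.embY i c) ∧
      (∀ (b : FlatChain.Homology n Y i) (A₁ A₂ : FlatChain.cycles n M i),
        FlatChain.cls (A₁ + A₂) = Φ (0, b) →
        FlatChain.spt A₁.1 ⊆ D.hatX → FlatChain.spt A₂.1 ⊆ D.hatY →
        A₁.1 ∈ FlatChain.boundaries n M i) ∧
      (∀ b : FlatChain.Homology n Y i, b ≠ 0 → ∀ r : ℝ, 1 / 2 < r → r ≤ 1 →
        FlatChain.IsAnchored (D.closedHatY r) (Φ (0, b))) := by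
  have : SecondCountableTopology Y :=
    ChartedSpace.secondCountable_of_sigmaCompact (EuclideanSpace ℝ (Fin n)) Y
  obtain ⟨k, rfl⟩ : ∃ k, i = k + 1 := ⟨i - 1, by omega⟩
  have hk : k + 1 < n := hin
  obtain ⟨Θ, Ψ, J, L, h, hΨ, hU, hV, hJt, hLt, hJ, hL⟩ := FlatChain.exists_gluePair (by omega) D
  have hneX := FlatChain.nonempty_hat (by omega) D.ballX
  have hneY := FlatChain.nonempty_hat (by omega) D.ballY
  obtain ⟨cX, hcX, hcX0⟩ := h.exists_retract_homology D.ballX.hat hU D.embX hJ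
  obtain ⟨cY, hcY, hcY0⟩ := h.symm.exists_retract_homology D.ballY.hat hV D.embY hL
  have hcX' : ∀ a, FlatChain.homologyMap cX (k + 1) (FlatChain.homologyMap D.embX (k + 1) a)
      = FlatChain.homologyMap D.ballX.incl (k + 1) a := hcX k
  have hcY' : ∀ a, FlatChain.homologyMap cY (k + 1) (FlatChain.homologyMap D.embY (k + 1) a)
      = FlatChain.homologyMap D.ballY.incl (k + 1) a := hcY k
  have hsX : Function.Surjective (FlatChain.homologyMap D.ballX.incl (k + 1)) := fun a => by
    obtain ⟨P, hP, hPa, -⟩ := h.exists_avoiding_lift hk D.ballX.hat hU a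
    exact ⟨_, hPa⟩
  have hsY : Function.Surjective (FlatChain.homologyMap D.ballY.incl (k + 1)) := fun a => by
    obtain ⟨P, hP, hPa, -⟩ := h.symm.exists_avoiding_lift hk D.ballY.hat hV a
    exact ⟨_, hPa⟩
  have hYX : ∀ a, FlatChain.homologyMap cY (k + 1) (FlatChain.homologyMap D.embX (k + 1) a) = 0 :=
    fun a => by
      obtain ⟨P, hP, rfl⟩ := FlatChain.exists_rectifiable_cycle a
      rw [FlatChain.homologyMap_toCycle D.embX]
      exact hcY0 k _ (FlatChain.GluePair.spt_map_subset D.ballX.hat hU D.embX hJ P)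
  have hXY : ∀ a, FlatChain.homologyMap cX (k + 1) (FlatChain.homologyMap D.embY (k + 1) a) = 0 :=
    fun a => by
      obtain ⟨P, hP, rfl⟩ := FlatChain.exists_rectifiable_cycle a
      rw [FlatChain.homologyMap_toCycle D.embY]
      exact hcX0 k _ (FlatChain.GluePair.spt_map_subset D.ballY.hat hV D.embY hL P)
  -- After splitting `c`, the two collapsing maps recover the images of the summands in `X` and in
  -- `Y`. Both vanish, hence so do the summands in `M`.
  have hker : ∀ c, FlatChain.homologyMap cX (k + 1) c = 0 → FlatChain.homologyMap cY (k + 1) c = 0 →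
      c = 0 := by
    intro c h1 h2
    obtain ⟨a, b, rfl⟩ := h.exists_sum hk D.ballX.hat hU D.embX hJ D.ballY.hat hV D.embY hL c
    rw [map_add, hcX', hXY, add_zero] at h1
    rw [map_add, hcY', hYX, zero_add] at h2
    rw [FlatChain.GluePair.homologyMap_eq_zero_of_opensVal D.ballX.hat hU D.embX hJ
        (h.exists_boundary_left hY hk) a h1,
      FlatChain.GluePair.homologyMap_eq_zero_of_opensVal D.ballY.hat hV D.embY hL
        (h.exists_boundary_right hY hk) b h2, add_zero]
  -- The isomorphism is defined as the inverse of this map; its values on the two pieces are then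
  -- checked by applying the collapsing maps.
  have hbij : Function.Bijective
      ((FlatChain.homologyMap cX (k + 1)).prod (FlatChain.homologyMap cY (k + 1))) := by
    refine ⟨(injective_iff_map_eq_zero _).2 fun c hc =>
      hker c (congrArg Prod.fst hc) (congrArg Prod.snd hc), fun ⟨a, b⟩ => ?_⟩
    obtain ⟨a, rfl⟩ := hsX a
    obtain ⟨b, rfl⟩ := hsY b
    refine ⟨FlatChain.homologyMap D.embX (k + 1) a + FlatChain.homologyMap D.embY (k + 1) b, ?_⟩
    rw [AddMonoidHom.prod_apply, map_add, map_add, hcX', hXY, hYX, hcY', add_zero, zero_add]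
  have hfst : ∀ b, FlatChain.homologyMap cX (k + 1) ((AddEquiv.ofBijective _ hbij).symm (0, b)) = 0 :=
    fun b => congrArg Prod.fst ((AddEquiv.ofBijective _ hbij).apply_symm_apply (0, b))
  have hsnd : ∀ b, FlatChain.homologyMap cY (k + 1) ((AddEquiv.ofBijective _ hbij).symm (0, b)) = b :=
    fun b => congrArg Prod.snd ((AddEquiv.ofBijective _ hbij).apply_symm_apply (0, b))
  have hembY : ∀ c, (AddEquiv.ofBijective _ hbij).symm
      (0, FlatChain.homologyMap D.ballY.incl (k + 1) c) = FlatChain.homologyMap D.embY (k + 1) c :=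
    fun c => (AddEquiv.symm_apply_eq _).2 (Prod.ext (hXY c).symm (hcY' c).symm)
  refine ⟨hsX, hsY, (AddEquiv.ofBijective _ hbij).symm, fun c => ?_, hembY,
    fun b A₁ A₂ hA h1 h2 => ?_, fun b hb r hr hr1 => ⟨?_, ?_, ?_⟩⟩
  · exact (AddEquiv.symm_apply_eq _).2 (Prod.ext (hcX' c).symm (hYX c).symm)
  -- The map `cY` kills `A₁` by its support; `cX` kills the whole class and, by its support, `A₂`,
  -- hence also `A₁`.
  · refine FlatChain.cls_eq_zero_iff.1 (hker _ ?_ (hcY0 k A₁ (hJt ▸ h1)))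
    have h3 := hfst b
    rwa [← hA, FlatChain.cls_add, map_add, hcX0 k A₂ (hLt ▸ h2), add_zero] at h3
  · have heq : D.closedHatY r = L '' (Ψ '' Metric.ball 0 r)ᶜ := by
      rw [funext hΨ]
      ext p
      constructor
      · rintro ⟨q, hq, rfl⟩
        exact ⟨q, hq, hL q⟩
      · rintro ⟨q, hq, rfl⟩
        have hqs : q ∈ D.ballY.hat := by
          rw [← SetLike.mem_coe, hV]
          refine h.symm.compl_ball_subset hr ?_
          rwa [funext hΨ]
        exact ⟨⟨q, hqs⟩, hq, (hL ⟨q, hqs⟩).symm⟩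
    rw [heq]
    exact (FlatChain.isOpen_image_ball Ψ h.source_right
      (by linarith)).isClosed_compl.isCompact.image_of_continuousOn
      (L.contMDiffOn.continuousOn.mono (h.symm.compl_ball_subset hr))
  · obtain ⟨P, hP, hPb, hPK⟩ := h.symm.exists_avoiding_lift hk D.ballY.hat hV b
    refine ⟨(P.map D.embY).toCycle (FlatChain.boundary_map_eq_zero D.embY P hP), ?_, ?_⟩
    · rw [← FlatChain.homologyMap_toCycle D.embY P hP, ← hembY]
      exact congrArg (fun x => (AddEquiv.ofBijective _ hbij).symm (0, x)) hPb
    · refine (FlatChain.spt_current_subset _).trans ?_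
      rintro _ ⟨q, hq, rfl⟩
      refine ⟨q, fun hq' => hPK q hq ?_, rfl⟩
      rw [funext hΨ]
      exact Set.image_mono (Metric.ball_subset_ball hr1) hq'
  -- A point of `M` outside the first piece comes from outside the ball of radius `2 > r` in `Y` and
  -- lies in the compact set. So `T` is supported in the first piece, and `cY` sends its class both
  -- to zero and to `b`.
  · rintro ⟨T, hT, hdis⟩
    refine hb ?_
    rw [← hsnd b, ← hT]
    refine hcY0 k T fun p hp => ?_
    by_contra hpJ
    obtain ⟨q, hq, rfl, hqΨ⟩ := h.exists_of_notMem_target hpJ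
    have hqs : q ∈ D.ballY.hat := by
      rwa [← SetLike.mem_coe, hV]
    refine hdis.notMem_of_mem_left hp ⟨⟨q, hqs⟩, fun hq' => hqΨ ?_, (hL ⟨q, hqs⟩).symm⟩
    rw [funext hΨ]
    exact Set.image_mono (Metric.ball_subset_ball (by linarith)) hq'
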